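/- For $n=(j,k)\in\mathbb Z^2$ put $|n|^2=j^2+k^2$ and $\langle n\rangle=(1+|n|^2)^{1/2}$, and for $\mu\in\mathbb Z$ let $$\Gamma_\mu^+(n)=\{(n_1,n_2,n_3)\in(\mathbb Z^2)^3:\ n_1-n_2+n_3=n,\ n\ne n_1,n_3,\ |n|^2-|n_1|^2+|n_2|^2-|n_3|^2=\mu\}.$$ For dyadic $N\ge 1$ (that is, $N=2^a$ with an integer $a\ge0$), $|n|\sim N$ means $N/2\le|n|<2N$ if $N\ge2$, and $|n|<2$ if $N=1$. Let $\mathbb T^2=(\mathbb R/2\pi\mathbb Z)^2$ with normalized Lebesgue measure, and let $\mathcal FL^{s,p}(\mathbb T^2)$ be the space of periodic distributions $f$ with $\|f\|_{\mathcal FL^{s,p}}=\|\langle n\rangle^s\widehat f(n)\|_{\ell^p(\mathbb Z^2)}<\infty$. Then the following hold. (a) (Elliptic counting estimate.) For every $\theta>0$ there is $C>0$ such that for all $n\in\mathbb Z^2$, $\mu\in\mathbb Z$ and all dyadic $N_1,N_2,N_3\ge1$, $$|\Gamma_\mu^+(n)\cap\{|n_1|\sim N_1,\ |n_3|\sim N_3\}|\le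 C N_1N_3\max(N_1,N_3)^\theta,$$ $$|\Gamma_\mu^+(n)\cap\{|n_1|\sim N_1,\ |n_2|\sim N_2\}|\le C N_1N_2\max(N_1,N_2)^\theta.$$ (b) (Unconditional local well-posedness.) Let $1<p<\infty$ and $s\in\mathbb R$ satisfy either $p\le3$ and $s>1-\frac1p$, or $p\ge3$ and $s>\frac43-\frac2p$. Then, for either choice of the sign, the cubic elliptic nonlinear Schrödinger equation $i\partial_tu+\Delta u\pm|u|^2u=0$ on $\mathbb T^2$ is unconditionally locally well-posed in $\mathcal FL^{s,p}(\mathbb T^2)$: for every $u_0\in\mathcal FL^{s,p}(\mathbb T^2)$ there exist $T>0$ and a unique $u\in C([0,T];\mathcal FL^{s,p}(\mathbb T^2))$ with $u|_{t=0}=u_0$ that solves the equation on $[0,T]$ in the Duhamel formulation $$u(t)=e^{it\Delta}u_0\pm i\int_0^te^{i(t-t')\Delta}\big(|u|^2u\big)(t')\,dt',$$ where $u(t)\in L^3(\mathbb T^2)$ gives a meaning to $|u|^2u$ and the integral is taken for each Fourier coefficient. Uniqueness holds in all of $C([0,T];\mathcal FL^{s,p}(\mathbb T^2))$. (c) (Sharpness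 for $p\ge3$.) Let $3\le p<\infty$, and let either $s<\frac43-\frac2p$, or $p>3$ and $s=\frac43-\frac2p$. Then $\mathcal FL^{s,p}(\mathbb T^2)\not\subset L^3(\mathbb T^2)$, so that the integrability needed to define $|u|^2u$ at a fixed time fails. -/

import Mathlib

open Real Set MeasureTheory Filter Topology
open scoped ENNReal ComplexConjugate

noncomputable section

namespace EllipticNLS

/-- Frequencies `n = (j, k)` in `ℤ²`. -/
abbrev Freq : Type := Fin 2 → ℤ

/-- The elliptic modulus squared `|n|² = j² + k²`. -/
def modSq (n : Freq) : ℤ := n 0 ^ 2 + n 1 ^ 2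

/-- The Euclidean length `|n|`. -/
def length (n : Freq) : ℝ := √(modSq n : ℝ)

/-- The Japanese bracket `⟨n⟩ = (1 + |n|²)^{1/2}`. -/
def bracket (n : Freq) : ℝ := √(1 + (modSq n : ℝ))

lemma bracket_pos (n : Freq) : 0 < bracket n := by
  unfold bracket modSq
  push_cast
  positivity

/-! ### Counting -/

/-- The set of triples `(n₁, n₂, n₃)` with `n₁ - n₂ + n₃ = n`, `n ≠ n₁, n₃` and
`|n|² - |n₁|² + |n₂|² - |n₃|² = μ`. -/
def Gam (μ : ℤ) (n : Freq) : Set (Freq × Freq × Freq) :=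
  {q | q.1 - q.2.1 + q.2.2 = n ∧ n ≠ q.1 ∧ n ≠ q.2.2 ∧
    modSq n - modSq q.1 + modSq q.2.1 - modSq q.2.2 = μ}

/-- The dyadic localisation `|n| ∼ 2^a`: it means `|n| < 2` for `a = 0`, and
`2^a / 2 ≤ |n| < 2 · 2^a` for `a ≥ 1`. -/
def Shell (a : ℕ) (n : Freq) : Prop :=
  (1 ≤ a → (2 : ℝ) ^ a / 2 ≤ length n) ∧ length n < 2 * (2 : ℝ) ^ a

/-- The counting estimate: for every `θ > 0` there is `C > 0` such that both bounds hold for all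
`n`, `μ` and all dyadic numbers `2^a`, `2^b`. -/
def CountingEstimate : Prop :=
  ∀ θ : ℝ, 0 < θ → ∃ C : ℝ, 0 < C ∧ ∀ (n : Freq) (μ : ℤ) (a b : ℕ),
    ((Gam μ n ∩ {q | Shell a q.1 ∧ Shell b q.2.2}).Finite ∧
      ((Gam μ n ∩ {q | Shell a q.1 ∧ Shell b q.2.2}).ncard : ℝ) ≤
        C * 2 ^ a * 2 ^ b * (max ((2 : ℝ) ^ a) ((2 : ℝ) ^ b)) ^ θ) ∧
    ((Gam μ n ∩ {q | Shell a q.1 ∧ Shell b q.2.1}).Finite ∧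
      ((Gam μ n ∩ {q | Shell a q.1 ∧ Shell b q.2.1}).ncard : ℝ) ≤
        C * 2 ^ a * 2 ^ b * (max ((2 : ℝ) ^ a) ((2 : ℝ) ^ b)) ^ θ)

/-! ### The torus and Fourier coefficients -/

instance instFactTwoPiPos : Fact (0 < 2 * π) := ⟨Real.two_pi_pos⟩

/-- The torus `𝕋² = (ℝ / 2πℤ)²`. -/
abbrev Torus : Type := Fin 2 → AddCircle (2 * π)

/-- The normalized Lebesgue measure `(2π)⁻² dx` on `𝕋²`. -/
def torusMeasure : Measure Torus :=
  Measure.pi fun _ => AddCircle.haarAddCircle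

/-- The Fourier coefficient `∫ F(x) e^{-i n·x} dx` with respect to the normalized measure. -/
def coeff (F : Torus → ℂ) (n : Freq) : ℂ :=
  ∫ x, F x * ∏ i, fourier (-(n i)) (x i) ∂torusMeasure

/-- `F` is a function in `L³(𝕋²)` whose Fourier coefficients are given by `f`; that is, the
distribution `∑ f(n) e^{i n·x}` is the function `F`, and it belongs to `L³(𝕋²)`. -/
def IsL3Function (f : Freq → ℂ) (F : Torus → ℂ) : Prop :=
  MemLp F 3 torusMeasure ∧ ∀ n, coeff F n = f n

/-! ### Fourier–Lebesgue spaces -/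

/-- The linear subspace of all `f : ℤ² → ℂ` with `⟨n⟩^s f(n)` in `ℓ^p(ℤ²)`. -/
def flSubmodule (s : ℝ) (p : ℝ≥0∞) : Submodule ℂ (Freq → ℂ) where
  carrier := {f | Memℓp (fun n => ((bracket n ^ s : ℝ) : ℂ) * f n) p}
  zero_mem' := by
    have h : (fun n : Freq => ((bracket n ^ s : ℝ) : ℂ) * (0 : Freq → ℂ) n) = 0 := by
      funext n; simp
    simp only [mem_ofPred_eq, h]
    exact zero_memℓp
  add_mem' := by
    intro f g hf hg
    have h : (fun n : Freq => ((bracket n ^ s : ℝ) : ℂ) * (f + g) n) =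
        (fun n => ((bracket n ^ s : ℝ) : ℂ) * f n) +
          fun n => ((bracket n ^ s : ℝ) : ℂ) * g n := by
      funext n; simp [mul_add]
    simp only [mem_ofPred_eq, h] at *
    exact hf.add hg
  smul_mem' := by
    intro c f hf
    have h : (fun n : Freq => ((bracket n ^ s : ℝ) : ℂ) * (c • f) n) =
        c • fun n => ((bracket n ^ s : ℝ) : ℂ) * f n := by
      funext n; simp [mul_left_comm]
    simp only [mem_ofPred_eq, h] at *
    exact hf.const_smul c

/-- The Fourier–Lebesgue space `𝓕L^{s,p}(𝕋²)`. A periodic distribution is identified with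
its sequence of Fourier coefficients. -/
def FL (s : ℝ) (p : ℝ≥0∞) : Type := flSubmodule s p

instance (s : ℝ) (p : ℝ≥0∞) : AddCommGroup (FL s p) :=
  inferInstanceAs (AddCommGroup (flSubmodule s p))

instance (s : ℝ) (p : ℝ≥0∞) : Module ℂ (FL s p) :=
  inferInstanceAs (Module ℂ (flSubmodule s p))

/-- The Fourier coefficients of an element of `𝓕L^{s,p}(𝕋²)`. -/
def FL.hat {s : ℝ} {p : ℝ≥0∞} (f : FL s p) : Freq → ℂ := f.1

/-- The linear map `f ↦ ⟨n⟩^s f̂(n)` into `ℓ^p(ℤ²)`. -/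
def FL.toLp (s : ℝ) (p : ℝ≥0∞) : FL s p →ₗ[ℂ] lp (fun _ : Freq => ℂ) p where
  toFun f := ⟨fun n => ((bracket n ^ s : ℝ) : ℂ) * f.1 n, f.2⟩
  map_add' f g := by
    apply Subtype.ext
    funext n
    exact mul_add _ _ _
  map_smul' c f := by
    apply Subtype.ext
    funext n
    exact mul_left_comm _ _ _

lemma FL.toLp_injective (s : ℝ) (p : ℝ≥0∞) : Function.Injective (FL.toLp s p) := by
  intro f g h
  apply Subtype.ext
  funext n
  have h1 : ((bracket n ^ s : ℝ) : ℂ) * f.1 n = ((bracket n ^ s : ℝ) : ℂ) * g.1 n :=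
    congrFun (congrArg Subtype.val h) n
  have h2 : ((bracket n ^ s : ℝ) : ℂ) ≠ 0 :=
    Complex.ofReal_ne_zero.mpr (Real.rpow_pos_of_pos (bracket_pos n) s).ne'
  exact mul_left_cancel₀ h2 h1

/-- The norm `‖f‖ = ‖⟨n⟩^s f̂(n)‖_{ℓ^p(ℤ²)}`. -/
instance (s : ℝ) (p : ℝ≥0∞) [Fact (1 ≤ p)] : NormedAddCommGroup (FL s p) :=
  NormedAddCommGroup.induced (FL s p) (lp (fun _ : Freq => ℂ) p) (FL.toLp s p)
    (FL.toLp_injective s p)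

instance (s : ℝ) (p : ℝ≥0∞) [Fact (1 ≤ p)] : NormedSpace ℂ (FL s p) :=
  NormedSpace.induced ℂ (FL s p) (lp (fun _ : Freq => ℂ) p) (FL.toLp s p)

/-! ### The elliptic nonlinear Schrödinger equation -/

/-- The cubic nonlinearity `|F|² F`. -/
def cubic (F : Torus → ℂ) : Torus → ℂ := fun x => ((‖F x‖ ^ 2 : ℝ) : ℂ) * F x

/-- The Fourier multiplier `e^{-i t |n|²}` of the propagator `e^{i t Δ}`. -/
def propagator (t : ℝ) (n : Freq) : ℂ :=
  Complex.exp (-Complex.I * ((t * (modSq n : ℝ) : ℝ) : ℂ))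

/-- `u ∈ C([0, T]; 𝓕L^{s,p}(𝕋²))` is a solution on `[0, T]` of
`i ∂ₜ u + Δ u + ε |u|² u = 0` with `u|_{t = 0} = u₀`, in the Duhamel formulation
`u(t) = e^{itΔ} u₀ + ε i ∫₀ᵗ e^{i(t - t')Δ} (|u|² u)(t') dt'`, read on Fourier coefficients.
For the cubic nonlinearity to make sense, each `u(t)` has to be an `L³` function `U t`
(which is unique up to null sets). -/
structure IsSolution {s : ℝ} {p : ℝ≥0∞} [Fact (1 ≤ p)] (ε T : ℝ) (u₀ : FL s p)
    (u : ℝ → FL s p) : Prop where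
  continuousOn : ContinuousOn u (Icc 0 T)
  initial : u 0 = u₀
  duhamel : ∃ U : ℝ → Torus → ℂ,
    (∀ t ∈ Icc 0 T, IsL3Function (u t).hat (U t)) ∧
    ∀ n : Freq,
      IntervalIntegrable (fun t => coeff (cubic (U t)) n) volume 0 T ∧
      ∀ t ∈ Icc 0 T, (u t).hat n = propagator t n * u₀.hat n +
        (ε : ℂ) * Complex.I *
          ∫ t' in (0 : ℝ)..t, propagator (t - t') n * coeff (cubic (U t')) n

/-- Unconditional local well-posedness in `𝓕L^{s,p}(𝕋²)`: for every initial datum there are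
`T > 0` and a solution in `C([0, T]; 𝓕L^{s,p}(𝕋²))`, unique in that whole class. -/
def UnconditionallyLocallyWellPosed (ε s : ℝ) (p : ℝ≥0∞) [Fact (1 ≤ p)] : Prop :=
  ∀ u₀ : FL s p, ∃ T : ℝ, 0 < T ∧ ∃ u : ℝ → FL s p, IsSolution ε T u₀ u ∧
    ∀ v : ℝ → FL s p, IsSolution ε T u₀ v → ∀ t ∈ Icc 0 T, v t = u t

end EllipticNLS

end

noncomputable section

namespace EllipticNLS

/-! ### Counting -/

/-! Counting. On `n₁ - n₂ + n₃ = n` the phase equals `2 (n - n₁)·(n - n₃) = 2 (n - n₁)·(n₁ - n₂)`, a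
sum of two products, one per coordinate. Fixing one coordinate of both free frequencies costs a
multiple of `N N'` choices and prescribes the product in the other coordinate. A nonzero integer has
`O(N^θ)` factorisations with factors in windows of length `N`, wherever the windows lie
(`exists_card_short_factorization_le`). When both products vanish, `n ≠ n₁, n₃` leaves only two free
integers.

Existence. Pass to the interaction representation and remove the resonant part, twice the mass times
the solution, by a unimodular gauge. On a time interval of length `π / M`, rescaled to `[0, 1/2]`,
functions of time are written as Fourier series of period one, with even reflection as the means of
extension, and measured by `‖⟨n⟩^s (1 + |k|) u(n, k)‖_{ℓ^p}`. Integration in time gains the factor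
`1 + |k|`, so it remains to bound the trilinear form in `ℓ^p`. Schur's test reduces this to sums of
`q`-th powers of the weights over level sets of the phase, `q` being conjugate to `p`. Dyadic
summation of the counting estimate bounds these uniformly, because `s > 1 - 1/p` means `s q > 1`
(`exists_tsum_res_le`, `exists_absTri_le`). The powers of `M` combine to `M⁻¹` in `exists_duh_le`,
so short intervals give a contraction (`exists_local`).

Uniqueness. A solution that is merely continuous in `𝓕L^{s,p}` need not lie in the space of the
fixed point argument. It is compared with the constructed flow as a numerical scheme would be, by
stability and consistency. Stability: weights on any two of the three frequencies suffice for the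
counting argument, so one factor may be measured in `ℓ^∞` of the spatial frequency only, and the
flow is Lipschitz in `ℓ^∞` on bounded sets (`exists_stability`). Consistency: `s > 4/3 - 2/p` gives
an embedding into `ℓ^{3/2}`, and `ℓ^{3/2} * ℓ^{3/2} * ℓ^{3/2} ⊂ ℓ^∞`, so the nonlinearity is
continuous into `ℓ^∞` and a step of size `h` of the flow misses the solution by `o(h)`. Adding up
the errors of many small steps shows that the solution is the flow (`exists_flow`). The gauge is
undone since equal gauged solutions have equal masses.

Return to the equation. The inequality `‖F‖₃³ ≤ ‖F‖_∞ ‖F‖₂²` on dyadic blocks embeds the space into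
`L³`, and `coeff_cubic` identifies the Fourier coefficients of `|u|² u` with the convolution sum.

Sharpness. Coefficients `2^{-4k/3} (k + 1)^{-1/3}` on the `k`-th shell belong to the space. Their
pairing with a combination of Fejér kernels of scales `a < A` is at least the harmonic number `H`,
while the combination has norm `O(H^{2/3})` in `L^{3/2}`. Duality with `L³` would keep `H` bounded.
-/

/-- The divisor bound `d(n) ≪ n^θ`. -/
lemma exists_card_divisors_le (θ : ℝ) (hθ : 0 < θ) :
    ∃ C : ℝ, 1 ≤ C ∧ ∀ n : ℕ, n ≠ 0 → (n.divisors.card : ℝ) ≤ C * (n : ℝ) ^ θ := by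
  obtain ⟨P, hP⟩ := exists_nat_ge ((2 : ℝ) ^ (1 / θ))
  have hl2 : 0 < Real.log 2 := Real.log_pos one_lt_two
  set K : ℝ := 1 + 1 / (θ * Real.log 2) with hK
  have hK1 : 1 ≤ K := by
    have : 0 < 1 / (θ * Real.log 2) := by positivity
    linarith
  -- `K` pays for the small primes, through `1 + y ≤ e^y`. From `2^{1/θ}` on, `x^θ ≥ 2` and no
  -- constant is needed. At most `P` primes have to pay, hence the constant `K ^ P`.
  have hsmall : ∀ (x : ℕ) (a : ℕ), 2 ≤ x → ((a : ℝ) + 1) ≤ K * ((x : ℝ) ^ a) ^ θ := by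
    intro x a hx
    have h1 : ((x : ℝ) ^ a) ^ θ ≥ Real.exp (a * (θ * Real.log 2)) := by
      rw [← Real.rpow_natCast, ← Real.rpow_mul (by positivity),
        Real.rpow_def_of_pos (by positivity)]
      apply Real.exp_le_exp.mpr
      have : Real.log 2 ≤ Real.log x := Real.log_le_log (by norm_num) (by exact_mod_cast hx)
      have h2 : 0 ≤ (a : ℝ) * θ := by positivity
      nlinarith
    have h2 := Real.add_one_le_exp (a * (θ * Real.log 2))
    have h3 : (1 : ℝ) ≤ Real.exp (a * (θ * Real.log 2)) := Real.one_le_exp (by positivity)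
    have h4 : (a : ℝ) = 1 / (θ * Real.log 2) * (a * (θ * Real.log 2)) := by
      field_simp
    have h5 : (0 : ℝ) < 1 / (θ * Real.log 2) := by positivity
    calc (a : ℝ) + 1 ≤ 1 / (θ * Real.log 2) * Real.exp (a * (θ * Real.log 2))
          + Real.exp (a * (θ * Real.log 2)) := by
          have : (a : ℝ) ≤ 1 / (θ * Real.log 2) * Real.exp (a * (θ * Real.log 2)) := by
            conv_lhs => rw [h4]
            exact mul_le_mul_of_nonneg_left (by linarith) h5.le
          linarith
      _ = K * Real.exp (a * (θ * Real.log 2)) := by rw [hK]; ring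
      _ ≤ _ := mul_le_mul_of_nonneg_left h1 (by linarith)
  have hbig : ∀ (x : ℕ) (a : ℕ), P ≤ x → ((a : ℝ) + 1) ≤ ((x : ℝ) ^ a) ^ θ := by
    intro x a hx
    have hx' : (2 : ℝ) ^ (1 / θ) ≤ x := hP.trans (by exact_mod_cast hx)
    have h2 : (2 : ℝ) ≤ (x : ℝ) ^ θ := by
      have := Real.rpow_le_rpow (by positivity) hx' hθ.le
      rwa [← Real.rpow_mul (by norm_num), one_div, inv_mul_cancel₀ hθ.ne', Real.rpow_one] at this
    have h3 : ((x : ℝ) ^ a) ^ θ = ((x : ℝ) ^ θ) ^ a := by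
      rw [← Real.rpow_natCast, ← Real.rpow_natCast, ← Real.rpow_mul (by positivity),
        ← Real.rpow_mul (by positivity), mul_comm]
    rw [h3]
    have h4 : ((a : ℝ) + 1) ≤ 2 ^ a := by
      exact_mod_cast Nat.lt_two_pow_self (n := a)
    exact h4.trans (pow_le_pow_left₀ (by norm_num) h2 a)
  refine ⟨K ^ P, one_le_pow₀ hK1, fun n hn => ?_⟩
  rw [Nat.card_divisors hn]
  have hn' : (n : ℝ) ^ θ = ∏ x ∈ n.primeFactors, ((x : ℝ) ^ n.factorization x) ^ θ := by
    rw [Real.finsetProd_rpow _ _ (fun i _ => by positivity)]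
    congr 1
    conv_lhs => rw [← Nat.prod_factorization_pow_eq_self hn]
    rw [Finsupp.prod]
    push_cast
    rfl
  rw [hn']
  push_cast
  calc ∏ x ∈ n.primeFactors, ((n.factorization x : ℝ) + 1)
      ≤ ∏ x ∈ n.primeFactors, ((if x < P then K else 1) * ((x : ℝ) ^ n.factorization x) ^ θ) := by
        apply Finset.prod_le_prod
        · intros; positivity
        · intro x hx
          split_ifs with h
          · exact hsmall x _ (Nat.prime_of_mem_primeFactors hx).two_le
          · rw [one_mul]; exact hbig x _ (not_lt.mp h)
    _ = (∏ x ∈ n.primeFactors, (if x < P then K else 1)) *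
          ∏ x ∈ n.primeFactors, ((x : ℝ) ^ n.factorization x) ^ θ := Finset.prod_mul_distrib
    _ ≤ _ := by
        apply mul_le_mul_of_nonneg_right _ (by positivity)
        rw [Finset.prod_ite, Finset.prod_const, Finset.prod_const_one, mul_one]
        apply pow_le_pow_right₀ hK1
        calc _ ≤ (Finset.range P).card := by
              apply Finset.card_le_card
              intro x hx
              simpa using (Finset.mem_filter.mp hx).2
          _ = P := Finset.card_range P

/-- The first factor is determined by its absolute value, a divisor of `|m|`, and its sign; the
second is then the quotient. -/
lemma card_filter_mul_eq_le (T : Finset (ℤ × ℤ)) (f g : ℤ × ℤ → ℤ)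
    (hfg : Function.Injective fun w => (f w, g w)) {m : ℤ} (hm : m ≠ 0) :
    (T.filter fun w => f w * g w = m).card ≤ 2 * m.natAbs.divisors.card := by
  have h1 : (T.filter fun w => f w * g w = m).card ≤
      (m.natAbs.divisors ×ˢ (Finset.univ : Finset Bool)).card := by
    apply Finset.card_le_card_of_injOn (fun w => ((f w).natAbs, decide (0 ≤ f w)))
    · intro w hw
      have hw2 := (Finset.mem_filter.mp hw).2
      simp only [Finset.coe_product, Finset.coe_univ, Set.mem_prod, Set.mem_univ, and_true,
        Finset.mem_coe, Nat.mem_divisors]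
      refine ⟨⟨(g w).natAbs, by rw [← Int.natAbs_mul, hw2]⟩, by simpa using hm⟩
    · intro w hw w' hw' h
      have hw2 := (Finset.mem_filter.mp hw).2
      have hw2' := (Finset.mem_filter.mp hw').2
      simp only [Prod.mk.injEq, decide_eq_decide] at h
      have hf : f w = f w' := by omega
      apply hfg
      have hf0 : f w ≠ 0 := by
        intro h0; rw [h0, zero_mul] at hw2; exact hm hw2.symm
      have : f w * g w = f w * g w' := by rw [hw2, hf, hw2']
      simp only [Prod.mk.injEq]
      exact ⟨hf, mul_left_cancel₀ hf0 this⟩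
  refine h1.trans (le_of_eq ?_)
  rw [Finset.card_product]
  simp [mul_comm]

/-- Factorisations of a nonzero integer with factors in short intervals. -/
lemma exists_card_short_factorization_le (θ : ℝ) (hθ : 0 < θ) :
    ∃ C : ℝ, 0 < C ∧ ∀ (T : Finset (ℤ × ℤ)) (f g : ℤ × ℤ → ℤ) (ν m : ℤ) (N : ℕ), 1 ≤ N →
      (Function.Injective fun w => (f w, g w)) → m ≠ 0 → (∀ w ∈ T, |f w - ν| ≤ N) →
      ((∀ w ∈ T, |g w - ν| ≤ N) ∨ (∀ w ∈ T, |g w| ≤ N)) →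
      ((T.filter fun w => f w * g w = m).card : ℝ) ≤ C * (N : ℝ) ^ θ := by
  -- The exponent `θ / 4` is right because the integer to be factored is at most `21² N⁴` when the
  -- centre is small.
  obtain ⟨C, hC1, hC⟩ := exists_card_divisors_le (θ / 4) (by positivity)
  refine ⟨2 * C * (21 * 21 : ℝ) ^ (θ / 4), by positivity, ?_⟩
  intro T f g ν m N hN hinj hm hf hg
  have hN' : (1 : ℝ) ≤ N := by exact_mod_cast hN
  have hNz : (1 : ℤ) ≤ N := by exact_mod_cast hN
  have hbase : (1 : ℝ) ≤ (21 * 21 : ℝ) ^ (θ / 4) := Real.one_le_rpow (by norm_num) (by positivity)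
  have hNθ : (1 : ℝ) ≤ (N : ℝ) ^ θ := Real.one_le_rpow hN' hθ.le
  have htwo : (2 : ℝ) ≤ 2 * C * (21 * 21 : ℝ) ^ (θ / 4) * (N : ℝ) ^ θ := by
    have h1 : (1 : ℝ) ≤ C * (21 * 21 : ℝ) ^ (θ / 4) := one_le_mul_of_one_le_of_one_le hC1 hbase
    have h2 := one_le_mul_of_one_le_of_one_le h1 hNθ
    nlinarith
  have hN2 : (N : ℤ) ≤ (N : ℤ) ^ 2 := by nlinarith
  -- For windows far out, `m` may be huge compared with `N` and the divisor bound is useless. There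
  -- the centre dominates every product of two offsets, and rigidity of the factorisation takes
  -- over.
  by_cases hν : |ν| ≤ 20 * (N : ℤ) ^ 2
  · -- small centre: the divisor bound
    by_cases hempty : (T.filter fun w => f w * g w = m) = ∅
    · rw [hempty]; simp; positivity
    obtain ⟨w, hw⟩ := Finset.nonempty_iff_ne_empty.mpr hempty
    obtain ⟨hwT, hwm⟩ := Finset.mem_filter.mp hw
    have hfw : |f w| ≤ 21 * (N : ℤ) ^ 2 := by
      have := hf w hwT
      have h3 : |f w| ≤ |f w - ν| + |ν| := by
        simpa using abs_add_le (f w - ν) ν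
      linarith
    have hgw : |g w| ≤ 21 * (N : ℤ) ^ 2 := by
      rcases hg with hg | hg
      · have := hg w hwT
        have h3 : |g w| ≤ |g w - ν| + |ν| := by
          simpa using abs_add_le (g w - ν) ν
        linarith
      · have := hg w hwT
        nlinarith
    have hmabs : (m.natAbs : ℝ) ≤ (21 * 21) * (N : ℝ) ^ (4 : ℕ) := by
      have h1 : |m| ≤ (21 * 21) * (N : ℤ) ^ 4 := by
        rw [← hwm, abs_mul]
        calc _ ≤ (21 * (N : ℤ) ^ 2) * (21 * (N : ℤ) ^ 2) :=
              mul_le_mul hfw hgw (abs_nonneg _) (by positivity)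
          _ = _ := by ring
      have h2 : ((m.natAbs : ℤ) : ℝ) = (|m| : ℤ) := by rw [Int.natCast_natAbs]
      have h3 : ((|m| : ℤ) : ℝ) ≤ (((21 * 21) * (N : ℤ) ^ 4 : ℤ) : ℝ) := by exact_mod_cast h1
      calc (m.natAbs : ℝ) = ((m.natAbs : ℤ) : ℝ) := by simp
        _ = (|m| : ℤ) := h2
        _ ≤ _ := h3
        _ = _ := by push_cast; ring
    have h4 : ((T.filter fun w => f w * g w = m).card : ℝ) ≤ 2 * m.natAbs.divisors.card := by
      exact_mod_cast card_filter_mul_eq_le T f g hinj hm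
    calc _ ≤ 2 * (m.natAbs.divisors.card : ℝ) := h4
      _ ≤ 2 * (C * (m.natAbs : ℝ) ^ (θ / 4)) := by
          have := hC m.natAbs (by simpa using hm)
          linarith
      _ ≤ 2 * (C * ((21 * 21) * (N : ℝ) ^ (4 : ℕ)) ^ (θ / 4)) := by
          have := Real.rpow_le_rpow (by positivity) hmabs (by positivity : 0 ≤ θ / 4)
          have := mul_le_mul_of_nonneg_left this (by linarith : 0 ≤ C)
          linarith
      _ = _ := by
          rw [Real.mul_rpow (by positivity) (by positivity), ← Real.rpow_natCast,
            ← Real.rpow_mul (by positivity)]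
          have : ((4 : ℕ) : ℝ) * (θ / 4) = θ := by push_cast; ring
          rw [this]; ring
  · -- large centre: at most two solutions
    push Not at hν
    refine le_trans ?_ htwo
    have key : ∀ w ∈ T.filter (fun w => f w * g w = m), ∀ w' ∈ T.filter (fun w => f w * g w = m),
        (f w' = f w ∧ g w' = g w) ∨ (f w' = g w ∧ g w' = f w) := by
      intro w hw w' hw'
      obtain ⟨hwT, hwm⟩ := Finset.mem_filter.mp hw
      obtain ⟨hwT', hwm'⟩ := Finset.mem_filter.mp hw'
      rcases hg with hg | hg
      · obtain ⟨r, hr⟩ : ∃ r, r = f w - ν := ⟨_, rfl⟩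
        obtain ⟨t, ht⟩ : ∃ r, r = g w - ν := ⟨_, rfl⟩
        obtain ⟨r', hr'⟩ : ∃ r, r = f w' - ν := ⟨_, rfl⟩
        obtain ⟨t', ht'⟩ : ∃ r, r = g w' - ν := ⟨_, rfl⟩
        have e1 : f w = ν + r := by omega
        have e2 : g w = ν + t := by omega
        have e3 : f w' = ν + r' := by omega
        have e4 : g w' = ν + t' := by omega
        have b1 : |r| ≤ N := hr ▸ hf w hwT
        have b2 : |t| ≤ N := ht ▸ hg w hwT
        have b3 : |r'| ≤ N := hr' ▸ hf w' hwT'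
        have b4 : |t'| ≤ N := ht' ▸ hg w' hwT'
        have hprod : ν * (r + t - r' - t') = r' * t' - r * t := by
          have : (ν + r) * (ν + t) = (ν + r') * (ν + t') := by
            rw [← e1, ← e2, ← e3, ← e4, hwm, hwm']
          linarith [this]
        have hb : |r' * t' - r * t| ≤ 2 * (N : ℤ) ^ 2 := by
          calc |r' * t' - r * t| ≤ |r' * t'| + |r * t| := abs_sub _ _
            _ ≤ N * N + N * N := by
              rw [abs_mul, abs_mul]
              exact add_le_add (mul_le_mul b3 b4 (abs_nonneg _) (by positivity))
                (mul_le_mul b1 b2 (abs_nonneg _) (by positivity))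
            _ = _ := by ring
        -- A nonzero integer here would make the left side of `hprod` larger than `20 N²`, against
        -- `2 N²` on the right. So two factorisations share their sum as well as their product, and
        -- agree up to order.
        have hsum : r + t - r' - t' = 0 := by
          by_contra hne
          have h1 : 1 ≤ |r + t - r' - t'| := Int.one_le_abs hne
          have h2 : |ν| * |r + t - r' - t'| ≤ 2 * (N : ℤ) ^ 2 := by
            rw [← abs_mul, hprod]; exact hb
          nlinarith [abs_nonneg ν]
        have hrt : r' * t' = r * t := by rw [hsum, mul_zero] at hprod; linarith
        have h5 : (r' - r) * (r' - t) = 0 := by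
          have : t' = r + t - r' := by linarith
          subst this
          linarith
        rcases mul_eq_zero.mp h5 with h | h
        · left; constructor <;> omega
        · right; constructor <;> omega
      · left
        have b1 := hf w hwT
        have b2 := hg w hwT
        have b3 := hf w' hwT'
        have b4 := hg w' hwT'
        have hd : |f w' - f w| ≤ 2 * N := by
          calc |f w' - f w| = |(f w' - ν) - (f w - ν)| := by ring_nf
            _ ≤ |f w' - ν| + |f w - ν| := abs_sub _ _
            _ ≤ _ := by linarith
        have hprod : f w * (g w - g w') = (f w' - f w) * g w' := by
          have : f w * g w = f w' * g w' := by rw [hwm, hwm']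
          linarith
        have hfw : 19 * (N : ℤ) ^ 2 < |f w| := by
          have : |ν| ≤ |f w - ν| + |f w| := by
            have := abs_sub (f w) (f w - ν)
            simpa [add_comm] using this
          linarith
        -- The same rigidity with a small second factor: a nonzero multiple of `f w`, which exceeds
        -- `19 N²`, cannot have size at most `2 N²`.
        have hgg : g w - g w' = 0 := by
          by_contra hne
          have h1 : 1 ≤ |g w - g w'| := Int.one_le_abs hne
          have h2 : |f w| * |g w - g w'| ≤ (2 * N) * N := by
            rw [← abs_mul, hprod, abs_mul]
            exact mul_le_mul hd b4 (abs_nonneg _) (by positivity)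
          nlinarith [abs_nonneg (f w)]
        have hgw0 : g w' ≠ 0 := by
          intro h0; rw [h0, mul_zero] at hwm'; exact hm hwm'.symm
        rw [hgg, mul_zero] at hprod
        rcases mul_eq_zero.mp hprod.symm with h | h
        · constructor <;> omega
        · exact absurd h hgw0
    by_cases hempty : (T.filter fun w => f w * g w = m) = ∅
    · rw [hempty]; simp
    obtain ⟨w, hw⟩ := Finset.nonempty_iff_ne_empty.mpr hempty
    have : ((T.filter fun w => f w * g w = m).card) ≤
        ({(f w, g w), (g w, f w)} : Finset (ℤ × ℤ)).card := by
      apply Finset.card_le_card_of_injOn (fun w => (f w, g w))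
      · intro w' hw'
        rcases key w hw w' hw' with ⟨h1, h2⟩ | ⟨h1, h2⟩ <;> simp [h1, h2]
      · exact hinj.injOn
    exact_mod_cast this.trans Finset.card_le_two

/-- The first component prescribes the value of `Q` at the second, so the fibres of the first
projection have at most `K` points. -/
lemma card_filter_sum_eq_le (T : Finset (ℤ × ℤ)) (P Q : ℤ × ℤ → ℤ) (c : ℤ) (K : ℕ)
    (hQ : ∀ m ≠ 0, (T.filter fun w => Q w = m).card ≤ K) :
    ((T ×ˢ T).filter fun z => P z.1 + Q z.2 = c ∧ Q z.2 ≠ 0).card ≤ K * T.card := by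
  refine Finset.card_le_mul_card_image_of_maps_to (f := Prod.fst) ?_ K ?_
  · intro z hz
    exact (Finset.mem_product.mp (Finset.mem_filter.mp hz).1).1
  · intro u _
    by_cases hm : c - P u = 0
    · rw [Finset.filter_filter, Finset.filter_false_of_mem]
      · simp
      · rintro z _ ⟨⟨h1, h2⟩, rfl⟩
        exact h2 (by linarith)
    · refine le_trans ?_ (hQ _ hm)
      apply Finset.card_le_card_of_injOn Prod.snd
      · intro z hz
        simp only [Finset.coe_filter, Finset.mem_filter, Finset.mem_product, Set.mem_ofPred_eq]
          at hz ⊢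
        obtain ⟨⟨⟨_, h1⟩, h2, h3⟩, h4⟩ := hz
        exact ⟨h1, by rw [← h4]; linarith⟩
      · intro z hz z' hz' h
        simp only [Finset.coe_filter, Finset.mem_filter, Set.mem_ofPred_eq] at hz hz'
        exact Prod.ext (hz.2.trans hz'.2.symm) h

/-- The counting bound behind both elliptic counting estimates: `x = (u.1, w.1)` and
`y = (u.2, w.2)` range over lattice boxes and `(ν - x) · g(x, y)` is prescribed, where `g` is
`ν - y` or `x - y`. -/
lemma exists_card_bilinear_le (θ : ℝ) (hθ : 0 < θ) :
    ∃ C : ℝ, 0 < C ∧ ∀ (A B : ℕ) (ν₀ ν₁ c : ℤ) (g : ℤ → ℤ × ℤ → ℤ), 1 ≤ A → 1 ≤ B →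
      ((g = fun ν u => ν - u.2) ∨ (g = fun _ u => u.1 - u.2)) →
      (((Finset.Icc (-(A : ℤ)) A ×ˢ Finset.Icc (-(B : ℤ)) B) ×ˢ
          (Finset.Icc (-(A : ℤ)) A ×ˢ Finset.Icc (-(B : ℤ)) B)).filter fun z =>
          (ν₀ - z.1.1) * g ν₀ z.1 + (ν₁ - z.2.1) * g ν₁ z.2 = c ∧
          (ν₀ - z.1.1 ≠ 0 ∨ ν₁ - z.2.1 ≠ 0) ∧ (g ν₀ z.1 ≠ 0 ∨ g ν₁ z.2 ≠ 0)).card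
        ≤ C * A * B * (max (A : ℝ) B) ^ θ := by
  obtain ⟨C, hC, hfib⟩ := exists_card_short_factorization_le θ hθ
  refine ⟨18 * (C * 2 ^ θ) + 18, by positivity, ?_⟩
  intro A B ν₀ ν₁ c g hA hB hg
  set T := Finset.Icc (-(A : ℤ)) A ×ˢ Finset.Icc (-(B : ℤ)) B with hT
  -- The factor `x - y` has size up to `A + B`, which `N` must dominate.
  set N : ℕ := 2 * max A B with hN
  have hTA : ∀ w ∈ T, |w.1| ≤ A ∧ |w.2| ≤ B := by
    intro w hw
    rw [hT, Finset.mem_product, Finset.mem_Icc, Finset.mem_Icc] at hw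
    exact ⟨abs_le.mpr hw.1, abs_le.mpr hw.2⟩
  have hAN : (A : ℤ) + B ≤ N := by
    have h1 := le_max_left A B
    have h2 := le_max_right A B
    have : A + B ≤ N := by omega
    exact_mod_cast this
  have hfibre : ∀ ν m : ℤ, m ≠ 0 →
      (T.filter fun w => (ν - w.1) * g ν w = m).card ≤ ⌊C * (N : ℝ) ^ θ⌋₊ := by
    intro ν m hm
    apply Nat.le_floor
    apply hfib T (fun w => ν - w.1) (g ν) ν m N (by omega) _ hm
    · intro w hw
      have := (hTA w hw).1
      simp only [sub_sub_cancel_left, abs_neg]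
      omega
    · rcases hg with rfl | rfl
      · left
        intro w hw
        have := (hTA w hw).2
        simp only [sub_sub_cancel_left, abs_neg]
        omega
      · right
        intro w hw
        have := hTA w hw
        have h3 := abs_sub w.1 w.2
        beta_reduce
        omega
    · rcases hg with rfl | rfl
      · intro w w' h
        simp only [Prod.mk.injEq] at h
        exact Prod.ext (by omega) (by omega)
      · intro w w' h
        simp only [Prod.mk.injEq] at h
        exact Prod.ext (by omega) (by omega)
  set K := ⌊C * (N : ℝ) ^ θ⌋₊ with hK
  have hTcard : T.card = (2 * A + 1) * (2 * B + 1) := by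
    rw [hT, Finset.card_product, Int.card_Icc, Int.card_Icc]
    congr 1 <;> omega
  have h1 := card_filter_sum_eq_le T (fun w => (ν₀ - w.1) * g ν₀ w)
    (fun w => (ν₁ - w.1) * g ν₁ w) c K (hfibre ν₁)
  have h2 := card_filter_sum_eq_le T (fun w => (ν₁ - w.1) * g ν₁ w)
    (fun w => (ν₀ - w.1) * g ν₀ w) c K (hfibre ν₀)
  set S := (T ×ˢ T).filter fun z =>
          (ν₀ - z.1.1) * g ν₀ z.1 + (ν₁ - z.2.1) * g ν₁ z.2 = c ∧
          (ν₀ - z.1.1 ≠ 0 ∨ ν₁ - z.2.1 ≠ 0) ∧ (g ν₀ z.1 ≠ 0 ∨ g ν₁ z.2 ≠ 0) with hS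
  set S1 := (T ×ˢ T).filter fun z => (ν₀ - z.1.1) * g ν₀ z.1 + (ν₁ - z.2.1) * g ν₁ z.2 = c ∧
    (ν₁ - z.2.1) * g ν₁ z.2 ≠ 0
  set S2 := (T ×ˢ T).filter fun z => (ν₁ - z.1.1) * g ν₁ z.1 + (ν₀ - z.2.1) * g ν₀ z.2 = c ∧
    (ν₀ - z.2.1) * g ν₀ z.2 ≠ 0
  set S3 := (T ×ˢ T).filter fun z => ν₀ - z.1.1 = 0 ∧ g ν₁ z.2 = 0
  set S4 := (T ×ˢ T).filter fun z => ν₁ - z.2.1 = 0 ∧ g ν₀ z.1 = 0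
  -- `S1` and `S2` have a nonvanishing product in one coordinate and are fibred over the other. If
  -- both products vanish, the two vanishing factors cannot belong to the same vector; the mixed
  -- cases `S3` and `S4` leave one free integer in each coordinate.
  have hsub : S ⊆ S1 ∪ S2.image Prod.swap ∪ S3 ∪ S4 := by
    intro z hz
    obtain ⟨hzT, hz1, hz2, hz3⟩ := Finset.mem_filter.mp hz
    simp only [Finset.mem_union]
    by_cases q1 : (ν₁ - z.2.1) * g ν₁ z.2 ≠ 0
    · left; left; left
      exact Finset.mem_filter.mpr ⟨hzT, hz1, q1⟩
    by_cases q2 : (ν₀ - z.1.1) * g ν₀ z.1 ≠ 0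
    · left; left; right
      refine Finset.mem_image.mpr ⟨z.swap, Finset.mem_filter.mpr ⟨?_, ?_, q2⟩, Prod.swap_swap z⟩
      · rw [Finset.mem_product] at hzT ⊢
        exact ⟨hzT.2, hzT.1⟩
      · simp only [Prod.fst_swap, Prod.snd_swap]; linarith
    push Not at q1 q2
    rcases mul_eq_zero.mp q1 with r1 | r1 <;> rcases mul_eq_zero.mp q2 with r2 | r2
    · omega
    · right; exact Finset.mem_filter.mpr ⟨hzT, r1, r2⟩
    · left; right; exact Finset.mem_filter.mpr ⟨hzT, r2, r1⟩
    · omega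
  have hT' : (Finset.Icc (-(B : ℤ)) B ×ˢ Finset.Icc (-(A : ℤ)) A).card = T.card := by
    rw [hT, Finset.card_product, Finset.card_product, mul_comm]
  have h3 : S3.card ≤ T.card := by
    rw [← hT']
    apply Finset.card_le_card_of_injOn (fun z => (z.1.2, z.2.1))
    · intro z hz
      have hz' := (Finset.mem_filter.mp hz).1
      simp only [hT, Finset.mem_product] at hz'
      simp only [Finset.coe_product, Set.mem_prod, Finset.mem_coe]
      exact ⟨hz'.1.2, hz'.2.1⟩
    · intro z hz z' hz' h
      obtain ⟨_, e1, e2⟩ := Finset.mem_filter.mp hz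
      obtain ⟨_, e1', e2'⟩ := Finset.mem_filter.mp hz'
      simp only [Prod.mk.injEq] at h
      rcases hg with rfl | rfl
      · exact Prod.ext (Prod.ext (by omega) h.1) (Prod.ext h.2 (by dsimp only at *; omega))
      · exact Prod.ext (Prod.ext (by omega) h.1) (Prod.ext h.2 (by dsimp only at *; omega))
  have h4 : S4.card ≤ T.card := by
    apply Finset.card_le_card_of_injOn (fun z => (z.1.1, z.2.2))
    · intro z hz
      have hz' := (Finset.mem_filter.mp hz).1
      simp only [hT, Finset.mem_product] at hz'
      simp only [hT, Finset.coe_product, Set.mem_prod, Finset.mem_coe]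
      exact ⟨hz'.1.1, hz'.2.2⟩
    · intro z hz z' hz' h
      obtain ⟨_, e1, e2⟩ := Finset.mem_filter.mp hz
      obtain ⟨_, e1', e2'⟩ := Finset.mem_filter.mp hz'
      simp only [Prod.mk.injEq] at h
      rcases hg with rfl | rfl
      · exact Prod.ext (Prod.ext h.1 (by dsimp only at *; omega)) (Prod.ext (by omega) h.2)
      · exact Prod.ext (Prod.ext h.1 (by dsimp only at *; omega)) (Prod.ext (by omega) h.2)
  have hcard : S.card ≤ 2 * (K * T.card) + 2 * T.card := by
    have e1 := Finset.card_le_card hsub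
    have e2 := Finset.card_union_le (S1 ∪ S2.image Prod.swap ∪ S3) S4
    have e3 := Finset.card_union_le (S1 ∪ S2.image Prod.swap) S3
    have e4 := Finset.card_union_le S1 (S2.image Prod.swap)
    have e5 : (S2.image Prod.swap).card ≤ S2.card := Finset.card_image_le
    omega
  have hA' : (1 : ℝ) ≤ A := by exact_mod_cast hA
  have hB' : (1 : ℝ) ≤ B := by exact_mod_cast hB
  have hmax : (1 : ℝ) ≤ max (A : ℝ) B := hA'.trans (le_max_left _ _)
  have hKle : (K : ℝ) ≤ C * 2 ^ θ * (max (A : ℝ) B) ^ θ := by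
    have h5 : (K : ℝ) ≤ C * (N : ℝ) ^ θ := Nat.floor_le (by positivity)
    have h6 : (N : ℝ) = 2 * max (A : ℝ) B := by rw [hN]; push_cast; rfl
    rw [h6, Real.mul_rpow (by norm_num) (by linarith)] at h5
    linarith
  have hTc : (T.card : ℝ) ≤ 9 * (A * B) := by
    rw [hTcard]; push_cast
    nlinarith
  have hm1 : (1 : ℝ) ≤ (max (A : ℝ) B) ^ θ := Real.one_le_rpow hmax hθ.le
  calc (S.card : ℝ) ≤ 2 * (K * T.card) + 2 * T.card := by exact_mod_cast hcard
    _ ≤ 2 * ((C * 2 ^ θ * (max (A : ℝ) B) ^ θ) * (9 * (A * B))) +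
        2 * (9 * (A * B)) * (max (A : ℝ) B) ^ θ := by
      have e1 : (K : ℝ) * T.card ≤ (C * 2 ^ θ * (max (A : ℝ) B) ^ θ) * (9 * (A * B)) :=
        mul_le_mul hKle hTc (by positivity) (by positivity)
      have e2 : (2 : ℝ) * T.card ≤ 2 * (9 * (A * B)) * 1 := by linarith
      have e3 : 2 * (9 * (A * B)) * (1 : ℝ) ≤ 2 * (9 * (A * B)) * (max (A : ℝ) B) ^ θ :=
        mul_le_mul_of_nonneg_left hm1 (by positivity)
      linarith
    _ = _ := by ring

lemma Shell.abs_le {a : ℕ} {n : Freq} (h : Shell a n) (i : Fin 2) :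
    |n i| ≤ ((2 * 2 ^ a : ℕ) : ℤ) := by
  have h1 : length n < 2 * (2 : ℝ) ^ a := h.2
  have h2 : ((n i : ℝ)) ^ 2 ≤ (modSq n : ℝ) := by
    have : n i ^ 2 ≤ modSq n := by
      unfold modSq
      fin_cases i <;> simp [sq_nonneg]
    exact_mod_cast this
  have h3 : |(n i : ℝ)| ≤ length n := by
    rw [← Real.sqrt_sq_eq_abs]; exact Real.sqrt_le_sqrt h2
  have h4 : ((|n i| : ℤ) : ℝ) ≤ (((2 * 2 ^ a : ℕ) : ℤ) : ℝ) := by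
    push_cast; linarith
  exact_mod_cast h4

/-- **The elliptic counting estimate.** -/
theorem countingEstimate : CountingEstimate := by
  intro θ hθ
  obtain ⟨C, hC, hcount⟩ := exists_card_bilinear_le θ hθ
  refine ⟨4 * C * 2 ^ θ, by positivity, ?_⟩
  intro n μ a b
  have hfin : ∀ (g : ℤ → ℤ × ℤ → ℤ) (S : Set (Freq × Freq × Freq))
      (y : Freq × Freq × Freq → Freq),
      ((g = fun ν u => ν - u.2) ∨ (g = fun _ u => u.1 - u.2)) →
      (∀ q ∈ S, Shell a q.1 ∧ Shell b (y q)) →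
      (∀ q ∈ S, 2 * ((n 0 - q.1 0) * g (n 0) (q.1 0, y q 0) +
        (n 1 - q.1 1) * g (n 1) (q.1 1, y q 1)) = μ) →
      (∀ q ∈ S, n ≠ q.1 ∧ (g (n 0) (q.1 0, y q 0) ≠ 0 ∨ g (n 1) (q.1 1, y q 1) ≠ 0)) →
      (∀ q ∈ S, ∀ q' ∈ S, q.1 = q'.1 → y q = y q' → q = q') →
      S.Finite ∧ (S.ncard : ℝ) ≤
        4 * C * 2 ^ θ * 2 ^ a * 2 ^ b * (max ((2 : ℝ) ^ a) ((2 : ℝ) ^ b)) ^ θ := by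
    intro g S y hg hshell hsum hne hinj
    -- The division `μ / 2` is exact on `S`, as the phase is even. The box has radius `2 * 2 ^ a`
    -- because `|n| < 2 · 2^a` on the shell.
    have hc := hcount (2 * 2 ^ a) (2 * 2 ^ b) (n 0) (n 1) (μ / 2) g
      (by have := Nat.one_le_two_pow (n := a); omega)
      (by have := Nat.one_le_two_pow (n := b); omega) hg
    set F := (((Finset.Icc (-((2 * 2 ^ a : ℕ) : ℤ)) (2 * 2 ^ a : ℕ) ×ˢ
      Finset.Icc (-((2 * 2 ^ b : ℕ) : ℤ)) (2 * 2 ^ b : ℕ)) ×ˢ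
          (Finset.Icc (-((2 * 2 ^ a : ℕ) : ℤ)) (2 * 2 ^ a : ℕ) ×ˢ
          Finset.Icc (-((2 * 2 ^ b : ℕ) : ℤ)) (2 * 2 ^ b : ℕ))).filter fun z =>
          (n 0 - z.1.1) * g (n 0) z.1 + (n 1 - z.2.1) * g (n 1) z.2 = μ / 2 ∧
          (n 0 - z.1.1 ≠ 0 ∨ n 1 - z.2.1 ≠ 0) ∧ (g (n 0) z.1 ≠ 0 ∨ g (n 1) z.2 ≠ 0))
    set φ : Freq × Freq × Freq → (ℤ × ℤ) × (ℤ × ℤ) :=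
      fun q => ((q.1 0, y q 0), (q.1 1, y q 1))
    have hmaps : Set.MapsTo φ S F := by
      intro q hq
      refine Finset.mem_coe.mpr (Finset.mem_filter.mpr ⟨?_, ?_, ?_, (hne q hq).2⟩)
      · have h1 := (hshell q hq).1.abs_le
        have h2 := (hshell q hq).2.abs_le
        simp only [Finset.mem_product, Finset.mem_Icc, ← _root_.abs_le]
        exact ⟨⟨h1 0, h2 0⟩, h1 1, h2 1⟩
      · have := hsum q hq
        simp only [φ]
        omega
      · by_contra hcon
        push Not at hcon
        apply (hne q hq).1
        ext i
        fin_cases i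
        · have := hcon.1; simp only [φ] at this; simp; omega
        · have := hcon.2; simp only [φ] at this; simp; omega
    have hinjOn : Set.InjOn φ S := by
      intro q hq q' hq' h
      simp only [φ, Prod.mk.injEq] at h
      apply hinj q hq q' hq'
      · ext i; fin_cases i
        · exact h.1.1
        · exact h.2.1
      · ext i; fin_cases i
        · exact h.1.2
        · exact h.2.2
    refine ⟨Set.Finite.of_injOn hmaps hinjOn F.finite_toSet, ?_⟩
    have h1 : S.ncard ≤ F.card := by
      rw [← Set.ncard_coe_finset]
      exact Set.ncard_le_ncard_of_injOn φ (fun q hq => hmaps hq) hinjOn F.finite_toSet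
    have h2 : (S.ncard : ℝ) ≤ F.card := by exact_mod_cast h1
    refine h2.trans (hc.trans (le_of_eq ?_))
    push_cast
    rw [← mul_max_of_nonneg _ _ (by norm_num : (0 : ℝ) ≤ 2),
      Real.mul_rpow (by norm_num) (by positivity)]
    ring
  constructor
  · apply hfin (fun ν u => ν - u.2) _ (fun q => q.2.2) (Or.inl rfl)
    · exact fun q hq => hq.2
    · rintro q ⟨⟨h1, h2, h3, h4⟩, -⟩
      rw [← h4]
      have e0 : q.2.1 0 = q.1 0 + q.2.2 0 - n 0 := by
        have := congrFun h1 0; simp only [Pi.add_apply, Pi.sub_apply] at this; omega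
      have e1 : q.2.1 1 = q.1 1 + q.2.2 1 - n 1 := by
        have := congrFun h1 1; simp only [Pi.add_apply, Pi.sub_apply] at this; omega
      simp only [modSq, e0, e1]; ring
    · rintro q ⟨⟨h1, h2, h3, h4⟩, -⟩
      refine ⟨h2, ?_⟩
      by_contra hcon
      push Not at hcon
      apply h3
      ext i; fin_cases i
      · have := hcon.1; simp; omega
      · have := hcon.2; simp; omega
    · rintro q ⟨⟨h1, -⟩, -⟩ q' ⟨⟨h1', -⟩, -⟩ e1 e2
      have : q.2.1 = q'.2.1 := by
        have : q.1 - q.2.1 + q.2.2 = q'.1 - q'.2.1 + q'.2.2 := h1.trans h1'.symm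
        rw [e1, e2] at this
        simpa using this
      exact Prod.ext e1 (Prod.ext this e2)
  · apply hfin (fun _ u => u.1 - u.2) _ (fun q => q.2.1) (Or.inr rfl)
    · exact fun q hq => hq.2
    · rintro q ⟨⟨h1, h2, h3, h4⟩, -⟩
      rw [← h4]
      have e0 : q.2.2 0 = n 0 - q.1 0 + q.2.1 0 := by
        have := congrFun h1 0; simp only [Pi.add_apply, Pi.sub_apply] at this; omega
      have e1 : q.2.2 1 = n 1 - q.1 1 + q.2.1 1 := by
        have := congrFun h1 1; simp only [Pi.add_apply, Pi.sub_apply] at this; omega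
      simp only [modSq, e0, e1]; ring
    · rintro q ⟨⟨h1, h2, h3, h4⟩, -⟩
      refine ⟨h2, ?_⟩
      by_contra hcon
      push Not at hcon
      apply h3
      rw [← h1]
      ext i; fin_cases i
      · have := hcon.1; simp; omega
      · have := hcon.2; simp; omega
    · rintro q ⟨⟨h1, -⟩, -⟩ q' ⟨⟨h1', -⟩, -⟩ e1 e2
      have : q.2.2 = q'.2.2 := by
        have : q.1 - q.2.1 + q.2.2 = q'.1 - q'.2.1 + q'.2.2 := h1.trans h1'.symm
        rw [e1, e2] at this
        simpa using this
      exact Prod.ext e1 (Prod.ext e2 this)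

/-! ### Weighted sums over resonance sets -/

lemma one_le_bracket (n : Freq) : 1 ≤ bracket n := by
  unfold bracket
  rw [Real.one_le_sqrt]
  have : (0 : ℝ) ≤ (modSq n : ℝ) := by unfold modSq; push_cast; positivity
  linarith

lemma length_le_bracket (n : Freq) : length n ≤ bracket n :=
  Real.sqrt_le_sqrt (by linarith)

lemma bracket_sq (n : Freq) : bracket n ^ 2 = 1 + (n 0 : ℝ) ^ 2 + (n 1 : ℝ) ^ 2 := by
  unfold bracket modSq
  push_cast
  rw [Real.sq_sqrt (by positivity), add_assoc]

/-- The index of a dyadic shell containing `n`. -/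
def shellIndex (n : Freq) : ℕ := Nat.log 2 ⌊length n⌋₊

lemma shell_shellIndex (n : Freq) : Shell (shellIndex n) n := by
  have h0 : 0 ≤ length n := Real.sqrt_nonneg _
  constructor
  · intro ha
    have hne : ⌊length n⌋₊ ≠ 0 := by
      intro h; simp [shellIndex, h] at ha
    have h1 : 2 ^ shellIndex n ≤ ⌊length n⌋₊ := Nat.pow_log_le_self 2 hne
    have h2 : ((2 : ℝ) ^ shellIndex n) ≤ length n := by
      calc ((2 : ℝ) ^ shellIndex n) = ((2 ^ shellIndex n : ℕ) : ℝ) := by push_cast; rfl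
        _ ≤ (⌊length n⌋₊ : ℝ) := by exact_mod_cast h1
        _ ≤ _ := Nat.floor_le h0
    have : (0 : ℝ) < 2 ^ shellIndex n := by positivity
    linarith
  · have h1 : ⌊length n⌋₊ < 2 ^ (shellIndex n + 1) := Nat.lt_pow_succ_log_self one_lt_two _
    have h2 : length n < (2 ^ (shellIndex n + 1) : ℕ) := by
      rw [← Nat.floor_lt h0]; exact h1
    push_cast at h2
    rw [pow_succ] at h2
    linarith

lemma two_pow_shellIndex_le (n : Freq) : (2 : ℝ) ^ shellIndex n ≤ bracket n := by
  by_cases hne : ⌊length n⌋₊ = 0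
  · simp only [shellIndex, hne, Nat.log_zero_right, pow_zero]
    exact one_le_bracket n
  · have h1 : 2 ^ shellIndex n ≤ ⌊length n⌋₊ := Nat.pow_log_le_self 2 hne
    calc ((2 : ℝ) ^ shellIndex n) = ((2 ^ shellIndex n : ℕ) : ℝ) := by push_cast; rfl
        _ ≤ (⌊length n⌋₊ : ℝ) := by exact_mod_cast h1
        _ ≤ length n := Nat.floor_le (Real.sqrt_nonneg _)
        _ ≤ _ := length_le_bracket n

/-- A counting bound on pairs of dyadic shells turns into a bound of a weighted sum. -/
lemma tsum_indicator_bracket_le {ι : Type*} (S : Set ι) (y z : ι → Freq) {C θ σ : ℝ} (hC : 0 ≤ C)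
    (hθ : 0 < θ) (hσ : 0 ≤ σ)
    (hcount : ∀ a b : ℕ, (S ∩ {q | Shell a (y q) ∧ Shell b (z q)}).Finite ∧
      ((S ∩ {q | Shell a (y q) ∧ Shell b (z q)}).ncard : ℝ) ≤
        C * 2 ^ a * 2 ^ b * (max ((2 : ℝ) ^ a) ((2 : ℝ) ^ b)) ^ θ) :
    ∑' q, S.indicator (fun q => ENNReal.ofReal ((bracket (y q) * bracket (z q)) ^ (-σ))) q ≤
      ENNReal.ofReal C * ((1 - ENNReal.ofReal (2 ^ (1 + θ - σ)))⁻¹ *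
        (1 - ENNReal.ofReal (2 ^ (1 + θ - σ)))⁻¹) := by
  set r : ℝ := 2 ^ (1 + θ - σ) with hr
  have hr0 : 0 ≤ r := by positivity
  have hsplit : ∀ q, S.indicator
      (fun q => ENNReal.ofReal ((bracket (y q) * bracket (z q)) ^ (-σ))) q =
      ∑' ij : ℕ × ℕ, if ij = (shellIndex (y q), shellIndex (z q)) then S.indicator
      (fun q => ENNReal.ofReal ((bracket (y q) * bracket (z q)) ^ (-σ))) q else 0 := by
    intro q; rw [tsum_ite_eq]
  rw [tsum_congr hsplit, ENNReal.tsum_comm]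
  have hterm : ∀ ij : ℕ × ℕ, (∑' q, if ij = (shellIndex (y q), shellIndex (z q)) then S.indicator
      (fun q => ENNReal.ofReal ((bracket (y q) * bracket (z q)) ^ (-σ))) q else 0) ≤
      ENNReal.ofReal C * (ENNReal.ofReal r ^ ij.1 * ENNReal.ofReal r ^ ij.2) := by
    rintro ⟨i, j⟩
    obtain ⟨hfin, hcard⟩ := hcount i j
    set S' := S ∩ {q | Shell i (y q) ∧ Shell j (z q)}
    have h1 : ∀ q, (if (i, j) = (shellIndex (y q), shellIndex (z q)) then S.indicator
        (fun q => ENNReal.ofReal ((bracket (y q) * bracket (z q)) ^ (-σ))) q else 0) ≤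
        S'.indicator (fun _ => ENNReal.ofReal (((2 : ℝ) ^ i * 2 ^ j) ^ (-σ))) q := by
      intro q
      split_ifs with h
      · by_cases hq : q ∈ S
        · simp only [Prod.mk.injEq] at h
          have hq' : q ∈ S' := ⟨hq, by
            rw [h.1, h.2]; exact ⟨shell_shellIndex _, shell_shellIndex _⟩⟩
          rw [Set.indicator_of_mem hq, Set.indicator_of_mem hq']
          apply ENNReal.ofReal_le_ofReal
          apply Real.rpow_le_rpow_of_nonpos (by positivity) _ (by linarith)
          rw [h.1, h.2]
          exact mul_le_mul (two_pow_shellIndex_le _) (two_pow_shellIndex_le _) (by positivity)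
            (bracket_pos _).le
        · rw [Set.indicator_of_notMem hq]; exact zero_le
      · exact zero_le
    refine (ENNReal.tsum_le_tsum h1).trans ?_
    rw [← tsum_subtype, ENNReal.tsum_set_const, ← hfin.cast_ncard_eq]
    have h2 : ((((S'.ncard : ℕ∞)) : ℝ≥0∞)) = ENNReal.ofReal (S'.ncard : ℝ) := by simp
    rw [h2, ← ENNReal.ofReal_mul (by positivity), ← ENNReal.ofReal_pow hr0,
      ← ENNReal.ofReal_pow hr0, ← ENNReal.ofReal_mul (by positivity), ← ENNReal.ofReal_mul hC]
    apply ENNReal.ofReal_le_ofReal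
    have hi : (1 : ℝ) ≤ 2 ^ i := one_le_pow₀ (by norm_num)
    have hj : (1 : ℝ) ≤ 2 ^ j := one_le_pow₀ (by norm_num)
    -- Replacing the maximum by the product decouples the shell indices and leaves a product of two
    -- geometric series of ratio `r`.
    have hmax : (max ((2 : ℝ) ^ i) ((2 : ℝ) ^ j)) ^ θ ≤ ((2 : ℝ) ^ i * 2 ^ j) ^ θ := by
      apply Real.rpow_le_rpow (by positivity) _ hθ.le
      apply max_le <;> nlinarith
    have hrij : r ^ i * r ^ j = ((2 : ℝ) ^ i * 2 ^ j) ^ (1 + θ - σ) := by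
      rw [hr, ← pow_add, ← pow_add, ← Real.rpow_natCast, ← Real.rpow_mul (by norm_num),
        ← Real.rpow_natCast, ← Real.rpow_mul (by norm_num), mul_comm]
    calc _ ≤ (C * 2 ^ i * 2 ^ j * ((2 : ℝ) ^ i * 2 ^ j) ^ θ) * (((2 : ℝ) ^ i * 2 ^ j) ^ (-σ)) := by
          gcongr
          exact hcard.trans (by gcongr)
      _ = C * (((2 : ℝ) ^ i * 2 ^ j) ^ (1 : ℝ) * ((2 : ℝ) ^ i * 2 ^ j) ^ θ *
            ((2 : ℝ) ^ i * 2 ^ j) ^ (-σ)) := by rw [Real.rpow_one]; ring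
      _ = C * (r ^ i * r ^ j) := by
          rw [← Real.rpow_add (by positivity), ← Real.rpow_add (by positivity), hrij]
          rfl
  refine (ENNReal.tsum_le_tsum hterm).trans (le_of_eq ?_)
  rw [ENNReal.tsum_mul_left,
    ENNReal.tsum_prod (f := fun i j : ℕ => ENNReal.ofReal r ^ i * ENNReal.ofReal r ^ j)]
  congr 1
  simp_rw [ENNReal.tsum_mul_left, ENNReal.tsum_mul_right, ENNReal.tsum_geometric]

/-- The phase `|n|² - |a|² + |a + b - n|² - |b|² = 2 (n - a) · (n - b)`. -/
def phase (n a b : Freq) : ℤ := 2 * ((n 0 - a 0) * (n 0 - b 0) + (n 1 - a 1) * (n 1 - b 1))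

lemma phase_eq (n a b : Freq) :
    phase n a b = modSq n - modSq a + modSq (a + b - n) - modSq b := by
  simp only [phase, modSq, Pi.add_apply, Pi.sub_apply]; ring

lemma phase_comm (n a b : Freq) : phase n a b = phase n b a := by
  unfold phase; ring

/-- Pairs `(n₁, n₃)` with phase `μ` that are nonresonant or equal to `(n, n)`. -/
def res (μ : ℤ) (n : Freq) : Set (Freq × Freq) :=
  {z | phase n z.1 z.2 = μ ∧ ((n ≠ z.1 ∧ n ≠ z.2) ∨ (n = z.1 ∧ n = z.2))}

/-- Since `n₁` and `n₃` determine `n₂`, the nonresonant part is a subsum of the sum over `Gam`. The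
pair `(n, n)`, which carries the correction term of the gauged nonlinearity, adds at most `1`. -/
lemma tsum_res_le {μ : ℤ} {n : Freq} (f : Freq × Freq × Freq → ℝ≥0∞) (h1 : f (n, n, n) ≤ 1) :
    ∑' z, (res μ n).indicator (fun z => f (z.1, z.1 + z.2 - n, z.2)) z ≤
      ∑' q, (Gam μ n).indicator f q + 1 := by
  have hle : ∀ z : Freq × Freq, (res μ n).indicator (fun z => f (z.1, z.1 + z.2 - n, z.2)) z ≤
      (Gam μ n).indicator f (z.1, z.1 + z.2 - n, z.2) + if z = (n, n) then 1 else 0 := by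
    intro z
    by_cases hz : z ∈ res μ n
    · rw [Set.indicator_of_mem hz]
      rcases hz.2 with h | h
      · have : (z.1, z.1 + z.2 - n, z.2) ∈ Gam μ n :=
          ⟨by simp only; abel, h.1, h.2, by rw [← hz.1, phase_eq]⟩
        rw [Set.indicator_of_mem this]
        exact le_self_add
      · have hz2 : z = (n, n) := Prod.ext h.1.symm h.2.symm
        rw [if_pos hz2, hz2]
        simp only [add_sub_cancel_right]
        exact h1.trans le_add_self
    · rw [Set.indicator_of_notMem hz]; exact zero_le
  refine (ENNReal.tsum_le_tsum hle).trans ?_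
  rw [ENNReal.tsum_add, tsum_ite_eq]
  gcongr
  apply ENNReal.tsum_comp_le_tsum_of_injective (f := fun z : Freq × Freq => (z.1, z.1 + z.2 - n, z.2))
  intro z z' h
  simp only [Prod.mk.injEq] at h
  exact Prod.ext h.1 h.2.2

lemma bracket_add_sub_le (a b c : Freq) :
    bracket (a - c + b) ≤ bracket a + bracket c + bracket b := by
  have key : ∀ x y : Freq, |(x 0 : ℝ) * y 0 + (x 1 : ℝ) * y 1| ≤ bracket x * bracket y := by
    intro x y
    apply abs_le_of_sq_le_sq _ (mul_nonneg (bracket_pos _).le (bracket_pos _).le)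
    rw [mul_pow, bracket_sq, bracket_sq]
    nlinarith [sq_nonneg ((x 0 : ℝ) * y 1 - (x 1 : ℝ) * y 0), sq_nonneg (x 0 : ℝ),
      sq_nonneg (x 1 : ℝ), sq_nonneg (y 0 : ℝ), sq_nonneg (y 1 : ℝ)]
  apply le_of_sq_le_sq _ (by positivity [bracket_pos a, bracket_pos b, bracket_pos c])
  have h1 := abs_le.mp (key a b)
  have h2 := abs_le.mp (key a c)
  have h3 := abs_le.mp (key b c)
  have ea := bracket_sq a
  have eb := bracket_sq b
  have ec := bracket_sq c
  rw [bracket_sq]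
  simp only [Pi.add_apply, Pi.sub_apply]
  push_cast
  nlinarith

/-- The resonance sums, for each pair of frequencies and for the full weight. -/
lemma exists_tsum_res_le {s q : ℝ} (hq : 0 < q) (hs : 0 < s) (hsq : 1 < s * q) :
    ∃ C : ℝ≥0∞, C ≠ ∞ ∧ ∀ (n : Freq) (μ : ℤ),
      (∑' z, (res μ n).indicator (fun z => ENNReal.ofReal
        ((bracket (z.1 + z.2 - n) * bracket z.2) ^ (-s)) ^ q) z ≤ C) ∧
      (∑' z, (res μ n).indicator (fun z => ENNReal.ofReal
        ((bracket z.1 * bracket z.2) ^ (-s)) ^ q) z ≤ C) ∧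
      (∑' z, (res μ n).indicator (fun z => ENNReal.ofReal
        ((bracket z.1 * bracket (z.1 + z.2 - n)) ^ (-s)) ^ q) z ≤ C) ∧
      (∑' z, (res μ n).indicator (fun z => ENNReal.ofReal
        (bracket n ^ s * (bracket z.1 * bracket (z.1 + z.2 - n) * bracket z.2) ^ (-s)) ^ q) z
          ≤ C) := by
  set σ := s * q with hσ
  -- Half of the room above `1`, so that the ratio `2 ^ (1 + θ - σ)` equals `2 ^ (-θ) < 1`.
  set θ := (σ - 1) / 2 with hθ
  obtain ⟨C, hC, hcount⟩ := countingEstimate θ (by linarith)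
  set K : ℝ≥0∞ := ENNReal.ofReal C * ((1 - ENNReal.ofReal (2 ^ (1 + θ - σ)))⁻¹ *
        (1 - ENNReal.ofReal (2 ^ (1 + θ - σ)))⁻¹) with hK
  have hr1 : ENNReal.ofReal (2 ^ (1 + θ - σ)) < 1 := by
    rw [ENNReal.ofReal_lt_one]
    exact Real.rpow_lt_one_of_one_lt_of_neg (by norm_num) (by rw [hθ]; linarith)
  have hinv : (1 - ENNReal.ofReal (2 ^ (1 + θ - σ)))⁻¹ ≠ ∞ := by
    rw [Ne, ENNReal.inv_eq_top, tsub_eq_zero_iff_le, not_le]; exact hr1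
  have hKtop : K ≠ ∞ := ENNReal.mul_ne_top ENNReal.ofReal_ne_top (ENNReal.mul_ne_top hinv hinv)
  have hpow : ∀ x : ℝ, 0 < x → ENNReal.ofReal (x ^ (-s)) ^ q = ENNReal.ofReal (x ^ (-σ)) := by
    intro x hx
    rw [ENNReal.ofReal_rpow_of_nonneg (by positivity) hq.le, ← Real.rpow_mul hx.le, hσ, neg_mul]
  have hle1 : ∀ a b : Freq, ENNReal.ofReal ((bracket a * bracket b) ^ (-σ)) ≤ 1 := by
    intro a b
    rw [ENNReal.ofReal_le_one]
    exact Real.rpow_le_one_of_one_le_of_nonpos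
      (one_le_mul_of_one_le_of_one_le (one_le_bracket a) (one_le_bracket b)) (by linarith)
  have hb : ∀ a b : Freq, 0 < bracket a * bracket b :=
    fun a b => mul_pos (bracket_pos a) (bracket_pos b)
  have h13 : ∀ n μ, ∑' z, (res μ n).indicator (fun z => ENNReal.ofReal
        ((bracket z.1 * bracket z.2) ^ (-s)) ^ q) z ≤ K + 1 := by
    intro n μ
    simp_rw [hpow _ (hb _ _)]
    refine (tsum_res_le (fun q => ENNReal.ofReal ((bracket q.1 * bracket q.2.2) ^ (-σ)))
      (hle1 n n)).trans ?_
    gcongr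
    exact tsum_indicator_bracket_le (Gam μ n) (fun q => q.1) (fun q => q.2.2) hC.le
      (by linarith) (by linarith) fun a b => (hcount n μ a b).1
  have h12 : ∀ n μ, ∑' z, (res μ n).indicator (fun z => ENNReal.ofReal
        ((bracket z.1 * bracket (z.1 + z.2 - n)) ^ (-s)) ^ q) z ≤ K + 1 := by
    intro n μ
    simp_rw [hpow _ (hb _ _)]
    refine (tsum_res_le (fun q => ENNReal.ofReal ((bracket q.1 * bracket q.2.1) ^ (-σ)))
      (hle1 n n)).trans ?_
    gcongr
    exact tsum_indicator_bracket_le (Gam μ n) (fun q => q.1) (fun q => q.2.1) hC.le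
      (by linarith) (by linarith) fun a b => (hcount n μ a b).2
  -- The pair `(n₂, n₃)` needs no counting of its own: exchanging `n₁` and `n₃` preserves the phase
  -- and leads to `(n₁, n₂)`.
  have h23 : ∀ n μ, ∑' z, (res μ n).indicator (fun z => ENNReal.ofReal
        ((bracket (z.1 + z.2 - n) * bracket z.2) ^ (-s)) ^ q) z ≤ K + 1 := by
    intro n μ
    refine le_trans (le_of_eq ?_) (h12 n μ)
    rw [← (Equiv.prodComm Freq Freq).tsum_eq]
    refine tsum_congr fun z => ?_
    have hmem : (Equiv.prodComm Freq Freq) z ∈ res μ n ↔ z ∈ res μ n := by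
      simp only [res, Equiv.prodComm_apply, Set.mem_ofPred_eq, Prod.fst_swap, Prod.snd_swap,
        phase_comm n z.2 z.1]
      tauto
    by_cases hz : z ∈ res μ n
    · rw [Set.indicator_of_mem hz, Set.indicator_of_mem (hmem.mpr hz)]
      simp only [Equiv.prodComm_apply, Prod.fst_swap, Prod.snd_swap]
      rw [mul_comm, add_comm z.2 z.1]
    · rw [Set.indicator_of_notMem hz, Set.indicator_of_notMem (fun h => hz (hmem.mp h))]
  set L : ℝ≥0∞ := ENNReal.ofReal (3 ^ s) ^ q
  have hL : L ≠ ∞ := ENNReal.rpow_ne_top_of_nonneg hq.le ENNReal.ofReal_ne_top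
  -- One of the three brackets is at least `⟨n⟩ / 3`. It absorbs `⟨n⟩^s` and leaves one of the three
  -- pair sums.
  have hfull : ∀ n μ, ∑' z, (res μ n).indicator (fun z => ENNReal.ofReal
        (bracket n ^ s * (bracket z.1 * bracket (z.1 + z.2 - n) * bracket z.2) ^ (-s)) ^ q) z
          ≤ L * ((K + 1) + (K + 1) + (K + 1)) := by
    intro n μ
    refine le_trans (ENNReal.tsum_le_tsum (g := fun z => L * ((res μ n).indicator (fun z =>
        ENNReal.ofReal ((bracket (z.1 + z.2 - n) * bracket z.2) ^ (-s)) ^ q) z +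
        (res μ n).indicator (fun z =>
        ENNReal.ofReal ((bracket z.1 * bracket z.2) ^ (-s)) ^ q) z +
        (res μ n).indicator (fun z =>
        ENNReal.ofReal ((bracket z.1 * bracket (z.1 + z.2 - n)) ^ (-s)) ^ q) z)) ?_) ?_
    · intro z
      by_cases hz : z ∈ res μ n
      · simp only [Set.indicator_of_mem hz]
        set A := bracket z.1 with hA
        set B := bracket z.2 with hB
        set D := bracket (z.1 + z.2 - n) with hD
        have hA0 : 0 < A := bracket_pos _
        have hB0 : 0 < B := bracket_pos _
        have hD0 : 0 < D := bracket_pos _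
        have hn0 : 0 < bracket n := bracket_pos n
        have htri : bracket n ≤ A + D + B := by
          have := bracket_add_sub_le z.1 z.2 (z.1 + z.2 - n)
          have e : z.1 - (z.1 + z.2 - n) + z.2 = n := by abel
          rwa [e] at this
        have hgen : ∀ X Y, 0 < X → 0 < Y → bracket n ≤ 3 * X →
            ENNReal.ofReal (bracket n ^ s * (X * Y) ^ (-s)) ^ q ≤
              L * ENNReal.ofReal (Y ^ (-s)) ^ q := by
          intro X Y hX hY hXn
          rw [← ENNReal.mul_rpow_of_nonneg _ _ hq.le, ← ENNReal.ofReal_mul (by positivity)]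
          apply ENNReal.rpow_le_rpow _ hq.le
          apply ENNReal.ofReal_le_ofReal
          rw [Real.mul_rpow hX.le hY.le, ← mul_assoc]
          apply mul_le_mul_of_nonneg_right _ (by positivity)
          calc bracket n ^ s * X ^ (-s) ≤ (3 * X) ^ s * X ^ (-s) := by
                gcongr
            _ = 3 ^ s := by
                rw [Real.mul_rpow (by norm_num) hX.le, mul_assoc, ← Real.rpow_add hX]
                simp
        by_cases c1 : bracket n ≤ 3 * A
        · have := hgen A (D * B) hA0 (by positivity) c1
          rw [← mul_assoc] at this
          refine this.trans (mul_le_mul_right (le_trans ?_ le_self_add) L)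
          exact le_self_add
        by_cases c2 : bracket n ≤ 3 * D
        · have := hgen D (A * B) hD0 (by positivity) c2
          rw [show D * (A * B) = A * D * B by ring] at this
          refine this.trans (mul_le_mul_right (le_trans ?_ le_self_add) L)
          exact le_add_self
        · have := hgen B (A * D) hB0 (by positivity) (by push Not at c1 c2; linarith)
          rw [show B * (A * D) = A * D * B by ring] at this
          exact this.trans (mul_le_mul_right le_add_self L)
      · simp [Set.indicator_of_notMem hz]
    · rw [ENNReal.tsum_mul_left, ENNReal.tsum_add, ENNReal.tsum_add]
      gcongr
      · exact h23 n μ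
      · exact h13 n μ
      · exact h12 n μ
  have hK1 : K + 1 ≠ ∞ := ENNReal.add_ne_top.mpr ⟨hKtop, ENNReal.one_ne_top⟩
  refine ⟨(K + 1) + L * ((K + 1) + (K + 1) + (K + 1)), ?_, fun n μ => ⟨?_, ?_, ?_, ?_⟩⟩
  · refine ENNReal.add_ne_top.mpr ⟨hK1, ENNReal.mul_ne_top hL ?_⟩
    exact ENNReal.add_ne_top.mpr ⟨ENNReal.add_ne_top.mpr ⟨hK1, hK1⟩, hK1⟩
  · exact (h23 n μ).trans le_self_add
  · exact (h13 n μ).trans le_self_add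
  · exact (h12 n μ).trans le_self_add
  · exact (hfull n μ).trans le_add_self

/-! ### Periodic extension from a half period -/

/-- The character `x ↦ e^{2πikx}`. -/
def ech (k : ℤ) (x : ℝ) : ℂ := Complex.exp (((2 * π * k * x : ℝ) : ℂ) * Complex.I)

lemma norm_ech (k : ℤ) (x : ℝ) : ‖ech k x‖ = 1 := Complex.norm_exp_ofReal_mul_I _

lemma ech_add (k l : ℤ) (x : ℝ) : ech (k + l) x = ech k x * ech l x := by
  unfold ech; rw [← Complex.exp_add]; congr 1; push_cast; ring

lemma ech_add_right (k : ℤ) (x y : ℝ) : ech k (x + y) = ech k x * ech k y := by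
  unfold ech; rw [← Complex.exp_add]; congr 1; push_cast; ring

lemma ech_zero_left (x : ℝ) : ech 0 x = 1 := by simp [ech]

lemma ech_zero_right (k : ℤ) : ech k 0 = 1 := by simp [ech]

lemma ech_neg (k : ℤ) (x : ℝ) : ech (-k) x = conj (ech k x) := by
  unfold ech
  rw [← Complex.exp_conj, map_mul, Complex.conj_I, Complex.conj_ofReal]
  congr 1; push_cast; ring

lemma continuous_ech (k : ℤ) : Continuous (ech k) := by unfold ech; fun_prop

/-- The Fourier coefficients of the even extension of `g|_{[0, 1/2]}` to a function of
period one. -/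
def cosCoeff (g : ℝ → ℂ) (k : ℤ) : ℂ :=
  2 * ∫ x in (0 : ℝ)..(1 / 2), g x * (Real.cos (2 * π * k * x) : ℂ)

/-- Two integrations by parts. The boundary terms of the first vanish because `sin (2πkx)` is zero
at `0` and `1/2`. Those of the second remain, the even reflection having corners, and they limit the
decay to `|k|⁻²`. -/
lemma norm_cosCoeff_le {g g' g'' : ℝ → ℂ} {B : ℝ} (hg : ∀ x, HasDerivAt g (g' x) x)
    (hg' : ∀ x, HasDerivAt g' (g'' x) x) (hc : Continuous g'')
    (h0 : ∀ x ∈ Icc (0 : ℝ) (1 / 2), ‖g x‖ ≤ B) (h1 : ∀ x ∈ Icc (0 : ℝ) (1 / 2), ‖g' x‖ ≤ B)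
    (h2 : ∀ x ∈ Icc (0 : ℝ) (1 / 2), ‖g'' x‖ ≤ B) (k : ℤ) :
    ‖cosCoeff g k‖ ≤ 4 * B / (1 + |(k : ℝ)|) ^ 2 := by
  have hB : 0 ≤ B := (norm_nonneg _).trans (h0 0 (by norm_num))
  have hle : ∀ f : ℝ → ℂ, (∀ x ∈ Icc (0 : ℝ) (1 / 2), ‖f x‖ ≤ B) →
      ‖∫ x in (0 : ℝ)..(1 / 2), f x * (Real.cos (2 * π * k * x) : ℂ)‖ ≤ B / 2 := by
    intro f hf
    refine (intervalIntegral.norm_integral_le_of_norm_le_const (C := B) ?_).trans ?_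
    · intro x hx
      rw [Set.uIoc_of_le (by norm_num)] at hx
      rw [norm_mul, Complex.norm_real]
      calc _ ≤ B * 1 := mul_le_mul (hf x ⟨hx.1.le, hx.2⟩) (Real.abs_cos_le_one _)
            (abs_nonneg _) hB
        _ = B := mul_one B
    · rw [abs_of_nonneg (by norm_num)]; linarith
  rw [cosCoeff, norm_mul]
  by_cases hk : k = 0
  · have := hle g h0
    subst hk
    simp only [Int.cast_zero, abs_zero, add_zero, one_pow, div_one] at this ⊢
    norm_num at this ⊢
    linarith
  have hkR : (k : ℝ) ≠ 0 := by exact_mod_cast hk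
  set c : ℝ := 2 * π * k with hcdef
  have hc0 : c ≠ 0 := by rw [hcdef]; positivity
  have hcC : (c : ℂ) ≠ 0 := by exact_mod_cast hc0
  have hsin : ∀ x : ℝ, HasDerivAt (fun x : ℝ => ((Real.sin (c * x) : ℝ) : ℂ) / c)
      ((Real.cos (c * x) : ℝ) : ℂ) x := by
    intro x
    have h : HasDerivAt (fun x : ℝ => Real.sin (c * x) / c) (Real.cos (c * x)) x := by
      have := ((Real.hasDerivAt_sin (c * x)).comp x ((hasDerivAt_id x).const_mul c)).div_const c
      simpa [hc0] using this
    simpa using h.ofReal_comp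
  have hcos : ∀ x : ℝ, HasDerivAt (fun x : ℝ => -((Real.cos (c * x) : ℝ) : ℂ) / c)
      ((Real.sin (c * x) : ℝ) : ℂ) x := by
    intro x
    have h : HasDerivAt (fun x : ℝ => -Real.cos (c * x) / c) (Real.sin (c * x)) x := by
      have := (((Real.hasDerivAt_cos (c * x)).comp x
        ((hasDerivAt_id x).const_mul c)).neg).div_const c
      simpa [hc0] using this
    simpa using h.ofReal_comp
  have hg'c : Continuous g' := continuous_iff_continuousAt.mpr fun x => (hg' x).continuousAt
  have e1 := intervalIntegral.integral_mul_deriv_eq_deriv_mul (a := 0) (b := 1 / 2)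
    (u := g) (v := fun x : ℝ => ((Real.sin (c * x) : ℝ) : ℂ) / c)
    (fun x _ => hg x) (fun x _ => hsin x) (hg'c.intervalIntegrable _ _)
    (Continuous.intervalIntegrable (by fun_prop) _ _)
  have hs : Real.sin (c * (1 / 2)) = 0 := by
    rw [hcdef, show 2 * π * (k : ℝ) * (1 / 2) = k * π by ring]; exact Real.sin_int_mul_pi k
  rw [hs, mul_zero, Real.sin_zero] at e1
  simp only [Complex.ofReal_zero, zero_div, mul_zero, sub_zero, zero_sub] at e1
  have e2 := intervalIntegral.integral_mul_deriv_eq_deriv_mul (a := 0) (b := 1 / 2)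
    (u := g') (v := fun x : ℝ => -((Real.cos (c * x) : ℝ) : ℂ) / c)
    (fun x _ => hg' x) (fun x _ => hcos x) (hc.intervalIntegrable _ _)
    (Continuous.intervalIntegrable (by fun_prop) _ _)
  have e3 : ∫ x in (0 : ℝ)..(1 / 2), g' x * (((Real.sin (c * x) : ℝ) : ℂ) / c) =
      (∫ x in (0 : ℝ)..(1 / 2), g' x * ((Real.sin (c * x) : ℝ) : ℂ)) / c := by
    rw [← intervalIntegral.integral_div]
    congr 1; ext x; ring
  have e4 : ∫ x in (0 : ℝ)..(1 / 2), g'' x * (-((Real.cos (c * x) : ℝ) : ℂ) / c) =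
      -(∫ x in (0 : ℝ)..(1 / 2), g'' x * ((Real.cos (c * x) : ℝ) : ℂ)) / c := by
    rw [← intervalIntegral.integral_neg, ← intervalIntegral.integral_div]
    congr 1; ext x; ring
  rw [e1, e3, e2, e4]
  have hI := hle g'' h2
  set I := ∫ x in (0 : ℝ)..(1 / 2), g'' x * ((Real.cos (c * x) : ℝ) : ℂ)
  have hn : ‖-((g' (1 / 2) * (-((Real.cos (c * (1 / 2)) : ℝ) : ℂ) / c) -
      g' 0 * (-((Real.cos (c * 0) : ℝ) : ℂ) / c) - -I / c) / c)‖ ≤ (5 / 2 * B) / (|c| * |c|) := by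
    have : -((g' (1 / 2) * (-((Real.cos (c * (1 / 2)) : ℝ) : ℂ) / c) -
        g' 0 * (-((Real.cos (c * 0) : ℝ) : ℂ) / c) - -I / c) / c) =
        (g' (1 / 2) * ((Real.cos (c * (1 / 2)) : ℝ) : ℂ) - g' 0 * ((Real.cos (c * 0) : ℝ) : ℂ)
          - I) / (c * c) := by
      field_simp; ring
    rw [this, norm_div, norm_mul, Complex.norm_real, Real.norm_eq_abs]
    apply div_le_div_of_nonneg_right _ (by positivity)
    refine (norm_sub_le _ _).trans ?_
    have t1 : ‖g' (1 / 2) * ((Real.cos (c * (1 / 2)) : ℝ) : ℂ)‖ ≤ B := by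
      rw [norm_mul, Complex.norm_real]
      calc _ ≤ B * 1 := mul_le_mul (h1 _ (by norm_num)) (Real.abs_cos_le_one _)
            (abs_nonneg _) hB
        _ = B := mul_one B
    have t2 : ‖g' 0 * ((Real.cos (c * 0) : ℝ) : ℂ)‖ ≤ B := by
      rw [norm_mul, Complex.norm_real]
      calc _ ≤ B * 1 := mul_le_mul (h1 _ (by norm_num)) (Real.abs_cos_le_one _)
            (abs_nonneg _) hB
        _ = B := mul_one B
    have t3 := norm_sub_le (g' (1 / 2) * ((Real.cos (c * (1 / 2)) : ℝ) : ℂ))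
      (g' 0 * ((Real.cos (c * 0) : ℝ) : ℂ))
    linarith
  have hk1 : 1 ≤ |(k : ℝ)| := by exact_mod_cast Int.one_le_abs hk
  have hcabs : 6 * |(k : ℝ)| ≤ |c| := by
    rw [hcdef, abs_mul, abs_of_pos Real.two_pi_pos]
    nlinarith [Real.pi_gt_three]
  calc _ ≤ ‖(2 : ℂ)‖ * ((5 / 2 * B) / (|c| * |c|)) := mul_le_mul_of_nonneg_left hn (norm_nonneg _)
    _ = (5 * B) / (|c| * |c|) := by simp; ring
    _ ≤ _ := by
      rw [div_le_div_iff₀ (by positivity) (by positivity)]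
      have q1 : (1 + |(k : ℝ)|) ^ 2 ≤ 4 * |(k : ℝ)| ^ 2 := by nlinarith
      have q2 : 36 * |(k : ℝ)| ^ 2 ≤ |c| * |c| := by nlinarith
      calc 5 * B * (1 + |(k : ℝ)|) ^ 2 ≤ 5 * B * (4 * |(k : ℝ)| ^ 2) :=
            mul_le_mul_of_nonneg_left q1 (by positivity)
        _ ≤ 4 * B * (36 * |(k : ℝ)| ^ 2) := by nlinarith [mul_nonneg hB (sq_nonneg |(k : ℝ)|)]
        _ ≤ _ := mul_le_mul_of_nonneg_left q2 (by positivity)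

lemma summable_one_add_abs_rpow {r : ℝ} (hr : 1 < r) :
    Summable fun k : ℤ => (1 + |(k : ℝ)|) ^ (-r) := by
  have h := (Real.summable_abs_int_rpow hr)
  have h2 : Summable fun k : ℤ => |(k : ℝ)| ^ (-r) + if k = 0 then 1 else 0 := by
    apply h.add
    exact summable_of_ne_finset_zero (s := {0}) (by intro b hb; simp at hb; simp [hb])
  refine Summable.of_nonneg_of_le (fun k => by positivity) (fun k => ?_) h2
  by_cases hk : k = 0
  · subst hk; simp; positivity
  · rw [if_neg hk, add_zero]
    have : 0 < |(k : ℝ)| := by positivity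
    exact Real.rpow_le_rpow_of_nonpos this (by linarith) (by linarith)

lemma summable_div_one_add_abs_sq (B : ℝ) :
    Summable fun k : ℤ => B / (1 + |(k : ℝ)|) ^ 2 := by
  refine ((summable_one_add_abs_rpow (r := 2) (by norm_num)).mul_left B).congr fun k => ?_
  rw [Real.rpow_neg (by positivity), div_eq_mul_inv]
  norm_cast

/-- The even reflection is continuous on the circle of length one, so its Fourier series converges
to it pointwise once the coefficients are summable. -/
lemma hasSum_cosCoeff {g : ℝ → ℂ} (hg : Continuous g) (hs : Summable (cosCoeff g)) {x : ℝ}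
    (hx : x ∈ Icc (0 : ℝ) (1 / 2)) : HasSum (fun k => cosCoeff g k * ech k x) (g x) := by
  set f : ℝ → ℂ := fun y => g |y| with hf
  have hfc : Continuous f := hg.comp continuous_abs
  have hcont : Continuous (AddCircle.liftIco (1 : ℝ) (-(1 / 2)) f) := by
    apply AddCircle.liftIco_continuous
    · simp only [hf]; norm_num
    · exact hfc.continuousOn
  set F : C(AddCircle (1 : ℝ), ℂ) := ⟨_, hcont⟩ with hF
  have hcoef : ∀ k : ℤ, fourierCoeff F k = cosCoeff g k := by
    intro k
    have h1 : fourierCoeff F k = fourierCoeff (AddCircle.liftIco (1 : ℝ) (-(1 / 2)) f) k := rfl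
    rw [h1, fourierCoeff_liftIco_eq, fourierCoeffOn_eq_integral]
    have h2 : (1 : ℝ) / (-(1 / 2) + 1 - -(1 / 2)) = 1 := by norm_num
    rw [h2, one_smul, show (-(1 / 2) : ℝ) + 1 = 1 / 2 by norm_num]
    have hint : ∀ y : ℝ, (fourier (-k) : AddCircle ((1 / 2 : ℝ) - -(1 / 2)) → ℂ) y • f y =
        ech (-k) y * g |y| := by
      intro y
      rw [fourier_coe_apply, smul_eq_mul, ech, hf]
      congr 2
      push_cast
      ring
    simp_rw [hint]
    have hc1 : Continuous fun y : ℝ => ech (-k) y * g |y| := (continuous_ech _).mul hfc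
    rw [← intervalIntegral.integral_add_adjacent_intervals (b := 0)
      (hc1.intervalIntegrable _ _) (hc1.intervalIntegrable _ _)]
    have h3 : ∫ y in (-(1 / 2) : ℝ)..0, ech (-k) y * g |y| =
        ∫ y in (0 : ℝ)..(1 / 2), ech k y * g |y| := by
      have := intervalIntegral.integral_comp_neg (a := 0) (b := 1 / 2)
        (fun y : ℝ => ech (-k) y * g |y|)
      rw [neg_zero] at this
      rw [← this]
      congr 1; ext y
      rw [abs_neg]; congr 1
      unfold ech; congr 1; push_cast; ring
    have hc2 : Continuous fun y : ℝ => ech k y * g |y| := (continuous_ech _).mul hfc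
    rw [h3, ← intervalIntegral.integral_add (hc2.intervalIntegrable _ _)
      (hc1.intervalIntegrable _ _), cosCoeff, ← intervalIntegral.integral_const_mul]
    apply intervalIntegral.integral_congr
    intro y hy
    rw [Set.uIcc_of_le (by norm_num)] at hy
    simp only
    rw [abs_of_nonneg hy.1, Complex.ofReal_cos, Complex.cos]
    unfold ech
    push_cast
    ring_nf
  have hs' : Summable (fourierCoeff F) := by
    have : (fourierCoeff F) = cosCoeff g := funext hcoef
    rw [this]; exact hs
  have := has_pointwise_sum_fourier_series_of_summable hs' (x : AddCircle (1 : ℝ))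
  have happ : ∀ y ∈ Ico (-(1 / 2) : ℝ) (-(1 / 2) + 1), F (y : AddCircle (1 : ℝ)) = f y :=
    fun y hy => AddCircle.liftIco_coe_apply (p := (1 : ℝ)) (a := -(1 / 2)) (f := f) hy
  have hFx : F (x : AddCircle (1 : ℝ)) = g x := by
    rcases lt_or_eq_of_le hx.2 with h | h
    · rw [happ x ⟨by linarith [hx.1], by linarith⟩, hf]
      simp only
      rw [abs_of_nonneg hx.1]
    · have e : ((x : ℝ) : AddCircle (1 : ℝ)) = ((-(1 / 2) : ℝ) : AddCircle (1 : ℝ)) := by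
        rw [h, ← AddCircle.coe_add_period (1 : ℝ) (-(1 / 2))]
        norm_num
      rw [e, happ _ (by constructor <;> norm_num), h, hf]
      simp only
      rw [abs_neg, abs_of_nonneg (by norm_num)]
  rw [hFx] at this
  convert this using 2 with k
  rw [hcoef, smul_eq_mul, fourier_coe_apply]
  congr 1
  unfold ech
  congr 1
  push_cast
  ring

/-- Coefficients of the periodic extension of `e^{iθx}`, `0 ≤ x ≤ 1/2`. -/
def expCoeff (θ : ℝ) : ℤ → ℂ := cosCoeff fun x => Complex.exp (((θ * x : ℝ) : ℂ) * Complex.I)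

/-- Coefficients of the periodic extension of `x`, `0 ≤ x ≤ 1/2`. -/
def linCoeff : ℤ → ℂ := cosCoeff fun x => (x : ℂ)

lemma norm_expCoeff_le {θ : ℝ} (hθ : θ ∈ Icc 0 (2 * π)) (k : ℤ) :
    ‖expCoeff θ k‖ ≤ 160 / (1 + |(k : ℝ)|) ^ 2 := by
  have hd : ∀ (c : ℂ) (x : ℝ), HasDerivAt (fun x : ℝ => c * Complex.exp (((θ * x : ℝ) : ℂ) * Complex.I))
      (c * (θ * Complex.I) * Complex.exp (((θ * x : ℝ) : ℂ) * Complex.I)) x := by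
    intro c x
    have h1 : HasDerivAt (fun x : ℝ => ((θ * x : ℝ) : ℂ) * Complex.I) (θ * Complex.I) x := by
      have := ((hasDerivAt_id x).const_mul θ).ofReal_comp.mul_const Complex.I
      simpa using this
    have := (h1.cexp).const_mul c
    exact this.congr_deriv (by ring)
  have hθ2 : θ ≤ 6.3 := hθ.2.trans (by linarith [Real.pi_lt_d2])
  have hθ0 := hθ.1
  have hnorm : ∀ (c : ℂ) (x : ℝ), ‖c * Complex.exp (((θ * x : ℝ) : ℂ) * Complex.I)‖ = ‖c‖ := by
    intro c x; rw [norm_mul, Complex.norm_exp_ofReal_mul_I, mul_one]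
  -- `40` dominates `1`, `θ` and `θ²` for `θ ≤ 6.3`, uniformly in `θ`.
  have h := norm_cosCoeff_le (B := 40)
    (g := fun x : ℝ => 1 * Complex.exp (((θ * x : ℝ) : ℂ) * Complex.I)) (hd 1) (hd _)
    (by fun_prop) (fun x _ => by rw [hnorm]; norm_num)
    (fun x _ => by
      rw [hnorm]; simp only [one_mul, norm_mul, Complex.norm_real, Complex.norm_I, mul_one,
        Real.norm_eq_abs, abs_of_nonneg hθ0]; linarith)
    (fun x _ => by
      rw [hnorm]; simp only [one_mul, norm_mul, Complex.norm_real, Complex.norm_I, mul_one,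
        Real.norm_eq_abs, abs_of_nonneg hθ0]; nlinarith) k
  rw [show (4 : ℝ) * 40 = 160 by norm_num] at h
  simp only [one_mul] at h
  exact h

lemma norm_linCoeff_le (k : ℤ) : ‖linCoeff k‖ ≤ 4 / (1 + |(k : ℝ)|) ^ 2 := by
  have h := norm_cosCoeff_le (B := 1) (g := fun x : ℝ => (x : ℂ)) (g' := fun _ => 1)
    (g'' := fun _ => 0) (fun x => by simpa using (hasDerivAt_id x).ofReal_comp)
    (fun x => hasDerivAt_const x _) continuous_const
    (fun x hx => by
      rw [Complex.norm_real, Real.norm_eq_abs, abs_of_nonneg hx.1]; linarith [hx.2])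
    (fun x _ => by simp) (fun x _ => by simp) k
  simpa [linCoeff] using h

lemma hasSum_expCoeff {θ : ℝ} (hθ : θ ∈ Icc 0 (2 * π)) {x : ℝ} (hx : x ∈ Icc (0 : ℝ) (1 / 2)) :
    HasSum (fun k => expCoeff θ k * ech k x) (Complex.exp (((θ * x : ℝ) : ℂ) * Complex.I)) :=
  hasSum_cosCoeff (g := fun x => Complex.exp (((θ * x : ℝ) : ℂ) * Complex.I)) (by fun_prop)
    (Summable.of_norm_bounded (summable_div_one_add_abs_sq 160) (norm_expCoeff_le hθ)) hx

lemma hasSum_linCoeff {x : ℝ} (hx : x ∈ Icc (0 : ℝ) (1 / 2)) :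
    HasSum (fun k => linCoeff k * ech k x) (x : ℂ) :=
  hasSum_cosCoeff (g := fun x => (x : ℂ)) (by fun_prop)
    (Summable.of_norm_bounded (summable_div_one_add_abs_sq 4) norm_linCoeff_le) hx

/-- The integral `∫₀ˣ e^{2πikx'} dx'`. -/
def primEch (k : ℤ) (x : ℝ) : ℂ := ∫ y in (0 : ℝ)..x, ech k y

lemma primEch_zero (x : ℝ) : primEch 0 x = x := by
  simp [primEch, ech_zero_left]

lemma primEch_of_ne_zero {k : ℤ} (hk : k ≠ 0) (x : ℝ) :
    primEch k x = (ech k x - 1) / (2 * π * Complex.I * k) := by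
  have hc : (2 * π * Complex.I * k : ℂ) ≠ 0 := by
    simp [hk, Real.pi_ne_zero]
  have h := integral_exp_mul_complex (a := 0) (b := x) hc
  have e : ∀ y : ℝ, ech k y = Complex.exp (2 * π * Complex.I * k * y) := by
    intro y; unfold ech; congr 1; push_cast; ring
  simp_rw [primEch, e]
  rw [h]
  simp

lemma norm_primEch_le (k : ℤ) {x : ℝ} (hx : x ∈ Icc (0 : ℝ) (1 / 2)) :
    ‖primEch k x‖ ≤ 2 / (1 + |(k : ℝ)|) := by
  by_cases hk : k = 0
  · subst hk
    rw [primEch_zero, Complex.norm_real, Real.norm_eq_abs, abs_of_nonneg hx.1]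
    simp; linarith [hx.2]
  · have hk1 : 1 ≤ |(k : ℝ)| := by exact_mod_cast Int.one_le_abs hk
    rw [primEch_of_ne_zero hk, norm_div]
    have h1 : ‖(2 * π * Complex.I * k : ℂ)‖ = 2 * π * |(k : ℝ)| := by
      simp [abs_of_pos Real.pi_pos]
    have h2 : ‖ech k x - 1‖ ≤ 2 := (norm_sub_le _ _).trans (by rw [norm_ech]; norm_num)
    rw [h1]
    apply div_le_div₀ (by norm_num) h2 (by positivity)
    nlinarith [Real.pi_gt_three]

/-- The coefficients of (the periodic extension of) `x ↦ ∫₀ˣ ∑ₖ c(k) e^{2πikx'} dx'`. -/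
def integ (c : ℤ → ℂ) (l : ℤ) : ℂ :=
  c l / (2 * π * Complex.I * l) + c 0 * linCoeff l -
    if l = 0 then ∑' k : ℤ, c k / (2 * π * Complex.I * k) else 0

lemma norm_div_two_pi_le (c : ℂ) (k : ℤ) :
    ‖c / (2 * π * Complex.I * k)‖ ≤ ‖c‖ / (1 + |(k : ℝ)|) := by
  by_cases hk : k = 0
  · subst hk; simp
  · have hk1 : 1 ≤ |(k : ℝ)| := by exact_mod_cast Int.one_le_abs hk
    rw [norm_div]
    apply div_le_div_of_nonneg_left (norm_nonneg _) (by positivity)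
    have h1 : ‖(2 * π * Complex.I * k : ℂ)‖ = 2 * π * |(k : ℝ)| := by
      simp [abs_of_pos Real.pi_pos]
    rw [h1]
    nlinarith [Real.pi_gt_three]

/-- For `k ≠ 0` the primitive of `e^{2πikx}` is `(e^{2πikx} - 1) / (2πik)`, and the constants
collect at `l = 0`. For `k = 0` it is `x`, which is not periodic and is replaced by its extension
from the half period. Division by zero gives `0`, so the series in `integ` may run over all `k`. -/
lemma hasSum_integ {c : ℤ → ℂ} (hc : Summable fun k : ℤ => ‖c k‖ / (1 + |(k : ℝ)|)) {x : ℝ}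
    (hx : x ∈ Icc (0 : ℝ) (1 / 2)) :
    HasSum (fun l => integ c l * ech l x) (∑' k, c k * primEch k x) := by
  have hs1 : Summable fun k : ℤ => c k / (2 * π * Complex.I * k) :=
    Summable.of_norm_bounded hc fun k => norm_div_two_pi_le _ _
  have hs2 : Summable fun k : ℤ => c k / (2 * π * Complex.I * k) * ech k x :=
    Summable.of_norm_bounded hc fun k => by
      rw [norm_mul, norm_ech, mul_one]; exact norm_div_two_pi_le _ _
  have h3 := ((hs2.hasSum.add ((hasSum_linCoeff hx).mul_left (c 0))).sub
    (hasSum_ite_eq (0 : ℤ) (∑' k : ℤ, c k / (2 * π * Complex.I * k))))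
  have e1 : (fun l => integ c l * ech l x) = fun l => c l / (2 * π * Complex.I * l) * ech l x +
      c 0 * (linCoeff l * ech l x) -
      if l = 0 then ∑' k : ℤ, c k / (2 * π * Complex.I * k) else 0 := by
    ext l
    unfold integ
    split_ifs with h
    · subst h; rw [ech_zero_left]; ring
    · ring
  rw [e1]
  have h4 : ∀ k : ℤ, c k * primEch k x = c k / (2 * π * Complex.I * k) * ech k x +
      (if k = 0 then c 0 * x else 0) - c k / (2 * π * Complex.I * k) := by
    intro k
    by_cases hk : k = 0
    · subst hk; rw [primEch_zero]; simp
    · rw [primEch_of_ne_zero hk, if_neg hk]; ring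
  have hite := hasSum_ite_eq (0 : ℤ) (c 0 * x)
  rw [tsum_congr h4, ((hs2.hasSum.add hite).sub hs1.hasSum).tsum_eq]
  exact h3

/-! ### Schur estimates -/

/-- The weight `1 + |k|`. -/
def jw (k : ℤ) : ℝ≥0∞ := ENNReal.ofReal (1 + |(k : ℝ)|)

lemma jw_ne_zero (k : ℤ) : jw k ≠ 0 := by
  unfold jw; rw [Ne, ENNReal.ofReal_eq_zero, not_le]; positivity

lemma jw_ne_top (k : ℤ) : jw k ≠ ∞ := ENNReal.ofReal_ne_top

lemma jw_zero : jw 0 = 1 := by simp [jw]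

lemma tsum_jw_inv_rpow_ne_top {r : ℝ} (hr : 1 < r) : ∑' k, ((jw k)⁻¹) ^ r ≠ ∞ := by
  have h := (summable_one_add_abs_rpow hr).tsum_ofReal_ne_top
  convert h using 3 with k
  rw [jw, ← ENNReal.rpow_neg_one, ← ENNReal.rpow_mul, ENNReal.ofReal_rpow_of_pos (by positivity)]
  congr 2; ring

lemma tsum_mul_le_rpow {κ : Type*} {p q : ℝ} (hpq : p.HolderConjugate q) (f g : κ → ℝ≥0∞) :
    ∑' j, f j * g j ≤ (∑' j, f j ^ p) ^ (1 / p) * (∑' j, g j ^ q) ^ (1 / q) := by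
  let _ : MeasurableSpace κ := ⊤
  have h := ENNReal.lintegral_mul_le_Lp_mul_Lq (Measure.count : Measure κ) hpq
    (f := f) (g := g) (measurable_from_top).aemeasurable (measurable_from_top).aemeasurable
  simpa [lintegral_count] using h

/-- Schur's test with weights on the input side. -/
lemma tsum_kernel_rpow_le {ι κ : Type*} {p q : ℝ} (hpq : p.HolderConjugate q)
    (K w : ι → κ → ℝ≥0∞) (g : κ → ℝ≥0∞) {A B : ℝ≥0∞}
    (hA : ∀ i, ∑' j, K i j * w i j ^ q ≤ A) (hB : ∀ j, ∑' i, K i j ≤ B) :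
    ∑' i, (∑' j, K i j * w i j * g j) ^ p ≤ A ^ (p / q) * (B * ∑' j, g j ^ p) := by
  have hp0 := hpq.pos
  have hq0 := hpq.symm.pos
  have h1 : ∀ i, (∑' j, K i j * w i j * g j) ^ p ≤ A ^ (p / q) * ∑' j, K i j * g j ^ p := by
    intro i
    -- Hölder with the kernel split as `K^{1/p} K^{1/q}`: the weight goes to the `q` side, the input
    -- to the `p` side.
    have h2 : ∑' j, K i j * w i j * g j ≤
        (∑' j, K i j * g j ^ p) ^ (1 / p) * (∑' j, K i j * w i j ^ q) ^ (1 / q) := by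
      refine le_trans (le_of_eq ?_) ((tsum_mul_le_rpow hpq (fun j => K i j ^ (1 / p) * g j)
        (fun j => K i j ^ (1 / q) * w i j)).trans (le_of_eq ?_))
      · refine tsum_congr fun j => ?_
        have : K i j = K i j ^ (1 / p) * K i j ^ (1 / q) := by
          rw [← ENNReal.rpow_add_of_nonneg _ _ (by positivity) (by positivity), one_div, one_div,
            hpq.inv_add_inv_eq_one, ENNReal.rpow_one]
        calc K i j * w i j * g j = (K i j ^ (1 / p) * K i j ^ (1 / q)) * w i j * g j := by
              rw [← this]
          _ = _ := by ring
      · congr 2 <;> refine tsum_congr fun j => ?_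
        · rw [ENNReal.mul_rpow_of_nonneg _ _ hp0.le, ← ENNReal.rpow_mul, one_div,
            inv_mul_cancel₀ hp0.ne', ENNReal.rpow_one]
        · rw [ENNReal.mul_rpow_of_nonneg _ _ hq0.le, ← ENNReal.rpow_mul, one_div,
            inv_mul_cancel₀ hq0.ne', ENNReal.rpow_one]
    calc (∑' j, K i j * w i j * g j) ^ p ≤
        ((∑' j, K i j * g j ^ p) ^ (1 / p) * A ^ (1 / q)) ^ p := by
          apply ENNReal.rpow_le_rpow (h2.trans _) hp0.le
          gcongr
          exact hA i
      _ = _ := by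
          rw [ENNReal.mul_rpow_of_nonneg _ _ hp0.le, ← ENNReal.rpow_mul, ← ENNReal.rpow_mul,
            one_div, inv_mul_cancel₀ hp0.ne', ENNReal.rpow_one, mul_comm]
          congr 2; ring
  refine (ENNReal.tsum_le_tsum h1).trans ?_
  rw [ENNReal.tsum_mul_left, ENNReal.tsum_comm]
  gcongr
  rw [← ENNReal.tsum_mul_left]
  refine ENNReal.tsum_le_tsum fun j => ?_
  rw [ENNReal.tsum_mul_right]
  gcongr
  exact hB j

lemma add_add_rpow_le {p : ℝ} (hp : 0 ≤ p) (x y z : ℝ≥0∞) :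
    (x + y + z) ^ p ≤ 3 ^ p * (x ^ p + y ^ p + z ^ p) := by
  have h1 : x + y + z ≤ 3 * max x (max y z) := by
    calc x + y + z ≤ max x (max y z) + max x (max y z) + max x (max y z) := by
          gcongr
          · exact le_max_left _ _
          · exact (le_max_left _ _).trans (le_max_right _ _)
          · exact (le_max_right _ _).trans (le_max_right _ _)
      _ = _ := by ring
  calc (x + y + z) ^ p ≤ (3 * max x (max y z)) ^ p := ENNReal.rpow_le_rpow h1 hp
    _ = 3 ^ p * (max x (max y z)) ^ p := ENNReal.mul_rpow_of_nonneg _ _ hp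
    _ ≤ _ := by
      gcongr
      rcases max_choice x (max y z) with h | h
      · rw [h, add_assoc]; exact le_self_add
      · rw [h]
        rcases max_choice y z with h | h
        · rw [h, add_right_comm]; exact le_add_self
        · rw [h]; exact le_add_self

/-- The `p`-th power of the weighted norm `‖(1 + |k|) c(k)‖_{ℓ^p}`. -/
def en (p : ℝ) (c : ℤ → ℂ) : ℝ≥0∞ := ∑' k, (jw k * ‖c k‖ₑ) ^ p

/-- Schur's test with a single output. The first factor is finite as `q > 1`, so the weight `1 +
|k|` in `ℓ^p` controls absolute sums over time frequencies. -/
lemma tsum_jw_inv_mul_rpow_le {p q : ℝ} (hpq : p.HolderConjugate q) (f : ℤ → ℝ≥0∞) :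
    (∑' k, (jw k)⁻¹ * f k) ^ p ≤ (∑' k, ((jw k)⁻¹) ^ q) ^ (p / q) * ∑' k, f k ^ p := by
  have h := tsum_kernel_rpow_le (ι := Unit) hpq (fun _ _ => 1) (fun _ k => (jw k)⁻¹) f
    (A := ∑' k, ((jw k)⁻¹) ^ q) (B := 1) (fun _ => by simp) (fun _ => by simp)
  simpa using h

lemma enorm_div_two_pi_le (c : ℂ) (k : ℤ) :
    ‖c / (2 * π * Complex.I * k)‖ₑ ≤ (jw k)⁻¹ * ‖c‖ₑ := by
  have h := norm_div_two_pi_le c k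
  rw [jw, ← ENNReal.ofReal_inv_of_pos (by positivity), ← ofReal_norm, ← ofReal_norm,
    ← ENNReal.ofReal_mul (by positivity)]
  apply ENNReal.ofReal_le_ofReal
  rwa [inv_mul_eq_div]

/-- Division by `k` gains exactly the weight `1 + |k|` in `en`. The two remaining terms have rank
one: `linCoeff` decays quadratically, hence is in the weighted space because `p > 1`, and the
constant of integration is bounded by Hölder. -/
lemma exists_en_integ_le {p q : ℝ} (hpq : p.HolderConjugate q) :
    ∃ C : ℝ≥0∞, C ≠ ∞ ∧ ∀ c : ℤ → ℂ, en p (integ c) ≤ C * ∑' k, ‖c k‖ₑ ^ p := by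
  have hp0 := hpq.pos
  set Sp := ∑' k, ((jw k)⁻¹) ^ p
  set Sq := ∑' k, ((jw k)⁻¹) ^ q
  have hSp : Sp ≠ ∞ := tsum_jw_inv_rpow_ne_top hpq.lt
  have hSq : Sq ≠ ∞ := tsum_jw_inv_rpow_ne_top hpq.symm.lt
  refine ⟨3 ^ p * (1 + 4 ^ p * Sp + Sq ^ (p / q)), ?_, fun c => ?_⟩
  · refine ENNReal.mul_ne_top (ENNReal.rpow_ne_top_of_nonneg hp0.le (by norm_num)) ?_
    refine ENNReal.add_ne_top.mpr ⟨ENNReal.add_ne_top.mpr ⟨ENNReal.one_ne_top, ?_⟩, ?_⟩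
    · exact ENNReal.mul_ne_top (ENNReal.rpow_ne_top_of_nonneg hp0.le (by norm_num)) hSp
    · exact ENNReal.rpow_ne_top_of_nonneg (div_nonneg hp0.le hpq.symm.pos.le) hSq
  have hpt : ∀ l : ℤ, jw l * ‖integ c l‖ₑ ≤ ‖c l‖ₑ + 4 * (jw l)⁻¹ * ‖c 0‖ₑ +
      if l = 0 then ∑' k, (jw k)⁻¹ * ‖c k‖ₑ else 0 := by
    intro l
    have h1 : jw l * ‖c l / (2 * π * Complex.I * l)‖ₑ ≤ ‖c l‖ₑ := by
      calc _ ≤ jw l * ((jw l)⁻¹ * ‖c l‖ₑ) := by gcongr; exact enorm_div_two_pi_le _ _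
        _ = ‖c l‖ₑ := by
          rw [← mul_assoc, ENNReal.mul_inv_cancel (jw_ne_zero l) (jw_ne_top l), one_mul]
    have h2 : jw l * ‖c 0 * linCoeff l‖ₑ ≤ 4 * (jw l)⁻¹ * ‖c 0‖ₑ := by
      rw [enorm_mul, mul_comm ‖c 0‖ₑ, ← mul_assoc]
      refine mul_le_mul_left ?_ _
      have h := norm_linCoeff_le l
      rw [jw, ← ENNReal.ofReal_inv_of_pos (by positivity), ← ofReal_norm,
        ← ENNReal.ofReal_mul (by positivity), show (4 : ℝ≥0∞) = ENNReal.ofReal 4 by simp,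
        ← ENNReal.ofReal_mul (by positivity)]
      apply ENNReal.ofReal_le_ofReal
      have hpos : 0 < 1 + |(l : ℝ)| := by positivity
      calc (1 + |(l : ℝ)|) * ‖linCoeff l‖ ≤ (1 + |(l : ℝ)|) * (4 / (1 + |(l : ℝ)|) ^ 2) := by gcongr
        _ = _ := by field_simp
    have h3 : jw l * ‖(if l = 0 then ∑' k : ℤ, c k / (2 * π * Complex.I * k) else 0)‖ₑ ≤
        if l = 0 then ∑' k, (jw k)⁻¹ * ‖c k‖ₑ else 0 := by
      split_ifs with h
      · subst h
        rw [jw_zero, one_mul]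
        by_cases hs : Summable fun k : ℤ => c k / (2 * π * Complex.I * k)
        · exact (enorm_tsum_le_tsum_enorm).trans
            (ENNReal.tsum_le_tsum fun k => enorm_div_two_pi_le _ _)
        · rw [tsum_eq_zero_of_not_summable hs]; simp
      · simp
    unfold integ
    calc _ ≤ jw l * (‖c l / (2 * π * Complex.I * l)‖ₑ + ‖c 0 * linCoeff l‖ₑ +
        ‖(if l = 0 then ∑' k : ℤ, c k / (2 * π * Complex.I * k) else 0)‖ₑ) := by
          gcongr
          refine (enorm_sub_le).trans ?_
          gcongr
          exact enorm_add_le _ _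
      _ ≤ _ := by rw [mul_add, mul_add]; gcongr
  calc en p (integ c) ≤ ∑' l, 3 ^ p * (‖c l‖ₑ ^ p + (4 * (jw l)⁻¹ * ‖c 0‖ₑ) ^ p +
        (if l = 0 then ∑' k, (jw k)⁻¹ * ‖c k‖ₑ else 0) ^ p) :=
        ENNReal.tsum_le_tsum fun l =>
          (ENNReal.rpow_le_rpow (hpt l) hp0.le).trans (add_add_rpow_le hp0.le _ _ _)
    _ = 3 ^ p * (∑' l, ‖c l‖ₑ ^ p + ∑' l, (4 * (jw l)⁻¹ * ‖c 0‖ₑ) ^ p +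
        ∑' l : ℤ, (if l = 0 then ∑' k, (jw k)⁻¹ * ‖c k‖ₑ else 0) ^ p) := by
        rw [ENNReal.tsum_mul_left, ENNReal.tsum_add, ENNReal.tsum_add]
    _ ≤ 3 ^ p * (∑' l, ‖c l‖ₑ ^ p + (4 ^ p * Sp) * (∑' l, ‖c l‖ₑ ^ p) +
        Sq ^ (p / q) * ∑' l, ‖c l‖ₑ ^ p) := by
        gcongr
        · have : ∀ l, (4 * (jw l)⁻¹ * ‖c 0‖ₑ) ^ p = 4 ^ p * ((jw l)⁻¹) ^ p * ‖c 0‖ₑ ^ p := by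
            intro l
            rw [ENNReal.mul_rpow_of_nonneg _ _ hp0.le, ENNReal.mul_rpow_of_nonneg _ _ hp0.le]
          simp_rw [this]
          rw [ENNReal.tsum_mul_right, ENNReal.tsum_mul_left]
          gcongr
          exact ENNReal.le_tsum (f := fun l => ‖c l‖ₑ ^ p) 0
        · have : ∀ l : ℤ, (if l = 0 then ∑' k, (jw k)⁻¹ * ‖c k‖ₑ else 0) ^ p =
              if l = 0 then (∑' k, (jw k)⁻¹ * ‖c k‖ₑ) ^ p else 0 := by
            intro l; split_ifs
            · rfl
            · exact ENNReal.zero_rpow_of_pos hp0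
          simp_rw [this]
          rw [tsum_ite_eq]
          exact tsum_jw_inv_mul_rpow_le hpq _
    _ = _ := by ring

/-! ### The trilinear form on space-time Fourier coefficients -/

/-- Pairs `(n₁, n₃)` contributing to the gauged nonlinearity at `n`. -/
def resAll (n : Freq) : Set (Freq × Freq) :=
  {z | (n ≠ z.1 ∧ n ≠ z.2) ∨ (n = z.1 ∧ n = z.2)}

open Classical in
/-- The sign with which the pair `(n₁, n₃)` contributes to the gauged nonlinearity at `n`. -/
def sgn (n : Freq) (z : Freq × Freq) : ℂ :=
  if n ≠ z.1 ∧ n ≠ z.2 then 1 else if n = z.1 ∧ n = z.2 then -1 else 0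

lemma sgn_eq_zero {n : Freq} {z : Freq × Freq} (h : z ∉ resAll n) : sgn n z = 0 := by
  simp only [resAll, Set.mem_ofPred_eq, not_or] at h
  rw [sgn, if_neg h.1, if_neg h.2]

lemma norm_sgn_le (n : Freq) (z : Freq × Freq) : ‖sgn n z‖ ≤ 1 := by
  unfold sgn; split_ifs <;> simp

/-- The fractional part of the phase `μ / M`, as an angle in `[0, 2π]`. -/
def theta (M : ℕ) (μ : ℤ) : ℝ := 2 * π * ((μ % (M : ℤ) : ℤ) : ℝ) / M

lemma theta_mem (M : ℕ) [NeZero M] (μ : ℤ) : theta M μ ∈ Icc 0 (2 * π) := by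
  have hM : (0 : ℝ) < M := by exact_mod_cast Nat.pos_of_ne_zero (NeZero.ne M)
  have hMz : (0 : ℤ) < M := by exact_mod_cast Nat.pos_of_ne_zero (NeZero.ne M)
  have h0 : (0 : ℝ) ≤ ((μ % (M : ℤ) : ℤ) : ℝ) := by exact_mod_cast Int.emod_nonneg μ hMz.ne'
  have h1 : ((μ % (M : ℤ) : ℤ) : ℝ) ≤ M := by
    have := (Int.emod_lt_of_pos μ hMz).le
    exact_mod_cast this
  constructor
  · unfold theta; positivity
  · unfold theta
    rw [div_le_iff₀ hM]
    exact mul_le_mul_of_nonneg_left h1 Real.two_pi_pos.le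

/-- The index set of the trilinear sum: spatial frequencies `(n₁, n₃)` and time frequencies. -/
abbrev TriIndex : Type := (Freq × Freq) × (ℤ × ℤ × ℤ)

/-- The time frequency offset. -/
def offset (M : ℕ) (n : Freq) (k : ℤ) (j : TriIndex) : ℤ :=
  k - j.2.1 + j.2.2.1 - j.2.2.2 - phase n j.1.1 j.1.2 / (M : ℤ)

/-- The kernel of the trilinear form. -/
def ker (M : ℕ) (t₀ : ℝ) (n : Freq) (k : ℤ) (j : TriIndex) : ℂ :=
  sgn n j.1 * Complex.exp (((t₀ * phase n j.1.1 j.1.2 : ℝ) : ℂ) * Complex.I) *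
    expCoeff (theta M (phase n j.1.1 j.1.2)) (offset M n k j)

/-- The bound for `expCoeff`. -/
def bet (k : ℤ) : ℝ≥0∞ := ENNReal.ofReal (160 / (1 + |(k : ℝ)|) ^ 2)

lemma tsum_bet_ne_top : ∑' k, bet k ≠ ∞ := (summable_div_one_add_abs_sq 160).tsum_ofReal_ne_top

open Classical in
/-- The bound for the kernel. -/
def kerB (M : ℕ) (n : Freq) (k : ℤ) (j : TriIndex) : ℝ≥0∞ :=
  if j.1 ∈ resAll n then bet (offset M n k j) else 0

lemma enorm_ker_le (M : ℕ) [NeZero M] (t₀ : ℝ) (n : Freq) (k : ℤ) (j : TriIndex) :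
    ‖ker M t₀ n k j‖ₑ ≤ kerB M n k j := by
  unfold kerB ker
  split_ifs with h
  · rw [bet, ← ofReal_norm]
    apply ENNReal.ofReal_le_ofReal
    rw [norm_mul, norm_mul, Complex.norm_exp_ofReal_mul_I, mul_one]
    calc _ ≤ 1 * (160 / (1 + |((offset M n k j : ℤ) : ℝ)|) ^ 2) :=
          mul_le_mul (norm_sgn_le _ _) (norm_expCoeff_le (theta_mem M _) _) (norm_nonneg _)
            zero_le_one
      _ = _ := one_mul _
  · rw [sgn_eq_zero h]; simp

/-- Each integer is the quotient `μ / M` for exactly `M` values of `μ`. This loss, raised to the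
power `p / q = p - 1`, is outweighed by the factor `M ^ (-p)` that the rescaling of time brings. -/
lemma tsum_bet_ediv (M : ℕ) [NeZero M] (l : ℤ) :
    ∑' μ : ℤ, bet (l - μ / (M : ℤ)) = M * ∑' k, bet k := by
  have h : ∀ μ : ℤ, bet (l - μ / (M : ℤ)) =
      (fun z : ℤ × Fin M => bet (l - z.1)) (Int.divModEquiv M μ) := fun μ => rfl
  rw [tsum_congr h, (Int.divModEquiv M).tsum_eq (fun z : ℤ × Fin M => bet (l - z.1)),
    ENNReal.tsum_prod (f := fun (a : ℤ) (_ : Fin M) => bet (l - a))]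
  simp only [tsum_fintype, Finset.sum_const, Finset.card_univ, Fintype.card_fin, nsmul_eq_mul]
  rw [ENNReal.tsum_mul_left]
  congr 1
  exact (Equiv.subLeft l).tsum_eq bet

lemma tsum_kerB_le (M : ℕ) (n : Freq) (j : TriIndex) :
    ∑' k, kerB M n k j ≤ ∑' k, bet k := by
  by_cases h : j.1 ∈ resAll n
  · simp only [kerB, if_pos h]
    apply le_of_eq
    rw [← (Equiv.subRight (j.2.1 - j.2.2.1 + j.2.2.2 + phase n j.1.1 j.1.2 / (M : ℤ))).tsum_eq bet]
    refine tsum_congr fun k => ?_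
    congr 1
    simp only [offset, Equiv.subRight_apply]; ring
  · simp [kerB, if_neg h]

/-- Schur's test with output variable `k`, for fixed `n`. On the input side `bet` confines the phase
to blocks of `M` values, with summable tails, and on each single value of the phase the weights sum
to at most `A`. -/
lemma tsum_tri_rpow_le {p q : ℝ} (hpq : p.HolderConjugate q) (M : ℕ) [NeZero M] (n : Freq)
    (W : Freq × Freq → ℝ≥0∞) {A : ℝ≥0∞}
    (hW : ∀ μ, ∑' z, (res μ n).indicator (fun z => W z ^ q) z ≤ A)
    (g₁ g₂ g₃ : Freq → ℤ → ℝ≥0∞) :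
    ∑' k, (∑' j : TriIndex, kerB M n k j *
        (W j.1 * ((jw j.2.1)⁻¹ * (jw j.2.2.1)⁻¹ * (jw j.2.2.2)⁻¹)) *
        (g₁ j.1.1 j.2.1 * g₂ (j.1.1 + j.1.2 - n) j.2.2.1 * g₃ j.1.2 j.2.2.2)) ^ p ≤
      ((∑' k, ((jw k)⁻¹) ^ q) ^ 3 * (A * (M * ∑' k, bet k))) ^ (p / q) *
        ((∑' k, bet k) * ∑' z : Freq × Freq, (∑' k, g₁ z.1 k ^ p) *
          (∑' k, g₂ (z.1 + z.2 - n) k ^ p) * ∑' k, g₃ z.2 k ^ p) := by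
  have hp0 := hpq.pos
  have hq0 := hpq.symm.pos
  set S := ∑' k, ((jw k)⁻¹) ^ q with hS
  have h := tsum_kernel_rpow_le hpq (kerB M n)
    (fun _ j => W j.1 * ((jw j.2.1)⁻¹ * (jw j.2.2.1)⁻¹ * (jw j.2.2.2)⁻¹))
    (fun j : TriIndex => g₁ j.1.1 j.2.1 * g₂ (j.1.1 + j.1.2 - n) j.2.2.1 * g₃ j.1.2 j.2.2.2)
    (A := S ^ 3 * (A * (M * ∑' k, bet k))) (B := ∑' k, bet k) ?_ (tsum_kerB_le M n)
  · refine h.trans (le_of_eq ?_)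
    congr 2
    rw [ENNReal.tsum_prod (f := fun (z : Freq × Freq) (κ : ℤ × ℤ × ℤ) =>
      (g₁ z.1 κ.1 * g₂ (z.1 + z.2 - n) κ.2.1 * g₃ z.2 κ.2.2) ^ p)]
    refine tsum_congr fun z => ?_
    rw [ENNReal.tsum_prod (f := fun (k₁ : ℤ) (κ : ℤ × ℤ) =>
      (g₁ z.1 k₁ * g₂ (z.1 + z.2 - n) κ.1 * g₃ z.2 κ.2) ^ p)]
    have e : ∀ k₁ : ℤ, ∑' κ : ℤ × ℤ, (g₁ z.1 k₁ * g₂ (z.1 + z.2 - n) κ.1 * g₃ z.2 κ.2) ^ p =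
        g₁ z.1 k₁ ^ p * ((∑' k, g₂ (z.1 + z.2 - n) k ^ p) * ∑' k, g₃ z.2 k ^ p) := by
      intro k₁
      rw [ENNReal.tsum_prod (f := fun (k₂ k₃ : ℤ) =>
        (g₁ z.1 k₁ * g₂ (z.1 + z.2 - n) k₂ * g₃ z.2 k₃) ^ p)]
      simp_rw [ENNReal.mul_rpow_of_nonneg _ _ hp0.le, ENNReal.tsum_mul_left,
        ENNReal.tsum_mul_right, ENNReal.tsum_mul_left]
      ring
    simp_rw [e]
    rw [ENNReal.tsum_mul_right]
    ring
  · intro k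
    rw [ENNReal.tsum_prod (f := fun (z : Freq × Freq) (κ : ℤ × ℤ × ℤ) =>
      kerB M n k (z, κ) * (W z * ((jw κ.1)⁻¹ * (jw κ.2.1)⁻¹ * (jw κ.2.2)⁻¹)) ^ q),
      ENNReal.tsum_comm]
    have hz : ∀ κ : ℤ × ℤ × ℤ, ∑' z : Freq × Freq, kerB M n k (z, κ) *
        (W z * ((jw κ.1)⁻¹ * (jw κ.2.1)⁻¹ * (jw κ.2.2)⁻¹)) ^ q ≤
        (A * (M * ∑' k, bet k)) *
          (((jw κ.1)⁻¹) ^ q * (((jw κ.2.1)⁻¹) ^ q * ((jw κ.2.2)⁻¹) ^ q)) := by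
      intro κ
      have e1 : ∀ z : Freq × Freq, kerB M n k (z, κ) *
          (W z * ((jw κ.1)⁻¹ * (jw κ.2.1)⁻¹ * (jw κ.2.2)⁻¹)) ^ q =
          (kerB M n k (z, κ) * W z ^ q) *
          (((jw κ.1)⁻¹) ^ q * (((jw κ.2.1)⁻¹) ^ q * ((jw κ.2.2)⁻¹) ^ q)) := by
        intro z
        rw [ENNReal.mul_rpow_of_nonneg _ _ hq0.le, ENNReal.mul_rpow_of_nonneg _ _ hq0.le,
          ENNReal.mul_rpow_of_nonneg _ _ hq0.le]
        ring
      simp_rw [e1]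
      rw [ENNReal.tsum_mul_right]
      gcongr
      set l : ℤ := k - κ.1 + κ.2.1 - κ.2.2
      -- Each pair has exactly one phase, so the sum over pairs can be sorted by level sets.
      have e2 : ∀ z : Freq × Freq, kerB M n k (z, κ) * W z ^ q =
          ∑' μ : ℤ, bet (l - μ / (M : ℤ)) * (res μ n).indicator (fun z => W z ^ q) z := by
        intro z
        by_cases hz : z ∈ resAll n
        · rw [tsum_eq_single (phase n z.1 z.2)]
          · have : z ∈ res (phase n z.1 z.2) n := ⟨rfl, hz⟩
            rw [Set.indicator_of_mem this, kerB, if_pos hz]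
            rfl
          · intro μ hμ
            rw [Set.indicator_of_notMem (fun h => hμ h.1.symm), mul_zero]
        · rw [kerB, if_neg hz, zero_mul, eq_comm, ENNReal.tsum_eq_zero]
          intro μ
          rw [Set.indicator_of_notMem (fun h => hz h.2), mul_zero]
      simp_rw [e2]
      rw [ENNReal.tsum_comm]
      simp_rw [ENNReal.tsum_mul_left]
      calc _ ≤ ∑' μ : ℤ, bet (l - μ / (M : ℤ)) * A :=
            ENNReal.tsum_le_tsum fun μ => mul_le_mul_right (hW μ) _
        _ = _ := by rw [ENNReal.tsum_mul_right, tsum_bet_ediv, mul_comm]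
    refine (ENNReal.tsum_le_tsum hz).trans (le_of_eq ?_)
    rw [ENNReal.tsum_mul_left, ENNReal.tsum_prod (f := fun (k₁ : ℤ) (κ : ℤ × ℤ) =>
      ((jw k₁)⁻¹) ^ q * (((jw κ.1)⁻¹) ^ q * ((jw κ.2)⁻¹) ^ q))]
    simp_rw [ENNReal.tsum_mul_left]
    rw [ENNReal.tsum_mul_right, ENNReal.tsum_prod (f := fun (k₁ k₂ : ℤ) =>
      (((jw k₁)⁻¹) ^ q * ((jw k₂)⁻¹) ^ q))]
    simp_rw [ENNReal.tsum_mul_left]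
    rw [ENNReal.tsum_mul_right]
    ring

/-- The sum of absolute values in the trilinear form. -/
def absTri (M : ℕ) (n : Freq) (k : ℤ) (u v w : Freq → ℤ → ℂ) : ℝ≥0∞ :=
  ∑' j : TriIndex, kerB M n k j *
    (‖u j.1.1 j.2.1‖ₑ * ‖v (j.1.1 + j.1.2 - n) j.2.2.1‖ₑ * ‖w j.1.2 j.2.2.2‖ₑ)

/-- `W` is the part of the weights that is summed by counting, and `ρ₁`, `ρ₂`, `ρ₃` are the parts
kept in the norms; `hρ` says that together they dominate the output weight `ρ₀`. -/
lemma absTri_le {p q : ℝ} (hpq : p.HolderConjugate q) (M : ℕ) [NeZero M] (n : Freq)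
    (W : Freq × Freq → ℝ≥0∞) {A : ℝ≥0∞}
    (hW : ∀ μ, ∑' z, (res μ n).indicator (fun z => W z ^ q) z ≤ A)
    (ρ₀ : ℝ≥0∞) (ρ₁ ρ₂ ρ₃ : Freq → ℝ≥0∞)
    (hρ : ∀ z : Freq × Freq, ρ₀ ≤ W z * (ρ₁ z.1 * ρ₂ (z.1 + z.2 - n) * ρ₃ z.2))
    (u v w : Freq → ℤ → ℂ) :
    ∑' k, (ρ₀ * absTri M n k u v w) ^ p ≤
      ((∑' k, ((jw k)⁻¹) ^ q) ^ 3 * (A * (M * ∑' k, bet k))) ^ (p / q) *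
        ((∑' k, bet k) * ∑' z : Freq × Freq, (ρ₁ z.1 ^ p * en p (u z.1)) *
          (ρ₂ (z.1 + z.2 - n) ^ p * en p (v (z.1 + z.2 - n))) * (ρ₃ z.2 ^ p * en p (w z.2))) := by
  have hp0 := hpq.pos
  have h := tsum_tri_rpow_le hpq M n W hW (fun a k => ρ₁ a * (jw k * ‖u a k‖ₑ))
    (fun a k => ρ₂ a * (jw k * ‖v a k‖ₑ)) (fun a k => ρ₃ a * (jw k * ‖w a k‖ₑ))
  simp_rw [ENNReal.mul_rpow_of_nonneg (ρ₁ _) _ hp0.le, ENNReal.mul_rpow_of_nonneg (ρ₂ _) _ hp0.le,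
    ENNReal.mul_rpow_of_nonneg (ρ₃ _) _ hp0.le, ENNReal.tsum_mul_left] at h
  refine le_trans (ENNReal.tsum_le_tsum fun k => ENNReal.rpow_le_rpow ?_ hp0.le) h
  rw [absTri, ← ENNReal.tsum_mul_left]
  refine ENNReal.tsum_le_tsum fun j => ?_
  have c : ∀ k : ℤ, (jw k)⁻¹ * jw k = 1 :=
    fun k => ENNReal.inv_mul_cancel (jw_ne_zero k) (jw_ne_top k)
  calc _ ≤ (W j.1 * (ρ₁ j.1.1 * ρ₂ (j.1.1 + j.1.2 - n) * ρ₃ j.1.2)) * (kerB M n k j *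
    (‖u j.1.1 j.2.1‖ₑ * ‖v (j.1.1 + j.1.2 - n) j.2.2.1‖ₑ * ‖w j.1.2 j.2.2.2‖ₑ)) :=
        mul_le_mul_left (hρ j.1) _
    _ = _ := by
      calc _ = (W j.1 * (ρ₁ j.1.1 * ρ₂ (j.1.1 + j.1.2 - n) * ρ₃ j.1.2)) * (kerB M n k j *
            (‖u j.1.1 j.2.1‖ₑ * ‖v (j.1.1 + j.1.2 - n) j.2.2.1‖ₑ * ‖w j.1.2 j.2.2.2‖ₑ)) *
            (((jw j.2.1)⁻¹ * jw j.2.1) * ((jw j.2.2.1)⁻¹ * jw j.2.2.1) *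
              ((jw j.2.2.2)⁻¹ * jw j.2.2.2)) := by rw [c, c, c]; ring
        _ = _ := by ring

/-- The weight `⟨n⟩^s`. -/
def bw (s : ℝ) (n : Freq) : ℝ≥0∞ := ENNReal.ofReal (bracket n ^ s)

/-- The `p`-th power of the norm `‖⟨n⟩^s (1 + |k|) u(n, k)‖_{ℓ^p}`. -/
def NX (s p : ℝ) (u : Freq → ℤ → ℂ) : ℝ≥0∞ := ∑' n, bw s n ^ p * en p (u n)

/-- The `p`-th power of the norm `sup_n ‖(1 + |k|) u(n, k)‖_{ℓ^p}`. -/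
def NY (p : ℝ) (u : Freq → ℤ → ℂ) : ℝ≥0∞ := ⨆ n, en p (u n)

/-- The first bound serves the contraction. In the other three the output has no weight and one
input is known only in `sup_n`, so the weights of the remaining two frequencies have to do all the
work; each of the three pair sums of `exists_tsum_res_le` is used once. -/
lemma exists_absTri_le {s p q : ℝ} (hpq : p.HolderConjugate q) (hs : 0 < s) (hsq : 1 < s * q) :
    ∃ C : ℝ≥0∞, C ≠ ∞ ∧ ∀ (M : ℕ) [NeZero M] (u v w : Freq → ℤ → ℂ),
      (∑' n, bw s n ^ p * ∑' k, absTri M n k u v w ^ p ≤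
        C * (M : ℝ≥0∞) ^ (p / q) * (NX s p u * NX s p v * NX s p w)) ∧
      (∀ n, ∑' k, absTri M n k u v w ^ p ≤
        C * (M : ℝ≥0∞) ^ (p / q) * (NY p u * NX s p v * NX s p w)) ∧
      (∀ n, ∑' k, absTri M n k u v w ^ p ≤
        C * (M : ℝ≥0∞) ^ (p / q) * (NX s p u * NY p v * NX s p w)) ∧
      (∀ n, ∑' k, absTri M n k u v w ^ p ≤
        C * (M : ℝ≥0∞) ^ (p / q) * (NX s p u * NX s p v * NY p w)) := by
  have hp0 := hpq.pos
  have hq0 := hpq.symm.pos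
  have hpq0 : 0 ≤ p / q := div_nonneg hp0.le hq0.le
  obtain ⟨A, hA, hres⟩ := exists_tsum_res_le hq0 hs hsq
  set S := ∑' k, ((jw k)⁻¹) ^ q with hS
  set b := ∑' k, bet k with hb
  have hStop : S ≠ ∞ := tsum_jw_inv_rpow_ne_top hpq.symm.lt
  have hbtop : b ≠ ∞ := tsum_bet_ne_top
  have hbr : ∀ a : Freq, 0 < bracket a := bracket_pos
  have hconst : ∀ M : ℕ, (S ^ 3 * (A * (M * b))) ^ (p / q) * b =
      (S ^ 3 * (A * b)) ^ (p / q) * b * (M : ℝ≥0∞) ^ (p / q) := by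
    intro M
    rw [show S ^ 3 * (A * (M * b)) = (S ^ 3 * (A * b)) * M by ring,
      ENNReal.mul_rpow_of_nonneg _ _ hpq0]
    ring
  have hsum : ∀ (n : Freq) (F : Freq → ℝ≥0∞) (a : Freq), ∑' b, F (a + b - n) = ∑' b, F b := by
    intro n F a
    rw [← (Equiv.addLeft (a - n)).tsum_eq F]
    refine tsum_congr fun b => ?_
    simp only [Equiv.coe_addLeft]; congr 1; abel
  refine ⟨(S ^ 3 * (A * b)) ^ (p / q) * b, ENNReal.mul_ne_top
    (ENNReal.rpow_ne_top_of_nonneg hpq0 (ENNReal.mul_ne_top (ENNReal.pow_ne_top hStop)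
      (ENNReal.mul_ne_top hA hbtop))) hbtop, fun M _ u v w => ⟨?_, ?_, ?_, ?_⟩⟩
  · have h1 : ∀ n, bw s n ^ p * ∑' k, absTri M n k u v w ^ p ≤
        (S ^ 3 * (A * b)) ^ (p / q) * b * (M : ℝ≥0∞) ^ (p / q) *
        ∑' z : Freq × Freq, (bw s z.1 ^ p * en p (u z.1)) *
          (bw s (z.1 + z.2 - n) ^ p * en p (v (z.1 + z.2 - n))) *
          (bw s z.2 ^ p * en p (w z.2)) := by
      intro n
      have h := absTri_le hpq M n (fun z => ENNReal.ofReal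
        (bracket n ^ s * (bracket z.1 * bracket (z.1 + z.2 - n) * bracket z.2) ^ (-s)))
        (fun μ => (hres n μ).2.2.2) (bw s n) (bw s) (bw s) (bw s) ?_ u v w
      · rw [← mul_assoc, ← hS, ← hb, hconst] at h
        rw [← ENNReal.tsum_mul_left]
        simp_rw [← ENNReal.mul_rpow_of_nonneg _ _ hp0.le] at h ⊢
        exact h
      · intro z
        have h1 := hbr z.1
        have h2 := hbr z.2
        have h3 := hbr (z.1 + z.2 - n)
        have h4 := hbr n
        unfold bw
        rw [← ENNReal.ofReal_mul (by positivity), ← ENNReal.ofReal_mul (by positivity),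
          ← ENNReal.ofReal_mul (by positivity)]
        apply ENNReal.ofReal_le_ofReal
        rw [← Real.mul_rpow h1.le h3.le, ← Real.mul_rpow (by positivity) h2.le, mul_assoc,
          ← Real.rpow_add (by positivity)]
        simp
    refine (ENNReal.tsum_le_tsum h1).trans (le_of_eq ?_)
    rw [ENNReal.tsum_mul_left, ENNReal.tsum_comm]
    congr 1
    have h2 : ∀ z : Freq × Freq, ∑' n, (bw s z.1 ^ p * en p (u z.1)) *
          (bw s (z.1 + z.2 - n) ^ p * en p (v (z.1 + z.2 - n))) *
          (bw s z.2 ^ p * en p (w z.2)) =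
        (bw s z.1 ^ p * en p (u z.1)) * NX s p v * (bw s z.2 ^ p * en p (w z.2)) := by
      intro z
      rw [ENNReal.tsum_mul_right, ENNReal.tsum_mul_left]
      congr 2
      exact (Equiv.subLeft (z.1 + z.2)).tsum_eq fun n => bw s n ^ p * en p (v n)
    rw [tsum_congr h2, ENNReal.tsum_prod (f := fun a b =>
      (bw s a ^ p * en p (u a)) * NX s p v * (bw s b ^ p * en p (w b)))]
    simp_rw [ENNReal.tsum_mul_left, ENNReal.tsum_mul_right]
    rfl
  · intro n
    have h := absTri_le hpq M n (fun z => ENNReal.ofReal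
        ((bracket (z.1 + z.2 - n) * bracket z.2) ^ (-s)))
        (fun μ => (hres n μ).1) 1 (fun _ => 1) (bw s) (bw s) ?_ u v w
    · rw [← mul_assoc, ← hS, ← hb, hconst] at h
      simp only [one_mul, ENNReal.one_rpow] at h
      refine h.trans ?_
      gcongr
      calc _ ≤ ∑' z : Freq × Freq, NY p u * (bw s (z.1 + z.2 - n) ^ p * en p (v (z.1 + z.2 - n))) *
            (bw s z.2 ^ p * en p (w z.2)) := by
            refine ENNReal.tsum_le_tsum fun z => ?_
            gcongr
            exact le_iSup (fun n => en p (u n)) z.1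
        _ = _ := by
            rw [ENNReal.tsum_prod (f := fun a b => NY p u * (bw s (a + b - n) ^ p *
              en p (v (a + b - n))) * (bw s b ^ p * en p (w b))), ENNReal.tsum_comm]
            simp_rw [ENNReal.tsum_mul_right, ENNReal.tsum_mul_left, add_comm _ (_ : Freq),
              hsum n (fun a => bw s a ^ p * en p (v a)), ENNReal.tsum_mul_left]
            rfl
    · intro z
      have h1 := hbr z.2
      have h2 := hbr (z.1 + z.2 - n)
      unfold bw
      rw [one_mul, ← ENNReal.ofReal_mul (by positivity), ← ENNReal.ofReal_mul (by positivity),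
        ← Real.mul_rpow (by positivity) (by positivity), ← Real.rpow_add (by positivity)]
      simp
  · intro n
    have h := absTri_le hpq M n (fun z => ENNReal.ofReal
        ((bracket z.1 * bracket z.2) ^ (-s)))
        (fun μ => (hres n μ).2.1) 1 (bw s) (fun _ => 1) (bw s) ?_ u v w
    · rw [← mul_assoc, ← hS, ← hb, hconst] at h
      simp only [one_mul, ENNReal.one_rpow] at h
      refine h.trans ?_
      gcongr
      calc _ ≤ ∑' z : Freq × Freq, (bw s z.1 ^ p * en p (u z.1)) * NY p v *
            (bw s z.2 ^ p * en p (w z.2)) := by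
            refine ENNReal.tsum_le_tsum fun z => ?_
            gcongr
            exact le_iSup (fun n => en p (v n)) (z.1 + z.2 - n)
        _ = _ := by
            rw [ENNReal.tsum_prod (f := fun a b => (bw s a ^ p * en p (u a)) * NY p v *
              (bw s b ^ p * en p (w b)))]
            simp_rw [ENNReal.tsum_mul_left, ENNReal.tsum_mul_right]
            rfl
    · intro z
      have h1 := hbr z.2
      have h2 := hbr z.1
      unfold bw
      rw [mul_one, ← ENNReal.ofReal_mul (by positivity), ← ENNReal.ofReal_mul (by positivity),
        ← Real.mul_rpow (by positivity) (by positivity), ← Real.rpow_add (by positivity)]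
      simp
  · intro n
    have h := absTri_le hpq M n (fun z => ENNReal.ofReal
        ((bracket z.1 * bracket (z.1 + z.2 - n)) ^ (-s)))
        (fun μ => (hres n μ).2.2.1) 1 (bw s) (bw s) (fun _ => 1) ?_ u v w
    · rw [← mul_assoc, ← hS, ← hb, hconst] at h
      simp only [one_mul, ENNReal.one_rpow] at h
      refine h.trans ?_
      gcongr
      calc _ ≤ ∑' z : Freq × Freq, (bw s z.1 ^ p * en p (u z.1)) *
            (bw s (z.1 + z.2 - n) ^ p * en p (v (z.1 + z.2 - n))) * NY p w := by
            refine ENNReal.tsum_le_tsum fun z => ?_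
            gcongr
            exact le_iSup (fun n => en p (w n)) z.2
        _ = _ := by
            rw [ENNReal.tsum_prod (f := fun a b => (bw s a ^ p * en p (u a)) *
              (bw s (a + b - n) ^ p * en p (v (a + b - n))) * NY p w)]
            simp_rw [ENNReal.tsum_mul_right, ENNReal.tsum_mul_left,
              hsum n (fun a => bw s a ^ p * en p (v a)), ENNReal.tsum_mul_right]
            rfl
    · intro z
      have h1 := hbr z.1
      have h2 := hbr (z.1 + z.2 - n)
      unfold bw
      rw [mul_one, ← ENNReal.ofReal_mul (by positivity), ← ENNReal.ofReal_mul (by positivity),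
        ← Real.mul_rpow (by positivity) (by positivity), ← Real.rpow_add (by positivity)]
      simp

/-- The trilinear form on space-time Fourier coefficients. -/
def tri (M : ℕ) (t₀ : ℝ) (u v w : Freq → ℤ → ℂ) (n : Freq) (k : ℤ) : ℂ :=
  ∑' j : TriIndex, ker M t₀ n k j *
    (u j.1.1 j.2.1 * conj (v (j.1.1 + j.1.2 - n) j.2.2.1) * w j.1.2 j.2.2.2)

/-- The Duhamel term on a time interval of length `π / M`, in rescaled time `x`, `t = t₀ + 2πx/M`,
on space-time Fourier coefficients. -/
def duh (M : ℕ) (t₀ : ℝ) (u v w : Freq → ℤ → ℂ) (n : Freq) (l : ℤ) : ℂ :=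
  ((2 * π / M : ℝ) : ℂ) * integ (tri M t₀ u v w n) l

lemma enorm_tri_term_le (M : ℕ) [NeZero M] (t₀ : ℝ) (u v w : Freq → ℤ → ℂ) (n : Freq) (k : ℤ)
    (j : TriIndex) : ‖ker M t₀ n k j *
      (u j.1.1 j.2.1 * conj (v (j.1.1 + j.1.2 - n) j.2.2.1) * w j.1.2 j.2.2.2)‖ₑ ≤
    kerB M n k j *
      (‖u j.1.1 j.2.1‖ₑ * ‖v (j.1.1 + j.1.2 - n) j.2.2.1‖ₑ * ‖w j.1.2 j.2.2.2‖ₑ) := by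
  rw [enorm_mul, enorm_mul, enorm_mul, RCLike.enorm_conj]
  gcongr
  exact enorm_ker_le M t₀ n k j

lemma enorm_tri_le (M : ℕ) [NeZero M] (t₀ : ℝ) (u v w : Freq → ℤ → ℂ) (n : Freq) (k : ℤ) :
    ‖tri M t₀ u v w n k‖ₑ ≤ absTri M n k u v w :=
  enorm_tsum_le_tsum_enorm.trans
    (ENNReal.tsum_le_tsum fun j => enorm_tri_term_le M t₀ u v w n k j)

lemma summable_tri_term {M : ℕ} [NeZero M] {t₀ : ℝ} {u v w : Freq → ℤ → ℂ} {n : Freq} {k : ℤ}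
    (h : absTri M n k u v w ≠ ∞) : Summable fun j : TriIndex => ker M t₀ n k j *
      (u j.1.1 j.2.1 * conj (v (j.1.1 + j.1.2 - n) j.2.2.1) * w j.1.2 j.2.2.2) :=
  Summable.of_enorm (ne_top_of_le_ne_top h
    (ENNReal.tsum_le_tsum fun j => enorm_tri_term_le M t₀ u v w n k j))

lemma bw_ne_zero (s : ℝ) (n : Freq) : bw s n ≠ 0 := by
  rw [bw, Ne, ENNReal.ofReal_eq_zero, not_le]; exact Real.rpow_pos_of_pos (bracket_pos n) s

lemma bw_ne_top (s : ℝ) (n : Freq) : bw s n ≠ ∞ := ENNReal.ofReal_ne_top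

lemma tsum_absTri_rpow_ne_top {s p q : ℝ} (hpq : p.HolderConjugate q) (hs : 0 < s)
    (hsq : 1 < s * q) (M : ℕ) [NeZero M] {u v w : Freq → ℤ → ℂ} (hu : NX s p u ≠ ∞)
    (hv : NX s p v ≠ ∞) (hw : NX s p w ≠ ∞) (n : Freq) :
    ∑' k, absTri M n k u v w ^ p ≠ ∞ := by
  obtain ⟨C, hC, h⟩ := exists_absTri_le hpq hs hsq
  have h1 := (h M u v w).1
  have h2 : bw s n ^ p * ∑' k, absTri M n k u v w ^ p ≠ ∞ := by
    refine ne_top_of_le_ne_top ?_ ((ENNReal.le_tsum n).trans h1)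
    refine ENNReal.mul_ne_top (ENNReal.mul_ne_top hC ?_)
      (ENNReal.mul_ne_top (ENNReal.mul_ne_top hu hv) hw)
    exact ENNReal.rpow_ne_top_of_nonneg (div_nonneg hpq.nonneg hpq.symm.nonneg) (by simp)
  have h3 : bw s n ^ p ≠ 0 := by
    rw [Ne, ENNReal.rpow_eq_zero_iff]
    rintro (⟨h, _⟩ | ⟨h, _⟩)
    · exact bw_ne_zero s n h
    · exact bw_ne_top s n h
  intro htop
  rw [htop, ENNReal.mul_top h3] at h2
  exact h2 rfl

lemma absTri_ne_top {s p q : ℝ} (hpq : p.HolderConjugate q) (hs : 0 < s)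
    (hsq : 1 < s * q) (M : ℕ) [NeZero M] {u v w : Freq → ℤ → ℂ} (hu : NX s p u ≠ ∞)
    (hv : NX s p v ≠ ∞) (hw : NX s p w ≠ ∞) (n : Freq) (k : ℤ) :
    absTri M n k u v w ≠ ∞ := by
  have h := ENNReal.ne_top_of_tsum_ne_top
    (tsum_absTri_rpow_ne_top hpq hs hsq M hu hv hw n) k
  intro htop
  rw [htop, ENNReal.top_rpow_of_pos hpq.pos] at h
  exact h rfl

lemma summable_norm_div_of_tsum_rpow {p q : ℝ} (hpq : p.HolderConjugate q) {c : ℤ → ℂ}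
    (h : ∑' k, ‖c k‖ₑ ^ p ≠ ∞) : Summable fun k : ℤ => ‖c k‖ / (1 + |(k : ℝ)|) := by
  have h1 := tsum_jw_inv_mul_rpow_le hpq (fun k => ‖c k‖ₑ)
  have h2 : ∑' k, (jw k)⁻¹ * ‖c k‖ₑ ≠ ∞ := by
    intro htop
    rw [htop, ENNReal.top_rpow_of_pos hpq.pos, top_le_iff] at h1
    refine ENNReal.mul_ne_top ?_ h h1
    exact ENNReal.rpow_ne_top_of_nonneg (div_nonneg hpq.nonneg hpq.symm.nonneg)
      (tsum_jw_inv_rpow_ne_top hpq.symm.lt)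
  apply Summable.of_enorm
  convert h2 using 3 with k
  rw [div_eq_inv_mul, enorm_mul, enorm_norm, jw, ← ENNReal.ofReal_inv_of_pos (by positivity)]
  congr 1
  rw [← ofReal_norm, Real.norm_of_nonneg (by positivity)]

lemma tsum_enorm_tri_rpow_ne_top {s p q : ℝ} (hpq : p.HolderConjugate q) (hs : 0 < s)
    (hsq : 1 < s * q) (M : ℕ) [NeZero M] (t₀ : ℝ) {u v w : Freq → ℤ → ℂ} (hu : NX s p u ≠ ∞)
    (hv : NX s p v ≠ ∞) (hw : NX s p w ≠ ∞) (n : Freq) :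
    ∑' k, ‖tri M t₀ u v w n k‖ₑ ^ p ≠ ∞ :=
  ne_top_of_le_ne_top (tsum_absTri_rpow_ne_top hpq hs hsq M hu hv hw n)
    (ENNReal.tsum_le_tsum fun k => ENNReal.rpow_le_rpow (enorm_tri_le M t₀ u v w n k) hpq.nonneg)

/-- `M ^ (-p)` from the time scale against `M ^ (p / q)` from the kernel leaves `M⁻¹`, the smallness
for short times in both norms. -/
lemma exists_duh_le {s p q : ℝ} (hpq : p.HolderConjugate q) (hs : 0 < s) (hsq : 1 < s * q) :
    ∃ C : ℝ≥0∞, C ≠ ∞ ∧ ∀ (M : ℕ) [NeZero M] (t₀ : ℝ) (u v w : Freq → ℤ → ℂ),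
      (NX s p (duh M t₀ u v w) ≤ C * (M : ℝ≥0∞)⁻¹ * (NX s p u * NX s p v * NX s p w)) ∧
      (NY p (duh M t₀ u v w) ≤ C * (M : ℝ≥0∞)⁻¹ * (NY p u * NX s p v * NX s p w)) ∧
      (NY p (duh M t₀ u v w) ≤ C * (M : ℝ≥0∞)⁻¹ * (NX s p u * NY p v * NX s p w)) ∧
      (NY p (duh M t₀ u v w) ≤ C * (M : ℝ≥0∞)⁻¹ * (NX s p u * NX s p v * NY p w)) := by
  obtain ⟨A, hA, hI⟩ := exists_en_integ_le hpq
  obtain ⟨B, hB, hT⟩ := exists_absTri_le hpq hs hsq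
  have hp0 := hpq.pos
  set P : ℝ≥0∞ := ENNReal.ofReal (2 * π) ^ p with hP
  have hPtop : P ≠ ∞ := ENNReal.rpow_ne_top_of_nonneg hp0.le ENNReal.ofReal_ne_top
  refine ⟨P * A * B, ENNReal.mul_ne_top (ENNReal.mul_ne_top hPtop hA) hB, ?_⟩
  intro M _ t₀ u v w
  have hM0 : (M : ℝ≥0∞) ≠ 0 := by exact_mod_cast NeZero.ne M
  have hMtop : (M : ℝ≥0∞) ≠ ∞ := ENNReal.natCast_ne_top M
  have hMR : (0 : ℝ) < M := by exact_mod_cast Nat.pos_of_ne_zero (NeZero.ne M)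
  have hMpow : (M : ℝ≥0∞)⁻¹ ^ p * (M : ℝ≥0∞) ^ (p / q) = (M : ℝ≥0∞)⁻¹ := by
    rw [← ENNReal.rpow_neg_one, ← ENNReal.rpow_mul, ← ENNReal.rpow_add _ _ hM0 hMtop]
    congr 1
    rw [hpq.div_conj_eq_sub_one]; ring
  have hen : ∀ n, en p (duh M t₀ u v w n) ≤
      P * (M : ℝ≥0∞)⁻¹ ^ p * A * ∑' k, absTri M n k u v w ^ p := by
    intro n
    have h1 : en p (duh M t₀ u v w n) = P * (M : ℝ≥0∞)⁻¹ ^ p * en p (integ (tri M t₀ u v w n)) := by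
      unfold en
      rw [← ENNReal.tsum_mul_left]
      refine tsum_congr fun k => ?_
      rw [duh, enorm_mul, ← ofReal_norm (((2 * π / M : ℝ) : ℂ)), Complex.norm_real,
        Real.norm_of_nonneg (by positivity), ENNReal.ofReal_div_of_pos hMR, div_eq_mul_inv,
        ENNReal.ofReal_natCast, hP, ← ENNReal.mul_rpow_of_nonneg _ _ hp0.le,
        ← ENNReal.mul_rpow_of_nonneg _ _ hp0.le]
      congr 1; ring
    rw [h1, mul_assoc (P * _)]
    gcongr
    refine (hI _).trans ?_
    gcongr with k
    exact enorm_tri_le M t₀ u v w n k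
  have hfin : ∀ X : ℝ≥0∞, P * (M : ℝ≥0∞)⁻¹ ^ p * A * (B * (M : ℝ≥0∞) ^ (p / q) * X) =
      P * A * B * (M : ℝ≥0∞)⁻¹ * X := by
    intro X
    calc _ = P * A * B * ((M : ℝ≥0∞)⁻¹ ^ p * (M : ℝ≥0∞) ^ (p / q)) * X := by ring
      _ = _ := by rw [hMpow]
  obtain ⟨h1, h2, h3, h4⟩ := hT M u v w
  refine ⟨?_, ?_, ?_, ?_⟩
  · rw [← hfin]
    calc NX s p (duh M t₀ u v w) ≤ ∑' n, P * (M : ℝ≥0∞)⁻¹ ^ p * A *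
          (bw s n ^ p * ∑' k, absTri M n k u v w ^ p) := by
          refine ENNReal.tsum_le_tsum fun n => ?_
          refine (mul_le_mul_right (hen n) _).trans (le_of_eq ?_)
          ring
      _ ≤ _ := by
          rw [ENNReal.tsum_mul_left]
          gcongr
  · rw [← hfin]
    exact iSup_le fun n => (hen n).trans (mul_le_mul_right (h2 n) _)
  · rw [← hfin]
    exact iSup_le fun n => (hen n).trans (mul_le_mul_right (h3 n) _)
  · rw [← hfin]
    exact iSup_le fun n => (hen n).trans (mul_le_mul_right (h4 n) _)

/-! ### Algebra of `p`-th powers of norms, and multilinearity of the Duhamel term -/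

lemma en_add_add_le {p : ℝ} (hp : 0 ≤ p) (a b c : ℤ → ℂ) :
    en p (a + b + c) ≤ 3 ^ p * (en p a + en p b + en p c) := by
  unfold en
  rw [← ENNReal.tsum_add, ← ENNReal.tsum_add, ← ENNReal.tsum_mul_left]
  refine ENNReal.tsum_le_tsum fun k => ?_
  refine le_trans (ENNReal.rpow_le_rpow ?_ hp) (add_add_rpow_le hp _ _ _)
  rw [← mul_add, ← mul_add]
  gcongr
  refine (enorm_add_le _ _).trans ?_
  gcongr
  exact enorm_add_le _ _

lemma NX_add_add_le {s p : ℝ} (hp : 0 ≤ p) (a b c : Freq → ℤ → ℂ) :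
    NX s p (a + b + c) ≤ 3 ^ p * (NX s p a + NX s p b + NX s p c) := by
  unfold NX
  rw [← ENNReal.tsum_add, ← ENNReal.tsum_add, ← ENNReal.tsum_mul_left]
  refine ENNReal.tsum_le_tsum fun n => ?_
  calc _ ≤ bw s n ^ p * (3 ^ p * (en p (a n) + en p (b n) + en p (c n))) := by
        gcongr; exact en_add_add_le hp _ _ _
    _ = _ := by ring

lemma NY_add_add_le {p : ℝ} (hp : 0 ≤ p) (a b c : Freq → ℤ → ℂ) :
    NY p (a + b + c) ≤ 3 ^ p * (NY p a + NY p b + NY p c) := by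
  refine iSup_le fun n => (en_add_add_le hp _ _ _).trans ?_
  gcongr
  · exact le_iSup (fun n => en p (a n)) n
  · exact le_iSup (fun n => en p (b n)) n
  · exact le_iSup (fun n => en p (c n)) n

lemma en_smul {p : ℝ} (hp : 0 ≤ p) (c : ℂ) (a : ℤ → ℂ) : en p (c • a) = ‖c‖ₑ ^ p * en p a := by
  unfold en
  rw [← ENNReal.tsum_mul_left]
  refine tsum_congr fun k => ?_
  rw [Pi.smul_apply, smul_eq_mul, enorm_mul, ← ENNReal.mul_rpow_of_nonneg _ _ hp]
  congr 1; ring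

lemma NX_smul {s p : ℝ} (hp : 0 ≤ p) (c : ℂ) (a : Freq → ℤ → ℂ) :
    NX s p (c • a) = ‖c‖ₑ ^ p * NX s p a := by
  unfold NX
  rw [← ENNReal.tsum_mul_left]
  refine tsum_congr fun n => ?_
  rw [Pi.smul_apply, en_smul hp]; ring

lemma NY_smul {p : ℝ} (hp : 0 ≤ p) (c : ℂ) (a : Freq → ℤ → ℂ) :
    NY p (c • a) = ‖c‖ₑ ^ p * NY p a := by
  unfold NY
  rw [ENNReal.mul_iSup]
  congr 1; ext n
  rw [Pi.smul_apply, en_smul hp]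

lemma NX_zero {s p : ℝ} (hp : 0 < p) : NX s p 0 = 0 := by
  simp [NX, en, ENNReal.zero_rpow_of_pos hp]

lemma NX_sub_ne_top {s p : ℝ} (hp : 0 < p) {a b : Freq → ℤ → ℂ} (ha : NX s p a ≠ ∞)
    (hb : NX s p b ≠ ∞) : NX s p (a - b) ≠ ∞ := by
  have h := NX_add_add_le (s := s) hp.le a ((-1 : ℂ) • b) 0
  rw [NX_smul hp.le, NX_zero hp] at h
  rw [show a - b = a + (-1 : ℂ) • b + 0 by simp [sub_eq_add_neg]]
  refine ne_top_of_le_ne_top (ENNReal.mul_ne_top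
    (ENNReal.rpow_ne_top_of_nonneg hp.le (by norm_num)) ?_) h
  simpa using ⟨ha, hb⟩

lemma integ_sub {c d : ℤ → ℂ} (hc : Summable fun k : ℤ => ‖c k‖ / (1 + |(k : ℝ)|))
    (hd : Summable fun k : ℤ => ‖d k‖ / (1 + |(k : ℝ)|)) (l : ℤ) :
    integ (c - d) l = integ c l - integ d l := by
  have h1 : Summable fun k : ℤ => c k / (2 * π * Complex.I * k) :=
    Summable.of_norm_bounded hc fun k => norm_div_two_pi_le _ _
  have h2 : Summable fun k : ℤ => d k / (2 * π * Complex.I * k) :=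
    Summable.of_norm_bounded hd fun k => norm_div_two_pi_le _ _
  unfold integ
  simp only [Pi.sub_apply, sub_div]
  rw [h1.tsum_sub h2]
  split_ifs <;> ring

/-- An identity between single terms passes to the Duhamel terms because both series on the left
converge absolutely. It is stated with unrelated triples so as to cover the three telescoping
differences. -/
lemma duh_sub_aux {s p q : ℝ} (hpq : p.HolderConjugate q) (hs : 0 < s)
    (hsq : 1 < s * q) (M : ℕ) [NeZero M] (t₀ : ℝ) {u v w u' v' w' u'' v'' w'' : Freq → ℤ → ℂ}
    (hu : NX s p u ≠ ∞) (hv : NX s p v ≠ ∞) (hw : NX s p w ≠ ∞)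
    (hu' : NX s p u' ≠ ∞) (hv' : NX s p v' ≠ ∞) (hw' : NX s p w' ≠ ∞)
    (h : ∀ (n : Freq) (j : TriIndex),
      u j.1.1 j.2.1 * conj (v (j.1.1 + j.1.2 - n) j.2.2.1) * w j.1.2 j.2.2.2 -
      u' j.1.1 j.2.1 * conj (v' (j.1.1 + j.1.2 - n) j.2.2.1) * w' j.1.2 j.2.2.2 =
      u'' j.1.1 j.2.1 * conj (v'' (j.1.1 + j.1.2 - n) j.2.2.1) * w'' j.1.2 j.2.2.2) :
    duh M t₀ u v w - duh M t₀ u' v' w' = duh M t₀ u'' v'' w'' := by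
  have htri : ∀ n, tri M t₀ u v w n - tri M t₀ u' v' w' n = tri M t₀ u'' v'' w'' n := by
    intro n
    ext k
    rw [Pi.sub_apply, tri, tri, tri,
      ← (summable_tri_term (absTri_ne_top hpq hs hsq M hu hv hw n k)).tsum_sub
      (summable_tri_term (absTri_ne_top hpq hs hsq M hu' hv' hw' n k))]
    refine tsum_congr fun j => ?_
    rw [← mul_sub, h]
  ext n l
  rw [Pi.sub_apply, Pi.sub_apply, duh, duh, duh, ← mul_sub, ← integ_sub
    (summable_norm_div_of_tsum_rpow hpq (tsum_enorm_tri_rpow_ne_top hpq hs hsq M t₀ hu hv hw n))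
    (summable_norm_div_of_tsum_rpow hpq (tsum_enorm_tri_rpow_ne_top hpq hs hsq M t₀ hu' hv' hw' n)),
    htri]

/-- Telescoping of the difference of two Duhamel terms. -/
lemma duh_sub_duh {s p q : ℝ} (hpq : p.HolderConjugate q) (hs : 0 < s)
    (hsq : 1 < s * q) (M : ℕ) [NeZero M] (t₀ : ℝ) {u v : Freq → ℤ → ℂ}
    (hu : NX s p u ≠ ∞) (hv : NX s p v ≠ ∞) :
    duh M t₀ u u u - duh M t₀ v v v =
      duh M t₀ (u - v) u u + duh M t₀ v (u - v) u + duh M t₀ v v (u - v) := by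
  have h1 : duh M t₀ u u u - duh M t₀ v u u = duh M t₀ (u - v) u u :=
    duh_sub_aux hpq hs hsq M t₀ hu hu hu hv hu hu fun n j => by
      simp only [Pi.sub_apply]; ring
  have h2 : duh M t₀ v u u - duh M t₀ v v u = duh M t₀ v (u - v) u :=
    duh_sub_aux hpq hs hsq M t₀ hv hu hu hv hv hu fun n j => by
      simp only [Pi.sub_apply, map_sub]; ring
  have h3 : duh M t₀ v v u - duh M t₀ v v v = duh M t₀ v v (u - v) :=
    duh_sub_aux hpq hs hsq M t₀ hv hv hu hv hv hv fun n j => by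
      simp only [Pi.sub_apply]; ring
  rw [← h1, ← h2, ← h3]; abel

/-! ### The trilinear convolution on `ℓ^{3/2}` -/

lemma tsum_freq_add_sub (F : Freq → ℝ≥0∞) (n a : Freq) : ∑' b, F (a + b - n) = ∑' b, F b := by
  rw [← (Equiv.addLeft (a - n)).tsum_eq F]
  refine tsum_congr fun b => ?_
  simp only [Equiv.coe_addLeft]; congr 1; abel

/-- Hölder with three exponents `1/3`, applied to the products of `3/2`-th powers over the three
pairs among `f`, `g`, `h`; each function occurs in two pairs, which restores the power one. Each
pair sum factors, as any two of the three frequencies vary independently. -/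
lemma tsum_trilinear_le (f g h : Freq → ℝ≥0∞) (n : Freq) :
    ∑' z : Freq × Freq, f z.1 * g (z.1 + z.2 - n) * h z.2 ≤
      ((∑' a, f a ^ (3 / 2 : ℝ)) * (∑' a, g a ^ (3 / 2 : ℝ)) * (∑' a, h a ^ (3 / 2 : ℝ))) ^
        (2 / 3 : ℝ) := by
  let _ : MeasurableSpace (Freq × Freq) := ⊤
  set F := ∑' a, f a ^ (3 / 2 : ℝ)
  set G := ∑' a, g a ^ (3 / 2 : ℝ)
  set H := ∑' a, h a ^ (3 / 2 : ℝ)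
  set Φ : Fin 3 → Freq × Freq → ℝ≥0∞ := ![fun z => f z.1 ^ (3 / 2 : ℝ) * g (z.1 + z.2 - n) ^ (3 / 2 : ℝ),
    fun z => h z.2 ^ (3 / 2 : ℝ) * g (z.1 + z.2 - n) ^ (3 / 2 : ℝ),
    fun z => f z.1 ^ (3 / 2 : ℝ) * h z.2 ^ (3 / 2 : ℝ)] with hΦ
  have hkey := ENNReal.lintegral_prod_norm_pow_le (μ := (Measure.count : Measure (Freq × Freq)))
    (Finset.univ : Finset (Fin 3)) (f := Φ) (fun i _ => (measurable_from_top).aemeasurable)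
    (p := fun _ => (1 / 3 : ℝ)) (by norm_num) (fun _ _ => by norm_num)
  simp only [lintegral_count, Fin.prod_univ_three, hΦ, Matrix.cons_val_zero, Matrix.cons_val_one,
    Matrix.cons_val] at hkey
  have h1 : ∑' z : Freq × Freq, f z.1 ^ (3 / 2 : ℝ) * g (z.1 + z.2 - n) ^ (3 / 2 : ℝ) = F * G := by
    rw [ENNReal.tsum_prod (f := fun a b => f a ^ (3 / 2 : ℝ) * g (a + b - n) ^ (3 / 2 : ℝ))]
    simp_rw [ENNReal.tsum_mul_left, tsum_freq_add_sub (fun a => g a ^ (3 / 2 : ℝ)),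
      ENNReal.tsum_mul_right]
    rfl
  have h2 : ∑' z : Freq × Freq, h z.2 ^ (3 / 2 : ℝ) * g (z.1 + z.2 - n) ^ (3 / 2 : ℝ) = H * G := by
    refine ((Equiv.prodComm Freq Freq).tsum_eq _).symm.trans ?_
    refine (ENNReal.tsum_prod
      (f := fun a b => h a ^ (3 / 2 : ℝ) * g (b + a - n) ^ (3 / 2 : ℝ))).trans ?_
    have e : ∀ a b : Freq, g (b + a - n) = g (a + b - n) := fun a b => by rw [add_comm]
    simp_rw [e, ENNReal.tsum_mul_left, tsum_freq_add_sub (fun a => g a ^ (3 / 2 : ℝ)),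
      ENNReal.tsum_mul_right]
    rfl
  have h3 : ∑' z : Freq × Freq, f z.1 ^ (3 / 2 : ℝ) * h z.2 ^ (3 / 2 : ℝ) = F * H := by
    rw [ENNReal.tsum_prod (f := fun a b => f a ^ (3 / 2 : ℝ) * h b ^ (3 / 2 : ℝ))]
    simp_rw [ENNReal.tsum_mul_left, ENNReal.tsum_mul_right]
    rfl
  rw [h1, h2, h3] at hkey
  have h0 : (0 : ℝ) ≤ 1 / 3 := by norm_num
  have h00 : (0 : ℝ) ≤ 2 / 3 := by norm_num
  have hsq : ∀ x : ℝ≥0∞, x ^ (1 / 3 : ℝ) * x ^ (1 / 3 : ℝ) = x ^ (2 / 3 : ℝ) := fun x => by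
    rw [← ENNReal.rpow_add_of_nonneg _ _ h0 h0]; norm_num
  have hone : ∀ x : ℝ≥0∞, (x ^ (3 / 2 : ℝ)) ^ (1 / 3 : ℝ) * (x ^ (3 / 2 : ℝ)) ^ (1 / 3 : ℝ) = x :=
    fun x => by rw [hsq, ← ENNReal.rpow_mul]; norm_num
  refine le_trans (le_of_eq ?_) (hkey.trans (le_of_eq ?_))
  · refine tsum_congr fun z => ?_
    simp only [ENNReal.mul_rpow_of_nonneg _ _ h0]
    calc f z.1 * g (z.1 + z.2 - n) * h z.2 = _ := by
          rw [← hone (f z.1), ← hone (g (z.1 + z.2 - n)), ← hone (h z.2)]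
      _ = _ := by ring
  · simp only [ENNReal.mul_rpow_of_nonneg _ _ h0, ENNReal.mul_rpow_of_nonneg _ _ h00, ← hsq]
    ring

/-- `(1 + |n₀|)(1 + |n₁|) ≤ 2 ⟨n⟩²` reduces to a product of one-dimensional sums with exponent `r /
2 > 1`. -/
lemma tsum_bracket_rpow_ne_top {r : ℝ} (hr : 2 < r) :
    ∑' n : Freq, ENNReal.ofReal (bracket n ^ (-r)) ≠ ∞ := by
  have hr2 : 1 < r / 2 := by linarith
  have hS := tsum_jw_inv_rpow_ne_top hr2
  set S := ∑' k, ((jw k)⁻¹) ^ (r / 2)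
  have hle : ∀ n : Freq, ENNReal.ofReal (bracket n ^ (-r)) ≤
      ENNReal.ofReal (2 ^ (r / 2)) * (((jw (n 0))⁻¹) ^ (r / 2) * ((jw (n 1))⁻¹) ^ (r / 2)) := by
    intro n
    have hb := bracket_pos n
    have hb2 := bracket_sq n
    have e : ∀ k : ℤ, ((jw k)⁻¹) ^ (r / 2) = ENNReal.ofReal ((1 + |(k : ℝ)|) ^ (-(r / 2))) := by
      intro k
      rw [jw, ← ENNReal.rpow_neg_one, ← ENNReal.rpow_mul, ENNReal.ofReal_rpow_of_pos (by positivity)]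
      congr 2; ring
    rw [e, e, ← ENNReal.ofReal_mul (by positivity), ← ENNReal.ofReal_mul (by positivity)]
    apply ENNReal.ofReal_le_ofReal
    rw [← Real.mul_rpow (by positivity) (by positivity)]
    have h1 : (1 + |(n 0 : ℝ)|) * (1 + |(n 1 : ℝ)|) ≤ 2 * bracket n ^ 2 := by
      rw [hb2, ← sq_abs (n 0 : ℝ), ← sq_abs (n 1 : ℝ)]
      nlinarith [sq_nonneg (|(n 0 : ℝ)| - 1), sq_nonneg (|(n 1 : ℝ)| - 1),
        sq_nonneg (|(n 0 : ℝ)| - |(n 1 : ℝ)|)]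
    have h2 : (2 * bracket n ^ 2) ^ (-(r / 2)) ≤
        ((1 + |(n 0 : ℝ)|) * (1 + |(n 1 : ℝ)|)) ^ (-(r / 2)) :=
      Real.rpow_le_rpow_of_nonpos (by positivity) h1 (by linarith)
    refine le_trans (le_of_eq ?_) (mul_le_mul_of_nonneg_left h2 (by positivity))
    rw [Real.mul_rpow (by positivity) (by positivity), ← mul_assoc, ← Real.rpow_add (by norm_num),
      ← Real.rpow_natCast, ← Real.rpow_mul hb.le]
    rw [add_neg_cancel, Real.rpow_zero, one_mul]
    congr 1; push_cast; ring
  refine ne_top_of_le_ne_top ?_ (ENNReal.tsum_le_tsum hle)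
  rw [ENNReal.tsum_mul_left, ← (finTwoArrowEquiv ℤ).symm.tsum_eq]
  have h2 := ENNReal.tsum_prod (f := fun a b => ((jw a)⁻¹) ^ (r / 2) * ((jw b)⁻¹) ^ (r / 2))
  refine ENNReal.mul_ne_top ENNReal.ofReal_ne_top (ne_of_eq_of_ne h2 ?_)
  simp_rw [ENNReal.tsum_mul_left, ENNReal.tsum_mul_right]
  exact ENNReal.mul_ne_top hS hS

lemma one_le_bw {s : ℝ} (hs : 0 ≤ s) (n : Freq) : 1 ≤ bw s n := by
  rw [bw, ENNReal.one_le_ofReal]; exact Real.one_le_rpow (one_le_bracket n) hs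

lemma tsum_rpow_le_rpow_tsum {ι : Type*} (f : ι → ℝ≥0∞) {r : ℝ} (hr : 1 ≤ r) :
    ∑' i, f i ^ r ≤ (∑' i, f i) ^ r := by
  have h : ∀ i, f i ^ r ≤ f i * (∑' i, f i) ^ (r - 1) := by
    intro i
    calc f i ^ r = f i ^ (1 + (r - 1)) := by rw [add_sub_cancel]
      _ = f i ^ (1 : ℝ) * f i ^ (r - 1) := ENNReal.rpow_add_of_nonneg _ _ zero_le_one (by linarith)
      _ ≤ _ := by
        rw [ENNReal.rpow_one]
        exact mul_le_mul_right (ENNReal.rpow_le_rpow (ENNReal.le_tsum i) (by linarith)) _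
  refine (ENNReal.tsum_le_tsum h).trans (le_of_eq ?_)
  rw [ENNReal.tsum_mul_right]
  calc _ = (∑' i, f i) ^ (1 : ℝ) * (∑' i, f i) ^ (r - 1) := by rw [ENNReal.rpow_one]
    _ = (∑' i, f i) ^ (1 + (r - 1)) :=
      (ENNReal.rpow_add_of_nonneg _ _ zero_le_one (by linarith)).symm
    _ = _ := by rw [add_sub_cancel]

/-- For `p ≤ r` this is `ℓ^p ⊂ ℓ^r`. Otherwise Hölder with exponent `p / r`, whose conjugate is `Q`,
leaves `∑ ⟨n⟩^{-s r Q}`, and the hypothesis on `s` gives `s r Q > 2`, the condition for convergence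
in two dimensions. -/
lemma exists_tsum_rpow_le {s p r : ℝ} (hp : 0 < p) (hr : 0 < r) (hs : 0 ≤ s)
    (hsp : 2 * (1 / r - 1 / p) < s) :
    ∃ C : ℝ≥0∞, C ≠ ∞ ∧ ∀ f : Freq → ℝ≥0∞,
      ∑' n, f n ^ r ≤ C * (∑' n, (bw s n * f n) ^ p) ^ (r / p) := by
  rcases le_or_gt p r with hpr | hpr
  · refine ⟨1, ENNReal.one_ne_top, fun f => ?_⟩
    rw [one_mul]
    have hrp : 1 ≤ r / p := (one_le_div hp).mpr hpr
    calc ∑' n, f n ^ r ≤ ∑' n, ((bw s n * f n) ^ p) ^ (r / p) := by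
          refine ENNReal.tsum_le_tsum fun n => ?_
          rw [← ENNReal.rpow_mul, mul_div_cancel₀ _ hp.ne']
          refine ENNReal.rpow_le_rpow ?_ hr.le
          exact le_mul_of_one_le_left (zero_le) (one_le_bw hs n)
      _ ≤ _ := tsum_rpow_le_rpow_tsum _ hrp
  · have hP : 1 < p / r := (one_lt_div hr).mpr hpr
    have hPQ := Real.HolderConjugate.conjExponent hP
    set Q := Real.conjExponent (p / r)
    have hQ0 := hPQ.symm.pos
    have hQ : 1 / Q = 1 - r / p := by
      have := hPQ.inv_add_inv_eq_one
      rw [one_div]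
      rw [inv_div] at this; linarith
    have hexp : 2 < s * r * Q := by
      have h1 : 2 * (1 / Q) < s * r := by
        rw [hQ]
        calc 2 * (1 - r / p) = 2 * (1 / r - 1 / p) * r := by field_simp
          _ < s * r := mul_lt_mul_of_pos_right hsp hr
      rw [mul_one_div, div_lt_iff₀ hQ0] at h1
      exact h1
    refine ⟨(∑' n : Freq, ENNReal.ofReal (bracket n ^ (-(s * r * Q)))) ^ (1 / Q),
      ENNReal.rpow_ne_top_of_nonneg (by positivity) (tsum_bracket_rpow_ne_top hexp), fun f => ?_⟩
    have h := tsum_mul_le_rpow hPQ (fun n => (bw s n * f n) ^ r)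
      (fun n : Freq => ENNReal.ofReal (bracket n ^ (-(s * r))))
    rw [mul_comm]
    refine le_trans (le_of_eq ?_) (h.trans (le_of_eq ?_))
    · refine tsum_congr fun n => ?_
      have hb := bracket_pos n
      rw [ENNReal.mul_rpow_of_nonneg _ _ hr.le, bw, ENNReal.ofReal_rpow_of_pos (by positivity),
        mul_right_comm, ← ENNReal.ofReal_mul (by positivity), ← Real.rpow_mul hb.le,
        ← Real.rpow_add hb]
      simp
    · congr 1
      · rw [one_div_div]
        congr 1
        refine tsum_congr fun n => ?_
        rw [← ENNReal.rpow_mul, mul_div_cancel₀ _ hr.ne']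
      · congr 1
        refine tsum_congr fun n => ?_
        have hb := bracket_pos n
        rw [ENNReal.ofReal_rpow_of_pos (by positivity), ← Real.rpow_mul hb.le]
        congr 2; ring

/-- The hypotheses on the exponents: `q` is conjugate to `p`, and `s` is large enough for the
counting estimate and for the embedding into `ℓ^{3/2}`. -/
structure Admissible (s p q : ℝ) : Prop where
  holder : p.HolderConjugate q
  pos : 0 < s
  one_lt : 1 < s * q
  lt : 4 / 3 - 2 / p < s

/-- For `r = 3/2` the threshold `2 (1/r - 1/p)` is `4/3 - 2/p`. -/
lemma Admissible.exists_tsum_trilinear_le {s p q : ℝ} (h : Admissible s p q) :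
    ∃ C : ℝ≥0∞, C ≠ ∞ ∧ ∀ (f g k : Freq → ℝ≥0∞) (n : Freq),
      ∑' z : Freq × Freq, f z.1 * g (z.1 + z.2 - n) * k z.2 ≤
        C * ((∑' a, (bw s a * f a) ^ p) * (∑' a, (bw s a * g a) ^ p) *
          (∑' a, (bw s a * k a) ^ p)) ^ (1 / p) := by
  have hp := h.holder.pos
  obtain ⟨C, hC, hb⟩ := exists_tsum_rpow_le (s := s) (p := p) (r := 3 / 2) hp (by norm_num)
    h.pos.le (by have := h.lt; calc _ = 4 / 3 - 2 / p := by ring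
                   _ < s := this)
  have h00 : (0 : ℝ) ≤ 2 / 3 := by norm_num
  refine ⟨(C * C * C) ^ (2 / 3 : ℝ), ENNReal.rpow_ne_top_of_nonneg (by norm_num)
    (ENNReal.mul_ne_top (ENNReal.mul_ne_top hC hC) hC), fun f g k n => ?_⟩
  refine (tsum_trilinear_le f g k n).trans ?_
  refine (ENNReal.rpow_le_rpow (mul_le_mul' (mul_le_mul' (hb f) (hb g)) (hb k)) h00).trans
    (le_of_eq ?_)
  simp only [ENNReal.mul_rpow_of_nonneg _ _ h00, ENNReal.mul_rpow_of_nonneg _ _ (one_div_pos.mpr hp).le,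
    ← ENNReal.rpow_mul]
  rw [show (3 / 2 / p * (2 / 3) : ℝ) = 1 / p by ring]
  ring

/-! ### Evaluation of space-time Fourier coefficients -/

/-- The `p`-th power of the norm of `𝓕L^{s,p}`. -/
def eX (s p : ℝ) (f : Freq → ℂ) : ℝ≥0∞ := ∑' n, (bw s n * ‖f n‖ₑ) ^ p

/-- The gauged nonlinearity in the interaction representation. -/
def nonlin (t : ℝ) (f g h : Freq → ℂ) (n : Freq) : ℂ :=
  ∑' z : Freq × Freq, sgn n z * Complex.exp (((t * phase n z.1 z.2 : ℝ) : ℂ) * Complex.I) *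
    (f z.1 * conj (g (z.1 + z.2 - n)) * h z.2)

/-- The function of time with Fourier coefficients `u n`. -/
def val (u : Freq → ℤ → ℂ) (x : ℝ) (n : Freq) : ℂ := ∑' k, u n k * ech k x

/-- The absolute sum of the time frequencies. -/
def absSum (u : Freq → ℤ → ℂ) (n : Freq) : ℝ≥0∞ := ∑' k, ‖u n k‖ₑ

lemma enorm_val_le (u : Freq → ℤ → ℂ) (x : ℝ) (n : Freq) : ‖val u x n‖ₑ ≤ absSum u n := by
  refine enorm_tsum_le_tsum_enorm.trans (ENNReal.tsum_le_tsum fun k => ?_)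
  rw [enorm_mul, ← ofReal_norm (ech k x), norm_ech, ENNReal.ofReal_one, mul_one]

lemma jw_inv_mul_jw_mul (k : ℤ) (a : ℝ≥0∞) : (jw k)⁻¹ * (jw k * a) = a := by
  rw [← mul_assoc, ENNReal.inv_mul_cancel (jw_ne_zero k) (jw_ne_top k), one_mul]

lemma absSum_rpow_le {p q : ℝ} (hpq : p.HolderConjugate q) (u : Freq → ℤ → ℂ) (n : Freq) :
    absSum u n ^ p ≤ (∑' k, ((jw k)⁻¹) ^ q) ^ (p / q) * en p (u n) := by
  have h := tsum_jw_inv_mul_rpow_le hpq (fun k => jw k * ‖u n k‖ₑ)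
  simp_rw [jw_inv_mul_jw_mul] at h
  exact h

lemma tsum_bw_mul_absSum_le {s p q : ℝ} (hpq : p.HolderConjugate q) (u : Freq → ℤ → ℂ) :
    ∑' n, (bw s n * absSum u n) ^ p ≤ (∑' k, ((jw k)⁻¹) ^ q) ^ (p / q) * NX s p u := by
  unfold NX
  rw [← ENNReal.tsum_mul_left]
  refine ENNReal.tsum_le_tsum fun n => ?_
  rw [ENNReal.mul_rpow_of_nonneg _ _ hpq.nonneg]
  refine (mul_le_mul_right (absSum_rpow_le hpq u n) _).trans (le_of_eq ?_)
  ring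

lemma tsum_jw_const_ne_top {p q : ℝ} (hpq : p.HolderConjugate q) :
    (∑' k, ((jw k)⁻¹) ^ q) ^ (p / q) ≠ ∞ :=
  ENNReal.rpow_ne_top_of_nonneg (div_nonneg hpq.nonneg hpq.symm.nonneg)
      (tsum_jw_inv_rpow_ne_top hpq.symm.lt)

lemma tsum_bw_mul_absSum_ne_top {s p q : ℝ} (hpq : p.HolderConjugate q) {u : Freq → ℤ → ℂ}
    (hu : NX s p u ≠ ∞) : ∑' n, (bw s n * absSum u n) ^ p ≠ ∞ :=
  ne_top_of_le_ne_top (ENNReal.mul_ne_top (tsum_jw_const_ne_top hpq) hu)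
    (tsum_bw_mul_absSum_le hpq u)

lemma eX_val_le {s p q : ℝ} (hpq : p.HolderConjugate q) (u : Freq → ℤ → ℂ) (x : ℝ) :
    eX s p (val u x) ≤ (∑' k, ((jw k)⁻¹) ^ q) ^ (p / q) * NX s p u := by
  refine le_trans (ENNReal.tsum_le_tsum fun n => ?_) (tsum_bw_mul_absSum_le hpq u)
  exact ENNReal.rpow_le_rpow (mul_le_mul_right (enorm_val_le u x n) _) hpq.nonneg

lemma absSum_ne_top {s p q : ℝ} (hpq : p.HolderConjugate q) {u : Freq → ℤ → ℂ}
    (hu : NX s p u ≠ ∞) (n : Freq) : absSum u n ≠ ∞ := by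
  have h := ENNReal.ne_top_of_tsum_ne_top (tsum_bw_mul_absSum_ne_top hpq hu) n
  intro htop
  rw [htop, ENNReal.mul_top (bw_ne_zero s n), ENNReal.top_rpow_of_pos hpq.pos] at h
  exact h rfl

lemma summable_norm_of_NX {s p q : ℝ} (hpq : p.HolderConjugate q) {u : Freq → ℤ → ℂ}
    (hu : NX s p u ≠ ∞) (n : Freq) : Summable fun k => ‖u n k‖ :=
  tsum_enorm_ne_top_iff_summable_norm.mp (absSum_ne_top hpq hu n)

lemma summable_val {s p q : ℝ} (hpq : p.HolderConjugate q) {u : Freq → ℤ → ℂ}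
    (hu : NX s p u ≠ ∞) (x : ℝ) (n : Freq) : Summable fun k => u n k * ech k x :=
  Summable.of_norm_bounded (summable_norm_of_NX hpq hu n) fun k => by
    rw [norm_mul, norm_ech, mul_one]

/-! ### The Duhamel identity -/

/-- The time evolution of one term of the trilinear form. -/
def oscill (M : ℕ) (t₀ : ℝ) (n : Freq) (j : TriIndex) (y : ℝ) : ℂ :=
  sgn n j.1 * Complex.exp ((((t₀ + 2 * π / M * y) * phase n j.1.1 j.1.2 : ℝ) : ℂ) * Complex.I) *
    (ech j.2.1 y * conj (ech j.2.2.1 y) * ech j.2.2.2 y)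

lemma norm_oscill_le (M : ℕ) (t₀ : ℝ) (n : Freq) (j : TriIndex) (y : ℝ) :
    ‖oscill M t₀ n j y‖ ≤ 1 := by
  unfold oscill
  rw [norm_mul, norm_mul, Complex.norm_exp_ofReal_mul_I, norm_mul, norm_mul, RCLike.norm_conj,
    norm_ech, norm_ech, norm_ech]
  simpa using norm_sgn_le n j.1

lemma continuous_oscill (M : ℕ) (t₀ : ℝ) (n : Freq) (j : TriIndex) :
    Continuous (oscill M t₀ n j) := by
  have h1 := continuous_ech j.2.1
  have h2 := Complex.continuous_conj.comp (continuous_ech j.2.2.1)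
  have h3 := continuous_ech j.2.2.2
  unfold oscill
  exact Continuous.mul (by fun_prop) ((h1.mul h2).mul h3)

lemma summable_norm_ker (M : ℕ) [NeZero M] (t₀ : ℝ) (n : Freq) (j : TriIndex) :
    Summable fun k => ‖ker M t₀ n k j‖ := by
  refine tsum_enorm_ne_top_iff_summable_norm.mp (ne_top_of_le_ne_top tsum_bet_ne_top ?_)
  exact (ENNReal.tsum_le_tsum fun k => enorm_ker_le M t₀ n k j).trans (tsum_kerB_le M n j)

/-- Divide the phase by `M` with remainder. The quotient is an integer time frequency and merely
shifts `k`; the remainder becomes an angle in `[0, 2π]`, whose exponential is expanded on the half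
period with constants uniform in the phase. -/
lemma hasSum_ker_ech (M : ℕ) [NeZero M] (t₀ : ℝ) (n : Freq) (j : TriIndex) {y : ℝ}
    (hy : y ∈ Icc (0 : ℝ) (1 / 2)) :
    HasSum (fun k => ker M t₀ n k j * ech k y) (oscill M t₀ n j y) := by
  set μ := phase n j.1.1 j.1.2 with hμ
  set l : ℤ := j.2.1 - j.2.2.1 + j.2.2.2 + μ / (M : ℤ) with hl
  have h := (hasSum_expCoeff (theta_mem M μ) hy)
  have h2 := (Equiv.subRight l).hasSum_iff.mpr h
  have h3 := h2.mul_left (sgn n j.1 * Complex.exp (((t₀ * μ : ℝ) : ℂ) * Complex.I) * ech l y)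
  have hfun : ∀ k, ker M t₀ n k j * ech k y =
      sgn n j.1 * Complex.exp (((t₀ * μ : ℝ) : ℂ) * Complex.I) * ech l y *
        (expCoeff (theta M μ) (k - l) * ech (k - l) y) := by
    intro k
    rw [ker, show offset M n k j = k - l by rw [hl, offset]; ring,
      show ech k y = ech l y * ech (k - l) y by rw [← ech_add]; congr 1; ring]
    ring
  have hval : oscill M t₀ n j y =
      sgn n j.1 * Complex.exp (((t₀ * μ : ℝ) : ℂ) * Complex.I) * ech l y *
        Complex.exp (((theta M μ * y : ℝ) : ℂ) * Complex.I) := by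
    have hM : (M : ℝ) ≠ 0 := by exact_mod_cast NeZero.ne M
    have hμM : (μ : ℝ) = M * ((μ / (M : ℤ) : ℤ) : ℝ) + ((μ % (M : ℤ) : ℤ) : ℝ) := by
      have := Int.mul_ediv_add_emod μ M
      exact_mod_cast this.symm
    rw [oscill, hl, ech_add, ech_add, sub_eq_add_neg, ech_add, ech_neg, ← hμ]
    have e : Complex.exp ((((t₀ + 2 * π / M * y) * μ : ℝ) : ℂ) * Complex.I) =
        Complex.exp (((t₀ * μ : ℝ) : ℂ) * Complex.I) * ech (μ / (M : ℤ)) y *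
          Complex.exp (((theta M μ * y : ℝ) : ℂ) * Complex.I) := by
      rw [ech, ← Complex.exp_add, ← Complex.exp_add, ← add_mul, ← add_mul]
      congr 2
      rw [theta, ← Complex.ofReal_add, ← Complex.ofReal_add]
      congr 1
      rw [hμM]
      have : ((M * (μ / (M : ℤ)) : ℤ) + μ % (M : ℤ)) / (M : ℤ) = μ / (M : ℤ) := by
        rw [Int.mul_ediv_add_emod]
      field_simp
      ring
    rw [e]; ring
  rw [hval, funext hfun]
  exact h3

lemma hasSum_ker_primEch (M : ℕ) [NeZero M] (t₀ : ℝ) (n : Freq) (j : TriIndex) {x : ℝ}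
    (hx : x ∈ Icc (0 : ℝ) (1 / 2)) :
    HasSum (fun k => ker M t₀ n k j * primEch k x) (∫ y in (0 : ℝ)..x, oscill M t₀ n j y) := by
  have h := intervalIntegral.hasSum_integral_of_dominated_convergence (μ := volume) (a := 0) (b := x)
    (F := fun k y => ker M t₀ n k j * ech k y) (f := oscill M t₀ n j)
    (fun k _ => ‖ker M t₀ n k j‖)
    (fun k => (continuous_const.mul (continuous_ech k)).aestronglyMeasurable)
    (fun k => Eventually.of_forall fun y _ => by rw [norm_mul, norm_ech, mul_one])
    (Eventually.of_forall fun y _ => summable_norm_ker M t₀ n j)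
    intervalIntegrable_const
    (Eventually.of_forall fun y hy => by
      rw [Set.uIoc_of_le hx.1] at hy
      exact hasSum_ker_ech M t₀ n j ⟨hy.1.le, hy.2.trans hx.2⟩)
  simpa only [intervalIntegral.integral_const_mul, primEch] using h

lemma hasSum_trilinear {f g h : ℤ → ℂ} (hf : Summable fun k => ‖f k‖)
    (hg : Summable fun k => ‖g k‖) (hh : Summable fun k => ‖h k‖) :
    HasSum (fun κ : ℤ × ℤ × ℤ => f κ.1 * g κ.2.1 * h κ.2.2)
      ((∑' k, f k) * (∑' k, g k) * ∑' k, h k) := by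
  have h1 := (summable_mul_of_summable_norm hg hh).hasSum
  have h2 := hg.mul_norm hh
  have h3 := (summable_mul_of_summable_norm hf h2).hasSum
  rw [← tsum_mul_tsum_of_summable_norm hf h2, ← tsum_mul_tsum_of_summable_norm hg hh,
    ← mul_assoc] at h3
  refine h3.congr_fun fun κ => ?_
  ring

/-- The coefficient of one term of the trilinear form. -/
def triCoeff (u v w : Freq → ℤ → ℂ) (n : Freq) (j : TriIndex) : ℂ :=
  u j.1.1 j.2.1 * conj (v (j.1.1 + j.1.2 - n) j.2.2.1) * w j.1.2 j.2.2.2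

lemma tsum_enorm_triCoeff (u v w : Freq → ℤ → ℂ) (n : Freq) :
    ∑' j, ‖triCoeff u v w n j‖ₑ =
      ∑' z : Freq × Freq, absSum u z.1 * absSum v (z.1 + z.2 - n) * absSum w z.2 := by
  refine (ENNReal.tsum_prod (f := fun (z : Freq × Freq) (κ : ℤ × ℤ × ℤ) =>
    ‖triCoeff u v w n (z, κ)‖ₑ)).trans (tsum_congr fun z => ?_)
  refine (ENNReal.tsum_prod (f := fun (k₁ : ℤ) (κ : ℤ × ℤ) =>
    ‖triCoeff u v w n (z, (k₁, κ))‖ₑ)).trans ?_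
  have e : ∀ k₁ : ℤ, ∑' κ : ℤ × ℤ, ‖triCoeff u v w n (z, (k₁, κ))‖ₑ =
      ‖u z.1 k₁‖ₑ * (absSum v (z.1 + z.2 - n) * absSum w z.2) := by
    intro k₁
    refine (ENNReal.tsum_prod (f := fun (k₂ : ℤ) (k₃ : ℤ) =>
      ‖triCoeff u v w n (z, (k₁, k₂, k₃))‖ₑ)).trans ?_
    simp only [triCoeff, enorm_mul, RCLike.enorm_conj, ENNReal.tsum_mul_left,
      ENNReal.tsum_mul_right]
    rw [mul_assoc]; rfl
  simp_rw [e]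
  rw [ENNReal.tsum_mul_right, mul_assoc]; rfl

lemma Admissible.summable_norm_triCoeff {s p q : ℝ} (h : Admissible s p q) {u v w : Freq → ℤ → ℂ}
    (hu : NX s p u ≠ ∞) (hv : NX s p v ≠ ∞) (hw : NX s p w ≠ ∞) (n : Freq) :
    Summable fun j => ‖triCoeff u v w n j‖ := by
  refine tsum_enorm_ne_top_iff_summable_norm.mp ?_
  rw [tsum_enorm_triCoeff]
  obtain ⟨C, hC, hT⟩ := h.exists_tsum_trilinear_le
  refine ne_top_of_le_ne_top ?_ (hT (absSum u) (absSum v) (absSum w) n)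
  refine ENNReal.mul_ne_top hC (ENNReal.rpow_ne_top_of_nonneg
    (one_div_pos.mpr h.holder.pos).le (ENNReal.mul_ne_top (ENNReal.mul_ne_top ?_ ?_) ?_))
  all_goals apply tsum_bw_mul_absSum_ne_top h.holder; assumption

/-- The embedding into `ℓ^{3/2}` makes the sum over all spatial and time frequencies absolutely
convergent, so the three time series can be multiplied out. -/
lemma Admissible.hasSum_oscill {s p q : ℝ} (h : Admissible s p q) (M : ℕ) (t₀ : ℝ)
    {u v w : Freq → ℤ → ℂ}
    (hu : NX s p u ≠ ∞) (hv : NX s p v ≠ ∞) (hw : NX s p w ≠ ∞) (n : Freq) (y : ℝ) :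
    HasSum (fun j => triCoeff u v w n j * oscill M t₀ n j y)
      (nonlin (t₀ + 2 * π / M * y) (val u y) (val v y) (val w y) n) := by
  have hs : Summable fun j => triCoeff u v w n j * oscill M t₀ n j y :=
    Summable.of_norm_bounded (h.summable_norm_triCoeff hu hv hw n) fun j => by
      rw [norm_mul]
      exact mul_le_of_le_one_right (norm_nonneg _) (norm_oscill_le _ _ _ _ _)
  have e : nonlin (t₀ + 2 * π / M * y) (val u y) (val v y) (val w y) n =
      ∑' j, triCoeff u v w n j * oscill M t₀ n j y := by
    rw [hs.tsum_prod, nonlin]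
    refine tsum_congr fun z => ?_
    have hn : ∀ {u : Freq → ℤ → ℂ}, NX s p u ≠ ∞ → ∀ a, Summable fun k => ‖u a k * ech k y‖ := by
      intro u hu a
      simpa only [norm_mul, norm_ech, mul_one] using summable_norm_of_NX h.holder hu a
    have h1 := hasSum_trilinear (hn hu z.1)
      (g := fun k => conj (v (z.1 + z.2 - n) k * ech k y))
      (by simpa only [RCLike.norm_conj] using hn hv (z.1 + z.2 - n)) (hn hw z.2)
    have h2 := h1.mul_left (sgn n z *
      Complex.exp ((((t₀ + 2 * π / M * y) * phase n z.1 z.2 : ℝ) : ℂ) * Complex.I))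
    rw [val, val, val, Complex.conj_tsum, ← h2.tsum_eq]
    refine tsum_congr fun κ => ?_
    simp only [triCoeff, oscill, map_mul]
    ring
  rw [e]
  exact hs.hasSum

/-- The Duhamel identity. -/
lemma Admissible.hasSum_duh {s p q : ℝ} (h : Admissible s p q) (M : ℕ) [NeZero M] (t₀ : ℝ)
    {u v w : Freq → ℤ → ℂ}
    (hu : NX s p u ≠ ∞) (hv : NX s p v ≠ ∞) (hw : NX s p w ≠ ∞) (n : Freq) {x : ℝ}
    (hx : x ∈ Icc (0 : ℝ) (1 / 2)) :
    HasSum (fun l => duh M t₀ u v w n l * ech l x)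
      (((2 * π / M : ℝ) : ℂ) * ∫ y in (0 : ℝ)..x,
        nonlin (t₀ + 2 * π / M * y) (val u y) (val v y) (val w y) n) := by
  have hU := h.summable_norm_triCoeff hu hv hw n
  have hint : HasSum (fun j => triCoeff u v w n j * ∫ y in (0 : ℝ)..x, oscill M t₀ n j y)
      (∫ y in (0 : ℝ)..x, nonlin (t₀ + 2 * π / M * y) (val u y) (val v y) (val w y) n) := by
    have h1 := intervalIntegral.hasSum_integral_of_dominated_convergence (μ := volume)
      (a := 0) (b := x)
      (F := fun j y => triCoeff u v w n j * oscill M t₀ n j y)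
      (fun j _ => ‖triCoeff u v w n j‖)
      (fun j => (continuous_const.mul (continuous_oscill M t₀ n j)).aestronglyMeasurable)
      (fun j => Eventually.of_forall fun y _ => by
        rw [norm_mul]
        exact mul_le_of_le_one_right (norm_nonneg _) (norm_oscill_le _ _ _ _ _))
      (Eventually.of_forall fun y _ => hU)
      intervalIntegrable_const
      (Eventually.of_forall fun y _ => h.hasSum_oscill M t₀ hu hv hw n y)
    simpa only [intervalIntegral.integral_const_mul] using h1
  have hs := summable_norm_div_of_tsum_rpow h.holder
    (tsum_enorm_tri_rpow_ne_top h.holder h.pos h.one_lt M t₀ hu hv hw n)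
  have h2 := (hasSum_integ hs hx).mul_left (((2 * π / M : ℝ) : ℂ))
  -- Fubini between inputs and output frequencies, justified by the summable coefficients and by the
  -- bound of `∑ₖ kerB` that is uniform in the inputs.
  have e1 : ∑' k, tri M t₀ u v w n k * primEch k x =
      ∫ y in (0 : ℝ)..x, nonlin (t₀ + 2 * π / M * y) (val u y) (val v y) (val w y) n := by
    have hsum : Summable fun κ : TriIndex × ℤ =>
        triCoeff u v w n κ.1 * (ker M t₀ n κ.2 κ.1 * primEch κ.2 x) := by
      apply Summable.of_enorm
      refine ne_top_of_le_ne_top ?_ (le_of_eq (ENNReal.tsum_prod (f := fun j k =>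
        ‖triCoeff u v w n j * (ker M t₀ n k j * primEch k x)‖ₑ)))
      refine ne_top_of_le_ne_top (b := (∑' j, ‖triCoeff u v w n j‖ₑ) * ((∑' k, bet k) * 2))
        (ENNReal.mul_ne_top (tsum_enorm_ne_top_iff_summable_norm.mpr hU)
          (ENNReal.mul_ne_top tsum_bet_ne_top (by norm_num))) ?_
      rw [← ENNReal.tsum_mul_right]
      refine ENNReal.tsum_le_tsum fun j => ?_
      simp_rw [enorm_mul]
      rw [ENNReal.tsum_mul_left]
      gcongr
      refine le_trans ?_ (mul_le_mul_left (tsum_kerB_le M n j) 2)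
      rw [← ENNReal.tsum_mul_right]
      refine ENNReal.tsum_le_tsum fun k => ?_
      gcongr
      · exact enorm_ker_le M t₀ n k j
      · rw [← ofReal_norm]
        refine (ENNReal.ofReal_le_ofReal (q := 2) ?_).trans (by simp)
        refine (norm_primEch_le k hx).trans ?_
        exact div_le_self (by norm_num) (by linarith [abs_nonneg (k : ℝ)])
    rw [← hint.tsum_eq]
    calc _ = ∑' k, ∑' j, triCoeff u v w n j * (ker M t₀ n k j * primEch k x) := by
          refine tsum_congr fun k => ?_
          rw [tri, ← tsum_mul_right]
          refine tsum_congr fun j => ?_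
          rw [triCoeff]; ring
      _ = ∑' j, ∑' k, triCoeff u v w n j * (ker M t₀ n k j * primEch k x) :=
          Summable.tsum_comm (f := fun j k => triCoeff u v w n j * (ker M t₀ n k j * primEch k x))
            hsum
      _ = _ := by
          refine tsum_congr fun j => ?_
          rw [tsum_mul_left, (hasSum_ker_primEch M t₀ n j hx).tsum_eq]
  rw [e1] at h2
  refine h2.congr_fun fun l => ?_
  rw [duh, mul_assoc]

/-! ### Continuity of the nonlinearity -/

lemma Admissible.summable_nonlin {s p q : ℝ} (h : Admissible s p q) {f g k : Freq → ℂ}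
    (hf : eX s p f ≠ ∞) (hg : eX s p g ≠ ∞) (hk : eX s p k ≠ ∞) (n : Freq) :
    Summable fun z : Freq × Freq => ‖f z.1‖ * ‖g (z.1 + z.2 - n)‖ * ‖k z.2‖ := by
  obtain ⟨C, hC, hT⟩ := h.exists_tsum_trilinear_le
  apply Summable.of_enorm
  simp only [enorm_mul, enorm_norm]
  refine ne_top_of_le_ne_top ?_ (hT (fun a => ‖f a‖ₑ) (fun a => ‖g a‖ₑ) (fun a => ‖k a‖ₑ) n)
  exact ENNReal.mul_ne_top hC (ENNReal.rpow_ne_top_of_nonneg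
    (one_div_pos.mpr h.holder.pos).le (ENNReal.mul_ne_top (ENNReal.mul_ne_top hf hg) hk))

lemma norm_nonlin_term_le (t : ℝ) (f g k : Freq → ℂ) (n : Freq) (z : Freq × Freq) :
    ‖sgn n z * Complex.exp (((t * phase n z.1 z.2 : ℝ) : ℂ) * Complex.I) *
      (f z.1 * conj (g (z.1 + z.2 - n)) * k z.2)‖ ≤ ‖f z.1‖ * ‖g (z.1 + z.2 - n)‖ * ‖k z.2‖ := by
  rw [norm_mul, norm_mul, Complex.norm_exp_ofReal_mul_I, mul_one, norm_mul, norm_mul,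
    RCLike.norm_conj]
  exact mul_le_of_le_one_left (by positivity) (norm_sgn_le n z)

lemma Admissible.summable_nonlin_term {s p q : ℝ} (h : Admissible s p q) (t : ℝ) {f g k : Freq → ℂ}
    (hf : eX s p f ≠ ∞) (hg : eX s p g ≠ ∞) (hk : eX s p k ≠ ∞) (n : Freq) :
    Summable fun z : Freq × Freq =>
      sgn n z * Complex.exp (((t * phase n z.1 z.2 : ℝ) : ℂ) * Complex.I) *
        (f z.1 * conj (g (z.1 + z.2 - n)) * k z.2) :=
  Summable.of_norm_bounded (h.summable_nonlin hf hg hk n) fun z => norm_nonlin_term_le t f g k n z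

/-- At a fixed time the nonlinearity is controlled in the unweighted `ℓ^∞` only. This dictates the
norm in which solutions are compared for uniqueness. -/
lemma Admissible.exists_enorm_nonlin_le {s p q : ℝ} (h : Admissible s p q) :
    ∃ C : ℝ≥0∞, C ≠ ∞ ∧ ∀ (t : ℝ) (f g k : Freq → ℂ) (n : Freq),
      ‖nonlin t f g k n‖ₑ ≤ C * (eX s p f * eX s p g * eX s p k) ^ (1 / p) := by
  obtain ⟨C, hC, hT⟩ := h.exists_tsum_trilinear_le
  refine ⟨C, hC, fun t f g k n => ?_⟩
  refine le_trans ?_ (hT (fun a => ‖f a‖ₑ) (fun a => ‖g a‖ₑ) (fun a => ‖k a‖ₑ) n)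
  refine enorm_tsum_le_tsum_enorm.trans (ENNReal.tsum_le_tsum fun z => ?_)
  have := norm_nonlin_term_le t f g k n z
  rw [← ofReal_norm, ← ofReal_norm, ← ofReal_norm, ← ofReal_norm,
    ← ENNReal.ofReal_mul (by positivity), ← ENNReal.ofReal_mul (by positivity)]
  exact ENNReal.ofReal_le_ofReal this

lemma eX_add_add_le {s p : ℝ} (hp : 0 ≤ p) (f g k : Freq → ℂ) :
    eX s p (f + g + k) ≤ 3 ^ p * (eX s p f + eX s p g + eX s p k) := by
  unfold eX
  rw [← ENNReal.tsum_add, ← ENNReal.tsum_add, ← ENNReal.tsum_mul_left]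
  refine ENNReal.tsum_le_tsum fun n => ?_
  refine le_trans (ENNReal.rpow_le_rpow ?_ hp) (add_add_rpow_le hp _ _ _)
  rw [← mul_add, ← mul_add]
  gcongr
  refine (enorm_add_le _ _).trans ?_
  gcongr
  exact enorm_add_le _ _

lemma eX_neg {s p : ℝ} (f : Freq → ℂ) : eX s p (-f) = eX s p f := by
  simp [eX]

lemma eX_zero {s p : ℝ} (hp : 0 < p) : eX s p 0 = 0 := by
  simp [eX, ENNReal.zero_rpow_of_pos hp]

lemma eX_add_le {s p : ℝ} (hp : 0 < p) (f g : Freq → ℂ) :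
    eX s p (f + g) ≤ 3 ^ p * (eX s p f + eX s p g) := by
  simpa [eX_zero hp] using eX_add_add_le (s := s) hp.le f g 0

lemma eX_sub_ne_top {s p : ℝ} (hp : 0 < p) {f g : Freq → ℂ} (hf : eX s p f ≠ ∞)
    (hg : eX s p g ≠ ∞) : eX s p (f - g) ≠ ∞ := by
  have h := eX_add_le (s := s) hp f (-g)
  rw [eX_neg, ← sub_eq_add_neg] at h
  exact ne_top_of_le_ne_top (ENNReal.mul_ne_top
    (ENNReal.rpow_ne_top_of_nonneg hp.le (by norm_num)) (by simpa using ⟨hf, hg⟩)) h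

lemma Admissible.exists_enorm_nonlin_sub_le {s p q : ℝ} (h : Admissible s p q) :
    ∃ C : ℝ≥0∞, C ≠ ∞ ∧ ∀ (t : ℝ) (B : ℝ≥0∞), B ≠ ∞ → ∀ (f g : Freq → ℂ) (n : Freq), eX s p f ≤ B →
      eX s p g ≤ B → ‖nonlin t f f f n - nonlin t g g g n‖ₑ ≤
        C * (B * B * eX s p (f - g)) ^ (1 / p) := by
  obtain ⟨C, hC, hT⟩ := h.exists_enorm_nonlin_le
  refine ⟨3 * C, ENNReal.mul_ne_top (by norm_num) hC, fun t B hB f g n hf hg => ?_⟩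
  have hf' := ne_top_of_le_ne_top hB hf
  have hg' := ne_top_of_le_ne_top hB hg
  have hp1 : 0 ≤ 1 / p := (one_div_pos.mpr h.holder.pos).le
  have hfg := eX_sub_ne_top h.holder.pos hf' hg'
  have e : nonlin t f f f n - nonlin t g g g n =
      nonlin t (f - g) f f n + nonlin t g (f - g) f n + nonlin t g g (f - g) n := by
    unfold nonlin
    rw [← (h.summable_nonlin_term t hf' hf' hf' n).tsum_sub (h.summable_nonlin_term t hg' hg' hg' n),
      ← (h.summable_nonlin_term t hfg hf' hf' n).tsum_add (h.summable_nonlin_term t hg' hfg hf' n),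
      ← ((h.summable_nonlin_term t hfg hf' hf' n).add (h.summable_nonlin_term t hg' hfg hf' n)).tsum_add
        (h.summable_nonlin_term t hg' hg' hfg n)]
    refine tsum_congr fun z => ?_
    simp only [Pi.sub_apply, map_sub]; ring
  rw [e]
  have h1 : ‖nonlin t (f - g) f f n‖ₑ ≤ C * (B * B * eX s p (f - g)) ^ (1 / p) := by
    refine (hT t _ _ _ n).trans ?_
    rw [mul_assoc (eX _ _ _), mul_comm (eX _ _ _)]; gcongr
  have h2 : ‖nonlin t g (f - g) f n‖ₑ ≤ C * (B * B * eX s p (f - g)) ^ (1 / p) := by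
    refine (hT t _ _ _ n).trans ?_
    rw [mul_right_comm]; gcongr
  have h3 : ‖nonlin t g g (f - g) n‖ₑ ≤ C * (B * B * eX s p (f - g)) ^ (1 / p) := by
    refine (hT t _ _ _ n).trans ?_
    gcongr
  calc _ ≤ _ := (enorm_add_le _ _).trans (add_le_add (enorm_add_le _ _) le_rfl)
    _ ≤ _ := add_le_add (add_le_add h1 h2) h3
    _ = _ := by ring

/-- Continuity on `S` in `𝓕L^{s,p}`, for functions with values in sequences. -/
def CX (s p : ℝ) (S : Set ℝ) (g : ℝ → Freq → ℂ) : Prop :=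
  ∀ t ∈ S, eX s p (g t) ≠ ∞ ∧ Tendsto (fun t' => eX s p (g t' - g t)) (𝓝[S] t) (𝓝 0)

lemma tendsto_rpow_zero {α : Type*} {l : Filter α} {f : α → ℝ≥0∞} (hf : Tendsto f l (𝓝 0)) {r : ℝ}
    (hr : 0 < r) : Tendsto (fun a => f a ^ r) l (𝓝 0) := by
  have h := (ENNReal.continuous_rpow_const (y := r)).tendsto 0 |>.comp hf
  rwa [ENNReal.zero_rpow_of_pos hr] at h

lemma tendsto_const_mul_zero {α : Type*} {l : Filter α} {f : α → ℝ≥0∞} (hf : Tendsto f l (𝓝 0))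
    {c : ℝ≥0∞} (hc : c ≠ ∞) : Tendsto (fun a => c * f a) l (𝓝 0) := by
  have h := ENNReal.Tendsto.const_mul hf (Or.inr hc)
  rwa [mul_zero] at h

lemma tendsto_of_enorm_sub {α : Type*} {l : Filter α} {f : α → ℂ} {a : ℂ}
    (h : Tendsto (fun x => ‖f x - a‖ₑ) l (𝓝 0)) : Tendsto f l (𝓝 a) := by
  rw [tendsto_iff_edist_tendsto_0]
  simpa only [edist_eq_enorm_sub] using h

/-- With frozen functions, dominated convergence handles the oscillating phases; the change of the
functions is then uniform in the phases by `exists_enorm_nonlin_sub_le`. The affine time `a + b * t`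
covers both original and rescaled time. -/
lemma Admissible.continuousOn_nonlin {s p q : ℝ} (h : Admissible s p q) {S : Set ℝ}
    {g : ℝ → Freq → ℂ} (hg : CX s p S g) (a b : ℝ) (n : Freq) :
    ContinuousOn (fun t => nonlin (a + b * t) (g t) (g t) (g t) n) S := by
  obtain ⟨C, hC, hT⟩ := h.exists_enorm_nonlin_sub_le
  have hp := h.holder.pos
  intro t ht
  obtain ⟨hgt, hlim⟩ := hg t ht
  have h1 : Tendsto (fun t' => nonlin (a + b * t') (g t) (g t) (g t) n) (𝓝[S] t)
      (𝓝 (nonlin (a + b * t) (g t) (g t) (g t) n)) := by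
    unfold nonlin
    refine tendsto_tsum_of_dominated_convergence (h.summable_nonlin hgt hgt hgt n) (fun z => ?_)
      (Eventually.of_forall fun t' z => norm_nonlin_term_le _ _ _ _ n z)
    refine Tendsto.mono_left (Continuous.tendsto ?_ t) nhdsWithin_le_nhds
    fun_prop
  set B : ℝ≥0∞ := 3 ^ p * (1 + eX s p (g t)) with hB
  have h3p : (3 : ℝ≥0∞) ^ p ≠ ∞ := ENNReal.rpow_ne_top_of_nonneg hp.le (by norm_num)
  have hBtop : B ≠ ∞ := ENNReal.mul_ne_top h3p (by simpa using hgt)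
  have h2 : Tendsto (fun t' => ‖nonlin (a + b * t') (g t') (g t') (g t') n -
      nonlin (a + b * t') (g t) (g t) (g t) n‖ₑ) (𝓝[S] t) (𝓝 0) := by
    refine tendsto_of_tendsto_of_tendsto_of_le_of_le' tendsto_const_nhds
      (h := fun t' => C * (B * B * eX s p (g t' - g t)) ^ (1 / p))
      (tendsto_const_mul_zero (tendsto_rpow_zero (tendsto_const_mul_zero hlim
        (ENNReal.mul_ne_top hBtop hBtop)) (one_div_pos.mpr hp)) hC)
      (Eventually.of_forall fun _ => zero_le) ?_
    have h3 : ∀ᶠ t' in 𝓝[S] t, eX s p (g t' - g t) < 1 := hlim.eventually (gt_mem_nhds one_pos)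
    filter_upwards [h3] with t' ht'
    refine hT _ B hBtop _ _ n ?_ ?_
    · calc eX s p (g t') = eX s p ((g t' - g t) + g t) := by rw [sub_add_cancel]
        _ ≤ _ := eX_add_le hp _ _
        _ ≤ B := by rw [hB]; gcongr
    · calc eX s p (g t) = eX s p (0 + g t) := by rw [zero_add]
        _ ≤ _ := eX_add_le hp _ _
        _ ≤ B := by rw [hB, eX_zero hp]; gcongr; exact zero_le
  refine tendsto_of_enorm_sub ?_
  have h1' : Tendsto (fun t' => ‖nonlin (a + b * t') (g t) (g t) (g t) n -
      nonlin (a + b * t) (g t) (g t) (g t) n‖ₑ) (𝓝[S] t) (𝓝 0) := by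
    simpa only [edist_eq_enorm_sub] using tendsto_iff_edist_tendsto_0.mp h1
  have h4 := h2.add h1'
  rw [add_zero] at h4
  refine tendsto_of_tendsto_of_tendsto_of_le_of_le tendsto_const_nhds h4
    (fun _ => zero_le) fun t' => ?_
  refine le_trans (le_of_eq ?_) (enorm_add_le _ _)
  congr 1; ring

/-- The modulus of continuity of evaluations. -/
def modulus (p q : ℝ) (x : ℝ) : ℝ≥0∞ :=
  (∑' k, ((jw k)⁻¹ * ‖ech k x - 1‖ₑ) ^ q) ^ (p / q)

lemma enorm_ech_sub_one_le (k : ℤ) (x : ℝ) : ‖ech k x - 1‖ₑ ≤ 2 := by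
  rw [← ofReal_norm]
  refine (ENNReal.ofReal_le_ofReal (q := 2) ?_).trans (by simp)
  refine (norm_sub_le _ _).trans ?_
  rw [norm_ech]; norm_num

lemma tendsto_modulus {p q : ℝ} (hpq : p.HolderConjugate q) :
    Tendsto (modulus p q) (𝓝 0) (𝓝 0) := by
  have hq := hpq.symm.pos
  refine tendsto_rpow_zero ?_ (div_pos hpq.pos hq)
  have hle : ∀ (k : ℤ) (x : ℝ), ((jw k)⁻¹ * ‖ech k x - 1‖ₑ) ^ q ≤ ((jw k)⁻¹ * 2) ^ q := fun k x =>
    ENNReal.rpow_le_rpow (mul_le_mul_right (enorm_ech_sub_one_le k x) _) hq.le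
  have hsum : ∑' k, ((jw k)⁻¹ * 2) ^ q ≠ ∞ := by
    simp_rw [ENNReal.mul_rpow_of_nonneg _ _ hq.le]
    rw [ENNReal.tsum_mul_right]
    exact ENNReal.mul_ne_top (tsum_jw_inv_rpow_ne_top hpq.symm.lt)
      (ENNReal.rpow_ne_top_of_nonneg hq.le (by norm_num))
  let _ : MeasurableSpace ℤ := ⊤
  have h := tendsto_lintegral_filter_of_dominated_convergence (μ := (Measure.count : Measure ℤ))
    (l := 𝓝 (0 : ℝ)) (F := fun x k => ((jw k)⁻¹ * ‖ech k x - 1‖ₑ) ^ q) (f := fun _ => 0)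
    (fun k => ((jw k)⁻¹ * 2) ^ q) (Eventually.of_forall fun x => measurable_from_top)
    (Eventually.of_forall fun x => Eventually.of_forall fun k => hle k x)
    (by rwa [lintegral_count]) (Eventually.of_forall fun k => ?_)
  · simpa only [lintegral_count, tsum_zero] using h
  · refine tendsto_rpow_zero (tendsto_const_mul_zero ?_
      (ENNReal.inv_ne_top.mpr (jw_ne_zero k))) hq
    have h1 : Continuous fun x => ‖ech k x - 1‖ₑ :=
      continuous_enorm.comp ((continuous_ech k).sub continuous_const)
    have h2 := h1.tendsto 0
    simpa [ech_zero_right] using h2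

/-- The modulus of continuity depends on `u` through `NX` alone. This uniformity over balls is
needed for the consistency of the flow. -/
lemma eX_val_sub_val_le {s p q : ℝ} (hpq : p.HolderConjugate q) {u : Freq → ℤ → ℂ}
    (hu : NX s p u ≠ ∞) (x y : ℝ) :
    eX s p (val u x - val u y) ≤ modulus p q (x - y) * NX s p u := by
  unfold eX NX
  rw [← ENNReal.tsum_mul_left]
  refine ENNReal.tsum_le_tsum fun n => ?_
  rw [ENNReal.mul_rpow_of_nonneg _ _ hpq.nonneg, mul_left_comm]
  gcongr
  have h := tsum_kernel_rpow_le (ι := Unit) hpq (fun _ _ => 1)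
    (fun _ k => (jw k)⁻¹ * ‖ech k (x - y) - 1‖ₑ) (fun k => jw k * ‖u n k‖ₑ)
    (A := ∑' k, ((jw k)⁻¹ * ‖ech k (x - y) - 1‖ₑ) ^ q) (B := 1)
    (fun _ => by simp) (fun _ => by simp)
  simp only [one_mul, tsum_fintype, Finset.univ_unique, Finset.sum_singleton] at h
  refine le_trans (ENNReal.rpow_le_rpow ?_ hpq.nonneg) h
  rw [Pi.sub_apply, val, val, ← (summable_val hpq hu x n).tsum_sub (summable_val hpq hu y n)]
  refine enorm_tsum_le_tsum_enorm.trans (ENNReal.tsum_le_tsum fun k => le_of_eq ?_)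
  have e : u n k * ech k x - u n k * ech k y = u n k * (ech k (x - y) - 1) * ech k y := by
    rw [show ech k x = ech k (x - y) * ech k y by rw [← ech_add_right, sub_add_cancel]]; ring
  rw [e, enorm_mul, enorm_mul, ← ofReal_norm (ech k y), norm_ech, ENNReal.ofReal_one, mul_one]
  calc _ = ‖ech k (x - y) - 1‖ₑ * ((jw k)⁻¹ * (jw k * ‖u n k‖ₑ)) := by
        rw [jw_inv_mul_jw_mul, mul_comm]
    _ = _ := by ring

lemma CX_val {s p q : ℝ} (hpq : p.HolderConjugate q) {u : Freq → ℤ → ℂ}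
    (hu : NX s p u ≠ ∞) (S : Set ℝ) : CX s p S (val u) := by
  intro x _
  refine ⟨ne_top_of_le_ne_top (ENNReal.mul_ne_top (tsum_jw_const_ne_top hpq) hu)
    (eX_val_le hpq u x), ?_⟩
  have h0 : Tendsto (fun y : ℝ => y - x) (𝓝[S] x) (𝓝 0) := by
    have : Continuous fun y : ℝ => y - x := by fun_prop
    have h := this.tendsto x
    rw [sub_self] at h
    exact h.mono_left nhdsWithin_le_nhds
  have h1 := ((tendsto_modulus hpq).comp h0)
  have h2 := ENNReal.Tendsto.mul_const h1 (Or.inr hu)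
  rw [zero_mul] at h2
  exact tendsto_of_tendsto_of_tendsto_of_le_of_le tendsto_const_nhds h2 (fun _ => zero_le)
    fun y => eX_val_sub_val_le hpq hu y x

/-! ### Local solutions in space-time Fourier coefficients -/

/-- The constant function of time with value `φ`. -/
def dat (φ : Freq → ℂ) (n : Freq) (k : ℤ) : ℂ := if k = 0 then φ n else 0

lemma en_dat {p : ℝ} (hp : 0 < p) (φ : Freq → ℂ) (n : Freq) : en p (dat φ n) = ‖φ n‖ₑ ^ p := by
  rw [en, tsum_eq_single 0]
  · simp [dat, jw_zero]
  · intro k hk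
    simp [dat, hk, ENNReal.zero_rpow_of_pos hp]

lemma NX_dat {s p : ℝ} (hp : 0 < p) (φ : Freq → ℂ) : NX s p (dat φ) = eX s p φ := by
  unfold NX eX
  refine tsum_congr fun n => ?_
  rw [en_dat hp, ENNReal.mul_rpow_of_nonneg _ _ hp.le]

lemma hasSum_dat (φ : Freq → ℂ) (n : Freq) (x : ℝ) :
    HasSum (fun k => dat φ n k * ech k x) (φ n) := by
  have h := hasSum_ite_eq (0 : ℤ) (φ n)
  refine h.congr_fun fun k => ?_
  unfold dat
  split_ifs with hk
  · rw [hk, ech_zero_left, mul_one]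
  · rw [zero_mul]

/-- `V` represents a solution of the gauged equation with `iε = c` on the time interval
`t₀ + (2π/M) [0, b]`. -/
def SolvesOn (c : ℂ) (M : ℕ) (t₀ : ℝ) (V : Freq → ℤ → ℂ) (b : ℝ) : Prop :=
  ∀ x ∈ Icc 0 b, ∀ n, val V x n = val V 0 n + c * (((2 * π / M : ℝ) : ℂ) *
    ∫ y in (0 : ℝ)..x, nonlin (t₀ + 2 * π / M * y) (val V y) (val V y) (val V y) n)

/-- Translation in time. -/
def shift (V : Freq → ℤ → ℂ) (x₀ : ℝ) (n : Freq) (k : ℤ) : ℂ := V n k * ech k x₀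

lemma val_shift (V : Freq → ℤ → ℂ) (x₀ x : ℝ) : val (shift V x₀) x = val V (x₀ + x) := by
  ext n
  refine tsum_congr fun k => ?_
  rw [shift, ech_add_right, mul_assoc]

lemma NX_shift (s p : ℝ) (V : Freq → ℤ → ℂ) (x₀ : ℝ) : NX s p (shift V x₀) = NX s p V := by
  unfold NX en
  simp only [shift, enorm_mul]
  have : ∀ k, ‖ech k x₀‖ₑ = 1 := fun k => by rw [← ofReal_norm, norm_ech, ENNReal.ofReal_one]
  simp only [this, mul_one]

lemma Admissible.solvesOn_shift {s p q : ℝ} (h : Admissible s p q) {c : ℂ} {M : ℕ} {t₀ : ℝ}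
    {V : Freq → ℤ → ℂ} {b x₀ : ℝ} (hV : NX s p V ≠ ∞) (hs : SolvesOn c M t₀ V b)
    (hx₀ : 0 ≤ x₀) : SolvesOn c M (t₀ + 2 * π / M * x₀) (shift V x₀) (b - x₀) := by
  intro x hx n
  have hcont : Continuous fun y =>
      nonlin (t₀ + 2 * π / M * y) (val V y) (val V y) (val V y) n :=
    continuousOn_univ.mp (h.continuousOn_nonlin (CX_val h.holder hV univ) t₀ (2 * π / M) n)
  rw [val_shift, val_shift, add_zero, hs (x₀ + x) ⟨by linarith [hx.1], by linarith [hx.2]⟩,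
    hs x₀ ⟨hx₀, by linarith [hx.1, hx.2]⟩,
    ← intervalIntegral.integral_add_adjacent_intervals (hcont.intervalIntegrable 0 x₀)
      (hcont.intervalIntegrable x₀ (x₀ + x))]
  have e : ∫ y in (0 : ℝ)..x, nonlin (t₀ + 2 * π / M * x₀ + 2 * π / M * y) (val (shift V x₀) y)
      (val (shift V x₀) y) (val (shift V x₀) y) n =
      ∫ y in x₀..(x₀ + x), nonlin (t₀ + 2 * π / M * y) (val V y) (val V y) (val V y) n := by
    have := intervalIntegral.integral_comp_add_left (a := 0) (b := x)
      (fun y => nonlin (t₀ + 2 * π / M * y) (val V y) (val V y) (val V y) n) x₀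
    rw [add_zero] at this
    rw [← this]
    congr 1
    ext y
    rw [val_shift]
    congr 1; ring
  rw [e]; ring

/-! ### Stability of solutions in `ℓ^∞` of the spatial frequency -/

/-- One step of the extension iteration for the difference of two solutions. -/
def stabStep (c : ℂ) (M : ℕ) (t₀ : ℝ) (V V' : Freq → ℤ → ℂ) (W : Freq → ℤ → ℂ) : Freq → ℤ → ℂ :=
  dat (val (V - V') 0) + c • (duh M t₀ W V V + duh M t₀ V' W V + duh M t₀ V' V' W)

lemma exists_nat_gt_mul (A : ℝ≥0∞) (hA : A ≠ ∞) :
    ∃ M₀ : ℕ, 0 < M₀ ∧ ∀ M : ℕ, M₀ ≤ M → A * (M : ℝ≥0∞)⁻¹ ≤ 1 := by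
  obtain ⟨N, hN⟩ := ENNReal.exists_nat_gt hA
  refine ⟨N + 1, Nat.succ_pos N, fun M hM => ?_⟩
  have hM0 : (M : ℝ≥0∞) ≠ 0 := by
    have : M ≠ 0 := by omega
    exact_mod_cast this
  rw [← div_eq_mul_inv, ENNReal.div_le_iff hM0 (ENNReal.natCast_ne_top M), one_mul]
  refine hN.le.trans ?_
  exact_mod_cast (by omega : N ≤ M)

lemma NX_add_smul_ne_top {s p : ℝ} (hp : 0 < p) {φ : Freq → ℂ} (hφ : eX s p φ ≠ ∞)
    (c : ℂ) {A B D : Freq → ℤ → ℂ} (hA : NX s p A ≠ ∞) (hB : NX s p B ≠ ∞) (hD : NX s p D ≠ ∞) :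
    NX s p (dat φ + c • (A + B + D)) ≠ ∞ := by
  have h3p : (3 : ℝ≥0∞) ^ p ≠ ∞ := ENNReal.rpow_ne_top_of_nonneg hp.le (by norm_num)
  have h1 := NX_add_add_le (s := s) hp.le (dat φ) (c • (A + B + D)) 0
  rw [add_zero, NX_zero hp, NX_dat hp, NX_smul hp.le, add_zero] at h1
  refine ne_top_of_le_ne_top (ENNReal.mul_ne_top h3p (ENNReal.add_ne_top.mpr ⟨hφ,
    ENNReal.mul_ne_top (ENNReal.rpow_ne_top_of_nonneg hp.le enorm_ne_top) ?_⟩)) h1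
  refine ne_top_of_le_ne_top (ENNReal.mul_ne_top h3p ?_) (NX_add_add_le (s := s) hp.le A B D)
  simp [hA, hB, hD]

lemma Admissible.NX_duh_ne_top {s p q : ℝ} (h : Admissible s p q) (M : ℕ) [NeZero M] (t₀ : ℝ)
    {u v w : Freq → ℤ → ℂ} (hu : NX s p u ≠ ∞) (hv : NX s p v ≠ ∞) (hw : NX s p w ≠ ∞) :
    NX s p (duh M t₀ u v w) ≠ ∞ := by
  obtain ⟨C, hC, hb⟩ := exists_duh_le h.holder h.pos h.one_lt
  refine ne_top_of_le_ne_top (ENNReal.mul_ne_top (ENNReal.mul_ne_top hC ?_)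
    (ENNReal.mul_ne_top (ENNReal.mul_ne_top hu hv) hw)) (hb M t₀ u v w).1
  rw [ENNReal.inv_ne_top]
  exact_mod_cast NeZero.ne M

lemma val_sub {s p q : ℝ} (hpq : p.HolderConjugate q) {u v : Freq → ℤ → ℂ}
    (hu : NX s p u ≠ ∞) (hv : NX s p v ≠ ∞) (x : ℝ) : val (u - v) x = val u x - val v x := by
  ext n
  rw [Pi.sub_apply, val, val, val, ← (summable_val hpq hu x n).tsum_sub (summable_val hpq hv x n)]
  refine tsum_congr fun k => ?_
  simp only [Pi.sub_apply]; ring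

lemma Admissible.eX_val_ne_top {s p q : ℝ} (h : Admissible s p q) {u : Freq → ℤ → ℂ}
    (hu : NX s p u ≠ ∞) (x : ℝ) : eX s p (val u x) ≠ ∞ :=
  (CX_val h.holder hu univ x (mem_univ x)).1

/-- Values on `[0, b]` do not determine the coefficients, so `V - V'` need not be a fixed point of
`stabStep`. On `[0, b]`, however, `stabStep` depends only on the values of `W` there, and the
difference of two solutions satisfies the telescoped integral equation. -/
lemma val_stabStep {s p q : ℝ} (h : Admissible s p q) {c : ℂ} {M : ℕ} [NeZero M] {t₀ : ℝ}
    {V V' W : Freq → ℤ → ℂ} {b : ℝ} (hb : b ≤ 1 / 2) (hV : NX s p V ≠ ∞) (hV' : NX s p V' ≠ ∞)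
    (hW : NX s p W ≠ ∞) (hs : SolvesOn c M t₀ V b) (hs' : SolvesOn c M t₀ V' b)
    (hWe : ∀ x ∈ Icc 0 b, val W x = val (V - V') x) :
    ∀ x ∈ Icc 0 b, val (stabStep c M t₀ V V' W) x = val (V - V') x := by
  intro x hx
  ext n
  have hx2 : x ∈ Icc (0 : ℝ) (1 / 2) := ⟨hx.1, hx.2.trans hb⟩
  have hsub := NX_sub_ne_top h.holder.pos hV hV'
  have key : ∀ {u v w u' v' w' : Freq → ℤ → ℂ}, NX s p u ≠ ∞ → NX s p v ≠ ∞ → NX s p w ≠ ∞ →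
      NX s p u' ≠ ∞ → NX s p v' ≠ ∞ → NX s p w' ≠ ∞ → (∀ y ∈ Icc 0 b, val u y = val u' y) →
      (∀ y ∈ Icc 0 b, val v y = val v' y) → (∀ y ∈ Icc 0 b, val w y = val w' y) →
      HasSum (fun l => duh M t₀ u v w n l * ech l x) (val (duh M t₀ u' v' w') x n) := by
    intro u v w u' v' w' hu hv hw hu' hv' hw' e1 e2 e3
    have h1 := h.hasSum_duh M t₀ hu hv hw n hx2
    have h2 := h.hasSum_duh M t₀ hu' hv' hw' n hx2
    have e : ∫ y in (0 : ℝ)..x, nonlin (t₀ + 2 * π / M * y) (val u y) (val v y) (val w y) n =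
        ∫ y in (0 : ℝ)..x, nonlin (t₀ + 2 * π / M * y) (val u' y) (val v' y) (val w' y) n := by
      refine intervalIntegral.integral_congr fun y hy => ?_
      rw [Set.uIcc_of_le hx.1] at hy
      have hy' : y ∈ Icc 0 b := ⟨hy.1, hy.2.trans hx.2⟩
      simp only [e1 y hy', e2 y hy', e3 y hy']
    rw [e, ← h2.tsum_eq] at h1
    exact h1
  have r : ∀ u : Freq → ℤ → ℂ, ∀ y ∈ Icc 0 b, val u y = val u y := fun _ _ _ => rfl
  have k1 := key hW hV hV hsub hV hV hWe (r V) (r V)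
  have k2 := key hV' hW hV hV' hsub hV (r V') hWe (r V)
  have k3 := key hV' hV' hW hV' hV' hsub (r V') (r V') hWe
  have hall := (hasSum_dat (val (V - V') 0) n x).add (((k1.add k2).add k3).mul_left c)
  have e1 : val (stabStep c M t₀ V V' W) x n = val (V - V') 0 n +
      c * (val (duh M t₀ (V - V') V V) x n + val (duh M t₀ V' (V - V') V) x n +
        val (duh M t₀ V' V' (V - V')) x n) := by
    rw [← hall.tsum_eq]
    refine tsum_congr fun l => ?_
    simp only [stabStep, Pi.add_apply, Pi.smul_apply, smul_eq_mul]; ring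
  have f1 := (h.hasSum_duh M t₀ hsub hV hV n hx2).summable.hasSum
  have f2 := (h.hasSum_duh M t₀ hV' hsub hV n hx2).summable.hasSum
  have f3 := (h.hasSum_duh M t₀ hV' hV' hsub n hx2).summable.hasSum
  have g1 := h.hasSum_duh M t₀ hV hV hV n hx2
  have g2 := h.hasSum_duh M t₀ hV' hV' hV' n hx2
  have e2 : val (duh M t₀ (V - V') V V) x n + val (duh M t₀ V' (V - V') V) x n +
        val (duh M t₀ V' V' (V - V')) x n =
      ((2 * π / M : ℝ) : ℂ) * (∫ y in (0 : ℝ)..x,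
        nonlin (t₀ + 2 * π / M * y) (val V y) (val V y) (val V y) n) -
      ((2 * π / M : ℝ) : ℂ) * ∫ y in (0 : ℝ)..x,
        nonlin (t₀ + 2 * π / M * y) (val V' y) (val V' y) (val V' y) n := by
    refine ((f1.add f2).add f3).unique ?_
    refine (g1.sub g2).congr_fun fun l => ?_
    have := congrFun (congrFun (duh_sub_duh h.holder h.pos h.one_lt M t₀ hV hV') n) l
    simp only [Pi.add_apply, Pi.sub_apply] at this
    rw [← sub_mul, this]; ring
  rw [e1, e2, val_sub h.holder hV hV', val_sub h.holder hV hV', Pi.sub_apply, Pi.sub_apply,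
    hs x hx n, hs' x hx n]
  ring

lemma NY_dat {p : ℝ} (hp : 0 < p) (φ : Freq → ℂ) : NY p (dat φ) = ⨆ n, ‖φ n‖ₑ ^ p := by
  unfold NY; simp_rw [en_dat hp]

lemma NY_le_NX {s p : ℝ} (hs : 0 ≤ s) (hp : 0 < p) (u : Freq → ℤ → ℂ) : NY p u ≤ NX s p u := by
  refine iSup_le fun n => ?_
  calc en p (u n) ≤ bw s n ^ p * en p (u n) :=
        le_mul_of_one_le_left zero_le (ENNReal.one_le_rpow (one_le_bw hs n) hp)
    _ ≤ _ := ENNReal.le_tsum n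

/-- Stability in `ℓ^∞` of solutions given by space-time Fourier coefficients. -/
lemma Admissible.exists_stability {s p q : ℝ} (h : Admissible s p q) :
    ∃ C₀ : ℝ≥0∞, C₀ ≠ ∞ ∧ ∀ K : ℝ≥0∞, K ≠ ∞ → ∃ M₀ : ℕ, 0 < M₀ ∧ ∀ M : ℕ, M₀ ≤ M →
      ∀ (c : ℂ), ‖c‖ₑ = 1 → ∀ (t₀ b : ℝ) (V V' : Freq → ℤ → ℂ), b ≤ 1 / 2 → NX s p V ≤ K →
        NX s p V' ≤ K → SolvesOn c M t₀ V b → SolvesOn c M t₀ V' b → ∀ x ∈ Icc 0 b, ∀ n,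
        ‖val V x n - val V' x n‖ₑ ^ p ≤ C₀ * ⨆ m, ‖val V 0 m - val V' 0 m‖ₑ ^ p := by
  have hp := h.holder.pos
  obtain ⟨C, hC, hD⟩ := exists_duh_le h.holder h.pos h.one_lt
  set S := (∑' k, ((jw k)⁻¹) ^ q) ^ (p / q) with hS
  have hStop : S ≠ ∞ := tsum_jw_const_ne_top h.holder
  have h3p : (3 : ℝ≥0∞) ^ p ≠ ∞ := ENNReal.rpow_ne_top_of_nonneg hp.le (by norm_num)
  refine ⟨S * (2 * 3 ^ p), ENNReal.mul_ne_top hStop (ENNReal.mul_ne_top (by norm_num) h3p), ?_⟩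
  intro K hK
  obtain ⟨M₀, hM₀, hM₁⟩ := exists_nat_gt_mul (2 * (3 ^ p * (3 ^ p * (3 * C * (K * K)))))
    (ENNReal.mul_ne_top (by norm_num) (ENNReal.mul_ne_top h3p (ENNReal.mul_ne_top h3p
      (ENNReal.mul_ne_top (ENNReal.mul_ne_top (by norm_num) hC) (ENNReal.mul_ne_top hK hK)))))
  refine ⟨M₀, hM₀, fun M hM c hc t₀ b V V' hb hV hV' hs hs' x hx n => ?_⟩
  have hMz : NeZero M := ⟨by omega⟩
  have hVt := ne_top_of_le_ne_top hK hV
  have hVt' := ne_top_of_le_ne_top hK hV'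
  have hsub := NX_sub_ne_top hp hVt hVt'
  set d := ⨆ m, ‖val V 0 m - val V' 0 m‖ₑ ^ p with hd
  have hdat : NY p (dat (val (V - V') 0)) = d := by
    rw [NY_dat hp, val_sub h.holder hVt hVt', hd]; rfl
  -- All `W j` represent `V - V'` on `[0, b]`. Iteration improves the representative until its norm
  -- is comparable with the initial difference `d`, as the multilinear part contracts by `1/2` when
  -- `M ≥ M₀`.
  set W : ℕ → Freq → ℤ → ℂ := fun j => (stabStep c M t₀ V V')^[j] (V - V') with hW
  have hWsucc : ∀ j, W (j + 1) = stabStep c M t₀ V V' (W j) := fun j =>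
    Function.iterate_succ_apply' _ _ _
  have hWtop : ∀ j, NX s p (W j) ≠ ∞ := by
    intro j
    induction j with
    | zero => exact hsub
    | succ j ih =>
      rw [hWsucc]
      exact NX_add_smul_ne_top hp (h.eX_val_ne_top hsub 0) c (h.NX_duh_ne_top M t₀ ih hVt hVt)
        (h.NX_duh_ne_top M t₀ hVt' ih hVt) (h.NX_duh_ne_top M t₀ hVt' hVt' ih)
  have hWval : ∀ j, ∀ x ∈ Icc 0 b, val (W j) x = val (V - V') x := by
    intro j
    induction j with
    | zero => exact fun x _ => rfl
    | succ j ih =>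
      rw [hWsucc]
      exact val_stabStep h hb hVt hVt' (hWtop j) hs hs' ih
  have hWstep : ∀ j, NY p (W (j + 1)) ≤ 3 ^ p * d + 2⁻¹ * NY p (W j) := by
    intro j
    rw [hWsucc]
    obtain ⟨-, b1, -, -⟩ := hD M t₀ (W j) V V
    obtain ⟨-, -, b2, -⟩ := hD M t₀ V' (W j) V
    obtain ⟨-, -, -, b3⟩ := hD M t₀ V' V' (W j)
    have h1 := NY_add_add_le hp.le (dat (val (V - V') 0))
      (c • (duh M t₀ (W j) V V + duh M t₀ V' (W j) V + duh M t₀ V' V' (W j))) 0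
    have h0 : NY p 0 = 0 := by simp [NY, en, ENNReal.zero_rpow_of_pos hp]
    rw [add_zero, h0, add_zero, NY_smul hp.le, hc, ENNReal.one_rpow, one_mul, hdat] at h1
    refine h1.trans ?_
    rw [mul_add]
    refine add_le_add le_rfl ?_
    have h2 := NY_add_add_le hp.le (duh M t₀ (W j) V V) (duh M t₀ V' (W j) V) (duh M t₀ V' V' (W j))
    have c1 : NY p (duh M t₀ (W j) V V) ≤ C * (M : ℝ≥0∞)⁻¹ * (K * K * NY p (W j)) := by
      refine b1.trans ?_
      rw [mul_assoc (NY p _), mul_comm (NY p _)]; gcongr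
    have c2 : NY p (duh M t₀ V' (W j) V) ≤ C * (M : ℝ≥0∞)⁻¹ * (K * K * NY p (W j)) := by
      refine b2.trans ?_
      rw [mul_right_comm (NX s p _)]; gcongr
    have c3 : NY p (duh M t₀ V' V' (W j)) ≤ C * (M : ℝ≥0∞)⁻¹ * (K * K * NY p (W j)) := by
      refine b3.trans ?_
      gcongr
    have hM2 : 3 ^ p * (3 ^ p * (3 * C * (K * K))) * (M : ℝ≥0∞)⁻¹ ≤ 2⁻¹ := by
      have := hM₁ M hM
      rw [mul_assoc] at this
      calc _ = 2⁻¹ * (2 * (3 ^ p * (3 ^ p * (3 * C * (K * K))) * (M : ℝ≥0∞)⁻¹)) := by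
            rw [← mul_assoc 2⁻¹, ENNReal.inv_mul_cancel (by norm_num) (by norm_num), one_mul]
        _ ≤ 2⁻¹ * 1 := mul_le_mul_right this _
        _ = _ := mul_one _
    calc _ ≤ 3 ^ p * (3 ^ p * (C * (M : ℝ≥0∞)⁻¹ * (K * K * NY p (W j)) +
          C * (M : ℝ≥0∞)⁻¹ * (K * K * NY p (W j)) + C * (M : ℝ≥0∞)⁻¹ * (K * K * NY p (W j)))) := by
          refine mul_le_mul_right (h2.trans ?_) _
          gcongr
      _ = 3 ^ p * (3 ^ p * (3 * C * (K * K))) * (M : ℝ≥0∞)⁻¹ * NY p (W j) := by ring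
      _ ≤ _ := mul_le_mul_left hM2 _
  have hWle : ∀ j, NY p (W j) ≤ 2 * 3 ^ p * d + 2⁻¹ ^ j * NY p (V - V') := by
    intro j
    induction j with
    | zero => rw [pow_zero, one_mul]; exact le_add_self
    | succ j ih =>
      calc _ ≤ _ := hWstep j
        _ ≤ 3 ^ p * d + 2⁻¹ * (2 * 3 ^ p * d + 2⁻¹ ^ j * NY p (V - V')) := by gcongr
        _ = 3 ^ p * d + (2⁻¹ * 2) * (3 ^ p * d) + 2⁻¹ ^ (j + 1) * NY p (V - V') := by ring
        _ = _ := by rw [ENNReal.inv_mul_cancel (by norm_num) (by norm_num)]; ring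
  have hpt : ∀ j, ‖val V x n - val V' x n‖ₑ ^ p ≤
      S * (2 * 3 ^ p * d + 2⁻¹ ^ j * NY p (V - V')) := by
    intro j
    calc _ = ‖val (W j) x n‖ₑ ^ p := by
          rw [hWval j x hx, val_sub h.holder hVt hVt', Pi.sub_apply]
      _ ≤ absSum (W j) n ^ p := ENNReal.rpow_le_rpow (enorm_val_le _ _ _) hp.le
      _ ≤ S * en p (W j n) := absSum_rpow_le h.holder _ _
      _ ≤ S * NY p (W j) := mul_le_mul_right (le_iSup (fun n => en p (W j n)) n) _
      _ ≤ _ := mul_le_mul_right (hWle j) _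
  -- Finiteness of this norm is what makes the term with `2⁻¹ ^ j` disappear in the limit.
  have hNYtop : NY p (V - V') ≠ ∞ := ne_top_of_le_ne_top hsub (NY_le_NX h.pos.le hp _)
  have hlim : Tendsto (fun j : ℕ => S * (2 * 3 ^ p * d + 2⁻¹ ^ j * NY p (V - V'))) atTop
      (𝓝 (S * (2 * 3 ^ p * d + 0 * NY p (V - V')))) := by
    refine ENNReal.Tendsto.const_mul (Tendsto.add tendsto_const_nhds
      (ENNReal.Tendsto.mul_const (ENNReal.tendsto_pow_atTop_nhds_zero_of_lt_one ?_) (Or.inr hNYtop)))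
      (Or.inr hStop)
    rw [ENNReal.inv_lt_one]; norm_num
  have := ge_of_tendsto' hlim hpt
  rw [zero_mul, add_zero] at this
  rw [mul_assoc S]; exact this

/-! ### Existence of local solutions -/

/-- The space-time Fourier coefficients of an element of `ℓ^p`, after removal of the weights. -/
def raw (s : ℝ) {P : ℝ≥0∞} (v : lp (fun _ : Freq × ℤ => ℂ) P) (n : Freq) (k : ℤ) : ℂ :=
  v (n, k) / ((bracket n ^ s * (1 + |(k : ℝ)|) : ℝ) : ℂ)

lemma weight_pos (s : ℝ) (n : Freq) (k : ℤ) : 0 < bracket n ^ s * (1 + |(k : ℝ)|) :=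
  mul_pos (Real.rpow_pos_of_pos (bracket_pos n) s) (by positivity)

lemma enorm_weight (s : ℝ) (n : Freq) (k : ℤ) :
    ‖((bracket n ^ s * (1 + |(k : ℝ)|) : ℝ) : ℂ)‖ₑ = bw s n * jw k := by
  rw [← ofReal_norm, Complex.norm_real, Real.norm_of_nonneg (weight_pos s n k).le,
    ENNReal.ofReal_mul (Real.rpow_pos_of_pos (bracket_pos n) s).le]
  rfl

lemma raw_sub (s : ℝ) {P : ℝ≥0∞} (v w : lp (fun _ : Freq × ℤ => ℂ) P) :
    raw s (v - w) = raw s v - raw s w := by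
  ext n k
  simp only [raw, Pi.sub_apply, lp.coeFn_sub, sub_div]

lemma NX_eq_tsum {s p : ℝ} (hp : 0 < p) (V : Freq → ℤ → ℂ) :
    NX s p V = ∑' i : Freq × ℤ,
      ‖V i.1 i.2 * ((bracket i.1 ^ s * (1 + |(i.2 : ℝ)|) : ℝ) : ℂ)‖ₑ ^ p := by
  refine Eq.trans ?_ (ENNReal.tsum_prod (f := fun n k =>
    ‖V n k * ((bracket n ^ s * (1 + |(k : ℝ)|) : ℝ) : ℂ)‖ₑ ^ p)).symm
  refine tsum_congr fun n => ?_
  rw [en, ← ENNReal.tsum_mul_left]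
  refine tsum_congr fun k => ?_
  rw [enorm_mul, enorm_weight, ← ENNReal.mul_rpow_of_nonneg _ _ hp.le]
  congr 1; ring

lemma enorm_rpow_eq_NX {s p : ℝ} (hp : 0 < p) [Fact (1 ≤ ENNReal.ofReal p)]
    (v : lp (fun _ : Freq × ℤ => ℂ) (ENNReal.ofReal p)) :
    ‖v‖ₑ ^ p = NX s p (raw s v) := by
  have hP : (ENNReal.ofReal p).toReal = p := ENNReal.toReal_ofReal hp.le
  rw [NX_eq_tsum hp]
  have e : ∀ i : Freq × ℤ, ‖raw s v i.1 i.2 * ((bracket i.1 ^ s * (1 + |(i.2 : ℝ)|) : ℝ) : ℂ)‖ₑ ^ p =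
      ENNReal.ofReal (‖v i‖ ^ p) := by
    intro i
    have : ((bracket i.1 ^ s * (1 + |(i.2 : ℝ)|) : ℝ) : ℂ) ≠ 0 :=
      Complex.ofReal_ne_zero.mpr (weight_pos s i.1 i.2).ne'
    rw [raw, div_mul_cancel₀ _ this, ← ofReal_norm, ENNReal.ofReal_rpow_of_nonneg (norm_nonneg _) hp.le]
  have h := lp.hasSum_norm (by rw [hP]; exact hp) v
  rw [hP] at h
  rw [tsum_congr e, ← ENNReal.ofReal_tsum_of_nonneg (fun i => by positivity) h.summable, h.tsum_eq,
    ← ofReal_norm, ENNReal.ofReal_rpow_of_nonneg (norm_nonneg _) hp.le]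

lemma exists_raw_eq {s p : ℝ} (hp : 0 < p) {V : Freq → ℤ → ℂ} (hV : NX s p V ≠ ∞) :
    ∃ v : lp (fun _ : Freq × ℤ => ℂ) (ENNReal.ofReal p), raw s v = V := by
  have hP : (ENNReal.ofReal p).toReal = p := ENNReal.toReal_ofReal hp.le
  refine ⟨⟨fun i => V i.1 i.2 * ((bracket i.1 ^ s * (1 + |(i.2 : ℝ)|) : ℝ) : ℂ), ?_⟩, ?_⟩
  · refine (memℓp_gen_iff (by rw [hP]; exact hp)).mpr ?_
    rw [NX_eq_tsum hp] at hV
    rw [hP]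
    apply Summable.of_enorm
    convert hV using 3 with i
    rw [← ofReal_norm, ← ofReal_norm, ENNReal.ofReal_rpow_of_nonneg (norm_nonneg _) hp.le,
      Real.norm_of_nonneg (by positivity)]
  · ext n k
    have : ((bracket n ^ s * (1 + |(k : ℝ)|) : ℝ) : ℂ) ≠ 0 :=
      Complex.ofReal_ne_zero.mpr (weight_pos s n k).ne'
    exact mul_div_cancel_right₀ _ this

/-- Banach's fixed point theorem for `V ↦ dat φ + c • duh M t₀ V V V` on the ball `NX ≤ K`, carried
out in `lp` through `raw` for the sake of completeness. `K` and `M₀` depend on the datum only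
through `R`, so the lifespan is uniform on bounded sets. -/
lemma Admissible.exists_local {s p q : ℝ} (h : Admissible s p q) (R : ℝ≥0∞) (hR : R ≠ ∞) :
    ∃ K : ℝ≥0∞, K ≠ ∞ ∧ ∃ M₀ : ℕ, 0 < M₀ ∧ ∀ M : ℕ, M₀ ≤ M → ∀ c : ℂ, ‖c‖ₑ = 1 →
      ∀ (t₀ : ℝ) (φ : Freq → ℂ), eX s p φ ≤ R →
        ∃ V : Freq → ℤ → ℂ, NX s p V ≤ K ∧ val V 0 = φ ∧ SolvesOn c M t₀ V (1 / 2) := by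
  have hp := h.holder.pos
  have hP1 : Fact (1 ≤ ENNReal.ofReal p) := ⟨ENNReal.one_le_ofReal.mpr h.holder.lt.le⟩
  obtain ⟨C, hC, hD⟩ := exists_duh_le h.holder h.pos h.one_lt
  have h3p : (3 : ℝ≥0∞) ^ p ≠ ∞ := ENNReal.rpow_ne_top_of_nonneg hp.le (by norm_num)
  have h2p : (2 : ℝ≥0∞) ^ p ≠ ∞ := ENNReal.rpow_ne_top_of_nonneg hp.le (by norm_num)
  -- `3 ^ p` comes from the triangle inequality for `p`-th powers, `R` bounds the datum, and `1` is
  -- room for the Duhamel term.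
  set K : ℝ≥0∞ := 3 ^ p * (R + 1) with hKdef
  have hK : K ≠ ∞ := ENNReal.mul_ne_top h3p (by simpa using hR)
  obtain ⟨M₁, hM₁, hM₁'⟩ := exists_nat_gt_mul (C * (K * K * K))
    (ENNReal.mul_ne_top hC (ENNReal.mul_ne_top (ENNReal.mul_ne_top hK hK) hK))
  obtain ⟨M₂, hM₂, hM₂'⟩ := exists_nat_gt_mul (2 ^ p * (3 ^ p * (3 * C * (K * K))))
    (ENNReal.mul_ne_top h2p (ENNReal.mul_ne_top h3p
      (ENNReal.mul_ne_top (ENNReal.mul_ne_top (by norm_num) hC) (ENNReal.mul_ne_top hK hK))))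
  refine ⟨K, hK, max M₁ M₂, lt_max_of_lt_left hM₁, fun M hM c hc t₀ φ hφ => ?_⟩
  have hMz : NeZero M := ⟨by have := le_max_left M₁ M₂; omega⟩
  have hA := hM₁' M ((le_max_left _ _).trans hM)
  have hB := hM₂' M ((le_max_right _ _).trans hM)
  set T : (Freq → ℤ → ℂ) → Freq → ℤ → ℂ := fun V => dat φ + c • duh M t₀ V V V with hT
  have hφtop := ne_top_of_le_ne_top hR hφ
  have hTK : ∀ V, NX s p V ≤ K → NX s p (T V) ≤ K := by
    intro V hV
    have h1 := NX_add_add_le (s := s) hp.le (dat φ) (c • duh M t₀ V V V) 0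
    rw [add_zero, NX_zero hp, add_zero, NX_smul hp.le, hc, ENNReal.one_rpow, one_mul,
      NX_dat hp] at h1
    refine h1.trans ?_
    rw [hKdef]
    refine mul_le_mul_right (add_le_add hφ ?_) _
    calc _ ≤ _ := (hD M t₀ V V V).1
      _ ≤ C * (M : ℝ≥0∞)⁻¹ * (K * K * K) := by gcongr
      _ = C * (K * K * K) * (M : ℝ≥0∞)⁻¹ := by ring
      _ ≤ 1 := hA
  have hTtop : ∀ V, NX s p V ≠ ∞ → NX s p (T V) ≠ ∞ := by
    intro V hV
    have h0 : NX s p 0 ≠ ∞ := by rw [NX_zero hp]; simp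
    have := NX_add_smul_ne_top hp hφtop c (h.NX_duh_ne_top M t₀ hV hV hV) h0 h0
    simpa [hT] using this
  -- `NX` is the `p`-th power of a norm, so the factor `2 ^ p` means Lipschitz constant `1/2` in the
  -- norm.
  have hTlip : ∀ V W, NX s p V ≤ K → NX s p W ≤ K →
      2 ^ p * NX s p (T V - T W) ≤ NX s p (V - W) := by
    intro V W hV hW
    have hVt := ne_top_of_le_ne_top hK hV
    have hWt := ne_top_of_le_ne_top hK hW
    have e : T V - T W = c • (duh M t₀ (V - W) V V + duh M t₀ W (V - W) V + duh M t₀ W W (V - W)) := by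
      rw [← duh_sub_duh h.holder h.pos h.one_lt M t₀ hVt hWt, smul_sub]
      exact add_sub_add_left_eq_sub _ _ _
    rw [e, NX_smul hp.le, hc, ENNReal.one_rpow, one_mul]
    have h2 := NX_add_add_le (s := s) hp.le (duh M t₀ (V - W) V V) (duh M t₀ W (V - W) V)
      (duh M t₀ W W (V - W))
    have c1 : NX s p (duh M t₀ (V - W) V V) ≤ C * (M : ℝ≥0∞)⁻¹ * (K * K * NX s p (V - W)) := by
      refine (hD M t₀ _ _ _).1.trans ?_
      rw [mul_assoc (NX s p _), mul_comm (NX s p _)]; gcongr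
    have c2 : NX s p (duh M t₀ W (V - W) V) ≤ C * (M : ℝ≥0∞)⁻¹ * (K * K * NX s p (V - W)) := by
      refine (hD M t₀ _ _ _).1.trans ?_
      rw [mul_right_comm (NX s p _)]; gcongr
    have c3 : NX s p (duh M t₀ W W (V - W)) ≤ C * (M : ℝ≥0∞)⁻¹ * (K * K * NX s p (V - W)) := by
      refine (hD M t₀ _ _ _).1.trans ?_
      gcongr
    calc _ ≤ 2 ^ p * (3 ^ p * (C * (M : ℝ≥0∞)⁻¹ * (K * K * NX s p (V - W)) +
          C * (M : ℝ≥0∞)⁻¹ * (K * K * NX s p (V - W)) +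
          C * (M : ℝ≥0∞)⁻¹ * (K * K * NX s p (V - W)))) := by
          refine mul_le_mul_right (h2.trans ?_) _
          gcongr
      _ = 2 ^ p * (3 ^ p * (3 * C * (K * K))) * (M : ℝ≥0∞)⁻¹ * NX s p (V - W) := by ring
      _ ≤ 1 * NX s p (V - W) := mul_le_mul_left hB _
      _ = _ := one_mul _
  have hrawtop : ∀ v : lp (fun _ : Freq × ℤ => ℂ) (ENNReal.ofReal p), NX s p (raw s v) ≠ ∞ := by
    intro v
    rw [← enorm_rpow_eq_NX hp]
    exact ENNReal.rpow_ne_top_of_nonneg hp.le enorm_ne_top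
  choose f hf using fun v : lp (fun _ : Freq × ℤ => ℂ) (ENNReal.ofReal p) =>
    exists_raw_eq hp (hTtop (raw s v) (hrawtop v))
  set B : Set (lp (fun _ : Freq × ℤ => ℂ) (ENNReal.ofReal p)) := {v | ‖v‖ₑ ^ p ≤ K} with hBdef
  have hmem : ∀ v, v ∈ B ↔ NX s p (raw s v) ≤ K := fun v => by
    rw [hBdef, Set.mem_ofPred_eq, enorm_rpow_eq_NX (s := s) hp]
  have hBc : IsComplete B := by
    refine IsClosed.isComplete ?_
    exact isClosed_le ((ENNReal.continuous_rpow_const).comp continuous_enorm) continuous_const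
  have hmaps : MapsTo f B B := by
    intro v hv
    rw [hmem, hf]
    exact hTK _ ((hmem v).mp hv)
  have hcontr : ContractingWith 2⁻¹ (hmaps.restrict f B B) := by
    refine ⟨by rw [← NNReal.coe_lt_coe]; norm_num, fun v w => ?_⟩
    have h1 := hTlip _ _ ((hmem v).mp v.2) ((hmem w).mp w.2)
    rw [← hf, ← hf, ← raw_sub, ← raw_sub, ← enorm_rpow_eq_NX hp, ← enorm_rpow_eq_NX hp,
      ← ENNReal.mul_rpow_of_nonneg _ _ hp.le, ENNReal.rpow_le_rpow_iff hp] at h1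
    rw [Subtype.edist_eq, Subtype.edist_eq, MapsTo.val_restrict_apply, MapsTo.val_restrict_apply,
      edist_eq_enorm_sub, edist_eq_enorm_sub, ENNReal.coe_inv (by norm_num)]
    calc _ = 2⁻¹ * (2 * ‖f v - f w‖ₑ) := by
          rw [← mul_assoc, ENNReal.inv_mul_cancel (by norm_num) (by norm_num), one_mul]
      _ ≤ _ := by
          push_cast
          exact mul_le_mul_right h1 _
  have h0B : (0 : lp (fun _ : Freq × ℤ => ℂ) (ENNReal.ofReal p)) ∈ B := by
    rw [hBdef, Set.mem_ofPred_eq, enorm_zero, ENNReal.zero_rpow_of_pos hp]; exact zero_le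
  obtain ⟨v, hvB, hfix, -, -⟩ := hcontr.exists_fixedPoint' hBc hmaps h0B (edist_ne_top _ _)
  have hVfix : raw s v = T (raw s v) := by
    rw [← hf v, hfix.eq]
  set V := raw s v with hV
  have hVtop := hrawtop v
  have hval : ∀ x ∈ Icc (0 : ℝ) (1 / 2), ∀ n, val V x n = φ n + c * (((2 * π / M : ℝ) : ℂ) *
      ∫ y in (0 : ℝ)..x, nonlin (t₀ + 2 * π / M * y) (val V y) (val V y) (val V y) n) := by
    intro x hx n
    have h1 := (hasSum_dat φ n x).add ((h.hasSum_duh M t₀ hVtop hVtop hVtop n hx).mul_left c)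
    rw [← h1.tsum_eq]
    refine tsum_congr fun l => ?_
    conv_lhs => rw [hVfix]
    simp only [hT, Pi.add_apply, Pi.smul_apply, smul_eq_mul]; ring
  have hval0 : val V 0 = φ := by
    ext n
    rw [hval 0 (by norm_num) n]
    simp
  refine ⟨V, (hmem v).mp hvB, hval0, fun x hx n => ?_⟩
  rw [hval0]; exact hval x hx n

/-! ### Uniqueness for the gauged equation -/

/-- `g` is a bounded, uniformly continuous solution of the gauged equation on `[0, T]`. -/
structure GaugedSolution (s p : ℝ) (c : ℂ) (T : ℝ) (g : ℝ → Freq → ℂ) : Prop where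
  continuous : CX s p (Icc 0 T) g
  uniform : ∀ η : ℝ≥0∞, 0 < η → ∃ δ > 0, ∀ t ∈ Icc 0 T, ∀ t' ∈ Icc 0 T, |t - t'| < δ →
    eX s p (g t - g t') ≤ η
  bounded : ∃ R : ℝ≥0∞, R ≠ ∞ ∧ ∀ t ∈ Icc 0 T, eX s p (g t) ≤ R
  integral : ∀ t ∈ Icc 0 T, ∀ n,
    g t n = g 0 n + c * ∫ t' in (0 : ℝ)..t, nonlin t' (g t') (g t') (g t') n

lemma exists_le_of_tendsto_zero {F : ℝ≥0∞ → ℝ≥0∞} (hF : Tendsto F (𝓝 0) (𝓝 0)) {η : ℝ≥0∞}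
    (hη : 0 < η) : ∃ d > 0, ∀ x ≤ d, F x ≤ η := by
  have h := hF.eventually (ge_mem_nhds hη)
  rw [ENNReal.nhds_zero_basis_Iic.eventually_iff] at h
  obtain ⟨d, hd, h⟩ := h
  exact ⟨d, hd, fun x hx => h hx⟩

lemma Admissible.integral_gauged {s p q : ℝ} (h : Admissible s p q) {c : ℂ} {T : ℝ}
    {g : ℝ → Freq → ℂ} (hg : GaugedSolution s p c T g) {M : ℕ} (hM : 0 < M) {t x : ℝ} (ht : 0 ≤ t)
    (hx : 0 ≤ x) (htx : t + 2 * π / M * x ≤ T) (n : Freq) :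
    g (t + 2 * π / M * x) n = g t n + c * (((2 * π / M : ℝ) : ℂ) *
      ∫ y in (0 : ℝ)..x, nonlin (t + 2 * π / M * y) (g (t + 2 * π / M * y))
        (g (t + 2 * π / M * y)) (g (t + 2 * π / M * y)) n) := by
  have hMR : (0 : ℝ) < M := by exact_mod_cast hM
  set L : ℝ := 2 * π / M with hL
  have hLpos : 0 < L := by positivity
  have hLx : 0 ≤ L * x := by positivity
  have hcont : ContinuousOn (fun t' => nonlin t' (g t') (g t') (g t') n) (Icc 0 T) := by
    simpa only [zero_add, one_mul] using h.continuousOn_nonlin hg.continuous 0 1 n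
  have hi : ∀ a b, 0 ≤ a → a ≤ b → b ≤ T →
      IntervalIntegrable (fun t' => nonlin t' (g t') (g t') (g t') n) volume a b := by
    intro a b ha hab hb
    refine ContinuousOn.intervalIntegrable (hcont.mono ?_)
    rw [Set.uIcc_of_le hab]
    exact Icc_subset_Icc ha hb
  rw [hg.integral (t + L * x) ⟨by linarith, htx⟩, hg.integral t ⟨ht, by linarith⟩,
    ← intervalIntegral.integral_add_adjacent_intervals (hi 0 t le_rfl ht (by linarith))
      (hi t (t + L * x) ht (by linarith) htx), mul_add, add_assoc]
  congr 3
  have e := intervalIntegral.smul_integral_comp_add_mul (a := 0) (b := x)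
    (fun t' => nonlin t' (g t') (g t') (g t') n) L t
  rw [mul_zero, add_zero] at e
  rw [← e, Complex.real_smul]

/-- Cut `[0, x]` into `N` equal steps and let `ψ k` be the result of starting the flow from the
solution `g` at the `k`-th node and following it to the end. Then `ψ 0` is the flow and `ψ N` is
`g`. Consecutive values differ by one consistency error `o(1/N)`, propagated by the stability
estimate, so the total difference tends to zero. -/
lemma Admissible.exists_flow {s p q : ℝ} (h : Admissible s p q) (R : ℝ≥0∞) (hR : R ≠ ∞) :
    ∃ M : ℕ, 0 < M ∧ ∀ c : ℂ, ‖c‖ₑ = 1 → ∃ Φ : ℝ → (Freq → ℂ) → Freq → ℤ → ℂ,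
      (∀ t φ, eX s p φ ≤ R → NX s p (Φ t φ) ≠ ∞ ∧ val (Φ t φ) 0 = φ ∧
        SolvesOn c M t (Φ t φ) (1 / 2)) ∧
      ∀ (T : ℝ) (g : ℝ → Freq → ℂ), GaugedSolution s p c T g → (∀ t ∈ Icc 0 T, eX s p (g t) ≤ R) →
        ∀ t₀ x, 0 ≤ t₀ → x ∈ Icc (0 : ℝ) (1 / 2) → t₀ + 2 * π / M * x ≤ T →
          val (Φ t₀ (g t₀)) x = g (t₀ + 2 * π / M * x) := by
  have hp := h.holder.pos
  obtain ⟨K, hK, M₁, hM₁, hloc⟩ := h.exists_local R hR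
  obtain ⟨C₀, hC₀, hstab⟩ := h.exists_stability
  obtain ⟨M₂, hM₂, hstab⟩ := hstab K hK
  obtain ⟨C, hC, hsub⟩ := h.exists_enorm_nonlin_sub_le
  set M := max M₁ M₂ with hMdef
  have hM : 0 < M := lt_max_of_lt_left hM₁
  have hMR : (0 : ℝ) < M := by exact_mod_cast hM
  refine ⟨M, hM, fun c hc => ?_⟩
  have hloc' : ∀ (t : ℝ) (φ : Freq → ℂ), ∃ V : Freq → ℤ → ℂ, eX s p φ ≤ R →
      NX s p V ≤ K ∧ val V 0 = φ ∧ SolvesOn c M t V (1 / 2) := by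
    intro t φ
    by_cases hφ : eX s p φ ≤ R
    · obtain ⟨V, hV⟩ := hloc M (le_max_left _ _) c hc t φ hφ
      exact ⟨V, fun _ => hV⟩
    · exact ⟨0, fun h => absurd h hφ⟩
  choose Φ hΦ using hloc'
  refine ⟨Φ, fun t φ hφ => ⟨ne_top_of_le_ne_top hK (hΦ t φ hφ).1, (hΦ t φ hφ).2⟩, ?_⟩
  intro T g hg hgR t₀ x ht₀ hx hxT
  set L : ℝ := 2 * π / M with hL
  have hLpos : 0 < L := by positivity
  set S := (∑' k, ((jw k)⁻¹) ^ q) ^ (p / q) with hS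
  have hStop : S ≠ ∞ := tsum_jw_const_ne_top h.holder
  set B : ℝ≥0∞ := max R (S * K) with hB
  have hBtop : B ≠ ∞ := max_ne_top hR (ENNReal.mul_ne_top hStop hK)
  have hcnorm : ‖c‖ = 1 := by
    rw [← ofReal_norm, ← ENNReal.ofReal_one, ENNReal.ofReal_eq_ofReal_iff (norm_nonneg _) zero_le_one]
      at hc
    exact hc
  -- consistency of one step
  have hstep : ∀ η : ℝ, 0 < η → ∃ δ > 0, ∀ t y, 0 ≤ t → 0 ≤ y → y < δ → y ≤ 1 / 2 → t + L * y ≤ T →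
      ∀ m, ‖val (Φ t (g t)) y m - g (t + L * y) m‖ ≤ L * y * η := by
    intro η hη
    -- `d` will bound the oscillation over one step, both of the flow (uniformly, through `modulus`)
    -- and of `g`; the displayed function of `d` is the resulting error in the nonlinearity.
    obtain ⟨d, hd, hdle⟩ := exists_le_of_tendsto_zero
      (F := fun d => C * (B * B * (3 ^ p * (d * K + d))) ^ (1 / p)) (by
        have h3 : (3 : ℝ≥0∞) ^ p ≠ ∞ := ENNReal.rpow_ne_top_of_nonneg hp.le (by norm_num)
        refine tendsto_const_mul_zero (tendsto_rpow_zero (tendsto_const_mul_zero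
          (tendsto_const_mul_zero ?_ h3) (ENNReal.mul_ne_top hBtop hBtop)) (one_div_pos.mpr hp)) hC
        have h1 : Tendsto (fun d : ℝ≥0∞ => K * d + d) (𝓝 0) (𝓝 (0 + 0)) :=
          (tendsto_const_mul_zero tendsto_id hK).add tendsto_id
        simpa only [mul_comm K, add_zero] using h1) (ENNReal.ofReal_pos.mpr hη)
    have hmod := (tendsto_modulus h.holder).eventually (ge_mem_nhds hd)
    rw [Metric.eventually_nhds_iff] at hmod
    obtain ⟨δ₁, hδ₁, hmod⟩ := hmod
    obtain ⟨δ₂, hδ₂, hunif⟩ := hg.uniform d hd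
    refine ⟨min δ₁ (δ₂ / L), lt_min hδ₁ (by positivity), ?_⟩
    intro t y ht hy hyδ hy2 hyT m
    have hLy : 0 ≤ L * y := by positivity
    have htT : t ∈ Icc 0 T := ⟨ht, by linarith⟩
    obtain ⟨hVK, hV0, hVs⟩ := hΦ t (g t) (hgR t htT)
    have hVtop := ne_top_of_le_ne_top hK hVK
    rw [hVs y ⟨hy, hy2⟩, hV0, h.integral_gauged hg hM ht hy hyT m, add_sub_add_left_eq_sub,
      ← mul_sub, ← mul_sub, ← intervalIntegral.integral_sub]
    rotate_left
    · exact (continuousOn_univ.mp (h.continuousOn_nonlin (CX_val h.holder hVtop univ) t L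
        m)).intervalIntegrable 0 y
    · have hcont : ContinuousOn (fun t' => nonlin t' (g t') (g t') (g t') m) (Icc 0 T) := by
        simpa only [zero_add, one_mul] using h.continuousOn_nonlin hg.continuous 0 1 m
      refine ContinuousOn.intervalIntegrable (hcont.comp (f := fun y => t + L * y)
        (by fun_prop) ?_)
      intro z hz
      rw [Set.uIcc_of_le hy] at hz
      have h1 : L * z ≤ L * y := mul_le_mul_of_nonneg_left hz.2 hLpos.le
      have h2 : 0 ≤ L * z := mul_nonneg hLpos.le hz.1
      exact ⟨by linarith, by linarith⟩
    rw [norm_mul, hcnorm, one_mul, norm_mul, Complex.norm_real, Real.norm_of_nonneg hLpos.le,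
      mul_assoc]
    refine mul_le_mul_of_nonneg_left ?_ hLpos.le
    refine (intervalIntegral.norm_integral_le_of_norm_le_const (C := η) ?_).trans
      (le_of_eq (by rw [sub_zero, abs_of_nonneg hy, mul_comm]))
    intro z hz
    rw [Set.uIoc_of_le hy] at hz
    have h1 : L * z ≤ L * y := mul_le_mul_of_nonneg_left hz.2 hLpos.le
    have h2 : 0 < L * z := mul_pos hLpos hz.1
    have hzT : t + L * z ∈ Icc 0 T := ⟨by linarith, by linarith⟩
    have hmain : ‖nonlin (t + L * z) (val (Φ t (g t)) z) (val (Φ t (g t)) z) (val (Φ t (g t)) z) m -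
        nonlin (t + L * z) (g (t + L * z)) (g (t + L * z)) (g (t + L * z)) m‖ₑ ≤
        ENNReal.ofReal η := by
      refine (hsub (t + L * z) B hBtop _ _ m
        ((eX_val_le h.holder _ z).trans ((mul_le_mul_right hVK _).trans (le_max_right _ _)))
        ((hgR _ hzT).trans (le_max_left _ _))).trans ?_
      refine le_trans ?_ (hdle d le_rfl)
      have h3 : eX s p (val (Φ t (g t)) z - g (t + L * z)) ≤ 3 ^ p * (d * K + d) := by
        have e : val (Φ t (g t)) z - g (t + L * z) =
            (val (Φ t (g t)) z - val (Φ t (g t)) 0) + (g t - g (t + L * z)) := by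
          rw [hV0]; abel
        rw [e]
        refine (eX_add_le hp _ _).trans (mul_le_mul_right (add_le_add ?_ ?_) _)
        · refine (eX_val_sub_val_le h.holder hVtop z 0).trans (mul_le_mul' ?_ hVK)
          apply hmod
          rw [Real.dist_eq, sub_zero, sub_zero, abs_of_pos hz.1]
          exact hz.2.trans_lt (hyδ.trans_le (min_le_left _ _))
        · refine hunif t htT _ hzT ?_
          rw [sub_add_cancel_left, abs_neg, abs_of_pos h2]
          have h4 := hyδ.trans_le (min_le_right _ _)
          rw [lt_div_iff₀ hLpos] at h4
          linarith
      exact mul_le_mul_right (ENNReal.rpow_le_rpow (mul_le_mul_right h3 _)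
        (one_div_pos.mpr hp).le) _
    rw [← ofReal_norm] at hmain
    exact (ENNReal.ofReal_le_ofReal_iff hη.le).mp hmain
  ext n
  set A : ℝ := (C₀ ^ (1 / p)).toReal with hA
  have hAtop : C₀ ^ (1 / p) ≠ ∞ := ENNReal.rpow_ne_top_of_nonneg (one_div_pos.mpr hp).le hC₀
  have hfinal : ∀ η : ℝ, 0 < η → ‖val (Φ t₀ (g t₀)) x n - g (t₀ + L * x) n‖ ≤ A * (L * x * η) := by
    intro η hη
    obtain ⟨δ, hδ, hcons⟩ := hstep η hη
    obtain ⟨N, hN⟩ := exists_nat_gt (x / δ)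
    have hN0 : (0 : ℝ) < N := (div_nonneg hx.1 hδ.le).trans_lt hN
    have hNne : (N : ℝ) ≠ 0 := hN0.ne'
    set k₀ : ℝ := x / N with hk₀
    have hk₀0 : 0 ≤ k₀ := div_nonneg hx.1 hN0.le
    have hk₀δ : k₀ < δ := by
      rw [hk₀, div_lt_iff₀ hN0]; rw [div_lt_iff₀ hδ] at hN; linarith
    have hNk : N * k₀ = x := by rw [hk₀]; field_simp
    set ψ : ℕ → ℂ := fun k => val (Φ (t₀ + L * (k * k₀)) (g (t₀ + L * (k * k₀)))) (x - k * k₀) n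
      with hψ
    have hone : ∀ k, k < N → dist (ψ k) (ψ (k + 1)) ≤ A * (L * k₀ * η) := by
      intro k hk
      have hk1 : ((k : ℝ) + 1) * k₀ ≤ x := by
        rw [← hNk]
        refine mul_le_mul_of_nonneg_right ?_ hk₀0
        exact_mod_cast hk
      have hkk : 0 ≤ (k : ℝ) * k₀ := by positivity
      have hxk : (k : ℝ) * k₀ + k₀ ≤ x := by linarith
      set t := t₀ + L * (k * k₀) with ht
      have e1 : t₀ + L * (((k + 1 : ℕ) : ℝ) * k₀) = t + L * k₀ := by rw [ht]; push_cast; ring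
      have ht0 : 0 ≤ t := by positivity
      have hLxk : L * (k * k₀ + k₀) ≤ L * x := mul_le_mul_of_nonneg_left hxk hLpos.le
      have htk : t + L * k₀ ≤ T := by rw [ht]; linarith
      have hLk : 0 ≤ L * k₀ := by positivity
      obtain ⟨hVK, hV0, hVs⟩ := hΦ t (g t) (hgR t ⟨ht0, by linarith⟩)
      obtain ⟨hWK, hW0, hWs⟩ := hΦ (t + L * k₀) (g (t + L * k₀))
        (hgR (t + L * k₀) ⟨by linarith, htk⟩)
      -- The flow from node `k`, shifted by one step, and the flow from node `k + 1` solve the same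
      -- equation on the remaining `[0, 1/2 - k₀]`, and their data differ by the one-step error.
      have hst := hstab M (le_max_right _ _) c hc (t + L * k₀) (1 / 2 - k₀)
        (shift (Φ t (g t)) k₀) (Φ (t + L * k₀) (g (t + L * k₀))) (by linarith)
        (by rw [NX_shift]; exact hVK) hWK
        (h.solvesOn_shift (ne_top_of_le_ne_top hK hVK) hVs hk₀0)
        (fun z hz => hWs z ⟨hz.1, by linarith [hz.2]⟩) (x - k * k₀ - k₀)
        ⟨by linarith, by linarith [hx.2]⟩ n
      rw [val_shift, val_shift, add_zero, add_sub_cancel, hW0] at hst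
      have hsup : (⨆ m, ‖val (Φ t (g t)) k₀ m - g (t + L * k₀) m‖ₑ ^ p) ≤
          ENNReal.ofReal (L * k₀ * η) ^ p := by
        refine iSup_le fun m => ENNReal.rpow_le_rpow ?_ hp.le
        rw [← ofReal_norm]
        exact ENNReal.ofReal_le_ofReal (hcons t k₀ ht0 hk₀0 hk₀δ (by linarith [hx.2]) htk m)
      have h5 := ENNReal.rpow_le_rpow (hst.trans (mul_le_mul_right hsup _)) (one_div_pos.mpr hp).le
      rw [ENNReal.mul_rpow_of_nonneg _ _ (one_div_pos.mpr hp).le, ← ENNReal.rpow_mul,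
        ← ENNReal.rpow_mul, mul_one_div_cancel hp.ne', ENNReal.rpow_one, ENNReal.rpow_one] at h5
      have h6 := ENNReal.toReal_mono (ENNReal.mul_ne_top hAtop ENNReal.ofReal_ne_top) h5
      rw [ENNReal.toReal_mul, ENNReal.toReal_ofReal (by positivity), toReal_enorm] at h6
      rw [dist_eq_norm, hψ]
      simp only []
      rw [e1, show x - ((k + 1 : ℕ) : ℝ) * k₀ = x - k * k₀ - k₀ by push_cast; ring]
      exact h6
    have hsum := dist_le_range_sum_of_dist_le (f := ψ) N (d := fun _ => A * (L * k₀ * η))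
      (fun {k} hk => hone k hk)
    rw [Finset.sum_const, Finset.card_range, nsmul_eq_mul] at hsum
    have hψ0 : ψ 0 = val (Φ t₀ (g t₀)) x n := by
      rw [hψ]; simp
    have hψN : ψ N = g (t₀ + L * x) n := by
      rw [hψ]
      simp only [hNk, sub_self]
      rw [(hΦ _ _ (hgR _ ⟨by have := mul_nonneg hLpos.le hx.1; linarith, hxT⟩)).2.1]
    rw [hψ0, hψN, dist_eq_norm] at hsum
    refine hsum.trans (le_of_eq ?_)
    rw [← hNk]; ring
  have hlim : Tendsto (fun η : ℝ => A * (L * x * η)) (𝓝[>] 0) (𝓝 0) := by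
    have : Continuous fun η : ℝ => A * (L * x * η) := by fun_prop
    have h1 := this.tendsto 0
    rw [mul_zero, mul_zero] at h1
    exact h1.mono_left nhdsWithin_le_nhds
  have h0 := ge_of_tendsto hlim (eventually_nhdsWithin_of_forall fun η hη => hfinal η hη)
  exact sub_eq_zero.mp (norm_le_zero_iff.mp h0)

/-- Uniqueness of solutions to the gauged equation. -/
lemma Admissible.gauged_unique {s p q : ℝ} (h : Admissible s p q) {c : ℂ} (hc : ‖c‖ₑ = 1) {T : ℝ}
    {g g' : ℝ → Freq → ℂ} (hg : GaugedSolution s p c T g) (hg' : GaugedSolution s p c T g')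
    (h0 : g 0 = g' 0) : ∀ t ∈ Icc 0 T, g t = g' t := by
  obtain ⟨R₁, hR₁, hb₁⟩ := hg.bounded
  obtain ⟨R₂, hR₂, hb₂⟩ := hg'.bounded
  obtain ⟨M, hM, hflow⟩ := h.exists_flow (max R₁ R₂) (max_ne_top hR₁ hR₂)
  obtain ⟨Φ, -, hΦ⟩ := hflow c hc
  have hMR : (0 : ℝ) < M := by exact_mod_cast hM
  set L : ℝ := 2 * π / M with hL
  have hLpos : 0 < L := by positivity
  -- The flow covers half a unit of rescaled time, that is `L / 2`. The bound on `g` and `g'` holds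
  -- on all of `[0, T]`, so steps of the same length can be repeated.
  have key : ∀ k : ℕ, ∀ t ∈ Icc 0 T, t ≤ k * (L / 2) → g t = g' t := by
    intro k
    induction k with
    | zero =>
      intro t ht htk
      have : t = 0 := le_antisymm (by simpa using htk) ht.1
      rw [this, h0]
    | succ k ih =>
      intro t ht htk
      by_cases htk' : t ≤ k * (L / 2)
      · exact ih t ht htk'
      push Not at htk'
      have ht₀ : 0 ≤ (k : ℝ) * (L / 2) := by positivity
      have e0 := ih (k * (L / 2)) ⟨ht₀, by linarith [ht.2]⟩ le_rfl
      have hx : (t - k * (L / 2)) / L ∈ Icc (0 : ℝ) (1 / 2) := by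
        refine ⟨div_nonneg (by linarith) hLpos.le, ?_⟩
        rw [div_le_iff₀ hLpos]
        push_cast at htk
        linarith
      have et : k * (L / 2) + L * ((t - k * (L / 2)) / L) = t := by field_simp; ring
      have e1 := hΦ T g hg (fun t ht => (hb₁ t ht).trans (le_max_left _ _)) _ _ ht₀ hx
        (by rw [et]; exact ht.2)
      have e2 := hΦ T g' hg' (fun t ht => (hb₂ t ht).trans (le_max_right _ _)) _ _ ht₀ hx
        (by rw [et]; exact ht.2)
      rw [et] at e1 e2
      rw [← e1, ← e2, e0]
  intro t ht
  obtain ⟨k, hk⟩ := exists_nat_ge (t / (L / 2))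
  exact key k t ht (by rwa [div_le_iff₀ (by positivity)] at hk)

/-! ### Fourier–Lebesgue spaces and continuity in time -/

lemma enorm_rpow_eq_eX {s : ℝ} {P : ℝ≥0∞} [Fact (1 ≤ P)] (hP : 0 < P.toReal) (f : FL s P) :
    ‖f‖ₑ ^ P.toReal = eX s P.toReal f.hat := by
  have h := lp.hasSum_norm hP (FL.toLp s P f)
  have e : ∀ n : Freq, (bw s n * ‖f.hat n‖ₑ) ^ P.toReal =
      ENNReal.ofReal (‖FL.toLp s P f n‖ ^ P.toReal) := by
    intro n
    have : FL.toLp s P f n = ((bracket n ^ s : ℝ) : ℂ) * f.hat n := rfl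
    rw [this, ← ENNReal.ofReal_rpow_of_nonneg (norm_nonneg _) hP.le, norm_mul, Complex.norm_real,
      Real.norm_of_nonneg (Real.rpow_pos_of_pos (bracket_pos n) s).le,
      ENNReal.ofReal_mul (Real.rpow_pos_of_pos (bracket_pos n) s).le, ofReal_norm]
    rfl
  rw [eX, tsum_congr e, ← ENNReal.ofReal_tsum_of_nonneg (fun i => by positivity) h.summable,
    h.tsum_eq, ← ENNReal.ofReal_rpow_of_nonneg (norm_nonneg _) hP.le, ofReal_norm]
  rfl

lemma eX_hat_ne_top {s : ℝ} {P : ℝ≥0∞} [Fact (1 ≤ P)] (hP : 0 < P.toReal) (f : FL s P) :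
    eX s P.toReal f.hat ≠ ∞ := by
  rw [← enorm_rpow_eq_eX hP]
  exact ENNReal.rpow_ne_top_of_nonneg hP.le enorm_ne_top

lemma hat_sub {s : ℝ} {P : ℝ≥0∞} (f g : FL s P) : (f - g).hat = f.hat - g.hat := rfl

lemma hat_injective {s : ℝ} {P : ℝ≥0∞} : Function.Injective (FL.hat : FL s P → Freq → ℂ) :=
  Subtype.val_injective

lemma exists_hat_eq {s : ℝ} {P : ℝ≥0∞} (hP : 0 < P.toReal) {f : Freq → ℂ}
    (hf : eX s P.toReal f ≠ ∞) : ∃ F : FL s P, F.hat = f := by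
  refine ⟨⟨f, ?_⟩, rfl⟩
  refine (memℓp_gen_iff hP).mpr ?_
  apply Summable.of_enorm
  refine ne_of_eq_of_ne (tsum_congr fun n => ?_) hf
  rw [← ofReal_norm, Real.norm_of_nonneg (by positivity),
    ← ENNReal.ofReal_rpow_of_nonneg (norm_nonneg _) hP.le, norm_mul, Complex.norm_real,
    Real.norm_of_nonneg (Real.rpow_pos_of_pos (bracket_pos n) s).le,
    ENNReal.ofReal_mul (Real.rpow_pos_of_pos (bracket_pos n) s).le, ofReal_norm]
  rfl

lemma continuousOn_iff_CX {s : ℝ} {P : ℝ≥0∞} [Fact (1 ≤ P)] (hP : 0 < P.toReal) {S : Set ℝ}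
    (u : ℝ → FL s P) : ContinuousOn u S ↔ CX s P.toReal S (fun t => (u t).hat) := by
  have hlim : ∀ t, Tendsto u (𝓝[S] t) (𝓝 (u t)) ↔
      Tendsto (fun t' => eX s P.toReal ((u t').hat - (u t).hat)) (𝓝[S] t) (𝓝 0) := by
    intro t
    rw [tendsto_iff_edist_tendsto_0]
    simp only [edist_eq_enorm_sub, ← hat_sub, ← enorm_rpow_eq_eX hP]
    constructor
    · intro h; exact tendsto_rpow_zero h hP
    · intro h
      have h1 := tendsto_rpow_zero h (inv_pos.mpr hP)
      simpa only [← ENNReal.rpow_mul, mul_inv_cancel₀ hP.ne', ENNReal.rpow_one] using h1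
  constructor
  · exact fun h t ht => ⟨eX_hat_ne_top hP _, (hlim t).mp (h t ht)⟩
  · exact fun h t ht => (hlim t).mpr (h t ht).2

lemma CX.exists_lift {s : ℝ} {P : ℝ≥0∞} [Fact (1 ≤ P)] (hP : 0 < P.toReal) {S : Set ℝ}
    {g : ℝ → Freq → ℂ} (hg : CX s P.toReal S g) :
    ∃ u : ℝ → FL s P, ContinuousOn u S ∧ ∀ t ∈ S, (u t).hat = g t := by
  classical
  have h1 : ∀ t, ∃ F : FL s P, t ∈ S → F.hat = g t := by
    intro t
    by_cases ht : t ∈ S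
    · obtain ⟨F, hF⟩ := exists_hat_eq hP (hg t ht).1
      exact ⟨F, fun _ => hF⟩
    · exact ⟨0, fun h => absurd h ht⟩
  choose u hu using h1
  refine ⟨u, (continuousOn_iff_CX hP u).mpr fun t ht => ⟨eX_hat_ne_top hP _, ?_⟩, hu⟩
  refine (hg t ht).2.congr' ?_
  filter_upwards [self_mem_nhdsWithin] with t' ht'
  rw [hu t ht, hu t' ht']

/-- Compactness of `[0, T]`, applied to a lift to the normed space, supplies the uniform continuity
and the bound. -/
lemma GaugedSolution.of_CX {s : ℝ} {P : ℝ≥0∞} [Fact (1 ≤ P)] (hP : 0 < P.toReal) {c : ℂ} {T : ℝ}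
    {g : ℝ → Freq → ℂ} (hg : CX s P.toReal (Icc 0 T) g)
    (hint : ∀ t ∈ Icc 0 T, ∀ n,
      g t n = g 0 n + c * ∫ t' in (0 : ℝ)..t, nonlin t' (g t') (g t') (g t') n) :
    GaugedSolution s P.toReal c T g := by
  obtain ⟨u, hu, hug⟩ := hg.exists_lift hP
  refine ⟨hg, fun η hη => ?_, ?_, hint⟩
  · have h1 := isCompact_Icc.uniformContinuousOn_of_continuous hu
    rw [EMetric.uniformContinuousOn_iff] at h1
    obtain ⟨δ, hδ, h1⟩ := h1 (min 1 (η ^ P.toReal⁻¹)) (lt_min one_pos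
      (ENNReal.rpow_pos_of_nonneg hη (inv_nonneg.mpr hP.le)))
    -- `δ` may be `∞`, whose `toReal` is `0`; the minimum with `1` keeps the radius positive.
    refine ⟨(min 1 δ).toReal, ENNReal.toReal_pos (lt_min one_pos hδ).ne'
      (min_lt_of_left_lt ENNReal.one_lt_top).ne, fun t ht t' ht' htt => ?_⟩
    have h2 := h1 ht ht' (by
      rw [edist_dist, Real.dist_eq]
      refine lt_of_lt_of_le ((ENNReal.ofReal_lt_iff_lt_toReal (abs_nonneg _)
        (min_lt_of_left_lt ENNReal.one_lt_top).ne).mpr htt) (min_le_right _ _))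
    rw [← hug t ht, ← hug t' ht', ← hat_sub, ← enorm_rpow_eq_eX hP, ← edist_eq_enorm_sub]
    calc _ ≤ (η ^ P.toReal⁻¹) ^ P.toReal :=
          ENNReal.rpow_le_rpow (h2.le.trans (min_le_right _ _)) hP.le
      _ = η := by rw [← ENNReal.rpow_mul, inv_mul_cancel₀ hP.ne', ENNReal.rpow_one]
  · obtain ⟨R, hR⟩ := isCompact_Icc.exists_bound_of_continuousOn hu
    refine ⟨ENNReal.ofReal R ^ P.toReal, ENNReal.rpow_ne_top_of_nonneg hP.le ENNReal.ofReal_ne_top,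
      fun t ht => ?_⟩
    rw [← hug t ht, ← enorm_rpow_eq_eX hP, ← ofReal_norm]
    exact ENNReal.rpow_le_rpow (ENNReal.ofReal_le_ofReal (hR t ht)) hP.le

lemma eX_mono {s p : ℝ} (hp : 0 ≤ p) {f g : Freq → ℂ} (h : ∀ n, ‖f n‖ₑ ≤ ‖g n‖ₑ) :
    eX s p f ≤ eX s p g :=
  ENNReal.tsum_le_tsum fun n => ENNReal.rpow_le_rpow (mul_le_mul_right (h n) _) hp

/-- Multiplication by unimodular factors that are continuous in time preserves continuity. -/
lemma CX.mul_phase {s p : ℝ} (hp : 0 < p) {S : Set ℝ} {g : ℝ → Freq → ℂ} (hg : CX s p S g)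
    {φ : ℝ → Freq → ℂ} (hφ : ∀ t n, ‖φ t n‖ₑ ≤ 1) (hc : ∀ n, ContinuousOn (fun t => φ t n) S) :
    CX s p S (fun t n => φ t n * g t n) := by
  intro t ht
  obtain ⟨hgt, hlim⟩ := hg t ht
  have hmul : ∀ (t' : ℝ) (f : Freq → ℂ) n, ‖φ t' n * f n‖ₑ ≤ ‖f n‖ₑ := by
    intro t' f n
    rw [enorm_mul]
    exact mul_le_of_le_one_left zero_le (hφ t' n)
  refine ⟨ne_top_of_le_ne_top hgt (eX_mono hp.le (hmul t (g t))), ?_⟩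
  have h3 : (3 : ℝ≥0∞) ^ p ≠ ∞ := ENNReal.rpow_ne_top_of_nonneg hp.le (by norm_num)
  have h2 : Tendsto (fun t' => eX s p (fun n => (φ t' n - φ t n) * g t n)) (𝓝[S] t) (𝓝 0) := by
    let _ : MeasurableSpace Freq := ⊤
    have hle : ∀ t' n, (bw s n * ‖(φ t' n - φ t n) * g t n‖ₑ) ^ p ≤
        2 ^ p * (bw s n * ‖g t n‖ₑ) ^ p := by
      intro t' n
      rw [← ENNReal.mul_rpow_of_nonneg _ _ hp.le, enorm_mul, mul_left_comm]
      gcongr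
      refine (enorm_sub_le).trans ?_
      calc _ ≤ (1 : ℝ≥0∞) + 1 := add_le_add (hφ _ _) (hφ _ _)
        _ = 2 := by norm_num
    have h := tendsto_lintegral_filter_of_dominated_convergence
      (μ := (Measure.count : Measure Freq)) (l := 𝓝[S] t)
      (F := fun t' n => (bw s n * ‖(φ t' n - φ t n) * g t n‖ₑ) ^ p) (f := fun _ => 0)
      (fun n => 2 ^ p * (bw s n * ‖g t n‖ₑ) ^ p) (Eventually.of_forall fun x => measurable_from_top)
      (Eventually.of_forall fun x => Eventually.of_forall fun k => hle x k)
      (by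
        rw [lintegral_count, ENNReal.tsum_mul_left]
        exact ENNReal.mul_ne_top (ENNReal.rpow_ne_top_of_nonneg hp.le (by norm_num)) hgt)
      (Eventually.of_forall fun n => ?_)
    · simp only [lintegral_count, tsum_zero] at h
      exact h
    · refine tendsto_rpow_zero (tendsto_const_mul_zero ?_ (bw_ne_top s n)) hp
      have h4 : Tendsto (fun t' => ‖(φ t' n - φ t n) * g t n‖ₑ) (𝓝[S] t)
          (𝓝 ‖(φ t n - φ t n) * g t n‖ₑ) :=
        (continuous_enorm.tendsto _).comp (((hc n t ht).sub tendsto_const_nhds).mul_const _)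
      simpa using h4
  have h4 := tendsto_const_mul_zero ((hlim.add h2)|>.trans (by rw [add_zero])) h3
  refine tendsto_of_tendsto_of_tendsto_of_le_of_le tendsto_const_nhds h4 (fun _ => zero_le) ?_
  intro t'
  have e : (fun n => φ t' n * g t' n) - (fun n => φ t n * g t n) =
      (fun n => φ t' n * (g t' - g t) n) + fun n => (φ t' n - φ t n) * g t n := by
    ext n; simp only [Pi.sub_apply, Pi.add_apply]; ring
  simp only []
  rw [e]
  refine (eX_add_le hp _ _).trans (mul_le_mul_right (add_le_add ?_ le_rfl) _)
  exact eX_mono hp.le (hmul t' _)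

/-! ### The full nonlinearity -/

/-- The mass `∑ |f(n)|²`. -/
def mass (f : Freq → ℂ) : ℝ := ∑' n, ‖f n‖ ^ 2

/-- A term of the cubic nonlinearity in the interaction representation. -/
def fullTerm (t : ℝ) (f : Freq → ℂ) (n : Freq) (z : Freq × Freq) : ℂ :=
  Complex.exp (((t * phase n z.1 z.2 : ℝ) : ℂ) * Complex.I) *
    (f z.1 * conj (f (z.1 + z.2 - n)) * f z.2)

/-- The cubic nonlinearity in the interaction representation. -/
def full (t : ℝ) (f : Freq → ℂ) (n : Freq) : ℂ := ∑' z : Freq × Freq, fullTerm t f n z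

lemma norm_fullTerm (t : ℝ) (f : Freq → ℂ) (n : Freq) (z : Freq × Freq) :
    ‖fullTerm t f n z‖ = ‖f z.1‖ * ‖f (z.1 + z.2 - n)‖ * ‖f z.2‖ := by
  rw [fullTerm, norm_mul, norm_mul, norm_mul, RCLike.norm_conj, Complex.norm_exp_ofReal_mul_I,
    one_mul]

lemma fullTerm_swap (t : ℝ) (f : Freq → ℂ) (n : Freq) (z : Freq × Freq) :
    fullTerm t f n z.swap = fullTerm t f n z := by
  simp only [fullTerm, Prod.fst_swap, Prod.snd_swap]
  rw [phase_comm n z.2 z.1, add_comm z.2 z.1]; ring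

lemma fullTerm_diag (t : ℝ) (f : Freq → ℂ) (n b : Freq) :
    fullTerm t f n (n, b) = ((‖f b‖ ^ 2 : ℝ) : ℂ) * f n := by
  have hph : phase n n b = 0 := by simp [phase]
  simp only [fullTerm, hph, Int.cast_zero, mul_zero, Complex.ofReal_zero, zero_mul,
    Complex.exp_zero, one_mul, add_sub_cancel_left]
  rw [Complex.ofReal_pow, ← Complex.conj_mul']
  ring

/-- A Dirac mass at zero as one of the factors turns the trilinear bound into one for a pairing of
two functions, which makes the mass finite and continuous in time. -/
lemma Admissible.exists_tsum_mul_le {s p q : ℝ} (h : Admissible s p q) :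
    ∃ C : ℝ≥0∞, C ≠ ∞ ∧ ∀ f g : Freq → ℂ,
      ∑' n, ‖f n‖ₑ * ‖g n‖ₑ ≤ C * (eX s p f * eX s p g) ^ (1 / p) := by
  classical
  have hp := h.holder.pos
  have hp1 : 0 ≤ 1 / p := (one_div_pos.mpr hp).le
  obtain ⟨C, hC, hT⟩ := h.exists_tsum_trilinear_le
  set δ : Freq → ℝ≥0∞ := fun a => if a = 0 then 1 else 0 with hδ
  have e1 : ∑' a, (bw s a * δ a) ^ p = bw s 0 ^ p := by
    rw [tsum_eq_single 0]
    · simp [hδ]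
    · intro a ha; simp [hδ, ha, ENNReal.zero_rpow_of_pos hp]
  refine ⟨C * (bw s 0 ^ p) ^ (1 / p), ENNReal.mul_ne_top hC (ENNReal.rpow_ne_top_of_nonneg hp1
    (ENNReal.rpow_ne_top_of_nonneg hp.le (bw_ne_top s 0))), fun f g => ?_⟩
  have h1 := hT δ (fun a => ‖f a‖ₑ) (fun a => ‖g a‖ₑ) 0
  rw [e1, mul_assoc (bw s 0 ^ p), ENNReal.mul_rpow_of_nonneg _ _ hp1, ← mul_assoc] at h1
  refine le_trans (le_of_eq ?_) h1
  rw [ENNReal.tsum_prod (f := fun a b => δ a * ‖f (a + b - 0)‖ₑ * ‖g b‖ₑ)]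
  refine ((tsum_eq_single (0 : Freq) fun a ha => ?_).trans ?_).symm
  · simp [hδ, ha]
  · simp [hδ]

lemma Admissible.summable_mass {s p q : ℝ} (h : Admissible s p q) {f : Freq → ℂ}
    (hf : eX s p f ≠ ∞) : Summable fun n => ‖f n‖ ^ 2 := by
  obtain ⟨C, hC, hb⟩ := h.exists_tsum_mul_le
  apply Summable.of_enorm
  refine ne_top_of_le_ne_top (ENNReal.mul_ne_top hC (ENNReal.rpow_ne_top_of_nonneg
    (one_div_pos.mpr h.holder.pos).le (ENNReal.mul_ne_top hf hf))) (le_trans (le_of_eq ?_) (hb f f))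
  refine tsum_congr fun n => ?_
  rw [sq, enorm_mul, enorm_norm]

lemma Admissible.continuousOn_mass {s p q : ℝ} (h : Admissible s p q) {S : Set ℝ}
    {g : ℝ → Freq → ℂ} (hg : CX s p S g) : ContinuousOn (fun t => mass (g t)) S := by
  have hp := h.holder.pos
  have hp1 := one_div_pos.mpr hp
  obtain ⟨C, hC, hb⟩ := h.exists_tsum_mul_le
  intro t ht
  obtain ⟨hgt, hlim⟩ := hg t ht
  set B : ℝ≥0∞ := 3 ^ p * (1 + eX s p (g t)) with hB
  have h3p : (3 : ℝ≥0∞) ^ p ≠ ∞ := ENNReal.rpow_ne_top_of_nonneg hp.le (by norm_num)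
  have hBtop : B ≠ ∞ := ENNReal.mul_ne_top h3p (by simpa using hgt)
  refine tendsto_iff_edist_tendsto_0.mpr ?_
  refine tendsto_of_tendsto_of_tendsto_of_le_of_le' tendsto_const_nhds
      (h := fun t' => 2 * C * (B * eX s p (g t' - g t)) ^ (1 / p))
      (tendsto_const_mul_zero (tendsto_rpow_zero (tendsto_const_mul_zero hlim hBtop) hp1)
        (ENNReal.mul_ne_top (by norm_num) hC))
      (Eventually.of_forall fun _ => zero_le) ?_
  have h3 : ∀ᶠ t' in 𝓝[S] t, eX s p (g t' - g t) < 1 := hlim.eventually (gt_mem_nhds one_pos)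
  filter_upwards [h3, self_mem_nhdsWithin] with t' ht' htS
  have b1 : eX s p (g t') ≤ B := by
    calc eX s p (g t') = eX s p ((g t' - g t) + g t) := by rw [sub_add_cancel]
        _ ≤ _ := eX_add_le hp _ _
        _ ≤ B := by rw [hB]; gcongr
  have b2 : eX s p (g t) ≤ B := by
    calc eX s p (g t) = eX s p (0 + g t) := by rw [zero_add]
        _ ≤ _ := eX_add_le hp _ _
        _ ≤ B := by rw [hB, eX_zero hp]; gcongr; exact zero_le
  rw [edist_eq_enorm_sub, mass, mass, ← (h.summable_mass (hg t' htS).1).tsum_sub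
    (h.summable_mass hgt)]
  have hpt : ∀ n, ‖‖g t' n‖ ^ 2 - ‖g t n‖ ^ 2‖ₑ ≤
      ‖g t' n‖ₑ * ‖(g t' - g t) n‖ₑ + ‖g t n‖ₑ * ‖(g t' - g t) n‖ₑ := by
    intro n
    rw [← add_mul, ← ofReal_norm, ← ofReal_norm, ← ofReal_norm, ← ofReal_norm,
      ← ENNReal.ofReal_add (norm_nonneg _) (norm_nonneg _), ← ENNReal.ofReal_mul (by positivity)]
    apply ENNReal.ofReal_le_ofReal
    rw [sq_sub_sq, norm_mul, Real.norm_of_nonneg (by positivity)]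
    exact mul_le_mul_of_nonneg_left (abs_norm_sub_norm_le _ _) (by positivity)
  calc _ ≤ ∑' n, ‖‖g t' n‖ ^ 2 - ‖g t n‖ ^ 2‖ₑ := enorm_tsum_le_tsum_enorm
    _ ≤ ∑' n, (‖g t' n‖ₑ * ‖(g t' - g t) n‖ₑ + ‖g t n‖ₑ * ‖(g t' - g t) n‖ₑ) :=
        ENNReal.tsum_le_tsum hpt
    _ = ∑' n, ‖g t' n‖ₑ * ‖(g t' - g t) n‖ₑ + ∑' n, ‖g t n‖ₑ * ‖(g t' - g t) n‖ₑ :=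
        ENNReal.tsum_add
    _ ≤ C * (B * eX s p (g t' - g t)) ^ (1 / p) + C * (B * eX s p (g t' - g t)) ^ (1 / p) := by
        refine add_le_add ((hb _ _).trans ?_) ((hb _ _).trans ?_) <;> gcongr
    _ = _ := by ring

-- Inclusion and exclusion. The pairs with `z.1 = n` contribute `mass f * f n`, and so do those with
-- `z.2 = n`. The pair `(n, n)` is thereby counted twice, which the value `-1` of `sgn` corrects.
open Classical in
lemma Admissible.full_eq {s p q : ℝ} (h : Admissible s p q) (t : ℝ) {f : Freq → ℂ}
    (hf : eX s p f ≠ ∞) (n : Freq) :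
    full t f n = nonlin t f f f n + 2 * (mass f : ℂ) * f n := by
  have hs := h.summable_nonlin hf hf hf n
  obtain ⟨E₁, hE₁⟩ : ∃ E₁ : Freq × Freq → ℂ,
      ∀ z, E₁ z = if z.1 = n then fullTerm t f n z else 0 := ⟨_, fun _ => rfl⟩
  have hs₁ : Summable E₁ := Summable.of_norm_bounded hs fun z => by
    rw [hE₁]
    split_ifs
    · exact (norm_fullTerm t f n z).le
    · rw [norm_zero]; positivity
  have hs₂ : Summable fun z : Freq × Freq => E₁ z.swap :=
    (Equiv.prodComm Freq Freq).summable_iff.mpr hs₁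
  have hsum₁ : ∑' z, E₁ z = (mass f : ℂ) * f n := by
    rw [hs₁.tsum_prod]
    refine (tsum_eq_single n fun a ha => by simp [hE₁, ha]).trans ?_
    rw [mass, Complex.ofReal_tsum, ← tsum_mul_right]
    refine tsum_congr fun b => ?_
    simp only [hE₁, if_true, fullTerm_diag]
  have hsum₂ : ∑' z : Freq × Freq, E₁ z.swap = (mass f : ℂ) * f n := by
    rw [← hsum₁]; exact (Equiv.prodComm Freq Freq).tsum_eq E₁
  have hdec : ∀ z, fullTerm t f n z =
      sgn n z * Complex.exp (((t * phase n z.1 z.2 : ℝ) : ℂ) * Complex.I) *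
        (f z.1 * conj (f (z.1 + z.2 - n)) * f z.2) + (E₁ z + E₁ z.swap) := by
    intro z
    have e : sgn n z * Complex.exp (((t * phase n z.1 z.2 : ℝ) : ℂ) * Complex.I) *
        (f z.1 * conj (f (z.1 + z.2 - n)) * f z.2) = sgn n z * fullTerm t f n z := by
      rw [mul_assoc]; rfl
    rw [e, hE₁, hE₁, fullTerm_swap, Prod.fst_swap]
    generalize fullTerm t f n z = e
    unfold sgn
    by_cases h1 : z.1 = n <;> by_cases h2 : z.2 = n
    · simp [h1, h2]
    · simp [h1, h2, Ne.symm h2]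
    · simp [h1, h2, Ne.symm h1]
    · simp [h1, h2, Ne.symm h1, Ne.symm h2]
  rw [full, tsum_congr hdec, (h.summable_nonlin_term t hf hf hf n).tsum_add (hs₁.add hs₂),
    hs₁.tsum_add hs₂, hsum₁, hsum₂, nonlin]
  ring

/-! ### Integrating factors -/

lemma hasDerivAt_integral_of_continuousOn {A : ℝ → ℂ} {T t : ℝ} (hA : ContinuousOn A (Icc 0 T))
    (ht : t ∈ Ioo 0 T) : HasDerivAt (fun t => ∫ t' in (0 : ℝ)..t, A t') (A t) t := by
  have hn : Icc 0 T ∈ 𝓝 t := Icc_mem_nhds ht.1 ht.2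
  refine intervalIntegral.integral_hasDerivAt_right ?_ ?_ (hA.continuousAt hn)
  · refine (hA.mono ?_).intervalIntegrable
    rw [Set.uIcc_of_le ht.1.le]
    exact Icc_subset_Icc le_rfl ht.2.le
  · exact ContinuousOn.stronglyMeasurableAtFilter_nhdsWithin hA measurableSet_Icc t |>.filter_mono
      (by rw [nhdsWithin_eq_nhds.mpr hn])

lemma continuousOn_integral {A : ℝ → ℂ} {T : ℝ} (hA : ContinuousOn A (Icc 0 T)) :
    ContinuousOn (fun t => ∫ t' in (0 : ℝ)..t, A t') (Icc 0 T) := by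
  by_cases hT : 0 ≤ T
  · have h := intervalIntegral.continuousOn_primitive_interval (μ := volume) (a := 0) (b := T) (f := A)
      (by rw [Set.uIcc_of_le hT]; exact hA.integrableOn_Icc)
    rwa [Set.uIcc_of_le hT] at h
  · rw [Icc_eq_empty hT]; exact continuousOn_empty _

/-- The product rule in integrated form. The integral equation makes `y` differentiable only inside
`(0, T)`, which suffices for the fundamental theorem of calculus together with continuity up to the
ends. -/
lemma integrating_factor {A B y : ℝ → ℂ} {T : ℝ} (hA : ContinuousOn A (Icc 0 T))
    (hB : ContinuousOn B (Icc 0 T)) (hy : ∀ t ∈ Icc 0 T, y t = y 0 + ∫ t' in (0 : ℝ)..t, A t') :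
    ∀ t ∈ Icc 0 T, Complex.exp (∫ t' in (0 : ℝ)..t, B t') * y t = y 0 +
      ∫ t' in (0 : ℝ)..t, Complex.exp (∫ r in (0 : ℝ)..t', B r) * (A t' + B t' * y t') := by
  intro t ht
  have hcy : ContinuousOn y (Icc 0 T) :=
    (continuousOn_const.add (continuousOn_integral hA)).congr hy
  have hce : ContinuousOn (fun t => Complex.exp (∫ t' in (0 : ℝ)..t, B t')) (Icc 0 T) :=
    Complex.continuous_exp.comp_continuousOn (continuousOn_integral hB)
  have hsub : Icc 0 t ⊆ Icc 0 T := Icc_subset_Icc le_rfl ht.2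
  have h := intervalIntegral.integral_eq_sub_of_hasDerivAt_of_le (a := 0) (b := t) ht.1
    (f := fun t => Complex.exp (∫ t' in (0 : ℝ)..t, B t') * y t)
    (f' := fun t' => Complex.exp (∫ r in (0 : ℝ)..t', B r) * (A t' + B t' * y t'))
    ((hce.mul hcy).mono hsub) ?_ ?_
  · rw [h]; simp
  · intro r hr
    have hrT : r ∈ Ioo 0 T := ⟨hr.1, hr.2.trans_le ht.2⟩
    have d1 := (hasDerivAt_integral_of_continuousOn hB hrT).cexp
    have d2 : HasDerivAt y (A r) r := by
      have d3 := (hasDerivAt_integral_of_continuousOn hA hrT).const_add (y 0)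
      refine d3.congr_of_eventuallyEq ?_
      filter_upwards [Icc_mem_nhds hrT.1 hrT.2] with x hx using hy x hx
    exact (d1.mul d2).congr_deriv (by ring)
  · refine ContinuousOn.intervalIntegrable ?_
    rw [Set.uIcc_of_le ht.1]
    exact ((hce.mul (hA.add (hB.mul hcy)))).mono hsub

/-! ### Characters of the torus -/

instance : IsProbabilityMeasure torusMeasure := by unfold torusMeasure; infer_instance

instance : torusMeasure.WeaklyRegular := by unfold torusMeasure; infer_instance

/-- The character `x ↦ e^{i n·x}`. -/
def ch (n : Freq) : C(Torus, ℂ) where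
  toFun x := ∏ i, fourier (n i) (x i)
  continuous_toFun := by fun_prop

lemma ch_apply (n : Freq) (x : Torus) : ch n x = ∏ i, fourier (n i) (x i) := rfl

lemma ch_neg (n : Freq) (x : Torus) : ch (-n) x = conj (ch n x) := by
  simp only [ch_apply, Pi.neg_apply, fourier_neg, map_prod]

lemma ch_add (m n : Freq) (x : Torus) : ch (m + n) x = ch m x * ch n x := by
  simp only [ch_apply, Pi.add_apply, fourier_add, ← Finset.prod_mul_distrib]

lemma ch_zero (x : Torus) : ch 0 x = 1 := by
  simp [ch_apply]

lemma norm_ch (n : Freq) (x : Torus) : ‖ch n x‖ = 1 := by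
  rw [ch_apply, norm_prod]
  exact Finset.prod_eq_one fun i _ => by rw [fourier_apply]; exact Circle.norm_coe _

lemma enorm_ch (n : Freq) (x : Torus) : ‖ch n x‖ₑ = 1 := by
  rw [← ofReal_norm, norm_ch, ENNReal.ofReal_one]

lemma integral_fourier (k : ℤ) :
    ∫ x : AddCircle (2 * π), fourier k x ∂AddCircle.haarAddCircle = if k = 0 then 1 else 0 := by
  have h := fourierCoeff_fourier (T := 2 * π) k
  have h2 := congrFun h 0
  rw [fourierCoeff] at h2
  simp only [neg_zero, fourier_zero, one_smul] at h2
  rw [h2]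
  by_cases hk : k = 0
  · simp [hk]
  · simp [hk, Ne.symm hk]

lemma integral_ch (n : Freq) : ∫ x, ch n x ∂torusMeasure = if n = 0 then 1 else 0 := by
  have h := integral_fintype_prod_eq_prod (𝕜 := ℂ) (ι := Fin 2)
    (fun i (x : AddCircle (2 * π)) => fourier (n i) x)
    (μ := fun _ => AddCircle.haarAddCircle)
  refine Eq.trans h ?_
  simp only [integral_fourier, Fin.prod_univ_two]
  by_cases h0 : n 0 = 0 <;> by_cases h1 : n 1 = 0
  · have : n = 0 := by ext i; fin_cases i <;> assumption
    simp [this]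
  all_goals
    have : n ≠ 0 := fun h => by simp [h] at h0 h1
    simp [this, h0, h1]

lemma coeff_eq (F : Torus → ℂ) (n : Freq) : coeff F n = ∫ x, F x * ch (-n) x ∂torusMeasure := rfl

/-! ### Density of trigonometric polynomials -/

/-- The star subalgebra generated by the characters. -/
def chSubalgebra : StarSubalgebra ℂ C(Torus, ℂ) where
  toSubalgebra := Algebra.adjoin ℂ (range ch)
  star_mem' := by
    change Algebra.adjoin ℂ (range ch) ≤ star (Algebra.adjoin ℂ (range ch))
    refine Algebra.adjoin_le ?_
    rintro _ ⟨n, rfl⟩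
    refine Algebra.subset_adjoin ⟨-n, ?_⟩
    ext1 x
    simp only [ch_neg, starRingEnd_apply, ContinuousMap.star_apply]

lemma chSubalgebra_coe : chSubalgebra.toSubalgebra.toSubmodule = Submodule.span ℂ (range ch) := by
  apply Algebra.adjoin_eq_span_of_subset
  refine .trans (fun x ↦ Submonoid.closure_induction (fun _ ↦ id) ⟨0, ?_⟩ ?_) Submodule.subset_span
  · ext z
    rw [ch_zero, ContinuousMap.one_apply]
  · rintro _ _ _ _ ⟨m, rfl⟩ ⟨n, rfl⟩
    refine ⟨m + n, ?_⟩
    ext z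
    rw [ch_add, ContinuousMap.mul_apply]

lemma chSubalgebra_separatesPoints : chSubalgebra.SeparatesPoints := by
  classical
  intro x y hxy
  rw [Ne, funext_iff, not_forall] at hxy
  obtain ⟨i, hi⟩ := hxy
  refine ⟨_, ⟨ch (Pi.single i 1), Algebra.subset_adjoin ⟨Pi.single i 1, rfl⟩, rfl⟩, ?_⟩
  have e : ∀ x : Torus, ch (Pi.single i 1) x = fourier 1 (x i) := by
    intro x
    rw [ch_apply, Finset.prod_eq_single i]
    · rw [Pi.single_eq_same]
    · intro j _ hj
      rw [Pi.single_eq_of_ne hj, fourier_zero]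
    · intro h; exact absurd (Finset.mem_univ i) h
  intro h
  have h' : ch (Pi.single i 1) x = ch (Pi.single i 1) y := h
  rw [e, e, fourier_one, fourier_one] at h'
  exact hi (AddCircle.injective_toCircle Real.two_pi_pos.ne' (Circle.ext h'))

lemma span_ch_closure_eq_top : (Submodule.span ℂ (range ch)).topologicalClosure = ⊤ := by
  rw [← chSubalgebra_coe]
  exact congr_arg (Subalgebra.toSubmodule <| StarSubalgebra.toSubalgebra ·)
    (ContinuousMap.starSubalgebra_topologicalClosure_eq_top_of_separatesPoints _
      chSubalgebra_separatesPoints)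

/-- Vanishing coefficients mean orthogonality to the characters, whose span is dense in `L²` by the
Stone–Weierstrass theorem. -/
lemma ae_eq_zero_of_coeff_eq_zero {F : Torus → ℂ} (hF : MemLp F 2 torusMeasure)
    (h : ∀ n, coeff F n = 0) : F =ᵐ[torusMeasure] 0 := by
  have hspan : (Submodule.span ℂ (range fun n => ContinuousMap.toLp (E := ℂ) 2 torusMeasure ℂ
      (ch n))).topologicalClosure = ⊤ := by
    simpa only [Submodule.map_span, ContinuousLinearMap.coe_coe, ← range_comp, Function.comp_def]
      using (ContinuousMap.toLp_denseRange ℂ torusMeasure ℂ (p := 2)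
        (by simp)).topologicalClosure_map_submodule span_ch_closure_eq_top
  rw [Submodule.topologicalClosure_eq_top_iff] at hspan
  have hmem : hF.toLp F ∈ (Submodule.span ℂ (range fun n =>
      ContinuousMap.toLp (E := ℂ) 2 torusMeasure ℂ (ch n)))ᗮ := by
    rw [Submodule.mem_orthogonal]
    intro u hu
    induction hu using Submodule.span_induction with
    | mem u hu =>
      obtain ⟨n, rfl⟩ := hu
      rw [MeasureTheory.L2.inner_def, ← h n, coeff_eq]
      refine integral_congr_ae ?_
      filter_upwards [hF.coeFn_toLp, ContinuousMap.coeFn_toLp (p := 2) (𝕜 := ℂ) torusMeasure (ch n)]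
        with x h1 h2
      rw [h1, h2, RCLike.inner_apply, ch_neg]
    | zero => simp
    | add u v _ _ hu hv => rw [inner_add_left, hu, hv, add_zero]
    | smul c u _ hu => rw [inner_smul_left, hu, mul_zero]
  rw [hspan, Submodule.mem_bot] at hmem
  have := hF.coeFn_toLp
  rw [hmem] at this
  exact this.symm.trans (Lp.coeFn_zero _ _ _)

/-! ### Trigonometric polynomials -/

/-- The trigonometric polynomial with coefficients `f` on `A`. -/
def trig (A : Finset Freq) (f : Freq → ℂ) (x : Torus) : ℂ := ∑ n ∈ A, f n * ch n x

lemma continuous_trig (A : Finset Freq) (f : Freq → ℂ) : Continuous (trig A f) := by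
  unfold trig
  exact continuous_finsetSum _ fun n _ => continuous_const.mul (ch n).continuous

lemma memLp_of_continuous {F : Torus → ℂ} (hF : Continuous F) (r : ℝ≥0∞) :
    MemLp F r torusMeasure := by
  obtain ⟨C, hC⟩ := isCompact_univ.exists_bound_of_continuousOn hF.continuousOn
  exact MemLp.of_bound hF.aestronglyMeasurable C (Eventually.of_forall fun x => hC x (mem_univ x))

lemma integrable_of_continuous {F : Torus → ℂ} (hF : Continuous F) : Integrable F torusMeasure :=
  memLp_one_iff_integrable.mp (memLp_of_continuous hF 1)

lemma coeff_trig (A : Finset Freq) (f : Freq → ℂ) (n : Freq) :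
    coeff (trig A f) n = if n ∈ A then f n else 0 := by
  have e : ∀ x, trig A f x * ch (-n) x = ∑ m ∈ A, f m * ch (m - n) x := by
    intro x
    rw [trig, Finset.sum_mul]
    refine Finset.sum_congr rfl fun m _ => ?_
    rw [sub_eq_add_neg, ch_add]; ring
  rw [coeff_eq]
  simp_rw [e]
  rw [integral_finsetSum _ fun m _ => (integrable_of_continuous (ch (m - n)).continuous).const_mul _]
  simp_rw [integral_const_mul, integral_ch, sub_eq_zero, mul_ite, mul_one, mul_zero]
  rw [Finset.sum_ite_eq' A n f]

lemma integral_mul_conj_trig {F : Torus → ℂ} (hF : Integrable F torusMeasure) (A : Finset Freq)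
    (f : Freq → ℂ) :
    ∫ x, F x * conj (trig A f x) ∂torusMeasure = ∑ n ∈ A, coeff F n * conj (f n) := by
  have e : ∀ x, F x * conj (trig A f x) = ∑ n ∈ A, (F x * ch (-n) x) * conj (f n) := by
    intro x
    rw [trig, map_sum, Finset.mul_sum]
    refine Finset.sum_congr rfl fun n _ => ?_
    rw [ch_neg, map_mul]; ring
  simp_rw [e]
  rw [integral_finsetSum]
  · refine Finset.sum_congr rfl fun n _ => ?_
    rw [integral_mul_const, coeff_eq]
  · intro n _
    refine Integrable.mul_const ?_ _
    exact hF.mul_of_top_left (memLp_of_continuous (ch (-n)).continuous ⊤)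

lemma lintegral_trig_sq (A : Finset Freq) (f : Freq → ℂ) :
    ∫⁻ x, ‖trig A f x‖ₑ ^ 2 ∂torusMeasure = ∑ n ∈ A, ‖f n‖ₑ ^ 2 := by
  have h := integral_mul_conj_trig (integrable_of_continuous (continuous_trig A f)) A f
  have e1 : ∀ x, trig A f x * conj (trig A f x) = ((‖trig A f x‖ ^ 2 : ℝ) : ℂ) := fun x => by
    rw [Complex.mul_conj', Complex.ofReal_pow]
  have e2 : ∑ n ∈ A, coeff (trig A f) n * conj (f n) = ((∑ n ∈ A, ‖f n‖ ^ 2 : ℝ) : ℂ) := by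
    rw [Complex.ofReal_sum]
    refine Finset.sum_congr rfl fun n hn => ?_
    rw [coeff_trig, if_pos hn, Complex.mul_conj', Complex.ofReal_pow]
  simp_rw [e1] at h
  rw [e2, integral_complex_ofReal, Complex.ofReal_inj] at h
  have h3 : ∀ z : ℂ, ‖z‖ₑ ^ 2 = ENNReal.ofReal (‖z‖ ^ 2) := fun z => by
    rw [ENNReal.ofReal_pow (norm_nonneg _), ofReal_norm]
  simp_rw [h3]
  rw [← ENNReal.ofReal_sum_of_nonneg fun _ _ => by positivity, ← h,
    ofReal_integral_eq_lintegral_ofReal _ (Eventually.of_forall fun _ => by positivity)]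
  have := (memLp_of_continuous (continuous_trig A f) 2).integrable_norm_pow (by norm_num)
  exact this

/-- From `‖F‖₃³ ≤ ‖F‖_∞ ‖F‖₂²`: the sup is at most the absolute sum of the coefficients, and
Parseval gives the rest. -/
lemma eLpNorm_trig_le (A : Finset Freq) (f : Freq → ℂ) :
    eLpNorm (trig A f) 3 torusMeasure ≤
      ((∑ n ∈ A, ‖f n‖ₑ) * ∑ n ∈ A, ‖f n‖ₑ ^ 2) ^ (1 / 3 : ℝ) := by
  rw [eLpNorm_eq_lintegral_rpow_enorm_toReal (by norm_num) (by norm_num)]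
  simp only [ENNReal.toReal_ofNat]
  refine ENNReal.rpow_le_rpow ?_ (by norm_num)
  rw [← lintegral_trig_sq, ← lintegral_const_mul' _ _ (ENNReal.sum_ne_top.mpr fun _ _ => enorm_ne_top)]
  refine lintegral_mono fun x => ?_
  have e : ‖trig A f x‖ₑ ^ (3 : ℝ) = ‖trig A f x‖ₑ * ‖trig A f x‖ₑ ^ 2 := by
    rw [show (3 : ℝ) = ((3 : ℕ) : ℝ) by norm_num, ENNReal.rpow_natCast]; ring
  simp only []
  rw [e]
  gcongr
  refine (enorm_sum_le _ _).trans (Finset.sum_le_sum fun n _ => ?_)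
  rw [enorm_mul, enorm_ch, mul_one]

/-! ### The embedding into `L³` -/

/-- The finite set of frequencies in a dyadic shell. -/
def blk (k : ℕ) : Finset Freq :=
  (Fintype.piFinset fun _ => Finset.Icc (-(2 ^ (k + 1) : ℤ)) (2 ^ (k + 1))).filter
    fun n => shellIndex n = k

lemma mem_blk (k : ℕ) (n : Freq) : n ∈ blk k ↔ shellIndex n = k := by
  unfold blk
  rw [Finset.mem_filter, and_iff_right_iff_imp]
  intro h
  have h1 := (shell_shellIndex n).2
  rw [h] at h1
  rw [Fintype.mem_piFinset]
  have hl : ∀ i, |(n i : ℝ)| ≤ length n := by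
    intro i
    refine Real.abs_le_sqrt ?_
    unfold modSq
    push_cast
    fin_cases i
    · simp only [Fin.zero_eta, Fin.isValue]; nlinarith [sq_nonneg (n 1 : ℝ)]
    · simp only [Fin.mk_one, Fin.isValue]; nlinarith [sq_nonneg (n 0 : ℝ)]
  intro i
  rw [Finset.mem_Icc, ← abs_le]
  have h2 : |(n i : ℝ)| ≤ 2 ^ (k + 1) := by
    rw [pow_succ']; exact (hl i).trans h1.le
  exact_mod_cast h2

/-- The finite set of frequencies in the first `K` dyadic shells. -/
def box (K : ℕ) : Finset Freq := (Finset.range K).biUnion blk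

lemma mem_box (K : ℕ) (n : Freq) : n ∈ box K ↔ shellIndex n < K := by
  simp [box, mem_blk]

lemma trig_box_succ (K : ℕ) (f : Freq → ℂ) (x : Torus) :
    trig (box (K + 1)) f x = trig (box K) f x + trig (blk K) f x := by
  have h : box (K + 1) = box K ∪ blk K := by
    ext n
    rw [Finset.mem_union, mem_box, mem_box, mem_blk, Nat.lt_succ_iff_lt_or_eq]
  unfold trig
  rw [h, Finset.sum_union]
  rw [Finset.disjoint_left]
  intro n h1 h2
  rw [mem_box] at h1
  rw [mem_blk] at h2
  omega

lemma bracket_rpow_le_of_mem_blk {k : ℕ} {n : Freq} (h : n ∈ blk k) (δ : ℝ) :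
    bracket n ^ δ ≤ 3 ^ |δ| * (2 : ℝ) ^ (k * δ) := by
  rw [mem_blk] at h
  have h1 := two_pow_shellIndex_le n
  have h2 := (shell_shellIndex n).2
  rw [h] at h1 h2
  have hb := bracket_pos n
  have h3 : bracket n ≤ 3 * 2 ^ k := by
    have h4 : bracket n ≤ 1 + length n := by
      unfold bracket length
      have : (0 : ℝ) ≤ modSq n := by unfold modSq; push_cast; positivity
      rw [Real.sqrt_le_left (by positivity)]
      nlinarith [Real.sq_sqrt this, Real.sqrt_nonneg (modSq n : ℝ)]
    have h5 : (1 : ℝ) ≤ 2 ^ k := one_le_pow₀ (by norm_num)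
    linarith
  have h2k : (0 : ℝ) < 2 ^ k := by positivity
  rw [Real.rpow_mul (by norm_num), Real.rpow_natCast]
  rcases le_total 0 δ with hδ | hδ
  · rw [abs_of_nonneg hδ, ← Real.mul_rpow (by norm_num) h2k.le]
    exact Real.rpow_le_rpow hb.le h3 hδ
  · calc _ ≤ ((2 : ℝ) ^ k) ^ δ := Real.rpow_le_rpow_of_nonpos h2k h1 hδ
      _ ≤ _ := le_mul_of_one_le_left (by positivity)
        (Real.one_le_rpow (by norm_num) (abs_nonneg _))

/-- On a single shell, weights of orders `s` and `s'` differ by the factor `2^{k (s' - s)}` up to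
constants. So the embedding at an order `s'` just above its threshold gives an almost sharp power of
`2^k`, whatever `s` is. -/
lemma exists_sum_blk_le {s p r s' : ℝ} (hp : 0 < p) (hr : 0 < r) (hs' : 0 ≤ s')
    (hsp : 2 * (1 / r - 1 / p) < s') :
    ∃ C : ℝ≥0∞, C ≠ ∞ ∧ ∀ (f : Freq → ℂ) (k : ℕ),
      ∑ n ∈ blk k, ‖f n‖ₑ ^ r ≤
        C * (ENNReal.ofReal ((2 : ℝ) ^ (k * (s' - s))) * eX s p f ^ (1 / p)) ^ r := by
  classical
  obtain ⟨C, hC, h⟩ := exists_tsum_rpow_le hp hr hs' hsp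
  set D := ENNReal.ofReal ((3 : ℝ) ^ |s' - s|) with hD
  refine ⟨C * D ^ r, ENNReal.mul_ne_top hC (ENNReal.rpow_ne_top_of_nonneg hr.le
    ENNReal.ofReal_ne_top), fun f k => ?_⟩
  set E := ENNReal.ofReal ((2 : ℝ) ^ (k * (s' - s))) with hE
  have h1 := h (fun n => if n ∈ blk k then ‖f n‖ₑ else 0)
  have e1 : ∑' n, (if n ∈ blk k then ‖f n‖ₑ else 0) ^ r = ∑ n ∈ blk k, ‖f n‖ₑ ^ r := by
    rw [tsum_eq_sum (s := blk k)]
    · exact Finset.sum_congr rfl fun n hn => by rw [if_pos hn]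
    · intro n hn; rw [if_neg hn, ENNReal.zero_rpow_of_pos hr]
  have h2 : ∑' n, (bw s' n * if n ∈ blk k then ‖f n‖ₑ else 0) ^ p ≤ (D * E) ^ p * eX s p f := by
    unfold eX
    rw [← ENNReal.tsum_mul_left]
    refine ENNReal.tsum_le_tsum fun n => ?_
    rw [← ENNReal.mul_rpow_of_nonneg _ _ hp.le]
    refine ENNReal.rpow_le_rpow ?_ hp.le
    split_ifs with hn
    · rw [← mul_assoc]
      refine mul_le_mul_left ?_ _
      rw [hD, hE, bw, bw, ← ENNReal.ofReal_mul (by positivity), ← ENNReal.ofReal_mul (by positivity)]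
      apply ENNReal.ofReal_le_ofReal
      have hb := bracket_pos n
      calc bracket n ^ s' = bracket n ^ (s' - s) * bracket n ^ s := by
            rw [← Real.rpow_add hb, sub_add_cancel]
        _ ≤ _ := mul_le_mul_of_nonneg_right (bracket_rpow_le_of_mem_blk hn _) (by positivity)
    · rw [mul_zero]; exact zero_le
  rw [e1] at h1
  refine h1.trans ?_
  refine (mul_le_mul_right (ENNReal.rpow_le_rpow h2 (div_pos hr hp).le) _).trans (le_of_eq ?_)
  rw [ENNReal.mul_rpow_of_nonneg _ _ (div_pos hr hp).le, ← ENNReal.rpow_mul,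
    mul_div_cancel₀ _ hp.ne', ENNReal.mul_rpow_of_nonneg _ _ hr.le,
    ENNReal.mul_rpow_of_nonneg _ _ hr.le, ← ENNReal.rpow_mul, one_div_mul_eq_div]
  ring

/-- Combining `ℓ¹` and `ℓ²` on a shell costs `2^{kσ}` with `σ = (2 - 2/p + 2 max(0, 1 - 2/p)) / 3`,
up to an arbitrarily small loss. For `p ≥ 2` this is `4/3 - 2/p`, for `p ≤ 2` it is two thirds of `1
- 1/p`; in both cases `σ < s`. Half of the gap pays for the loss and the other half is the decay
rate. -/
lemma Admissible.exists_eLpNorm_blk_le {s p q : ℝ} (h : Admissible s p q) :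
    ∃ C : ℝ≥0∞, C ≠ ∞ ∧ ∃ γ : ℝ, 0 < γ ∧ ∀ (f : Freq → ℂ) (k : ℕ),
      eLpNorm (trig (blk k) f) 3 torusMeasure ≤
        C * eX s p f ^ (1 / p) * ENNReal.ofReal ((2 : ℝ) ^ (-(k * γ))) := by
  have hp := h.holder.pos
  have hp1 := h.holder.lt
  have hpinv : 1 / p < 1 := by rw [div_lt_one hp]; exact hp1
  have hs1 : 1 - 1 / p < s := by
    have hq := h.holder.symm.pos
    have e : 1 - 1 / p = 1 / q := by
      have := h.holder.inv_add_inv_eq_one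
      rw [one_div, one_div]; linarith
    rw [e, div_lt_iff₀ hq]; exact h.one_lt
  have hlt := h.lt
  set m : ℝ := max 0 (1 - 2 / p) with hm
  have hm2 : 2 / p = 2 * (1 / p) := by ring
  set γ₀ : ℝ := s - (2 - 2 / p + 2 * m) / 3 with hγ₀
  have hγ₀pos : 0 < γ₀ := by
    rw [hγ₀]
    rcases max_choice 0 (1 - 2 / p) with h0 | h0 <;> rw [hm, h0]
    · rw [hm2]; linarith
    · linarith
  have hm0 : 0 ≤ m := le_max_left _ _
  have hm1 : 1 - 2 / p ≤ m := le_max_right _ _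
  obtain ⟨C₁, hC₁, h1⟩ := exists_sum_blk_le (s := s) (p := p) (r := 1) (s' := 2 - 2 / p + γ₀ / 2) hp
    one_pos (by rw [hm2]; linarith) (by rw [hm2]; linarith)
  obtain ⟨C₂, hC₂, h2⟩ := exists_sum_blk_le (s := s) (p := p) (r := 2) (s' := m + γ₀ / 2) hp
    (by norm_num) (by positivity) (by rw [hm2] at hm1; linarith)
  refine ⟨(C₁ * C₂) ^ (1 / 3 : ℝ), ENNReal.rpow_ne_top_of_nonneg (by norm_num)
    (ENNReal.mul_ne_top hC₁ hC₂), γ₀ / 2, by positivity, fun f k => ?_⟩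
  have h1 := h1 f k
  have h2 := h2 f k
  simp only [ENNReal.rpow_one] at h1
  simp only [ENNReal.rpow_ofNat] at h2
  refine (eLpNorm_trig_le _ _).trans ?_
  refine (ENNReal.rpow_le_rpow (mul_le_mul' h1 h2) (by norm_num)).trans (le_of_eq ?_)
  set E := eX s p f ^ (1 / p)
  have h3 : (0 : ℝ) ≤ 1 / 3 := by norm_num
  have hE : E = (E ^ 3) ^ (1 / 3 : ℝ) := by
    rw [← ENNReal.rpow_natCast, ← ENNReal.rpow_mul]; norm_num
  have hpow : ENNReal.ofReal ((2 : ℝ) ^ (-(k * (γ₀ / 2)))) =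
      (ENNReal.ofReal ((2 : ℝ) ^ (k * (2 - 2 / p + γ₀ / 2 - s))) *
        ENNReal.ofReal ((2 : ℝ) ^ (k * (m + γ₀ / 2 - s))) ^ 2) ^ (1 / 3 : ℝ) := by
    rw [← ENNReal.ofReal_pow (by positivity), ← ENNReal.ofReal_mul (by positivity),
      ENNReal.ofReal_rpow_of_pos (by positivity), ← Real.rpow_natCast, ← Real.rpow_mul (by norm_num),
      ← Real.rpow_add (by norm_num), ← Real.rpow_mul (by norm_num)]
    congr 2
    rw [hγ₀]; push_cast; ring
  rw [hpow]
  conv_rhs => rw [hE]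
  rw [← ENNReal.mul_rpow_of_nonneg _ _ h3, ← ENNReal.mul_rpow_of_nonneg _ _ h3]
  congr 1; ring

lemma eLpNorm_one_le_three (F : Torus → ℂ) (hF : AEStronglyMeasurable F torusMeasure) :
    eLpNorm F 1 torusMeasure ≤ eLpNorm F 3 torusMeasure :=
  eLpNorm_le_eLpNorm_of_exponent_le (by norm_num) hF

lemma enorm_coeff_le (F : Torus → ℂ) (n : Freq) :
    ‖coeff F n‖ₑ ≤ eLpNorm F 1 torusMeasure := by
  rw [coeff_eq, eLpNorm_one_eq_lintegral_enorm]
  refine (enorm_integral_le_lintegral_enorm _).trans (le_of_eq ?_)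
  refine lintegral_congr fun x => ?_
  rw [enorm_mul, enorm_ch, mul_one]

lemma coeff_sub {F G : Torus → ℂ} (hF : Integrable F torusMeasure) (hG : Integrable G torusMeasure)
    (n : Freq) : coeff (F - G) n = coeff F n - coeff G n := by
  rw [coeff_eq, coeff_eq, coeff_eq, ← integral_sub]
  · refine integral_congr_ae (Eventually.of_forall fun x => ?_)
    simp only [Pi.sub_apply]; ring
  · exact hF.mul_of_top_left (memLp_of_continuous (ch (-n)).continuous ⊤)
  · exact hG.mul_of_top_left (memLp_of_continuous (ch (-n)).continuous ⊤)

lemma MemLp_three_integrable {F : Torus → ℂ} (hF : MemLp F 3 torusMeasure) :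
    Integrable F torusMeasure := hF.integrable (by norm_num)

/-- The function with Fourier coefficients `f` belongs to `L³`, as the limit of its dyadic partial
sums. -/
lemma Admissible.exists_isL3Function {s p q : ℝ} (h : Admissible s p q) {f : Freq → ℂ}
    (hf : eX s p f ≠ ∞) : ∃ F, IsL3Function f F ∧
      Tendsto (fun K => eLpNorm (F - trig (box K) f) 3 torusMeasure) atTop (𝓝 0) := by
  obtain ⟨C, hC, γ, hγ, hb⟩ := h.exists_eLpNorm_blk_le
  have hmem : ∀ A, MemLp (trig A f) 3 torusMeasure := fun A =>
    memLp_of_continuous (continuous_trig A f) 3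
  have h13 : Fact ((1 : ℝ≥0∞) ≤ 3) := ⟨by norm_num⟩
  set G : ℕ → Lp ℂ 3 torusMeasure := fun K => (hmem (box K)).toLp with hG
  have hD : C * eX s p f ^ (1 / p) ≠ ∞ := ENNReal.mul_ne_top hC
    (ENNReal.rpow_ne_top_of_nonneg (one_div_pos.mpr h.holder.pos).le hf)
  have hgeom : ∀ k : ℕ, (2 : ℝ) ^ (-(k * γ)) = ((2 : ℝ) ^ (-γ)) ^ k := fun k => by
    rw [← Real.rpow_natCast, ← Real.rpow_mul (by norm_num)]; congr 1; ring
  have hdist : ∀ K, edist (G K) (G (K + 1)) ≤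
      C * eX s p f ^ (1 / p) * ENNReal.ofReal (((2 : ℝ) ^ (-γ)) ^ K) := by
    intro K
    rw [edist_comm, Lp.edist_toLp_toLp, ← hgeom]
    refine le_trans (le_of_eq ?_) (hb f K)
    congr 1
    ext x
    rw [Pi.sub_apply, trig_box_succ]; ring
  have hr : (2 : ℝ) ^ (-γ) < 1 := Real.rpow_lt_one_of_one_lt_of_neg (by norm_num) (by linarith)
  have hcauchy : CauchySeq G := by
    refine cauchySeq_of_edist_le_of_tsum_ne_top _ hdist ?_
    rw [ENNReal.tsum_mul_left]
    exact ENNReal.mul_ne_top hD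
      (summable_geometric_of_lt_one (by positivity) hr).tsum_ofReal_ne_top
  obtain ⟨L, hL⟩ := cauchySeq_tendsto_of_complete hcauchy
  have hlim : Tendsto (fun K => eLpNorm (⇑L - trig (box K) f) 3 torusMeasure) atTop (𝓝 0) := by
    rw [tendsto_iff_edist_tendsto_0] at hL
    refine hL.congr fun K => ?_
    rw [edist_comm, Lp.edist_def]
    refine eLpNorm_congr_ae ?_
    filter_upwards [(hmem (box K)).coeFn_toLp] with x hx
    simp only [Pi.sub_apply]; rw [hx]
  refine ⟨L, ⟨Lp.memLp L, fun n => ?_⟩, hlim⟩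
  have hcl : Tendsto (fun _ : ℕ => ‖coeff L n - f n‖ₑ) atTop (𝓝 0) := by
    refine tendsto_of_tendsto_of_tendsto_of_le_of_le' tendsto_const_nhds hlim
      (Eventually.of_forall fun _ => zero_le) ?_
    filter_upwards [Filter.eventually_gt_atTop (shellIndex n)] with K hK
    have e : f n = coeff (trig (box K) f) n := by rw [coeff_trig, if_pos ((mem_box K n).mpr hK)]
    have hi := MemLp_three_integrable (hmem (box K))
    rw [e, ← coeff_sub (MemLp_three_integrable (Lp.memLp L)) hi]
    have hsm := ((Lp.memLp L).sub (hmem (box K))).aestronglyMeasurable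
    exact (enorm_coeff_le _ n).trans (eLpNorm_one_le_three _ hsm)
  have := tendsto_nhds_unique hcl tendsto_const_nhds
  exact sub_eq_zero.mp (enorm_eq_zero.mp this.symm)

/-! ### Fourier coefficients of the cubic nonlinearity -/

/-- On the torus `L³ ⊂ L²`, where coefficients determine the function. Hence the choice of `U t` in
`IsSolution` is immaterial. -/
lemma IsL3Function.ae_eq {f : Freq → ℂ} {F G : Torus → ℂ} (hF : IsL3Function f F)
    (hG : IsL3Function f G) : F =ᵐ[torusMeasure] G := by
  have h := ae_eq_zero_of_coeff_eq_zero (F := F - G)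
    ((hF.1.sub hG.1).mono_exponent (by norm_num)) fun n => by
      rw [coeff_sub (MemLp_three_integrable hF.1) (MemLp_three_integrable hG.1), hF.2, hG.2,
        sub_self]
  filter_upwards [h] with x hx
  exact sub_eq_zero.mp hx

lemma cubic_eq (F : Torus → ℂ) (x : Torus) : cubic F x = F x * conj (F x) * F x := by
  rw [cubic, Complex.mul_conj', Complex.ofReal_pow]

lemma lintegral_mul_mul_le {F G H : Torus → ℂ} (hF : AEStronglyMeasurable F torusMeasure)
    (hG : AEStronglyMeasurable G torusMeasure) (hH : AEStronglyMeasurable H torusMeasure) :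
    ∫⁻ x, ‖F x‖ₑ * ‖G x‖ₑ * ‖H x‖ₑ ∂torusMeasure ≤
      eLpNorm F 3 torusMeasure * eLpNorm G 3 torusMeasure * eLpNorm H 3 torusMeasure := by
  have hkey := ENNReal.lintegral_prod_norm_pow_le (μ := torusMeasure)
    (Finset.univ : Finset (Fin 3)) (f := ![fun x => ‖F x‖ₑ ^ (3 : ℝ), fun x => ‖G x‖ₑ ^ (3 : ℝ),
      fun x => ‖H x‖ₑ ^ (3 : ℝ)]) (fun i _ => by
        fin_cases i
        · exact hF.enorm.pow_const _
        · exact hG.enorm.pow_const _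
        · exact hH.enorm.pow_const _)
    (p := fun _ => (1 / 3 : ℝ)) (by norm_num) (fun _ _ => by norm_num)
  simp only [Fin.prod_univ_three, Matrix.cons_val_zero, Matrix.cons_val_one,
    Matrix.cons_val] at hkey
  have e : ∀ F : Torus → ℂ, eLpNorm F 3 torusMeasure =
      (∫⁻ x, ‖F x‖ₑ ^ (3 : ℝ) ∂torusMeasure) ^ (1 / 3 : ℝ) := fun F => by
    rw [eLpNorm_eq_lintegral_rpow_enorm_toReal (by norm_num) (by norm_num)]
    simp only [ENNReal.toReal_ofNat]
  rw [e, e, e]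
  refine le_trans (le_of_eq ?_) hkey
  refine lintegral_congr fun x => ?_
  simp only [← ENNReal.rpow_mul]
  norm_num

lemma enorm_cubic (F : Torus → ℂ) (x : Torus) : ‖cubic F x‖ₑ = ‖F x‖ₑ * ‖F x‖ₑ * ‖F x‖ₑ := by
  rw [cubic_eq, enorm_mul, enorm_mul, RCLike.enorm_conj]

lemma integrable_cubic {F : Torus → ℂ} (hF : MemLp F 3 torusMeasure) :
    Integrable (cubic F) torusMeasure := by
  constructor
  · have hc : Continuous fun z : ℂ => ((‖z‖ ^ 2 : ℝ) : ℂ) * z := by fun_prop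
    exact hc.comp_aestronglyMeasurable hF.1
  · rw [HasFiniteIntegral]
    simp_rw [enorm_cubic]
    refine (lintegral_mul_mul_le hF.1 hF.1 hF.1).trans_lt ?_
    exact ENNReal.mul_lt_top (ENNReal.mul_lt_top hF.2 hF.2) hF.2

lemma enorm_coeff_cubic_sub_le {F G : Torus → ℂ} (hF : MemLp F 3 torusMeasure)
    (hG : MemLp G 3 torusMeasure) {B : ℝ≥0∞} (hFB : eLpNorm F 3 torusMeasure ≤ B)
    (hGB : eLpNorm G 3 torusMeasure ≤ B) (n : Freq) :
    ‖coeff (cubic F) n - coeff (cubic G) n‖ₑ ≤ 3 * (B * B) * eLpNorm (F - G) 3 torusMeasure := by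
  rw [← coeff_sub (integrable_cubic hF) (integrable_cubic hG)]
  refine (enorm_coeff_le _ n).trans ?_
  rw [eLpNorm_one_eq_lintegral_enorm]
  have hFG := hF.sub hG
  have hpt : ∀ x, ‖(cubic F - cubic G) x‖ₑ ≤ ‖(F - G) x‖ₑ * ‖F x‖ₑ * ‖F x‖ₑ +
      (‖G x‖ₑ * ‖(F - G) x‖ₑ * ‖F x‖ₑ + ‖G x‖ₑ * ‖G x‖ₑ * ‖(F - G) x‖ₑ) := by
    intro x
    have e : (cubic F - cubic G) x = (F - G) x * conj (F x) * F x +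
        (G x * conj ((F - G) x) * F x + G x * conj (G x) * (F - G) x) := by
      simp only [Pi.sub_apply, cubic_eq, map_sub]; ring
    rw [e]
    refine (enorm_add_le _ _).trans (add_le_add ?_ ((enorm_add_le _ _).trans (add_le_add ?_ ?_)))
    all_goals rw [enorm_mul, enorm_mul, RCLike.enorm_conj]
  have m1 : AEMeasurable (fun x => ‖(F - G) x‖ₑ * ‖F x‖ₑ * ‖F x‖ₑ) torusMeasure :=
    (hFG.1.enorm.mul hF.1.enorm).mul hF.1.enorm
  have m2 : AEMeasurable (fun x => ‖G x‖ₑ * ‖(F - G) x‖ₑ * ‖F x‖ₑ) torusMeasure :=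
    (hG.1.enorm.mul hFG.1.enorm).mul hF.1.enorm
  refine (lintegral_mono hpt).trans ?_
  rw [lintegral_add_left' m1, lintegral_add_left' m2]
  have b1 := lintegral_mul_mul_le hFG.1 hF.1 hF.1
  have b2 := lintegral_mul_mul_le hG.1 hFG.1 hF.1
  have b3 := lintegral_mul_mul_le hG.1 hG.1 hFG.1
  set d := eLpNorm (F - G) 3 torusMeasure
  calc _ ≤ d * B * B + (B * d * B + B * B * d) := by
        refine add_le_add (b1.trans ?_) (add_le_add (b2.trans ?_) (b3.trans ?_)) <;> gcongr
    _ = _ := by ring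

open Classical in
lemma coeff_cubic_trig (A : Finset Freq) (f : Freq → ℂ) (n : Freq) :
    coeff (cubic (trig A f)) n =
      ∑ z ∈ A ×ˢ A, f z.1 * f z.2 * conj (if z.1 + z.2 - n ∈ A then f (z.1 + z.2 - n) else 0) := by
  have e : ∀ x, cubic (trig A f) x * ch (-n) x = ∑ z ∈ A ×ˢ A, f z.1 * f z.2 *
      conj (trig A f x * ch (-(z.1 + z.2 - n)) x) := by
    intro x
    have e1 : trig A f x * trig A f x = ∑ z ∈ A ×ˢ A, (f z.1 * ch z.1 x) * (f z.2 * ch z.2 x) := by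
      rw [trig, Finset.sum_mul_sum, ← Finset.sum_product']
    rw [cubic_eq, mul_right_comm (trig A f x), e1, Finset.sum_mul, Finset.sum_mul]
    refine Finset.sum_congr rfl fun z _ => ?_
    rw [map_mul, ← ch_neg, neg_neg, sub_eq_add_neg, ch_add, ch_add]; ring
  rw [coeff_eq]
  simp_rw [e]
  have hi : ∀ m : Freq, Integrable (fun x => conj (trig A f x * ch (-m) x)) torusMeasure := fun m =>
    integrable_of_continuous (Complex.continuous_conj.comp
      ((continuous_trig A f).mul (ch (-m)).continuous))
  rw [integral_finsetSum _ fun z _ => (hi _).const_mul _]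
  refine Finset.sum_congr rfl fun z _ => ?_
  rw [integral_const_mul, integral_conj, ← coeff_eq, coeff_trig]

/-- The Fourier coefficients of the cubic nonlinearity. -/
lemma Admissible.coeff_cubic {s p q : ℝ} (h : Admissible s p q) {f : Freq → ℂ}
    (hf : eX s p f ≠ ∞) {F : Torus → ℂ} (hF : IsL3Function f F) (n : Freq) :
    coeff (cubic F) n = full 0 f n := by
  classical
  obtain ⟨F', hF', hlim'⟩ := h.exists_isL3Function hf
  have hae := hF.ae_eq hF'
  have hlim : Tendsto (fun K => eLpNorm (F - trig (box K) f) 3 torusMeasure) atTop (𝓝 0) := by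
    refine hlim'.congr fun K => eLpNorm_congr_ae ?_
    filter_upwards [hae] with x hx
    simp only [Pi.sub_apply, hx]
  have hmem : ∀ A, MemLp (trig A f) 3 torusMeasure := fun A =>
    memLp_of_continuous (continuous_trig A f) 3
  set B := eLpNorm F 3 torusMeasure + 1 with hB
  have hBtop : B ≠ ∞ := by rw [hB]; simpa using hF.1.2.ne
  -- Both sides are limits of the coefficients of the dyadic partial sums: this one by continuity of
  -- the cubic map from `L³` to `L¹`, the other by dominated convergence in an absolutely convergent
  -- sum.
  have h1 : Tendsto (fun K => coeff (cubic (trig (box K) f)) n) atTop (𝓝 (coeff (cubic F) n)) := by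
    refine tendsto_of_enorm_sub ?_
    have h2 := tendsto_const_mul_zero hlim (c := 3 * (B * B))
      (ENNReal.mul_ne_top (by norm_num) (ENNReal.mul_ne_top hBtop hBtop))
    refine tendsto_of_tendsto_of_tendsto_of_le_of_le' tendsto_const_nhds h2
      (Eventually.of_forall fun _ => zero_le) ?_
    filter_upwards [hlim.eventually (gt_mem_nhds one_pos)] with K hK
    rw [← enorm_neg, neg_sub]
    refine enorm_coeff_cubic_sub_le hF.1 (hmem _) le_self_add ?_ n
    have e : trig (box K) f = F - (F - trig (box K) f) := by abel
    calc eLpNorm (trig (box K) f) 3 torusMeasure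
        = eLpNorm (F - (F - trig (box K) f)) 3 torusMeasure := by rw [← e]
      _ ≤ eLpNorm F 3 torusMeasure + eLpNorm (F - trig (box K) f) 3 torusMeasure :=
          eLpNorm_sub_le hF.1.1 (hF.1.sub (hmem _)).1 (by norm_num)
      _ ≤ B := by rw [hB]; gcongr
  have h2 : Tendsto (fun K => coeff (cubic (trig (box K) f)) n) atTop (𝓝 (full 0 f n)) := by
    have e : ∀ K, coeff (cubic (trig (box K) f)) n = ∑' z : Freq × Freq,
        if z.1 ∈ box K ∧ z.2 ∈ box K ∧ z.1 + z.2 - n ∈ box K then fullTerm 0 f n z else 0 := by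
      intro K
      rw [coeff_cubic_trig, tsum_eq_sum (s := box K ×ˢ box K)]
      · refine Finset.sum_congr rfl fun z hz => ?_
        rw [Finset.mem_product] at hz
        simp only [hz.1, hz.2, true_and]
        split_ifs
        · simp only [fullTerm, zero_mul, Complex.ofReal_zero, Complex.exp_zero, one_mul]; ring
        · simp
      · intro z hz
        rw [if_neg]
        exact fun h => hz (Finset.mem_product.mpr ⟨h.1, h.2.1⟩)
    simp_rw [e]
    refine tendsto_tsum_of_dominated_convergence (h.summable_nonlin hf hf hf n) (fun z => ?_)
      (Eventually.of_forall fun K z => ?_)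
    · refine tendsto_const_nhds.congr' ?_
      filter_upwards [Filter.eventually_gt_atTop (shellIndex z.1),
        Filter.eventually_gt_atTop (shellIndex z.2),
        Filter.eventually_gt_atTop (shellIndex (z.1 + z.2 - n))] with K k1 k2 k3
      rw [if_pos ⟨(mem_box _ _).mpr k1, (mem_box _ _).mpr k2, (mem_box _ _).mpr k3⟩]
    · split_ifs
      · exact (norm_fullTerm 0 f n z).le
      · rw [norm_zero]; positivity
  exact tendsto_nhds_unique h1 h2

/-! ### The gauge transformation -/

/-- The equation in the interaction representation, with the coefficient `κ` of the
resonant part. -/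
def InteractionEq (c : ℂ) (T κ : ℝ) (y : ℝ → Freq → ℂ) : Prop :=
  ∀ t ∈ Icc 0 T, ∀ n, y t n = y 0 n + c * ∫ t' in (0 : ℝ)..t,
    (nonlin t' (y t') (y t') (y t') n + ((κ * mass (y t') : ℝ) : ℂ) * y t' n)

/-- The unimodular gauge factor. -/
def gaugeFactor (ε μ : ℝ) (y : ℝ → Freq → ℂ) (t : ℝ) : ℂ :=
  Complex.exp (((ε * μ * ∫ t' in (0 : ℝ)..t, mass (y t') : ℝ) : ℂ) * Complex.I)

lemma norm_gaugeFactor (ε μ : ℝ) (y : ℝ → Freq → ℂ) (t : ℝ) : ‖gaugeFactor ε μ y t‖ = 1 :=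
  Complex.norm_exp_ofReal_mul_I _

lemma gaugeFactor_zero (ε μ : ℝ) (y : ℝ → Freq → ℂ) : gaugeFactor ε μ y 0 = 1 := by
  simp [gaugeFactor]

lemma mass_mul_unimodular {f : Freq → ℂ} {e : Freq → ℂ} (he : ∀ n, ‖e n‖ = 1) :
    mass (fun n => e n * f n) = mass f := by
  simp only [mass, norm_mul, he, one_mul]

/-- The factor does not depend on the frequency, so it enters as `e ē e = e`. -/
lemma nonlin_mul_unimodular (t : ℝ) {e : ℂ} (he : ‖e‖ = 1) (f : Freq → ℂ) (n : Freq) :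
    nonlin t (fun n => e * f n) (fun n => e * f n) (fun n => e * f n) n =
      e * nonlin t f f f n := by
  have h1 : e * conj e = 1 := by
    rw [Complex.mul_conj, Complex.normSq_eq_norm_sq, he]; norm_num
  rw [nonlin, nonlin, ← tsum_mul_left]
  refine tsum_congr fun z => ?_
  rw [map_mul]
  linear_combination (e * (sgn n z * Complex.exp (((t * phase n z.1 z.2 : ℝ) : ℂ) * Complex.I) *
    (f z.1 * conj (f (z.1 + z.2 - n)) * f z.2))) * h1

lemma Admissible.continuousOn_nonlin_self {s p q : ℝ} (h : Admissible s p q) {S : Set ℝ}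
    {g : ℝ → Freq → ℂ} (hg : CX s p S g) (n : Freq) :
    ContinuousOn (fun t => nonlin t (g t) (g t) (g t) n) S := by
  have := h.continuousOn_nonlin hg 0 1 n
  simpa only [zero_add, one_mul] using this

lemma CX.continuousOn_apply {s p : ℝ} (hp : 0 < p) {S : Set ℝ}
    {g : ℝ → Freq → ℂ} (hg : CX s p S g) (n : Freq) : ContinuousOn (fun t => g t n) S := by
  intro t ht
  refine tendsto_of_enorm_sub ?_
  have h1 := tendsto_rpow_zero (hg t ht).2 (inv_pos.mpr hp)
  have hb : (bw s n)⁻¹ ≠ ∞ := by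
    rw [ENNReal.inv_ne_top, bw]
    exact (ENNReal.ofReal_pos.mpr (Real.rpow_pos_of_pos (bracket_pos n) s)).ne'
  have hb0 : bw s n ≠ 0 := by
    rw [bw]; exact (ENNReal.ofReal_pos.mpr (Real.rpow_pos_of_pos (bracket_pos n) s)).ne'
  refine tendsto_of_tendsto_of_tendsto_of_le_of_le tendsto_const_nhds
    (tendsto_const_mul_zero h1 hb) (fun _ => zero_le) fun t' => ?_
  have h2 : (bw s n * ‖(g t' - g t) n‖ₑ) ^ p ≤ eX s p (g t' - g t) := ENNReal.le_tsum n
  have h3 := ENNReal.rpow_le_rpow h2 (inv_pos.mpr hp).le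
  rw [← ENNReal.rpow_mul, mul_inv_cancel₀ hp.ne', ENNReal.rpow_one] at h3
  calc ‖g t' n - g t n‖ₑ = (bw s n)⁻¹ * (bw s n * ‖(g t' - g t) n‖ₑ) := by
        rw [← mul_assoc, ENNReal.inv_mul_cancel hb0 (bw_ne_top s n), one_mul]; rfl
    _ ≤ _ := mul_le_mul_right h3 _

lemma Admissible.continuousOn_rhs {s p q : ℝ} (h : Admissible s p q) {S : Set ℝ}
    {g : ℝ → Freq → ℂ} (hg : CX s p S g) (κ : ℝ) (n : Freq) :
    ContinuousOn (fun t => nonlin t (g t) (g t) (g t) n + ((κ * mass (g t) : ℝ) : ℂ) * g t n) S :=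
  (h.continuousOn_nonlin_self hg n).add
    ((Complex.continuous_ofReal.comp_continuousOn
      (continuousOn_const.mul (h.continuousOn_mass hg))).mul
      (hg.continuousOn_apply h.holder.pos n))

lemma gaugeFactor_eq (ε μ : ℝ) (y : ℝ → Freq → ℂ) (t : ℝ) : gaugeFactor ε μ y t =
    Complex.exp (∫ t' in (0 : ℝ)..t, ((ε : ℂ) * Complex.I) * ((μ * mass (y t') : ℝ) : ℂ)) := by
  rw [gaugeFactor, intervalIntegral.integral_const_mul, intervalIntegral.integral_ofReal,
    intervalIntegral.integral_const_mul]
  congr 1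
  push_cast
  ring

lemma Admissible.CX_gauge {s p q : ℝ} (h : Admissible s p q) {T : ℝ} {y : ℝ → Freq → ℂ}
    (hy : CX s p (Icc 0 T) y) (ε μ : ℝ) :
    CX s p (Icc 0 T) (fun t n => gaugeFactor ε μ y t * y t n) := by
  refine hy.mul_phase h.holder.pos (φ := fun t _ => gaugeFactor ε μ y t) (fun t n => ?_) fun n => ?_
  · rw [← ofReal_norm, norm_gaugeFactor, ENNReal.ofReal_one]
  · simp only [gaugeFactor_eq]
    exact Complex.continuous_exp.comp_continuousOn (continuousOn_integral
      (continuousOn_const.mul (Complex.continuous_ofReal.comp_continuousOn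
      (continuousOn_const.mul (h.continuousOn_mass hy)))))

/-- A unimodular factor depending on time only changes neither the mass nor the form of `nonlin`, so
the integrating factor just adds `μ` to the resonant coefficient. The value `μ = -2` removes the
resonant part and `μ = 2` restores it. -/
lemma Admissible.interactionEq_gauge {s p q : ℝ} (h : Admissible s p q) {ε T κ : ℝ}
    {y : ℝ → Freq → ℂ} (hy : CX s p (Icc 0 T) y)
    (hyeq : InteractionEq (ε * Complex.I) T κ y) (μ : ℝ) :
    InteractionEq (ε * Complex.I) T (κ + μ) (fun t n => gaugeFactor ε μ y t * y t n) := by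
  intro t ht n
  have hA := h.continuousOn_rhs hy κ n
  have hB : ContinuousOn (fun t => ((ε : ℂ) * Complex.I) * ((μ * mass (y t) : ℝ) : ℂ)) (Icc 0 T) :=
    continuousOn_const.mul (Complex.continuous_ofReal.comp_continuousOn
      (continuousOn_const.mul (h.continuousOn_mass hy)))
  have h1 := integrating_factor (y := fun t => y t n)
    (A := fun t => ε * Complex.I *
      (nonlin t (y t) (y t) (y t) n + ((κ * mass (y t) : ℝ) : ℂ) * y t n))
    (continuousOn_const.mul hA) hB (fun t ht => by
      rw [intervalIntegral.integral_const_mul]; exact hyeq t ht n) t ht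
  simp only [← gaugeFactor_eq] at h1
  simp only [gaugeFactor_zero, one_mul]
  rw [h1, ← intervalIntegral.integral_const_mul]
  congr 1
  refine intervalIntegral.integral_congr fun t' _ => ?_
  rw [nonlin_mul_unimodular t' (norm_gaugeFactor ε μ y t'),
    mass_mul_unimodular (e := fun _ => gaugeFactor ε μ y t') fun _ => norm_gaugeFactor ε μ y t']
  push_cast
  ring

lemma InteractionEq.congr {c : ℂ} {T κ : ℝ} {y z : ℝ → Freq → ℂ} (hy : InteractionEq c T κ y)
    (hyz : ∀ t ∈ Icc 0 T, z t = y t) : InteractionEq c T κ z := by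
  intro t ht n
  rw [hyz t ht, hyz 0 ⟨le_rfl, ht.1.trans ht.2⟩, hy t ht n]
  congr 2
  refine intervalIntegral.integral_congr fun t' ht' => ?_
  rw [uIcc_of_le ht.1] at ht'
  simp only [hyz t' ⟨ht'.1, ht'.2.trans ht.2⟩]

/-- Uniqueness for the equation in the interaction representation. -/
lemma Admissible.interactionEq_unique {s q : ℝ} {P : ℝ≥0∞} [Fact (1 ≤ P)]
    (h : Admissible s P.toReal q) {ε T : ℝ} (hε : ‖(ε * Complex.I : ℂ)‖ₑ = 1)
    {y z : ℝ → Freq → ℂ} (hy : CX s P.toReal (Icc 0 T) y) (hz : CX s P.toReal (Icc 0 T) z)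
    (hyeq : InteractionEq (ε * Complex.I) T 2 y) (hzeq : InteractionEq (ε * Complex.I) T 2 z)
    (h0 : y 0 = z 0) : ∀ t ∈ Icc 0 T, y t = z t := by
  have hP := h.holder.pos
  have key : ∀ {w : ℝ → Freq → ℂ}, CX s P.toReal (Icc 0 T) w →
      InteractionEq (ε * Complex.I) T 2 w →
      GaugedSolution s P.toReal (ε * Complex.I) T (fun t n => gaugeFactor ε (-2) w t * w t n) := by
    intro w hw hweq
    refine GaugedSolution.of_CX hP (h.CX_gauge hw ε (-2)) fun t ht n => ?_
    have := h.interactionEq_gauge hw hweq (-2) t ht n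
    simpa using this
  have hg := h.gauged_unique hε (key hy hyeq) (key hz hzeq) (by
    ext n; simp only [gaugeFactor_zero, h0])
  -- The gauge factor depends on the solution through its mass alone. Equal gauged solutions have
  -- equal masses, hence equal factors, which can then be cancelled.
  have hm : ∀ t ∈ Icc 0 T, mass (y t) = mass (z t) := by
    intro t ht
    rw [← mass_mul_unimodular (f := y t) (e := fun _ => gaugeFactor ε (-2) y t)
      fun _ => norm_gaugeFactor _ _ _ _, ← mass_mul_unimodular (f := z t)
      (e := fun _ => gaugeFactor ε (-2) z t) fun _ => norm_gaugeFactor _ _ _ _]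
    exact congrArg mass (hg t ht)
  intro t ht
  ext n
  have h1 := congrFun (hg t ht) n
  have h2 : gaugeFactor ε (-2) y t = gaugeFactor ε (-2) z t := by
    rw [gaugeFactor, gaugeFactor]
    congr 4
    refine intervalIntegral.integral_congr fun t' ht' => ?_
    rw [uIcc_of_le ht.1] at ht'
    exact hm t' ⟨ht'.1, ht'.2.trans ht.2⟩
  simp only [h2] at h1
  refine mul_left_cancel₀ (norm_ne_zero_iff.mp ?_) h1
  rw [norm_gaugeFactor]; exact one_ne_zero

/-- Local existence for the equation in the interaction representation. -/
lemma Admissible.exists_interactionEq {s p q : ℝ} (h : Admissible s p q) {ε : ℝ}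
    (hε : ‖(ε * Complex.I : ℂ)‖ₑ = 1) {φ : Freq → ℂ} (hφ : eX s p φ ≠ ∞) :
    ∃ T : ℝ, 0 < T ∧ ∃ y : ℝ → Freq → ℂ, CX s p (Icc 0 T) y ∧ y 0 = φ ∧
      InteractionEq (ε * Complex.I) T 2 y := by
  obtain ⟨K, hK, M, hM, hloc⟩ := h.exists_local (eX s p φ) hφ
  obtain ⟨V, hV, hV0, hsol⟩ := hloc M le_rfl _ hε 0 φ le_rfl
  have hM0 : (0 : ℝ) < M := by exact_mod_cast hM
  obtain ⟨r, hr, hr0⟩ : ∃ r : ℝ, r = 2 * π / M ∧ 0 < r := ⟨_, rfl, by positivity⟩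
  have hT : 0 < r * (1 / 2) := by positivity
  have hmap : ∀ t ∈ Icc 0 (r * (1 / 2)), t / r ∈ Icc (0 : ℝ) (1 / 2) := fun t ht =>
    ⟨div_nonneg ht.1 hr0.le, by rw [div_le_iff₀ hr0, mul_comm]; exact ht.2⟩
  have hcx : CX s p (Icc 0 (r * (1 / 2))) (fun t => val V (t / r)) := by
    intro t ht
    have h1 := CX_val h.holder (ne_top_of_le_ne_top hK hV) (Icc 0 (1 / 2)) (t / r) (hmap t ht)
    refine ⟨h1.1, h1.2.comp ?_⟩
    refine tendsto_nhdsWithin_iff.mpr ⟨?_, ?_⟩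
    · exact ((continuous_id.div_const r).tendsto t).mono_left nhdsWithin_le_nhds
    · filter_upwards [self_mem_nhdsWithin] with t' ht' using hmap t' ht'
  have heq : InteractionEq (ε * Complex.I) (r * (1 / 2)) 0 (fun t => val V (t / r)) := by
    intro t ht n
    have h1 := hsol (t / r) (hmap t ht) n
    rw [← hr] at h1
    simp only [zero_div, zero_mul, Complex.ofReal_zero, add_zero, zero_add] at h1 ⊢
    rw [h1]
    congr 2
    have h2 := intervalIntegral.smul_integral_comp_mul_left (a := 0) (b := t / r)
      (fun t' => nonlin t' (val V (t' / r)) (val V (t' / r)) (val V (t' / r)) n) r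
    rw [mul_zero, mul_div_cancel₀ _ hr0.ne', Complex.real_smul] at h2
    rw [← h2]
    simp only [mul_div_cancel_left₀ _ hr0.ne']
  refine ⟨_, hT, _, h.CX_gauge hcx ε 2, ?_, ?_⟩
  · ext n; simp only [gaugeFactor_zero, one_mul, zero_div, hV0]
  · simpa using h.interactionEq_gauge hcx heq 2

/-! ### The Duhamel formulation -/

/-- The Fourier multiplier of `e^{-itΔ}`. -/
def expFactor (t : ℝ) (n : Freq) : ℂ := Complex.exp (((t * (modSq n : ℝ) : ℝ) : ℂ) * Complex.I)

lemma norm_expFactor (t : ℝ) (n : Freq) : ‖expFactor t n‖ = 1 := Complex.norm_exp_ofReal_mul_I _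

lemma expFactor_zero (n : Freq) : expFactor 0 n = 1 := by simp [expFactor]

lemma continuous_expFactor (n : Freq) : Continuous fun t => expFactor t n := by
  unfold expFactor; fun_prop

lemma propagator_mul_expFactor (t : ℝ) (n : Freq) : propagator t n * expFactor t n = 1 := by
  rw [propagator, expFactor, ← Complex.exp_add, ← Complex.exp_zero]
  congr 1; ring

lemma norm_propagator (t : ℝ) (n : Freq) : ‖propagator t n‖ = 1 := by
  have h := congrArg norm (propagator_mul_expFactor t n)
  rwa [norm_mul, norm_expFactor, mul_one, norm_one] at h

lemma propagator_sub (t t' : ℝ) (n : Freq) :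
    propagator (t - t') n = propagator t n * expFactor t' n := by
  rw [propagator, propagator, expFactor, ← Complex.exp_add]
  congr 1; push_cast; ring

/-- By `phase_eq`, the phase cancels the exponentials carried by the three factors and leaves the
one of the output frequency. -/
lemma full_expFactor (t : ℝ) (f : Freq → ℂ) (n : Freq) :
    full t (fun m => expFactor t m * f m) n = expFactor t n * full 0 f n := by
  rw [full, full, ← tsum_mul_left]
  refine tsum_congr fun z => ?_
  simp only [fullTerm, expFactor, map_mul, ← Complex.exp_conj, Complex.conj_ofReal, Complex.conj_I,
    zero_mul, Complex.ofReal_zero, Complex.exp_zero, one_mul]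
  have e : Complex.exp (((t * phase n z.1 z.2 : ℝ) : ℂ) * Complex.I) *
      (Complex.exp (((t * (modSq z.1 : ℝ) : ℝ) : ℂ) * Complex.I) *
      Complex.exp (((t * (modSq (z.1 + z.2 - n) : ℝ) : ℝ) : ℂ) * -Complex.I) *
      Complex.exp (((t * (modSq z.2 : ℝ) : ℝ) : ℂ) * Complex.I)) =
      Complex.exp (((t * (modSq n : ℝ) : ℝ) : ℂ) * Complex.I) := by
    rw [← Complex.exp_add, ← Complex.exp_add, ← Complex.exp_add, phase_eq]
    congr 1; push_cast; ring
  rw [← e]; ring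

lemma CX.expFactor_mul {s p : ℝ} (hp : 0 < p) {S : Set ℝ} {g : ℝ → Freq → ℂ} (hg : CX s p S g) :
    CX s p S (fun t n => expFactor t n * g t n) :=
  hg.mul_phase hp (fun t n => by rw [← ofReal_norm, norm_expFactor, ENNReal.ofReal_one])
    fun n => (continuous_expFactor n).continuousOn

lemma CX.propagator_mul {s p : ℝ} (hp : 0 < p) {S : Set ℝ} {g : ℝ → Freq → ℂ} (hg : CX s p S g) :
    CX s p S (fun t n => propagator t n * g t n) :=
  hg.mul_phase hp (fun t n => by rw [← ofReal_norm, norm_propagator, ENNReal.ofReal_one])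
    fun n => by unfold propagator; fun_prop

/-- The Duhamel formulation is equivalent to the equation in the interaction representation. -/
lemma Admissible.isSolution_iff {s q : ℝ} {P : ℝ≥0∞} [Fact (1 ≤ P)] (h : Admissible s P.toReal q)
    {ε T : ℝ} (hT : 0 ≤ T) (u₀ : FL s P) (u : ℝ → FL s P) :
    IsSolution ε T u₀ u ↔ ContinuousOn u (Icc 0 T) ∧ u 0 = u₀ ∧
      InteractionEq (ε * Complex.I) T 2 (fun t n => expFactor t n * (u t).hat n) := by
  have hP := h.holder.pos
  have hX : ∀ f : FL s P, eX s P.toReal f.hat ≠ ∞ := eX_hat_ne_top hP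
  have hrhs : ∀ t n, nonlin t (fun n => expFactor t n * (u t).hat n)
      (fun n => expFactor t n * (u t).hat n) (fun n => expFactor t n * (u t).hat n) n +
      ((2 * mass (fun n => expFactor t n * (u t).hat n) : ℝ) : ℂ) * (expFactor t n * (u t).hat n) =
      expFactor t n * full 0 (u t).hat n := by
    intro t n
    have h1 : eX s P.toReal (fun n => expFactor t n * (u t).hat n) ≠ ∞ :=
      ne_top_of_le_ne_top (hX (u t)) (eX_mono hP.le fun n => by
        rw [enorm_mul, ← ofReal_norm (expFactor t n), norm_expFactor, ENNReal.ofReal_one, one_mul])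
    rw [← full_expFactor, h.full_eq t h1 n]
    push_cast; ring
  have hduh : ∀ t n, u 0 = u₀ → (((u t).hat n = propagator t n * u₀.hat n + ε * Complex.I *
        ∫ t' in (0 : ℝ)..t, propagator (t - t') n * full 0 (u t').hat n) ↔
      expFactor t n * (u t).hat n = expFactor 0 n * (u 0).hat n + ε * Complex.I *
        ∫ t' in (0 : ℝ)..t, expFactor t' n * full 0 (u t').hat n) := by
    intro t n h0
    have h1 : expFactor t n * propagator t n = 1 := by
      rw [mul_comm]; exact propagator_mul_expFactor t n
    have hne : expFactor t n ≠ 0 := Complex.exp_ne_zero _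
    simp only [propagator_sub, mul_assoc (propagator t n), intervalIntegral.integral_const_mul,
      expFactor_zero, h0]
    rw [← mul_right_inj' hne]
    have e : ∀ a b : ℂ, expFactor t n * (propagator t n * a + ε * Complex.I *
        (propagator t n * b)) = 1 * a + ε * Complex.I * b := by
      intro a b
      linear_combination (a + ε * Complex.I * b) * h1
    rw [e]
  constructor
  · rintro ⟨hc, h0, U, hU, hd⟩
    refine ⟨hc, h0, fun t ht n => ?_⟩
    simp only [hrhs]
    refine (hduh t n h0).mp (((hd n).2 t ht).trans ?_)
    congr 2
    refine intervalIntegral.integral_congr fun t' ht' => ?_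
    rw [uIcc_of_le ht.1] at ht'
    simp only [h.coeff_cubic (hX _) (hU t' ⟨ht'.1, ht'.2.trans ht.2⟩)]
  · rintro ⟨hc, h0, hI⟩
    choose U hU _ using fun t => h.exists_isL3Function (hX (u t))
    refine ⟨hc, h0, U, fun t _ => hU t, fun n => ?_⟩
    simp only [fun t => h.coeff_cubic (hX (u t)) (hU t)]
    refine ⟨ContinuousOn.intervalIntegrable ?_, fun t ht => (hduh t n h0).mpr ?_⟩
    · rw [uIcc_of_le hT]
      have hcx := (continuousOn_iff_CX hP u).mp hc
      -- Both time coefficients are zero because `full 0` contains no oscillating phases.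
      have h2 := h.continuousOn_nonlin hcx 0 0 n
      simp only [zero_mul, add_zero] at h2
      refine ContinuousOn.congr (h2.add (((continuousOn_const (c := (2 : ℂ))).mul
        (Complex.continuous_ofReal.comp_continuousOn (h.continuousOn_mass hcx))).mul
        (hcx.continuousOn_apply hP n))) fun t _ => ?_
      exact h.full_eq 0 (hX (u t)) n
    · have h3 := hI t ht n
      simp only [hrhs] at h3
      exact h3

/-- Existence and uniqueness are transported by the unimodular multipliers `propagator` and
`expFactor`, which preserve continuity in time with values in the space. -/
lemma Admissible.unconditionallyLocallyWellPosed {s q : ℝ} {P : ℝ≥0∞} [Fact (1 ≤ P)]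
    (h : Admissible s P.toReal q) {ε : ℝ} (hε : ε = 1 ∨ ε = -1) :
    UnconditionallyLocallyWellPosed ε s P := by
  have hP := h.holder.pos
  have hc : ‖(ε * Complex.I : ℂ)‖ₑ = 1 := by
    rw [← ofReal_norm, norm_mul, Complex.norm_I, mul_one, Complex.norm_real]
    rcases hε with rfl | rfl <;> simp
  intro u₀
  obtain ⟨T, hT, y, hy, hy0, hyeq⟩ := h.exists_interactionEq hc (eX_hat_ne_top hP u₀)
  have h0T : (0 : ℝ) ∈ Icc 0 T := ⟨le_rfl, hT.le⟩
  obtain ⟨u, hu, huy⟩ := (hy.propagator_mul hP).exists_lift hP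
  have hE : ∀ t ∈ Icc 0 T, (fun n => expFactor t n * (u t).hat n) = y t := by
    intro t ht
    ext n
    simp only [huy t ht, ← mul_assoc]
    rw [mul_comm (expFactor t n), propagator_mul_expFactor, one_mul]
  have hu0 : u 0 = u₀ := by
    apply hat_injective
    rw [← hy0, ← hE 0 h0T]
    ext n; simp only [expFactor_zero, one_mul]
  have hueq := hyeq.congr hE
  refine ⟨T, hT, u, (h.isSolution_iff hT.le u₀ u).mpr ⟨hu, hu0, hueq⟩, fun v hv t ht => ?_⟩
  obtain ⟨hvc, hv0, hveq⟩ := (h.isSolution_iff hT.le u₀ v).mp hv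
  have h1 := h.interactionEq_unique hc (((continuousOn_iff_CX hP v).mp hvc).expFactor_mul hP)
    (((continuousOn_iff_CX hP u).mp hu).expFactor_mul hP) hveq hueq
    (by simp only [hv0, hu0]) t ht
  apply hat_injective
  ext n
  exact mul_left_cancel₀ (Complex.exp_ne_zero _) (congrFun h1 n)

/-- The thresholds `1 - 1/p` and `4/3 - 2/p` meet at `p = 3`; below it the first is the larger one,
above it the second. So the assumed inequality always implies both, and `1 - 1/p = 1/q` turns the
first into `1 < s q`. -/
lemma exists_admissible {s : ℝ} {P : ℝ≥0∞} (hP1 : 1 < P) (hP : P < ∞)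
    (hs : (P ≤ 3 ∧ 1 - 1 / P.toReal < s) ∨ (3 ≤ P ∧ 4 / 3 - 2 / P.toReal < s)) :
    ∃ q, Admissible s P.toReal q := by
  obtain ⟨p, hp⟩ : ∃ p, p = P.toReal := ⟨_, rfl⟩
  have hp1 : 1 < p := by
    rw [hp]; exact (ENNReal.toReal_lt_toReal ENNReal.one_ne_top hP.ne).mpr hP1
  have hp0 : 0 < p := by linarith
  have hs2 : 1 - 1 / p < s ∧ 4 / 3 - 2 / p < s := by
    rcases hs with ⟨h3, h⟩ | ⟨h3, h⟩
    · have h4 : p ≤ 3 := by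
        rw [hp]; exact (ENNReal.toReal_le_toReal hP.ne (by norm_num)).mpr h3
      rw [← hp] at h
      refine ⟨h, lt_of_le_of_lt ?_ h⟩
      have : 1 / 3 ≤ 1 / p := one_div_le_one_div_of_le hp0 h4
      have e : 2 / p = 2 * (1 / p) := by ring
      rw [e]; linarith
    · have h4 : 3 ≤ p := by
        rw [hp]; exact (ENNReal.toReal_le_toReal (by norm_num) hP.ne).mpr h3
      rw [← hp] at h
      refine ⟨lt_of_le_of_lt ?_ h, h⟩
      have : 1 / p ≤ 1 / 3 := one_div_le_one_div_of_le (by norm_num) h4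
      have e : 2 / p = 2 * (1 / p) := by ring
      rw [e]; linarith
  have hpq := Real.HolderConjugate.conjExponent hp1
  rw [← hp]
  have hpos : 0 < 1 - 1 / p := by
    rw [sub_pos, div_lt_one hp0]; exact hp1
  refine ⟨_, hpq, hpos.trans hs2.1, ?_, hs2.2⟩
  have h5 := hpq.symm.pos
  have h6 : 1 - 1 / p = (p.conjExponent)⁻¹ := by
    rw [one_div, ← hpq.inv_add_inv_eq_one]; ring
  rw [h6] at hs2
  calc 1 = (p.conjExponent)⁻¹ * p.conjExponent := (inv_mul_cancel₀ h5.ne').symm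
    _ < _ := mul_lt_mul_of_pos_right hs2.1 h5

/-! ### Sharpness: a Fejér kernel test for membership in `L³` -/

/-- The square of frequencies `[0, 2^a)²`. -/
def quad (a : ℕ) : Finset Freq := Fintype.piFinset fun _ => Finset.Ico (0 : ℤ) (2 ^ a)

lemma card_quad (a : ℕ) : (quad a).card = 4 ^ a := by
  rw [quad, Fintype.card_piFinset]
  simp only [Int.card_Ico, sub_zero, Finset.prod_const, Finset.card_univ, Fintype.card_fin]
  have : ((2 : ℤ) ^ a).toNat = 2 ^ a := by
    have h : ((2 : ℤ) ^ a) = ((2 ^ a : ℕ) : ℤ) := by push_cast; rfl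
    rw [h, Int.toNat_natCast]
  rw [this, ← pow_mul, mul_comm, pow_mul]; norm_num

/-- The Dirichlet kernel of the square `[0, 2^a)²`. -/
def dirichlet (a : ℕ) (x : Torus) : ℂ := trig (quad a) (fun _ => 1) x

/-- The Fejér kernel of the square `[0, 2^a)²`. -/
def fejer (a : ℕ) (x : Torus) : ℝ≥0∞ := ‖dirichlet a x‖ₑ ^ 2 / 4 ^ a

lemma continuous_dirichlet (a : ℕ) : Continuous (dirichlet a) := continuous_trig _ _

lemma measurable_fejer (a : ℕ) : Measurable (fejer a) :=
  ((continuous_dirichlet a).measurable.enorm.pow_const 2).div_const _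

lemma four_pow_ne_zero (a : ℕ) : (4 : ℝ≥0∞) ^ a ≠ 0 := pow_ne_zero _ (by norm_num)

lemma four_pow_ne_top (a : ℕ) : (4 : ℝ≥0∞) ^ a ≠ ∞ := ENNReal.pow_ne_top (by norm_num)

lemma lintegral_fejer (a : ℕ) : ∫⁻ x, fejer a x ∂torusMeasure = 1 := by
  unfold fejer dirichlet
  simp only [div_eq_mul_inv]
  rw [lintegral_mul_const _ ((continuous_trig _ _).measurable.enorm.pow_const 2),
    lintegral_trig_sq]
  simp only [enorm_one, one_pow, Finset.sum_const, card_quad, nsmul_eq_mul, mul_one]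
  push_cast
  exact ENNReal.mul_inv_cancel (four_pow_ne_zero a) (four_pow_ne_top a)

lemma fejer_le (a : ℕ) (x : Torus) : fejer a x ≤ 4 ^ a := by
  have h : ‖dirichlet a x‖ₑ ≤ 4 ^ a := by
    refine (enorm_sum_le _ _).trans (le_of_eq ?_)
    simp [enorm_ch, card_quad]
  unfold fejer
  rw [ENNReal.div_le_iff (four_pow_ne_zero a) (four_pow_ne_top a), ← sq]
  gcongr

/-- The kernel of lower order is at most `4 ^ min a b`, and the other has mass one. -/
lemma lintegral_fejer_mul_le (a b : ℕ) :
    ∫⁻ x, fejer a x * fejer b x ∂torusMeasure ≤ 4 ^ min a b := by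
  wlog hab : a ≤ b generalizing a b
  · have := this b a (le_of_not_ge hab)
    rw [min_comm]
    simpa only [mul_comm] using this
  rw [min_eq_left hab]
  calc _ ≤ ∫⁻ x, 4 ^ a * fejer b x ∂torusMeasure :=
        lintegral_mono fun x => mul_le_mul_left (fejer_le a x) _
    _ = 4 ^ a := by rw [lintegral_const_mul _ (measurable_fejer b), lintegral_fejer, mul_one]

/-- Cauchy–Schwarz, with one square root of `fejer a` split off; that factor has mass one. -/
lemma lintegral_fejer_mul_sqrt_le (a b : ℕ) :
    ∫⁻ x, fejer a x * fejer b x ^ (1 / 2 : ℝ) ∂torusMeasure ≤ 2 ^ min a b := by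
  have h := ENNReal.lintegral_mul_le_Lp_mul_Lq torusMeasure Real.HolderConjugate.two_two
    (f := fun x => fejer a x ^ (1 / 2 : ℝ)) (g := fun x => (fejer a x * fejer b x) ^ (1 / 2 : ℝ))
    ((measurable_fejer a).pow_const _).aemeasurable
    (((measurable_fejer a).mul (measurable_fejer b)).pow_const _).aemeasurable
  have e : ∀ x : ℝ≥0∞, (x ^ (1 / 2 : ℝ)) ^ (2 : ℝ) = x := fun x => by
    rw [← ENNReal.rpow_mul]; norm_num
  simp only [e, lintegral_fejer, ENNReal.one_rpow, one_mul] at h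
  have e2 : ∀ x, fejer a x * fejer b x ^ (1 / 2 : ℝ) =
      ((fun x => fejer a x ^ (1 / 2 : ℝ)) * fun x => (fejer a x * fejer b x) ^ (1 / 2 : ℝ)) x := by
    intro x
    simp only [Pi.mul_apply]
    rw [ENNReal.mul_rpow_of_nonneg _ _ (by norm_num), ← mul_assoc,
      ← ENNReal.rpow_add_of_nonneg _ _ (by norm_num) (by norm_num)]
    norm_num
  rw [lintegral_congr e2]
  refine h.trans ((ENNReal.rpow_le_rpow (lintegral_fejer_mul_le a b) (by norm_num)).trans
    (le_of_eq ?_))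
  have e4 : (4 : ℝ≥0∞) ^ min a b = (2 ^ min a b) ^ (2 : ℝ) := by
    rw [← ENNReal.rpow_natCast 2, ← ENNReal.rpow_mul, mul_comm, ENNReal.rpow_mul,
      ENNReal.rpow_natCast]
    norm_num
  rw [e4, ← ENNReal.rpow_mul]
  norm_num

/-! ### The test function and its norm in `L^{3/2}` -/

/-- The weights of the test function. -/
def testWeight (a : ℕ) : ℝ := (2 : ℝ) ^ (-(2 / 3 * a : ℝ)) * ((a : ℝ) + 1) ^ (-(2 / 3) : ℝ)

lemma testWeight_pos (a : ℕ) : 0 < testWeight a := by unfold testWeight; positivity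

/-- The test function. -/
def testFun (A : ℕ) (x : Torus) : ℝ≥0∞ :=
  ∑ a ∈ Finset.range A, ENNReal.ofReal (testWeight a) * fejer a x

lemma measurable_testFun (A : ℕ) : Measurable (testFun A) :=
  Finset.measurable_fun_sum _ fun a _ => (measurable_fejer a).const_mul _

lemma rpow_sum_le_sum_rpow {ι : Type*} (S : Finset ι) (f : ι → ℝ≥0∞) {r : ℝ} (h0 : 0 < r)
    (h1 : r ≤ 1) : (∑ i ∈ S, f i) ^ r ≤ ∑ i ∈ S, f i ^ r := by
  classical
  induction S using Finset.induction_on with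
  | empty => simp [ENNReal.zero_rpow_of_pos h0]
  | insert a S ha ih =>
    rw [Finset.sum_insert ha, Finset.sum_insert ha]
    exact (ENNReal.rpow_add_le_add_rpow _ _ h0.le h1).trans (add_le_add le_rfl ih)

/-- The harmonic numbers. -/
def harm (A : ℕ) : ℝ := ∑ a ∈ Finset.range A, 1 / ((a : ℝ) + 1)

/-- The powers of two balance on the diagonal and decay at least like `2^{-|a - b|/3}` off it. The
remaining factors are separated by the weighted inequality of arithmetic and geometric means, with
weights `2/3` and `1/3`. -/
lemma testWeight_mul_le (a b : ℕ) :
    testWeight a * testWeight b ^ (1 / 2 : ℝ) * 2 ^ min a b ≤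
      ((2 : ℝ) ^ (-(1 / 3) : ℝ)) ^ ((a : ℤ) - b).natAbs * (1 / ((a : ℝ) + 1) + 1 / ((b : ℝ) + 1)) := by
  have ha : (0 : ℝ) < (a : ℝ) + 1 := by positivity
  have hb : (0 : ℝ) < (b : ℝ) + 1 := by positivity
  have h1 : ((a : ℝ) + 1) ^ (-(2 / 3) : ℝ) * ((b : ℝ) + 1) ^ (-(1 / 3) : ℝ) ≤
      1 / ((a : ℝ) + 1) + 1 / ((b : ℝ) + 1) := by
    have h := Real.geom_mean_le_arith_mean2_weighted (w₁ := 2 / 3) (w₂ := 1 / 3) (by norm_num)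
      (by norm_num) (one_div_pos.mpr ha).le (one_div_pos.mpr hb).le (by norm_num)
    rw [one_div, one_div ((b : ℝ) + 1), Real.inv_rpow ha.le, Real.inv_rpow hb.le,
      ← Real.rpow_neg ha.le, ← Real.rpow_neg hb.le] at h
    have := inv_pos.mpr ha
    have := inv_pos.mpr hb
    rw [one_div ((a : ℝ) + 1), one_div ((b : ℝ) + 1)]
    linarith
  have h2 : (2 : ℝ) ^ (-(2 / 3 * a : ℝ)) * 2 ^ (-(1 / 3 * b : ℝ)) * 2 ^ min a b ≤
      ((2 : ℝ) ^ (-(1 / 3) : ℝ)) ^ ((a : ℤ) - b).natAbs := by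
    rw [← Real.rpow_natCast, ← Real.rpow_natCast, ← Real.rpow_mul (by norm_num),
      ← Real.rpow_add (by norm_num), ← Real.rpow_add (by norm_num)]
    refine Real.rpow_le_rpow_of_exponent_le (by norm_num) ?_
    rcases le_total a b with hab | hab
    · have e : ((((a : ℤ) - b).natAbs : ℕ) : ℝ) = b - a := by
        rw [show ((a : ℤ) - b).natAbs = b - a by omega, Nat.cast_sub hab]
      rw [e, min_eq_left hab]
      linarith
    · have e : ((((a : ℤ) - b).natAbs : ℕ) : ℝ) = a - b := by
        rw [show ((a : ℤ) - b).natAbs = a - b by omega, Nat.cast_sub hab]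
      have h : (b : ℝ) ≤ a := by exact_mod_cast hab
      rw [e, min_eq_right hab]
      linarith
  have h3 : testWeight b ^ (1 / 2 : ℝ) =
      2 ^ (-(1 / 3 * b : ℝ)) * ((b : ℝ) + 1) ^ (-(1 / 3) : ℝ) := by
    rw [testWeight, Real.mul_rpow (by positivity) (by positivity), ← Real.rpow_mul (by norm_num),
      ← Real.rpow_mul hb.le]
    congr 2 <;> ring
  calc _ = (2 : ℝ) ^ (-(2 / 3 * a : ℝ)) * 2 ^ (-(1 / 3 * b : ℝ)) * 2 ^ min a b *
        (((a : ℝ) + 1) ^ (-(2 / 3) : ℝ) * ((b : ℝ) + 1) ^ (-(1 / 3) : ℝ)) := by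
        rw [h3, testWeight]; ring
    _ ≤ _ := mul_le_mul h2 h1 (by positivity) (by positivity)

/-- The decay off the diagonal is summable, so the double sum is comparable with a sum of `1 / (a +
1)`. -/
lemma exists_sum_testWeight_le : ∃ C : ℝ, 0 ≤ C ∧ ∀ A : ℕ,
    ∑ a ∈ Finset.range A, ∑ b ∈ Finset.range A,
      testWeight a * testWeight b ^ (1 / 2 : ℝ) * 2 ^ min a b ≤ C * harm A := by
  obtain ⟨r, hr, hr0⟩ : ∃ r : ℝ, r = (2 : ℝ) ^ (-(1 / 3) : ℝ) ∧ 0 ≤ r := ⟨_, rfl, by positivity⟩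
  have hr1 : r < 1 := by
    rw [hr]; exact Real.rpow_lt_one_of_one_lt_of_neg (by norm_num) (by norm_num)
  have hS : Summable fun k : ℤ => r ^ k.natAbs := by
    refine Summable.of_nat_of_neg ?_ ?_ <;>
    simpa using summable_geometric_of_lt_one hr0 hr1
  have hsum : ∀ (A a : ℕ), ∑ b ∈ Finset.range A, r ^ ((a : ℤ) - b).natAbs ≤
      ∑' k : ℤ, r ^ k.natAbs := by
    intro A a
    have hinj : Function.Injective fun b : ℕ => (a : ℤ) - b := fun b b' h => by
      simp only [] at h; omega
    calc _ = ∑ k ∈ (Finset.range A).map ⟨_, hinj⟩, r ^ k.natAbs := by simp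
      _ ≤ _ := hS.sum_le_tsum _ fun k _ => by positivity
  have hS0 : 0 ≤ ∑' k : ℤ, r ^ k.natAbs := tsum_nonneg fun k => by positivity
  refine ⟨2 * ∑' k : ℤ, r ^ k.natAbs, by positivity, fun A => ?_⟩
  have h1 : ∑ a ∈ Finset.range A, ∑ b ∈ Finset.range A,
      r ^ ((a : ℤ) - b).natAbs * (1 / ((a : ℝ) + 1)) ≤ (∑' k : ℤ, r ^ k.natAbs) * harm A := by
    rw [harm, Finset.mul_sum]
    refine Finset.sum_le_sum fun a _ => ?_
    rw [← Finset.sum_mul]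
    exact mul_le_mul_of_nonneg_right (hsum A a) (by positivity)
  have h2 : ∑ a ∈ Finset.range A, ∑ b ∈ Finset.range A,
      r ^ ((a : ℤ) - b).natAbs * (1 / ((b : ℝ) + 1)) =
      ∑ a ∈ Finset.range A, ∑ b ∈ Finset.range A,
        r ^ ((a : ℤ) - b).natAbs * (1 / ((a : ℝ) + 1)) := by
    rw [Finset.sum_comm]
    refine Finset.sum_congr rfl fun a _ => Finset.sum_congr rfl fun b _ => ?_
    rw [show ((a : ℤ) - b).natAbs = ((b : ℤ) - a).natAbs by omega]
  calc _ ≤ ∑ a ∈ Finset.range A, ∑ b ∈ Finset.range A,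
        r ^ ((a : ℤ) - b).natAbs * (1 / ((a : ℝ) + 1) + 1 / ((b : ℝ) + 1)) := by
        rw [hr]
        exact Finset.sum_le_sum fun a _ => Finset.sum_le_sum fun b _ => testWeight_mul_le a b
    _ ≤ _ := by
        simp only [mul_add, Finset.sum_add_distrib]
        rw [h2]; linarith

/-- Write the power `3/2` as the function times its square root and use subadditivity of the square
root; the integrals left are those of `fejer a * fejer b ^ (1 / 2)`. -/
lemma exists_lintegral_testFun_le : ∃ C : ℝ, 0 ≤ C ∧ ∀ A : ℕ,
    ∫⁻ x, testFun A x ^ (3 / 2 : ℝ) ∂torusMeasure ≤ ENNReal.ofReal (C * harm A) := by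
  obtain ⟨C, hC, h⟩ := exists_sum_testWeight_le
  refine ⟨C, hC, fun A => ?_⟩
  have hpt : ∀ x, testFun A x ^ (3 / 2 : ℝ) ≤ ∑ a ∈ Finset.range A, ∑ b ∈ Finset.range A,
      ENNReal.ofReal (testWeight a * testWeight b ^ (1 / 2 : ℝ)) *
        (fejer a x * fejer b x ^ (1 / 2 : ℝ)) := by
    intro x
    calc testFun A x ^ (3 / 2 : ℝ) = testFun A x * testFun A x ^ (1 / 2 : ℝ) := by
          nth_rewrite 2 [← ENNReal.rpow_one (testFun A x)]
          rw [← ENNReal.rpow_add_of_nonneg _ _ (by norm_num) (by norm_num)]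
          norm_num
      _ ≤ testFun A x * ∑ b ∈ Finset.range A,
            (ENNReal.ofReal (testWeight b) * fejer b x) ^ (1 / 2 : ℝ) :=
          mul_le_mul_right (rpow_sum_le_sum_rpow _ _ (by norm_num) (by norm_num)) _
      _ = _ := by
          rw [testFun, Finset.sum_mul_sum]
          refine Finset.sum_congr rfl fun a _ => Finset.sum_congr rfl fun b _ => ?_
          rw [ENNReal.mul_rpow_of_nonneg _ _ (by norm_num),
            ENNReal.ofReal_rpow_of_pos (testWeight_pos b), ENNReal.ofReal_mul (testWeight_pos a).le]
          ring
  have hm : ∀ a b, Measurable fun x => fejer a x * fejer b x ^ (1 / 2 : ℝ) := fun a b =>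
    (measurable_fejer a).mul ((measurable_fejer b).pow_const _)
  refine (lintegral_mono hpt).trans ?_
  rw [lintegral_finsetSum _ fun a _ => Finset.measurable_fun_sum _ fun b _ => (hm a b).const_mul _]
  refine le_trans ?_ (ENNReal.ofReal_le_ofReal (h A))
  have hw : ∀ a b, 0 ≤ testWeight a * testWeight b ^ (1 / 2 : ℝ) := fun a b =>
    mul_nonneg (testWeight_pos a).le (Real.rpow_nonneg (testWeight_pos b).le _)
  rw [ENNReal.ofReal_sum_of_nonneg fun a _ => Finset.sum_nonneg fun b _ =>
    mul_nonneg (hw a b) (by positivity)]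
  refine Finset.sum_le_sum fun a _ => ?_
  rw [lintegral_finsetSum _ fun b _ => (hm a b).const_mul _,
    ENNReal.ofReal_sum_of_nonneg fun b _ => mul_nonneg (hw a b) (by positivity)]
  refine Finset.sum_le_sum fun b _ => ?_
  rw [lintegral_const_mul _ (hm a b), ENNReal.ofReal_mul (hw a b), ENNReal.ofReal_pow (by norm_num),
    ENNReal.ofReal_ofNat]
  exact mul_le_mul_right (lintegral_fejer_mul_sqrt_le a b) _

/-! ### The counterexample and its pairing with the test function -/

/-- The Fourier coefficients of the counterexample, on the dyadic shell `k`. -/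
def profile (k : ℕ) : ℝ := (2 : ℝ) ^ (-(4 / 3 * k : ℝ)) * ((k : ℝ) + 1) ^ (-(1 / 3) : ℝ)

lemma profile_pos (k : ℕ) : 0 < profile k := by unfold profile; positivity

lemma profile_anti : Antitone profile := by
  intro a b hab
  have h : (a : ℝ) ≤ b := by exact_mod_cast hab
  unfold profile
  refine mul_le_mul (Real.rpow_le_rpow_of_exponent_le (by norm_num) (by linarith))
    (Real.rpow_le_rpow_of_nonpos (by positivity) (by linarith) (by norm_num)) (by positivity)
    (by positivity)

lemma testWeight_mul_profile (a : ℕ) : testWeight a * 4 ^ a * profile a = 1 / ((a : ℝ) + 1) := by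
  have ha : (0 : ℝ) < (a : ℝ) + 1 := by positivity
  have e4 : (4 : ℝ) ^ a = 2 ^ (2 * a : ℝ) := by
    rw [Real.rpow_mul (by norm_num), Real.rpow_natCast]; norm_num
  calc _ = ((2 : ℝ) ^ (-(2 / 3 * a : ℝ)) * 2 ^ (2 * a : ℝ) * 2 ^ (-(4 / 3 * a : ℝ))) *
        (((a : ℝ) + 1) ^ (-(2 / 3) : ℝ) * ((a : ℝ) + 1) ^ (-(1 / 3) : ℝ)) := by
        rw [testWeight, profile, e4]; ring
    _ = 1 * ((a : ℝ) + 1) ^ (-1 : ℝ) := by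
        rw [← Real.rpow_add (by norm_num), ← Real.rpow_add (by norm_num), ← Real.rpow_add ha]
        congr 1
        · rw [show -(2 / 3 * a : ℝ) + 2 * a + -(4 / 3 * a) = 0 by ring, Real.rpow_zero]
        · norm_num
    _ = _ := by rw [Real.rpow_neg_one, one_mul, one_div]

/-- The counterexample. -/
def counterexample (n : Freq) : ℂ := (profile (shellIndex n) : ℂ)

/-- Differences of points of the square are shorter than `√2 · 2^a < 2^{a + 1}`. -/
lemma shellIndex_sub_le {a : ℕ} {m n : Freq} (hm : m ∈ quad a) (hn : n ∈ quad a) :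
    shellIndex (m - n) ≤ a := by
  rw [quad, Fintype.mem_piFinset] at hm hn
  have hi : ∀ i, ((m i : ℝ) - n i) ^ 2 < (2 ^ a) ^ 2 := by
    intro i
    have h1 := Finset.mem_Ico.mp (hm i)
    have h2 := Finset.mem_Ico.mp (hn i)
    have h3 : |(m i : ℤ) - n i| < 2 ^ a := abs_sub_lt_iff.mpr ⟨by linarith, by linarith⟩
    have h4 : |((m i : ℝ) - n i)| < 2 ^ a := by exact_mod_cast h3
    rw [← sq_abs]
    exact pow_lt_pow_left₀ h4 (abs_nonneg _) two_ne_zero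
  have hlen : length (m - n) < 2 ^ (a + 1) := by
    rw [length, Real.sqrt_lt' (by positivity)]
    have := hi 0
    have := hi 1
    simp only [modSq, Pi.sub_apply]
    push_cast
    have e : ((2 : ℝ) ^ (a + 1)) ^ 2 = 4 * (2 ^ a) ^ 2 := by ring
    have : (0 : ℝ) < (2 ^ a) ^ 2 := by positivity
    linarith
  have h5 : ⌊length (m - n)⌋₊ < 2 ^ (a + 1) := by
    rw [Nat.floor_lt (show 0 ≤ length (m - n) from Real.sqrt_nonneg _)]
    exact_mod_cast hlen
  exact Nat.lt_succ_iff.mp (Nat.log_lt_of_lt_pow' (Nat.succ_ne_zero a) h5)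

lemma integral_mul_dirichlet {F : Torus → ℂ} (hF : Integrable F torusMeasure) (a : ℕ) :
    Integrable (fun x => F x * dirichlet a x * conj (dirichlet a x)) torusMeasure ∧
    ∫ x, F x * dirichlet a x * conj (dirichlet a x) ∂torusMeasure =
      ∑ n ∈ quad a, ∑ m ∈ quad a, coeff F (n - m) := by
  have hb : ∀ x, ‖dirichlet a x‖ ≤ 4 ^ a := fun x => by
    refine (norm_sum_le _ _).trans (le_of_eq ?_)
    simp [norm_ch, card_quad]
  have hm := (continuous_dirichlet a).aestronglyMeasurable (μ := torusMeasure)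
  have hFD : Integrable (fun x => F x * dirichlet a x) torusMeasure :=
    hF.mul_bdd hm (Eventually.of_forall hb)
  refine ⟨hFD.mul_bdd (Complex.continuous_conj.comp_aestronglyMeasurable hm)
    (Eventually.of_forall fun x => by rw [RCLike.norm_conj]; exact hb x), ?_⟩
  rw [show (fun x => F x * dirichlet a x * conj (dirichlet a x)) =
    fun x => F x * dirichlet a x * conj (trig (quad a) (fun _ => 1) x) from rfl,
    integral_mul_conj_trig hFD]
  refine Finset.sum_congr rfl fun n _ => ?_
  rw [map_one, mul_one, coeff_eq]
  have e : ∀ x, F x * dirichlet a x * ch (-n) x = ∑ m ∈ quad a, F x * ch (-(n - m)) x := by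
    intro x
    rw [dirichlet, trig, mul_assoc, Finset.sum_mul, Finset.mul_sum]
    refine Finset.sum_congr rfl fun m _ => ?_
    rw [one_mul, ← ch_add, show m + -n = -(n - m) by abel]
  simp only [e]
  rw [integral_finsetSum _ fun m _ => hF.mul_bdd (ch _).continuous.aestronglyMeasurable
    (Eventually.of_forall fun x => (norm_ch _ x).le)]
  rfl

/-- Pairing `F` with `|dirichlet a|²` sums its coefficients over the differences of all `16^a` pairs
of points of the square, and each of them is at least `profile a` by monotonicity. The test weights
make the contribution of scale `a` at least `1 / (a + 1)`. -/
lemma ofReal_harm_le {F : Torus → ℂ} (hF : IsL3Function counterexample F) (A : ℕ) :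
    ENNReal.ofReal (harm A) ≤ ∫⁻ x, ‖F x‖ₑ * testFun A x ∂torusMeasure := by
  have hFi := MemLp_three_integrable hF.1
  obtain ⟨S, hS⟩ : ∃ S : ℕ → ℝ, ∀ a, S a =
      ∑ n ∈ quad a, ∑ m ∈ quad a, profile (shellIndex (n - m)) := ⟨_, fun _ => rfl⟩
  have hint : ∫ x, ∑ a ∈ Finset.range A, ((testWeight a / 4 ^ a : ℝ) : ℂ) *
      (F x * dirichlet a x * conj (dirichlet a x)) ∂torusMeasure =
      ((∑ a ∈ Finset.range A, testWeight a / 4 ^ a * S a : ℝ) : ℂ) := by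
    rw [integral_finsetSum _ fun a _ => (integral_mul_dirichlet hFi a).1.const_mul _,
      Complex.ofReal_sum]
    refine Finset.sum_congr rfl fun a _ => ?_
    rw [integral_const_mul, (integral_mul_dirichlet hFi a).2, hS, Complex.ofReal_mul]
    congr 1
    push_cast
    exact Finset.sum_congr rfl fun n _ => Finset.sum_congr rfl fun m _ => hF.2 _
  have hlow : harm A ≤ ∑ a ∈ Finset.range A, testWeight a / 4 ^ a * S a := by
    refine Finset.sum_le_sum fun a _ => ?_
    have h1 : (4 : ℝ) ^ a * (4 ^ a * profile a) ≤ S a := by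
      rw [hS]
      calc (4 : ℝ) ^ a * (4 ^ a * profile a) = ∑ n ∈ quad a, ∑ m ∈ quad a, profile a := by
            simp [card_quad]
        _ ≤ _ := Finset.sum_le_sum fun n hn => Finset.sum_le_sum fun m hm =>
            profile_anti (shellIndex_sub_le hn hm)
    have h4 : (0 : ℝ) < 4 ^ a := by positivity
    calc 1 / ((a : ℝ) + 1) = testWeight a / 4 ^ a * (4 ^ a * (4 ^ a * profile a)) := by
          rw [← testWeight_mul_profile]; field_simp
      _ ≤ _ := mul_le_mul_of_nonneg_left h1 (div_pos (testWeight_pos a) h4).le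
  have hharm : 0 ≤ harm A := Finset.sum_nonneg fun a _ => by positivity
  calc ENNReal.ofReal (harm A)
      ≤ ‖((∑ a ∈ Finset.range A, testWeight a / 4 ^ a * S a : ℝ) : ℂ)‖ₑ := by
        rw [← ofReal_norm, Complex.norm_real, Real.norm_of_nonneg (hharm.trans hlow)]
        exact ENNReal.ofReal_le_ofReal hlow
    _ ≤ ∫⁻ x, ‖∑ a ∈ Finset.range A, ((testWeight a / 4 ^ a : ℝ) : ℂ) *
          (F x * dirichlet a x * conj (dirichlet a x))‖ₑ ∂torusMeasure := by
        rw [← hint]; exact enorm_integral_le_lintegral_enorm _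
    _ ≤ _ := by
        refine lintegral_mono fun x => (enorm_sum_le _ _).trans (le_of_eq ?_)
        rw [testFun, Finset.mul_sum]
        refine Finset.sum_congr rfl fun a _ => ?_
        have e : ‖conj (dirichlet a x)‖ₑ = ‖dirichlet a x‖ₑ := by
          rw [← ofReal_norm, RCLike.norm_conj, ofReal_norm]
        have e2 : ‖((testWeight a / 4 ^ a : ℝ) : ℂ)‖ₑ = ENNReal.ofReal (testWeight a) / 4 ^ a := by
          rw [← ofReal_norm, Complex.norm_real, Real.norm_of_nonneg
            (div_nonneg (testWeight_pos a).le (by positivity)),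
            ENNReal.ofReal_div_of_pos (by positivity), ENNReal.ofReal_pow (by norm_num)]
          norm_num
        rw [enorm_mul, enorm_mul, enorm_mul, e, e2, fejer, div_eq_mul_inv, div_eq_mul_inv]
        ring

/-- Hölder gives `harm A ≤ ‖F‖₃ (C harm A)^{2/3}`, which would bound the harmonic numbers. -/
lemma not_isL3Function_counterexample (F : Torus → ℂ) : ¬ IsL3Function counterexample F := by
  intro hF
  obtain ⟨C, hC, hb⟩ := exists_lintegral_testFun_le
  obtain ⟨L, hL⟩ : ∃ L, L = ∫⁻ x, ‖F x‖ₑ ^ (3 : ℝ) ∂torusMeasure := ⟨_, rfl⟩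
  have hLtop : L ≠ ∞ := by
    have := lintegral_rpow_enorm_lt_top_of_eLpNorm_lt_top (p := 3) (by norm_num) (by norm_num)
      hF.1.eLpNorm_lt_top
    rw [hL]
    simpa using this.ne
  have key : ∀ A, harm A ^ 3 ≤ L.toReal * (C * harm A) ^ 2 := by
    intro A
    have hharm : 0 ≤ harm A := Finset.sum_nonneg fun a _ => by positivity
    have h1 := ENNReal.lintegral_mul_le_Lp_mul_Lq torusMeasure (p := 3) (q := 3 / 2)
      (Real.holderConjugate_iff.mpr ⟨by norm_num, by norm_num⟩)
      (f := fun x => ‖F x‖ₑ) (g := testFun A) hF.1.1.enorm (measurable_testFun A).aemeasurable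
    have h2 := (ofReal_harm_le hF A).trans (h1.trans (mul_le_mul_right
      (ENNReal.rpow_le_rpow (hb A) (by norm_num)) _))
    rw [← hL] at h2
    have h3 := ENNReal.rpow_le_rpow h2 (z := 3) (by norm_num)
    rw [ENNReal.mul_rpow_of_nonneg _ _ (by norm_num), ← ENNReal.rpow_mul, ← ENNReal.rpow_mul,
      ENNReal.ofReal_rpow_of_nonneg hharm (by norm_num)] at h3
    norm_num at h3
    rw [← ENNReal.ofReal_toReal hLtop, ← ENNReal.ofReal_pow (by positivity),
      ← ENNReal.ofReal_mul ENNReal.toReal_nonneg] at h3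
    exact (ENNReal.ofReal_le_ofReal_iff (by positivity)).mp h3
  have hlim : Tendsto harm atTop atTop := Real.tendsto_sum_range_one_div_nat_succ_atTop
  obtain ⟨A, hA⟩ := (hlim.eventually (Filter.eventually_gt_atTop (L.toReal * C ^ 2))).exists
  have h0 : 0 ≤ L.toReal * C ^ 2 := by positivity
  have h1 : 0 < harm A ^ 2 := by have := h0.trans_lt hA; positivity
  have h2 := key A
  nlinarith

/-! ### Membership of the counterexample in the Fourier–Lebesgue space -/

lemma card_blk_le (k : ℕ) : ((blk k).card : ℝ) ≤ 25 * 4 ^ k := by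
  have h1 : (blk k).card ≤ (2 * 2 ^ (k + 1) + 1) ^ 2 := by
    refine (Finset.card_filter_le _ _).trans ?_
    rw [Fintype.card_piFinset]
    simp only [Int.card_Icc, Finset.prod_const, Finset.card_univ, Fintype.card_fin]
    refine Nat.pow_le_pow_left (le_of_eq ?_) 2
    have : ((2 : ℤ) ^ (k + 1) + 1 - -2 ^ (k + 1)) = ((2 * 2 ^ (k + 1) + 1 : ℕ) : ℤ) := by
      push_cast; ring
    rw [this, Int.toNat_natCast]
  calc ((blk k).card : ℝ) ≤ (2 * 2 ^ (k + 1) + 1) ^ 2 := by exact_mod_cast h1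
    _ ≤ (5 * 2 ^ k) ^ 2 := by
        have h2 : (1 : ℝ) ≤ 2 ^ k := one_le_pow₀ (by norm_num)
        have h3 : (2 : ℝ) ^ (k + 1) = 2 ^ k * 2 := pow_succ 2 k
        exact pow_le_pow_left₀ (by positivity) (by linarith) 2
    _ = _ := by rw [mul_pow, ← pow_mul, mul_comm k, pow_mul]; norm_num

lemma tsum_freq_eq_tsum_blk (h : Freq → ℝ≥0∞) : ∑' n, h n = ∑' k, ∑ n ∈ blk k, h n := by
  calc ∑' n, h n = ∑' n, ∑' k, if k = shellIndex n then h n else 0 :=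
        tsum_congr fun n => (tsum_ite_eq _ (fun _ => h n)).symm
    _ = ∑' k, ∑' n, if k = shellIndex n then h n else 0 := ENNReal.tsum_comm
    _ = _ := by
        refine tsum_congr fun k => ?_
        rw [tsum_eq_sum (s := blk k) fun n hn => if_neg fun h => hn ((mem_blk k n).mpr h.symm)]
        exact Finset.sum_congr rfl fun n hn => if_pos ((mem_blk k n).mp hn).symm

/-- A shell has at most `25 · 4^k` points, so it contributes at most a multiple of `2^{-kδ} (k +
1)^{-p/3}` with `δ = (4/3 - 2/p - s) p`. Below the critical `s` the geometric factor is summable. At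
the critical `s`, where `δ = 0`, the power of `k + 1` takes its place, and `p > 3` is what makes it
summable. -/
lemma eX_counterexample_ne_top {s p : ℝ} (hp : 3 ≤ p)
    (hs : s < 4 / 3 - 2 / p ∨ (3 < p ∧ s = 4 / 3 - 2 / p)) : eX s p counterexample ≠ ∞ := by
  have hp0 : 0 < p := by linarith
  obtain ⟨δ, hδ⟩ : ∃ δ, δ = 4 / 3 * p - 2 - s * p := ⟨_, rfl⟩
  have hδ' : δ = (4 / 3 - 2 / p - s) * p := by rw [hδ]; field_simp
  obtain ⟨T, hT⟩ : ∃ T : ℕ → ℝ, ∀ k, T k =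
      (2 : ℝ) ^ (-(k * δ)) * ((k : ℝ) + 1) ^ (-(p / 3)) := ⟨_, fun _ => rfl⟩
  have hT0 : ∀ k, 0 ≤ T k := fun k => by rw [hT]; positivity
  have hsum : Summable T := by
    rcases hs with h | ⟨h3, h⟩
    · have hδ0 : 0 < δ := by rw [hδ']; exact mul_pos (by linarith) hp0
      refine Summable.of_nonneg_of_le hT0 (fun k => ?_) (summable_geometric_of_lt_one
        (r := (2 : ℝ) ^ (-δ)) (by positivity)
        (Real.rpow_lt_one_of_one_lt_of_neg (by norm_num) (by linarith)))
      rw [hT, ← Real.rpow_natCast, ← Real.rpow_mul (by norm_num)]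
      rw [show -δ * (k : ℝ) = -(k * δ) by ring]
      refine mul_le_of_le_one_right (by positivity) ?_
      exact Real.rpow_le_one_of_one_le_of_nonpos (by linarith [Nat.cast_nonneg (α := ℝ) k])
        (by linarith)
    · have hδ0 : δ = 0 := by rw [hδ', h]; ring
      have h1 : Summable fun k : ℕ => ((k + 1 : ℕ) : ℝ) ^ (-(p / 3)) :=
        (summable_nat_add_iff (f := fun k : ℕ => (k : ℝ) ^ (-(p / 3))) 1).mpr
          (Real.summable_nat_rpow.mpr (by linarith))
      refine h1.congr fun k => ?_
      rw [hT, hδ0, mul_zero, neg_zero, Real.rpow_zero, one_mul]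
      push_cast; rfl
  have hterm : ∀ k, ∑ n ∈ blk k, (bw s n * ‖counterexample n‖ₑ) ^ p ≤
      ENNReal.ofReal (25 * (3 ^ |s|) ^ p * T k) := by
    intro k
    have h1 : ∀ n ∈ blk k, (bw s n * ‖counterexample n‖ₑ) ^ p ≤
        ENNReal.ofReal ((3 ^ |s| * (2 : ℝ) ^ (k * s) * profile k) ^ p) := by
      intro n hn
      have hb := bracket_pos n
      rw [counterexample, (mem_blk k n).mp hn, ← ofReal_norm, Complex.norm_real,
        Real.norm_of_nonneg (profile_pos k).le, bw, ← ENNReal.ofReal_mul (by positivity),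
        ENNReal.ofReal_rpow_of_nonneg (mul_nonneg (by positivity) (profile_pos k).le) hp0.le]
      refine ENNReal.ofReal_le_ofReal (Real.rpow_le_rpow
        (mul_nonneg (by positivity) (profile_pos k).le) ?_ hp0.le)
      exact mul_le_mul_of_nonneg_right (bracket_rpow_le_of_mem_blk hn s) (profile_pos k).le
    refine (Finset.sum_le_card_nsmul _ _ _ h1).trans ?_
    rw [nsmul_eq_mul, ← ENNReal.ofReal_natCast, ← ENNReal.ofReal_mul (by positivity)]
    apply ENNReal.ofReal_le_ofReal
    have hk : (0 : ℝ) < (k : ℝ) + 1 := by positivity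
    have e : (3 ^ |s| * (2 : ℝ) ^ (k * s) * profile k) ^ p =
        (3 ^ |s|) ^ p * (2 ^ (k * s * p + -(4 / 3 * k) * p) * ((k : ℝ) + 1) ^ (-(p / 3))) := by
      rw [profile, Real.mul_rpow (by positivity) (by positivity),
        Real.mul_rpow (by positivity) (by positivity), Real.mul_rpow (by positivity) (by positivity),
        Real.rpow_add (by norm_num), ← Real.rpow_mul (x := 2) (by norm_num),
        ← Real.rpow_mul (x := 2) (by norm_num), ← Real.rpow_mul hk.le,
        show -(1 / 3) * p = -(p / 3) by ring]
      ring
    have e4 : (4 : ℝ) ^ k = 2 ^ (2 * k : ℝ) := by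
      rw [Real.rpow_mul (by norm_num), Real.rpow_natCast]; norm_num
    calc _ ≤ 25 * 4 ^ k * (3 ^ |s| * (2 : ℝ) ^ (k * s) * profile k) ^ p :=
          mul_le_mul_of_nonneg_right (card_blk_le k)
            (Real.rpow_nonneg (mul_nonneg (by positivity) (profile_pos k).le) _)
      _ = 25 * (3 ^ |s|) ^ p * ((2 ^ (2 * k : ℝ) * 2 ^ (k * s * p + -(4 / 3 * k) * p)) *
            ((k : ℝ) + 1) ^ (-(p / 3))) := by rw [e, e4]; ring
      _ = _ := by
          rw [← Real.rpow_add (by norm_num), hT, hδ]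
          congr 3; ring
  rw [eX, tsum_freq_eq_tsum_blk]
  refine ne_top_of_le_ne_top ?_ (ENNReal.tsum_le_tsum hterm)
  exact (hsum.mul_left _).tsum_ofReal_ne_top

lemma exists_FL_not_isL3Function {s : ℝ} {P : ℝ≥0∞} (hP3 : 3 ≤ P) (hP : P < ∞)
    (hs : s < 4 / 3 - 2 / P.toReal ∨ (3 < P ∧ s = 4 / 3 - 2 / P.toReal)) :
    ∃ f : FL s P, ¬ ∃ F : Torus → ℂ, IsL3Function f.hat F := by
  have h3 : 3 ≤ P.toReal := by
    have := (ENNReal.toReal_le_toReal (by norm_num) hP.ne).mpr hP3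
    simpa using this
  have hs' : s < 4 / 3 - 2 / P.toReal ∨ (3 < P.toReal ∧ s = 4 / 3 - 2 / P.toReal) := by
    refine hs.imp_right fun h => ⟨?_, h.2⟩
    have := (ENNReal.toReal_lt_toReal (by norm_num) hP.ne).mpr h.1
    simpa using this
  obtain ⟨f, hf⟩ := exists_hat_eq (s := s) (by linarith) (eX_counterexample_ne_top h3 hs')
  refine ⟨f, ?_⟩
  rintro ⟨F, hF⟩
  rw [hf] at hF
  exact not_isL3Function_counterexample F hF

end EllipticNLS

end

theorem mainTheorem6 :
    EllipticNLS.CountingEstimate ∧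
    (∀ (ε s : ℝ) (p : ℝ≥0∞) [Fact (1 ≤ p)], (ε = 1 ∨ ε = -1) → 1 < p → p < ∞ →
      ((p ≤ 3 ∧ 1 - 1 / p.toReal < s) ∨ (3 ≤ p ∧ 4 / 3 - 2 / p.toReal < s)) →
      EllipticNLS.UnconditionallyLocallyWellPosed ε s p) ∧
    (∀ (s : ℝ) (p : ℝ≥0∞), 3 ≤ p → p < ∞ →
      (s < 4 / 3 - 2 / p.toReal ∨ (3 < p ∧ s = 4 / 3 - 2 / p.toReal)) →
      ∃ f : EllipticNLS.FL s p, ¬ ∃ F : EllipticNLS.Torus → ℂ,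
        EllipticNLS.IsL3Function f.hat F) := by
  refine ⟨EllipticNLS.countingEstimate, fun ε s p _ hε hp1 hp hs => ?_, fun s p hp3 hp hs =>
    EllipticNLS.exists_FL_not_isL3Function hp3 hp hs⟩
  obtain ⟨q, hq⟩ := EllipticNLS.exists_admissible hp1 hp hs
  exact hq.unconditionallyLocallyWellPosed hε
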